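/- **Setting.** Let $M>0$, $\Lambda>0$ with $3M\sqrt\Lambda<1$, let $\xi\in(\pi,3\pi/2)$ with $\cos\xi=-3M\sqrt\Lambda$, $r_b=\frac{2}{\sqrt\Lambda}\cos\frac{\xi}{3}$ and $r_c=\frac{2}{\sqrt\Lambda}\cos\left(\frac{\xi}{3}+\frac{4\pi}{3}\right)$ (the horizon radii, roots of $1-\frac{2M}{r}-\frac{\Lambda r^2}{3}$), and let $\kappa_b=(r_c-r_b)(r_c+2r_b)\frac{\Lambda}{6r_b}$. The Killing horizon $\mathcal B$ of the Schwarzschild–de Sitter spacetime is $\mathbb R\times\mathbb S^2$ with coordinates $(U,\omega)$, and $X=-\kappa_bU\partial_U$ on $\mathcal B$. Its halves $H^{\pm}=\{\pm U>0\}$ are identified with $\mathbb R\times\mathbb S^2$ by $u=\pm\kappa_b^{-1}\ln(\pm\kappa_bU)$, so that $X=\mp\partial_u$ on $H^\pm$. In what follows $d\mathbb S^2$ is the surface measure of the unit sphere. $S(\mathcal B)$ is the real vector space of functions $\psi=\phi-\phi_0$ on $\mathcal B$, with $\phi$ smooth, $\phi=0$ at $U=0$, $\phi_0$ constant, such that for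 some $C>0$, $C'>1$: $|\psi|<C/|U|$ and $|\partial_U\psi|<C/U^2$ for $|U|>C'$. $S(H^{\pm})$ is the space of smooth real $\psi(u,\omega)$ with $|\psi|<Ce^{-|u|}$, $|\partial_u\psi|<Ce^{-|u|}$ for $|u|>C'$. Both carry the form $\sigma(\psi,\chi)=r_b^2\int(\psi\,\partial\chi-\chi\,\partial\psi)$, where $\partial$ and the integral are taken with respect to $dU\,d\mathbb S^2$, respectively $du\,d\mathbb S^2$. For a real vector space $L$ with antisymmetric bilinear form $\sigma$, $\mathcal W(L)$ is the Weyl $C^*$-algebra, the completion in the maximal $C^*$-norm of the $*$-algebra with linear basis $W(f)$, $f\in L$, where $W(f)W(g)=e^{-\frac i2\sigma(f,g)}W(f+g)$ and $W(f)^*=W(-f)$. A state is quasifree if $\omega(W(f))=e^{-\mu(f,f)/2}$ with a symmetric bilinear form $\mu$ such that $|\sigma(f,g)|^2\le4\mu(f,f)\mu(g,g)$. A real-linear $K:L\to H$ into a complex Hilbert space is a one-particle structure of $\omega$ if the complex span of its range is dense, $\mu=\mathrm{Re}\langle K\cdot,K\cdot\rangle$ and $\sigma=2\,\mathrm{Im}\langle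 K\cdot,K\cdot\rangle$ (inner product antilinear in the first argument). The two-point function of $\omega$ is $-\partial_s\partial_t\,\omega(W(sf)W(tg))|_{s=t=0}$. Pure means extreme point of the set of states. Let $H_{\mathcal B}=L^2(\mathbb R_+\times\mathbb S^2,\,2K\,dK\wedge r_b^2d\mathbb S^2)$ and $K_{\mathcal B}\psi=\hat\psi|_{K>0}$, with $\hat\psi$ the Fourier–Plancherel transform $\frac{1}{\sqrt{2\pi}}\int e^{iKU}\psi(U,\omega)\,dU$ (an $L^2(dK\wedge d\mathbb S^2)$-limit of truncated integrals). Let $H^{\beta_b}_{\pm}=L^2(\mathbb R\times\mathbb S^2,\,d\mu(k)\wedge r_b^2d\mathbb S^2)$ with $d\mu(k)=\dfrac{2k\,e^{\pi k/\kappa_b}}{e^{\pi k/\kappa_b}-e^{-\pi k/\kappa_b}}\,dk$, and let $K^{\beta_b}_{\pm}\psi=\frac{1}{\sqrt{2\pi}}\int e^{iku}\psi(u,\omega)\,du$ for $\psi\in S(H^{\pm})$. **Theorem.** $K_{\mathcal B}$ and $K^{\beta_b}_\pm$ are well-defined real-linear maps into $H_{\mathcal B}$ and $H^{\beta_b}_\pm$,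 and: (a) $(H_{\mathcal B},K_{\mathcal B})$ is the one-particle structure of a quasifree pure state $\omega_{\mathcal B}$ on $\mathcal W(S(\mathcal B))$. It is the unique quasifree state whose two-point function on $S(\mathcal B)$ is $$\lambda(\psi_1,\psi_2)=\lim_{\epsilon\to0^+}-\frac{r_b^2}{\pi}\int_{\mathbb R\times\mathbb R\times\mathbb S^2}\frac{\overline{\psi_1(U_1,\omega)}\,\psi_2(U_2,\omega)}{(U_1-U_2-i\epsilon)^2}\,dU_1\,dU_2\,d\mathbb S^2 .$$ (b) There are groups of $*$-automorphisms of $\mathcal W(S(\mathcal B))$ with $W(\psi)\mapsto W(\psi(e^{\kappa_b\tau}U,\omega))$, $\tau\in\mathbb R$ (the flow of $X$), and $W(\psi)\mapsto W(\psi(U,R^{-1}\omega))$, $R\in O(3)$ (the rotations of $\mathbb S^2$), and $\omega_{\mathcal B}$ is invariant under both. (c) For each sign, $(H^{\beta_b}_\pm,K^{\beta_b}_\pm)$ is the one-particle structure of exactly one quasifree state $\omega^{\beta_b}_\pm$ on $\mathcal W(S(H^\pm))$, and this is the restriction of $\omega_{\mathcal B}$: if the extension by zero $\Psi$ of $\psi\in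 S(H^\pm)$ to $\mathcal B$ lies in $S(\mathcal B)$, then $\omega^{\beta_b}_\pm(W(\psi))=\omega_{\mathcal B}(W(\Psi))$; the forms $\sigma$ agree on such functions; and their images under $K^{\beta_b}_\pm$ are dense in the range of $K^{\beta_b}_\pm$. (d) Let $\beta_\tau$ be the action of the flow of $X$: $(\beta_\tau\psi)(u,\omega)=\psi(u-\tau,\omega)$ on $S(H^-)$ and $\psi(u+\tau,\omega)$ on $S(H^+)$. Multiplication by $k$ on its maximal domain is a self-adjoint operator $\hat k$ on $H^{\beta_b}_\pm$, and $K^{\beta_b}_-\beta_\tau\psi=e^{i\tau\hat k}K^{\beta_b}_-\psi$, $K^{\beta_b}_+\beta_\tau\psi=e^{-i\tau\hat k}K^{\beta_b}_+\psi$. (e) $\omega^{\beta_b}_\pm$ is a KMS state at inverse temperature $\beta_b=2\pi/\kappa_b$ for the one-parameter group $\alpha$ of $*$-automorphisms of $\mathcal W(S(H^\pm))$ generated by $\mp X$, $\alpha_\tau W(\psi)=W(\beta_{\mp\tau}\psi)$. That is, for all $a,b$ there is a bounded continuous $F$ on $0\le\mathrm{Im}\,z\le\beta_b$, holomorphic in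 the interior, with $F(t)=\omega(a\,\alpha_t(b))$ and $F(t+i\beta_b)=\omega(\alpha_t(b)\,a)$ for $t\in\mathbb R$. -/

import Mathlib

open MeasureTheory Real Filter
open scoped Manifold Topology

open scoped ComplexOrder

set_option linter.unusedSectionVars false

noncomputable section

namespace SdSState

/-! ### States on unital complex `*`-algebras -/

/-- A state: a linear, positive and normalized functional. -/
structure AlgState (A : Type*) [Ring A] [StarRing A] [Algebra ℂ A] where
  toFun : A →ₗ[ℂ] ℂ
  nonneg : ∀ a : A, 0 ≤ toFun (star a * a)
  map_one : toFun 1 = 1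

instance {A : Type*} [Ring A] [StarRing A] [Algebra ℂ A] :
    CoeFun (AlgState A) (fun _ => A → ℂ) := ⟨fun ω => ω.toFun⟩

/-- A state is pure if it is an extreme point of the convex set of states. -/
def AlgState.IsPure {A : Type*} [Ring A] [StarRing A] [Algebra ℂ A] (ω : AlgState A) : Prop :=
  ∀ (ω₁ ω₂ : AlgState A) (t : ℝ), 0 < t → t < 1 →
    (∀ a, ω a = t * ω₁ a + (1 - t) * ω₂ a) → ω₁ = ω ∧ ω₂ = ω

namespace AlgState

variable {A : Type*} [Ring A] [StarRing A] [Algebra ℂ A] [StarModule ℂ A] (φ : AlgState A)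

lemma conj_symm (a b : A) : (starRingEnd ℂ) (φ (star b * a)) = φ (star a * b) := by
  have key : ∀ z : ℂ, (z * φ (star a * b) + star z * φ (star b * a)).im = 0 := by
    intro z
    have h := (Complex.le_def.1 (φ.nonneg (a + z • b))).2
    have ha := (Complex.le_def.1 (φ.nonneg a)).2
    have hb := (Complex.le_def.1 (φ.nonneg (z • b))).2
    have e : star (a + z • b) * (a + z • b)
        = star a * a + star (z • b) * (z • b) + (z • (star a * b) + star z • (star b * a)) := by
      simp only [star_add, star_smul, add_mul, mul_add, smul_mul_assoc, mul_smul_comm, smul_add]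
      abel
    rw [e] at h
    simp only [map_add, map_smul, smul_eq_mul, Complex.add_im, Complex.zero_im] at h ha hb ⊢
    linarith
  have h1 := key 1
  have hI := key Complex.I
  simp at h1 hI
  apply Complex.ext
  · simp; linarith
  · simp; linarith

/-- The positive semidefinite sesquilinear form `(a, b) ↦ φ (a* b)`. -/
@[reducible] def core : PreInnerProductSpace.Core ℂ A where
  inner a b := φ (star a * b)
  conj_inner_symm a b := φ.conj_symm a b
  re_inner_nonneg a := (Complex.le_def.1 (φ.nonneg a)).1
  add_left a b c := by simp [add_mul]
  smul_left a b z := by simp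

/-- The GNS seminorm of a state. -/
def gnsNorm (a : A) : ℝ := √(φ (star a * a)).re

lemma gnsNorm_nonneg (a : A) : 0 ≤ φ.gnsNorm a := Real.sqrt_nonneg _

lemma sq_gnsNorm (a : A) : φ.gnsNorm a ^ 2 = (φ (star a * a)).re :=
  Real.sq_sqrt (Complex.le_def.1 (φ.nonneg a)).1

lemma gnsNorm_add_le (a b : A) : φ.gnsNorm (a + b) ≤ φ.gnsNorm a + φ.gnsNorm b := by
  let _ := φ.core
  exact @norm_add_le A (InnerProductSpace.Core.toSeminormedAddCommGroup (𝕜 := ℂ)).toSeminormedAddGroup a b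

lemma gnsNorm_smul (z : ℂ) (a : A) : φ.gnsNorm (z • a) = ‖z‖ * φ.gnsNorm a := by
  have h : star (z • a) * (z • a) = ((‖z‖ ^ 2 : ℝ) : ℂ) • (star a * a) := by
    rw [star_smul, smul_mul_smul_comm, Complex.star_def, ← Complex.normSq_eq_conj_mul_self,
      Complex.normSq_eq_norm_sq]
  unfold gnsNorm
  rw [h, map_smul, smul_eq_mul, Complex.re_ofReal_mul, Real.sqrt_mul (sq_nonneg _),
    Real.sqrt_sq (norm_nonneg _)]

lemma norm_apply_le (a b : A) : ‖φ (star a * b)‖ ≤ φ.gnsNorm a * φ.gnsNorm b := by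
  let _ := φ.core
  exact InnerProductSpace.Core.norm_inner_le_norm (𝕜 := ℂ) a b

/-- The vector state `a ↦ φ (b* a b) / φ (b* b)`. -/
def conjBy (b : A) (hb : φ.gnsNorm b ≠ 0) : AlgState A where
  toFun := ((φ.gnsNorm b ^ 2 : ℝ) : ℂ)⁻¹ •
    (φ.toFun ∘ₗ LinearMap.mulLeft ℂ (star b) ∘ₗ LinearMap.mulRight ℂ b)
  nonneg a := by
    have h := φ.nonneg (a * b)
    have h2 : (0 : ℂ) ≤ ((φ.gnsNorm b ^ 2 : ℝ) : ℂ)⁻¹ := by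
      rw [← Complex.ofReal_inv]
      exact_mod_cast inv_nonneg.2 (sq_nonneg _)
    have e : star b * (star a * a * b) = star (a * b) * (a * b) := by
      simp [mul_assoc]
    simp only [LinearMap.smul_apply, LinearMap.comp_apply, LinearMap.mulLeft_apply,
      LinearMap.mulRight_apply, smul_eq_mul, e]
    exact mul_nonneg h2 h
  map_one := by
    have h : φ (star b * b) = ((φ.gnsNorm b ^ 2 : ℝ) : ℂ) := by
      rw [sq_gnsNorm]
      apply Complex.ext
      · simp
      · simpa using ((Complex.le_def.1 (φ.nonneg b)).2).symm
    have h0 : ((φ.gnsNorm b ^ 2 : ℝ) : ℂ) ≠ 0 := by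
      exact_mod_cast pow_ne_zero 2 hb
    simp only [LinearMap.smul_apply, LinearMap.comp_apply, LinearMap.mulLeft_apply,
      LinearMap.mulRight_apply, smul_eq_mul, one_mul, h]
    exact inv_mul_cancel₀ h0

lemma gnsNorm_mul (a b : A) (hb : φ.gnsNorm b ≠ 0) :
    φ.gnsNorm (a * b) = (φ.conjBy b hb).gnsNorm a * φ.gnsNorm b := by
  have e : star b * (star a * a * b) = star (a * b) * (a * b) := by simp [mul_assoc]
  have h : (φ.conjBy b hb).gnsNorm a ^ 2 * φ.gnsNorm b ^ 2 = φ.gnsNorm (a * b) ^ 2 := by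
    rw [sq_gnsNorm (φ.conjBy b hb), sq_gnsNorm φ (a * b)]
    simp only [conjBy, LinearMap.smul_apply, LinearMap.comp_apply, LinearMap.mulLeft_apply,
      LinearMap.mulRight_apply, smul_eq_mul, e]
    rw [← Complex.ofReal_inv, Complex.re_ofReal_mul]
    field_simp
  rw [← mul_pow] at h
  exact ((pow_left_inj₀ (mul_nonneg (gnsNorm_nonneg _ _) (gnsNorm_nonneg _ _))
    (gnsNorm_nonneg _ _) two_ne_zero).1 h).symm

lemma gnsNorm_mul_eq_zero (a b : A) (hb : φ.gnsNorm b = 0) : φ.gnsNorm (a * b) = 0 := by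
  have h := φ.norm_apply_le (star a * (a * b)) b
  rw [hb, mul_zero] at h
  have e : star (star a * (a * b)) * b = star (a * b) * (a * b) := by simp [mul_assoc]
  rw [e] at h
  have : φ (star (a * b) * (a * b)) = 0 := norm_le_zero_iff.1 h
  rw [gnsNorm, this, Complex.zero_re, Real.sqrt_zero]

lemma gnsNorm_sq_le (a : A) : φ.gnsNorm a ^ 2 ≤ φ.gnsNorm (star a * a) := by
  have h := φ.norm_apply_le 1 (star a * a)
  have h1 : φ.gnsNorm 1 = 1 := by simp [gnsNorm, φ.map_one]
  rw [h1, one_mul, star_one, one_mul] at h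
  rw [sq_gnsNorm]
  exact (Complex.re_le_norm _).trans h

end AlgState

/-! ### The Weyl algebra -/

/-- A real vector space form `σ` that is bilinear and antisymmetric. -/
structure SkewForm (L : Type*) [AddCommGroup L] [Module ℝ L] where
  toBilin : L →ₗ[ℝ] L →ₗ[ℝ] ℝ
  alt : ∀ f, toBilin f f = 0

instance {L : Type*} [AddCommGroup L] [Module ℝ L] :
    CoeFun (SkewForm L) (fun _ => L → L → ℝ) := ⟨fun σ f g => σ.toBilin f g⟩

section Weyl

variable {L : Type*} [AddCommGroup L] [Module ℝ L] (σ : SkewForm L)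

lemma SkewForm.swap (f g : L) : σ g f = - σ f g := by
  have h := σ.alt (f + g)
  simp only [map_add, LinearMap.add_apply, σ.alt] at h
  linarith

/-- The formal finite sums `∑ aᵢ W(fᵢ)` of Weyl symbols, before completion. -/
def PreWeyl (_ : SkewForm L) : Type _ := L →₀ ℂ

namespace PreWeyl

instance : AddCommGroup (PreWeyl σ) := inferInstanceAs (AddCommGroup (L →₀ ℂ))
instance : Module ℂ (PreWeyl σ) := inferInstanceAs (Module ℂ (L →₀ ℂ))

/-- The phase `exp (-i σ(f, g) / 2)` of the Weyl relations. -/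
def phase (f g : L) : ℂ := Complex.exp (-(Complex.I * (σ f g : ℂ) / 2))

/-- The symbol `x • W(f)`. -/
def sym (f : L) (x : ℂ) : PreWeyl σ := Finsupp.single f x

/-- The product, determined by `W(f) W(g) = exp (-i σ(f, g) / 2) W(f + g)`. -/
def mulHom : (L →₀ ℂ) →ₗ[ℂ] (L →₀ ℂ) →ₗ[ℂ] (L →₀ ℂ) :=
  Finsupp.lsum ℂ fun f => LinearMap.toSpanSingleton ℂ _
    (Finsupp.lsum ℂ fun g => phase σ f g • Finsupp.lsingle (f + g))

/-- The involution, determined by `W(f)* = W(-f)` and antilinearity. -/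
def starHom : (L →₀ ℂ) →+ (L →₀ ℂ) :=
  Finsupp.liftAddHom fun f =>
    (Finsupp.singleAddHom (-f)).comp ((starRingEnd ℂ : ℂ →+* ℂ) : ℂ →+ ℂ)

instance : Mul (PreWeyl σ) := ⟨fun a b => mulHom σ a b⟩
instance : One (PreWeyl σ) := ⟨sym σ 0 1⟩
instance : Star (PreWeyl σ) := ⟨fun a => starHom a⟩

lemma one_def : (1 : PreWeyl σ) = sym σ 0 1 := rfl

lemma sym_mul_sym (f g : L) (x y : ℂ) :
    sym σ f x * sym σ g y = sym σ (f + g) (x * y * phase σ f g) := by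
  change mulHom σ (Finsupp.single f x) (Finsupp.single g y) = Finsupp.single _ _
  simp only [mulHom, Finsupp.lsum_single, LinearMap.toSpanSingleton_apply, LinearMap.smul_apply,
    Finsupp.lsingle_apply, Finsupp.smul_single, smul_eq_mul]
  congr 1
  ring

lemma star_sym (f : L) (x : ℂ) : star (sym σ f x) = sym σ (-f) (star x) := by
  change starHom (Finsupp.single f x) = Finsupp.single _ _
  simp [starHom]

lemma smul_sym (f : L) (x z : ℂ) : z • sym σ f x = sym σ f (z * x) := by
  change z • Finsupp.single f x = Finsupp.single _ _
  simp

protected lemma add_mul' (a b c : PreWeyl σ) : (a + b) * c = a * c + b * c := by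
  exact LinearMap.map_add₂ (mulHom σ) a b c

protected lemma mul_add' (a b c : PreWeyl σ) : a * (b + c) = a * b + a * c :=
  map_add (mulHom σ a) b c

protected lemma star_add' (a b : PreWeyl σ) : star (a + b) = star a + star b :=
  map_add starHom a b

protected lemma zero_mul' (a : PreWeyl σ) : 0 * a = 0 := by
  exact LinearMap.map_zero₂ (mulHom σ) a

protected lemma mul_zero' (a : PreWeyl σ) : a * 0 = 0 := map_zero (mulHom σ a)

protected lemma star_zero' : star (0 : PreWeyl σ) = 0 := map_zero starHom

lemma induct {p : PreWeyl σ → Prop} (a : PreWeyl σ) (h0 : p 0)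
    (hadd : ∀ a b, p a → p b → p (a + b)) (hs : ∀ f x, p (sym σ f x)) : p a :=
  Finsupp.induction_linear (motive := p) a h0 hadd hs

lemma phase_zero_left (f : L) : phase σ 0 f = 1 := by simp [phase]
lemma phase_zero_right (f : L) : phase σ f 0 = 1 := by simp [phase]

lemma phase_cocycle (f g h : L) :
    phase σ f g * phase σ (f + g) h = phase σ g h * phase σ f (g + h) := by
  simp only [phase, ← Complex.exp_add, map_add, LinearMap.add_apply]
  congr 1
  push_cast
  ring

instance : Ring (PreWeyl σ) :=
  { (inferInstance : AddCommGroup (PreWeyl σ)) with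
    mul := (· * ·)
    one := 1
    left_distrib := PreWeyl.mul_add' σ
    right_distrib := PreWeyl.add_mul' σ
    zero_mul := PreWeyl.zero_mul' σ
    mul_zero := PreWeyl.mul_zero' σ
    mul_assoc := by
      intro a b c
      induction a using PreWeyl.induct with
      | h0 => simp only [PreWeyl.zero_mul']
      | hadd a a' h h' => simp only [PreWeyl.add_mul', h, h']
      | hs f x =>
        induction b using PreWeyl.induct with
        | h0 => simp only [PreWeyl.zero_mul', PreWeyl.mul_zero']
        | hadd a a' h h' => simp only [PreWeyl.add_mul', PreWeyl.mul_add', h, h']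
        | hs g y =>
          induction c using PreWeyl.induct with
          | h0 => simp only [PreWeyl.mul_zero']
          | hadd a a' h h' => simp only [PreWeyl.mul_add', h, h']
          | hs h z =>
            simp only [sym_mul_sym, add_assoc]
            congr 1
            linear_combination (x * y * z) * phase_cocycle σ f g h
    one_mul := by
      intro a
      induction a using PreWeyl.induct with
      | h0 => simp only [PreWeyl.mul_zero']
      | hadd a a' h h' => simp only [PreWeyl.mul_add', h, h']
      | hs f x => simp [one_def, sym_mul_sym, phase_zero_left]
    mul_one := by
      intro a
      induction a using PreWeyl.induct with
      | h0 => simp only [PreWeyl.zero_mul']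
      | hadd a a' h h' => simp only [PreWeyl.add_mul', h, h']
      | hs f x => simp [one_def, sym_mul_sym, phase_zero_right]
    neg_add_cancel := neg_add_cancel }

instance : StarRing (PreWeyl σ) where
  star_involutive := by
    intro a
    induction a using PreWeyl.induct with
    | h0 => simp only [PreWeyl.star_zero']
    | hadd a a' h h' => simp only [PreWeyl.star_add', h, h']
    | hs f x => simp [star_sym]
  star_mul := by
    intro a b
    induction a using PreWeyl.induct with
    | h0 => simp only [zero_mul, mul_zero, PreWeyl.star_zero']
    | hadd a a' h h' => simp only [add_mul, mul_add, PreWeyl.star_add', h, h']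
    | hs f x =>
      induction b using PreWeyl.induct with
      | h0 => simp only [zero_mul, mul_zero, PreWeyl.star_zero']
      | hadd a a' h h' => simp only [add_mul, mul_add, PreWeyl.star_add', h, h']
      | hs g y =>
        simp only [star_sym, sym_mul_sym, neg_add_rev]
        congr 1
        have : star (phase σ f g) = phase σ (-g) (-f) := by
          simp only [phase, Complex.star_def, ← Complex.exp_conj, map_neg, LinearMap.neg_apply,
            neg_neg, σ.swap f g]
          congr 1
          simp [map_ofNat]
        rw [star_mul, star_mul, this]
        ring
  star_add := PreWeyl.star_add' σ

instance : Algebra ℂ (PreWeyl σ) :=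
  Algebra.ofModule
    (fun r a b => by
      exact LinearMap.map_smul₂ (mulHom σ) r a b)
    (fun r a b => map_smul (mulHom σ a) r b)

instance : StarModule ℂ (PreWeyl σ) where
  star_smul r a := by
    induction a using PreWeyl.induct with
    | h0 => simp
    | hadd a a' h h' => simp only [smul_add, star_add, h, h']
    | hs f x => simp [smul_sym, star_sym]


/-- The underlying finitely supported function. -/
def toFinsupp (a : PreWeyl σ) : L →₀ ℂ := a

/-- The coefficient of `W(f)`. -/
def coeff (f : L) : PreWeyl σ →ₗ[ℂ] ℂ where
  toFun a := toFinsupp σ a f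
  map_add' _ _ := rfl
  map_smul' _ _ := rfl

lemma coeff_sym (f g : L) (x : ℂ) : coeff σ f (sym σ g x) = (Finsupp.single g x : L →₀ ℂ) f := rfl

lemma coeff_star_sym_mul (f : L) (x : ℂ) (a : PreWeyl σ) :
    coeff σ 0 (star (sym σ f x) * a) = star x * coeff σ f a := by
  induction a using PreWeyl.induct with
  | h0 => simp
  | hadd a a' h h' => rw [mul_add, map_add, map_add, h, h', mul_add]
  | hs g y =>
    rw [star_sym, sym_mul_sym, coeff_sym, coeff_sym]
    by_cases hfg : f = g
    · subst hfg
      simp [phase, σ.alt]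
    · rw [Finsupp.single_eq_of_ne, Finsupp.single_eq_of_ne, mul_zero]
      · exact hfg
      · intro h
        exact hfg (neg_add_eq_zero.1 h.symm)

lemma coeff_star_mul (a b : PreWeyl σ) :
    coeff σ 0 (star b * a) = (toFinsupp σ b).sum fun f x => star x * coeff σ f a := by
  induction b using PreWeyl.induct with
  | h0 =>
    rw [star_zero, zero_mul, map_zero]
    exact (Finsupp.sum_zero_index (h := fun f x => star x * coeff σ f a)).symm
  | hadd b b' h h' =>
    rw [star_add, add_mul, map_add, h, h']
    exact (Finsupp.sum_add_index' (f := toFinsupp σ b) (g := toFinsupp σ b')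
      (h := fun f x => star x * coeff σ f a) (by simp) (by intros; simp [add_mul])).symm
  | hs f x =>
    rw [coeff_star_sym_mul]
    exact (Finsupp.sum_single_index (h := fun f x => star x * coeff σ f a) (by simp)).symm

/-- The tracial state `∑ aᵢ W(fᵢ) ↦` coefficient of `W(0)`. -/
def trace : AlgState (PreWeyl σ) where
  toFun := coeff σ 0
  nonneg a := by
    rw [coeff_star_mul]
    exact Finset.sum_nonneg fun f _ => star_mul_self_nonneg _
  map_one := by
    rw [one_def, coeff_sym]
    simp

lemma trace_eq_zero (a : PreWeyl σ) (h : (trace σ).gnsNorm a = 0) : a = 0 := by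
  refine Finsupp.ext fun f => ?_
  have h2 := (trace σ).norm_apply_le (sym σ f 1) a
  rw [h, mul_zero] at h2
  have h3 : coeff σ 0 (star (sym σ f 1) * a) = 0 := norm_le_zero_iff.1 h2
  rw [coeff_star_sym_mul, star_one, one_mul] at h3
  exact h3

lemma gnsNorm_sym (φ : AlgState (PreWeyl σ)) (f : L) (x : ℂ) : φ.gnsNorm (sym σ f x) = ‖x‖ := by
  have e : sym σ f x = x • sym σ f 1 := by rw [smul_sym, mul_one]
  have h : star (sym σ f 1) * sym σ f 1 = 1 := by
    rw [star_sym, sym_mul_sym, one_def]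
    simp [phase, σ.alt]
  rw [e, φ.gnsNorm_smul, AlgState.gnsNorm, h, φ.map_one]
  simp

lemma exists_bound (a : PreWeyl σ) : ∃ C : ℝ, ∀ φ : AlgState (PreWeyl σ), φ.gnsNorm a ≤ C := by
  induction a using PreWeyl.induct with
  | h0 => exact ⟨0, fun φ => by simp [AlgState.gnsNorm]⟩
  | hadd a b ha hb =>
    obtain ⟨C, hC⟩ := ha
    obtain ⟨D, hD⟩ := hb
    exact ⟨C + D, fun φ => (φ.gnsNorm_add_le a b).trans (add_le_add (hC φ) (hD φ))⟩
  | hs f x => exact ⟨‖x‖, fun φ => (gnsNorm_sym σ φ f x).le⟩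

instance : Nonempty (AlgState (PreWeyl σ)) := ⟨trace σ⟩

/-- The C*-norm `‖a‖ = sup √(φ (a* a))`, the supremum being over all states `φ`. It is the largest
C*-norm; if `σ` is nondegenerate it is the only one. -/
instance : Norm (PreWeyl σ) := ⟨fun a => ⨆ φ : AlgState (PreWeyl σ), φ.gnsNorm a⟩

lemma norm_def (a : PreWeyl σ) : ‖a‖ = ⨆ φ : AlgState (PreWeyl σ), φ.gnsNorm a := rfl

lemma gnsNorm_le (φ : AlgState (PreWeyl σ)) (a : PreWeyl σ) : φ.gnsNorm a ≤ ‖a‖ := by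
  obtain ⟨C, hC⟩ := exists_bound σ a
  exact le_ciSup (f := fun φ : AlgState (PreWeyl σ) => φ.gnsNorm a)
    ⟨C, by rintro _ ⟨ψ, rfl⟩; exact hC ψ⟩ φ

lemma norm_le_of (a : PreWeyl σ) (C : ℝ) (h : ∀ φ : AlgState (PreWeyl σ), φ.gnsNorm a ≤ C) :
    ‖a‖ ≤ C := ciSup_le h

protected lemma norm_nonneg' (a : PreWeyl σ) : 0 ≤ ‖a‖ :=
  ((trace σ).gnsNorm_nonneg a).trans (gnsNorm_le σ _ a)

protected lemma norm_smul_le' (z : ℂ) (a : PreWeyl σ) : ‖z • a‖ ≤ ‖z‖ * ‖a‖ :=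
  norm_le_of σ _ _ fun φ => by
    rw [φ.gnsNorm_smul]
    exact mul_le_mul_of_nonneg_left (gnsNorm_le σ φ a) (norm_nonneg z)

protected lemma norm_mul_le' (a b : PreWeyl σ) : ‖a * b‖ ≤ ‖a‖ * ‖b‖ :=
  norm_le_of σ _ _ fun φ => by
    by_cases hb : φ.gnsNorm b = 0
    · rw [φ.gnsNorm_mul_eq_zero a b hb]
      exact mul_nonneg (PreWeyl.norm_nonneg' σ a) (PreWeyl.norm_nonneg' σ b)
    · rw [φ.gnsNorm_mul a b hb]
      exact mul_le_mul (gnsNorm_le σ _ a) (gnsNorm_le σ φ b) (φ.gnsNorm_nonneg b)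
        (PreWeyl.norm_nonneg' σ a)

protected lemma norm_sq_le' (a : PreWeyl σ) : ‖a‖ * ‖a‖ ≤ ‖star a * a‖ := by
  have h : ‖a‖ ≤ √‖star a * a‖ := norm_le_of σ _ _ fun φ =>
    Real.le_sqrt_of_sq_le ((φ.gnsNorm_sq_le a).trans (gnsNorm_le σ φ _))
  calc ‖a‖ * ‖a‖ ≤ √‖star a * a‖ * √‖star a * a‖ :=
        mul_self_le_mul_self (PreWeyl.norm_nonneg' σ a) h
    _ = _ := Real.mul_self_sqrt (PreWeyl.norm_nonneg' σ _)

instance : NormedRing (PreWeyl σ) :=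
  { (inferInstance : Ring (PreWeyl σ)),
    AddGroupNorm.toNormedAddCommGroup (E := PreWeyl σ)
      { toFun := fun a => ‖a‖
        map_zero' := le_antisymm (norm_le_of σ _ _ fun φ => by simp [AlgState.gnsNorm])
          (PreWeyl.norm_nonneg' σ 0)
        add_le' := fun a b => norm_le_of σ _ _ fun φ =>
          (φ.gnsNorm_add_le a b).trans (add_le_add (gnsNorm_le σ φ a) (gnsNorm_le σ φ b))
        neg' := fun a => by
          have h : ∀ b : PreWeyl σ, ‖-b‖ ≤ ‖b‖ := fun b => by
            have := PreWeyl.norm_smul_le' σ (-1) b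
            simpa using this
          exact le_antisymm (h a) (by simpa using h (-a))
        eq_zero_of_map_eq_zero' := fun a (h : ‖a‖ = 0) => trace_eq_zero σ a
          (le_antisymm ((gnsNorm_le σ _ a).trans h.le) ((trace σ).gnsNorm_nonneg a)) } with
    norm_mul_le := PreWeyl.norm_mul_le' σ }

instance : NormedAlgebra ℂ (PreWeyl σ) where
  norm_smul_le := PreWeyl.norm_smul_le' σ

instance : CStarRing (PreWeyl σ) where
  norm_mul_self_le := PreWeyl.norm_sq_le' σ

end PreWeyl

open UniformSpace in
/-- The Weyl algebra of `(L, σ)`: the C*-algebra completion of the formal finite sums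
`∑ aᵢ W(fᵢ)`. -/
def Weyl (σ : SkewForm L) : Type _ := Completion (PreWeyl σ)

namespace Weyl

open UniformSpace

instance : NormedRing (Weyl σ) := inferInstanceAs (NormedRing (Completion (PreWeyl σ)))
instance : NormedSpace ℂ (Weyl σ) := inferInstanceAs (NormedSpace ℂ (Completion (PreWeyl σ)))
instance : CompleteSpace (Weyl σ) := inferInstanceAs (CompleteSpace (Completion (PreWeyl σ)))

/-- The inclusion of the formal finite sums into the Weyl algebra. -/
def incl (a : PreWeyl σ) : Weyl σ := (a : Completion (PreWeyl σ))

lemma incl_mul (a b : PreWeyl σ) : incl σ (a * b) = incl σ a * incl σ b := Completion.coe_mul a b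
lemma incl_add (a b : PreWeyl σ) : incl σ (a + b) = incl σ a + incl σ b := Completion.coe_add a b
lemma incl_smul (z : ℂ) (a : PreWeyl σ) : incl σ (z • a) = z • incl σ a := Completion.coe_smul z a
lemma norm_incl (a : PreWeyl σ) : ‖incl σ a‖ = ‖a‖ := Completion.norm_coe a

lemma denseRange_incl : DenseRange (incl σ) := Completion.denseRange_coe

instance : NormedAlgebra ℂ (Weyl σ) :=
  { Algebra.ofModule (R := ℂ) (A := Weyl σ)
      (fun r a b => by
        refine (denseRange_incl σ).induction_on₂ (p := fun a b => r • a * b = r • (a * b))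
          (isClosed_eq ((continuous_fst.const_smul r).mul continuous_snd)
            ((continuous_fst.mul continuous_snd).const_smul r)) (fun a b => ?_) a b
        rw [← incl_smul, ← incl_mul, ← incl_mul, ← incl_smul, smul_mul_assoc])
      (fun r a b => by
        refine (denseRange_incl σ).induction_on₂ (p := fun a b => a * r • b = r • (a * b))
          (isClosed_eq (continuous_fst.mul (continuous_snd.const_smul r))
            ((continuous_fst.mul continuous_snd).const_smul r)) (fun a b => ?_) a b
        rw [← incl_smul, ← incl_mul, ← incl_mul, ← incl_smul, mul_smul_comm]) with
    norm_smul_le := fun r a => norm_smul_le r a }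

/-- The Weyl symbol `W(f)` as an element of the Weyl algebra. -/
def W (f : L) : Weyl σ := incl σ (PreWeyl.sym σ f 1)

instance : Star (Weyl σ) :=
  ⟨Completion.map (star : PreWeyl σ → PreWeyl σ)⟩

lemma uniformContinuous_star : UniformContinuous (star : PreWeyl σ → PreWeyl σ) :=
  (AddMonoidHomClass.isometry_of_norm (starAddEquiv : PreWeyl σ ≃+ PreWeyl σ)
    (fun a => norm_star a)).uniformContinuous

lemma continuous_star' : Continuous (star : Weyl σ → Weyl σ) :=
  Completion.continuous_map

lemma star_incl (a : PreWeyl σ) : star (incl σ a) = incl σ (star a) :=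
  Completion.map_coe (uniformContinuous_star σ) a

instance : StarRing (Weyl σ) where
  star_involutive := by
    intro a
    refine (denseRange_incl σ).induction_on a
      (isClosed_eq ((continuous_star' σ).comp (continuous_star' σ)) continuous_id) fun a => ?_
    rw [star_incl, star_incl, star_star]
  star_mul := by
    intro a b
    refine (denseRange_incl σ).induction_on₂ (p := fun a b => star (a * b) = star b * star a)
      (isClosed_eq ((continuous_star' σ).comp (continuous_fst.mul continuous_snd))
        (((continuous_star' σ).comp continuous_snd).mul ((continuous_star' σ).comp continuous_fst)))
      (fun a b => ?_) a b
    rw [← incl_mul, star_incl, star_incl, star_incl, star_mul, incl_mul]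
  star_add := by
    intro a b
    refine (denseRange_incl σ).induction_on₂ (p := fun a b => star (a + b) = star a + star b)
      (isClosed_eq ((continuous_star' σ).comp (continuous_fst.add continuous_snd))
        (((continuous_star' σ).comp continuous_fst).add ((continuous_star' σ).comp continuous_snd)))
      (fun a b => ?_) a b
    rw [← incl_add, star_incl, star_incl, star_incl, star_add, incl_add]

instance : StarModule ℂ (Weyl σ) where
  star_smul z a := by
    refine (denseRange_incl σ).induction_on a
      (isClosed_eq ((continuous_star' σ).comp (continuous_const_smul z))
        ((continuous_star' σ).const_smul (star z))) fun a => ?_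
    rw [← incl_smul, star_incl, star_incl, star_smul, incl_smul]

instance : CStarRing (Weyl σ) where
  norm_mul_self_le a := by
    refine (denseRange_incl σ).induction_on a
      (isClosed_le (continuous_norm.mul continuous_norm)
        (((continuous_star' σ).mul continuous_id).norm)) fun a => ?_
    change ‖incl σ a‖ * ‖incl σ a‖ ≤ ‖star (incl σ a) * incl σ a‖
    rw [star_incl, ← incl_mul, norm_incl, norm_incl]
    exact CStarRing.norm_mul_self_le a

instance : CStarAlgebra (Weyl σ) where

lemma W_zero : W σ 0 = 1 := rfl

lemma star_W (f : L) : star (W σ f) = W σ (-f) := by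
  rw [W, W, star_incl, PreWeyl.star_sym, star_one]

lemma W_mul_W (f g : L) :
    W σ f * W σ g = Complex.exp (-(Complex.I * (σ f g : ℂ) / 2)) • W σ (f + g) := by
  rw [W, W, W, ← incl_mul, ← incl_smul, PreWeyl.sym_mul_sym, PreWeyl.smul_sym, PreWeyl.phase]
  simp

lemma dense_span_W : Dense (Submodule.span ℂ (Set.range (W σ)) : Set (Weyl σ)) := by
  refine (denseRange_incl σ).mono ?_
  rintro _ ⟨a, rfl⟩
  induction a using PreWeyl.induct with
  | h0 => exact Submodule.zero_mem _
  | hadd a b ha hb => rw [incl_add]; exact Submodule.add_mem _ ha hb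
  | hs f x =>
    have : PreWeyl.sym σ f x = x • PreWeyl.sym σ f 1 := by rw [PreWeyl.smul_sym, mul_one]
    rw [this, incl_smul]
    exact Submodule.smul_mem _ _ (Submodule.subset_span ⟨f, rfl⟩)

end Weyl

end Weyl

/-! ### The black hole horizon of the Schwarzschild-de Sitter spacetime -/

/-- The metric function `F(r) = 1 - 2M/r - Λr²/3`. -/
def metricF (M Λ r : ℝ) : ℝ := 1 - 2 * M / r - Λ / 3 * r ^ 2

/-- The angle `ξ ∈ (π, 3π/2)` with `cos ξ = -3M√Λ`. -/
def angleXi (M Λ : ℝ) : ℝ := 2 * π - arccos (-(3 * M * √Λ))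

/-- The radius `r_b` of the black hole horizon, the smaller positive root of `F`. -/
def radiusB (M Λ : ℝ) : ℝ := 2 / √Λ * cos (angleXi M Λ / 3)

/-- The radius `r_c` of the cosmological horizon, the larger positive root of `F`. -/
def radiusC (M Λ : ℝ) : ℝ := 2 / √Λ * cos (angleXi M Λ / 3 + 4 * π / 3)

/-- The surface gravity `κ_b` of the black hole horizon. -/
def kappaB (M Λ : ℝ) : ℝ :=
  (radiusC M Λ - radiusB M Λ) * (radiusC M Λ + 2 * radiusB M Λ) * (Λ / (6 * radiusB M Λ))

lemma angleXi_mem {M Λ : ℝ} (hM : 0 < M) (hΛ : 0 < Λ) (h : 3 * M * √Λ < 1) :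
    π < angleXi M Λ ∧ angleXi M Λ < 3 * π / 2 := by
  have h0 : 0 < 3 * M * √Λ := by positivity
  have h1 : arccos (-(3 * M * √Λ)) < π := by
    rw [arccos_neg]
    have := arccos_pos.2 h
    linarith
  have h2 : π / 2 < arccos (-(3 * M * √Λ)) := by
    rw [arccos_neg]
    have := arccos_lt_pi_div_two.2 h0
    linarith
  unfold angleXi
  constructor <;> linarith

/-- `r_b` and `r_c` are positive roots of `F` and `r_b < r_c`. -/
lemma radius_spec {M Λ : ℝ} (hM : 0 < M) (hΛ : 0 < Λ) (h : 3 * M * √Λ < 1) :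
    0 < radiusB M Λ ∧ radiusB M Λ < radiusC M Λ ∧
      metricF M Λ (radiusB M Λ) = 0 ∧ metricF M Λ (radiusC M Λ) = 0 := by
  obtain ⟨hl, hu⟩ := angleXi_mem hM hΛ h
  have hpi := pi_pos
  have hs : 0 < √Λ := sqrt_pos.2 hΛ
  have h0 : 0 < 3 * M * √Λ := by positivity
  have hcos : cos (angleXi M Λ) = -(3 * M * √Λ) := by
    rw [angleXi, cos_two_pi_sub, cos_arccos] <;> linarith
  have hb : 0 < cos (angleXi M Λ / 3) := cos_pos_of_mem_Ioo ⟨by linarith, by linarith⟩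
  have hbc : cos (angleXi M Λ / 3) < cos (angleXi M Λ / 3 + 4 * π / 3) := by
    have e : cos (angleXi M Λ / 3 + 4 * π / 3) = cos (2 * π / 3 - angleXi M Λ / 3) := by
      rw [← cos_two_pi_sub]
      congr 1
      ring
    rw [e]
    exact cos_lt_cos_of_nonneg_of_le_pi (by linarith) (by linarith) (by linarith)
  have root : ∀ x : ℝ, 0 < cos x → cos (3 * x) = -(3 * M * √Λ) →
      metricF M Λ (2 / √Λ * cos x) = 0 := by
    intro x hx h3
    rw [cos_three_mul] at h3
    have hsq : √Λ ^ 2 = Λ := sq_sqrt hΛ.le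
    unfold metricF
    rw [← hsq] at *
    rw [sqrt_sq hs.le] at *
    field_simp
    nlinarith
  refine ⟨by unfold radiusB; positivity, ?_, root _ hb ?_, root _ (hb.trans hbc) ?_⟩
  · unfold radiusB radiusC
    exact mul_lt_mul_of_pos_left hbc (by positivity)
  · rw [← hcos]
    congr 1
    ring
  · rw [← hcos, ← cos_add_nat_mul_two_pi (angleXi M Λ) 2]
    congr 1
    push_cast
    ring

lemma kappaB_pos {M Λ : ℝ} (hM : 0 < M) (hΛ : 0 < Λ) (h : 3 * M * √Λ < 1) : 0 < kappaB M Λ := by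
  obtain ⟨h1, h2, -⟩ := radius_spec hM hΛ h
  have h3 : 0 < radiusC M Λ - radiusB M Λ := sub_pos.2 h2
  have h4 : 0 < radiusC M Λ := h1.trans h2
  unfold kappaB
  positivity

/-! ### Functions on `ℝ × S²` -/

abbrev E3 : Type := EuclideanSpace ℝ (Fin 3)

/-- The unit sphere of `ℝ³`, with Mathlib's smooth structure. -/
abbrev S2 : Type := Metric.sphere (0 : E3) 1

instance : Fact (Module.finrank ℝ E3 = 2 + 1) := ⟨by simp⟩

/-- The surface measure of the unit sphere, of total mass `4π`. -/
def sphereMeasure : Measure S2 := (volume : Measure E3).toSphere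

instance : IsFiniteMeasure sphereMeasure :=
  inferInstanceAs (IsFiniteMeasure (volume : Measure E3).toSphere)

/-- Smooth real functions on `ℝ × S²`. -/
def Smooth (ψ : ℝ × S2 → ℝ) : Prop := ContMDiff (𝓘(ℝ, ℝ).prod (𝓡 2)) 𝓘(ℝ, ℝ) ((⊤ : ℕ∞) : WithTop ℕ∞) ψ

/-- The partial derivative in the first variable. -/
def pd (ψ : ℝ × S2 → ℝ) (p : ℝ × S2) : ℝ := deriv (fun x => ψ (x, p.2)) p.1

lemma Smooth.differentiable {ψ : ℝ × S2 → ℝ} (h : Smooth ψ) (w : S2) :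
    Differentiable ℝ fun x => ψ (x, w) := by
  have h1 : ContMDiff 𝓘(ℝ, ℝ) (𝓘(ℝ, ℝ).prod (𝓡 2)) ((⊤ : ℕ∞) : WithTop ℕ∞) fun x : ℝ => ((x, w) : ℝ × S2) :=
    contMDiff_id.prodMk contMDiff_const
  have h2 : ContMDiff 𝓘(ℝ, ℝ) 𝓘(ℝ, ℝ) ((⊤ : ℕ∞) : WithTop ℕ∞) fun x => ψ (x, w) := ContMDiff.comp h h1
  exact h2.contDiff.differentiable (by simp)

lemma Smooth.continuous_pd {ψ : ℝ × S2 → ℝ} (h : Smooth ψ) : Continuous (pd ψ) := by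
  have key : ∀ p : ℝ × S2, ContinuousAt (pd ψ) p := by
    intro p
    have hf : ContMDiffAt ((𝓘(ℝ, ℝ).prod (𝓡 2)).prod 𝓘(ℝ, ℝ)) 𝓘(ℝ, ℝ) ((⊤ : ℕ∞) : WithTop ℕ∞)
        (Function.uncurry fun (q : ℝ × S2) (x : ℝ) => ψ (x, q.2)) (p, p.1) := by
      have h1 : ContMDiff ((𝓘(ℝ, ℝ).prod (𝓡 2)).prod 𝓘(ℝ, ℝ)) (𝓘(ℝ, ℝ).prod (𝓡 2)) ((⊤ : ℕ∞) : WithTop ℕ∞)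
          fun q : (ℝ × S2) × ℝ => ((q.2, q.1.2) : ℝ × S2) :=
        contMDiff_snd.prodMk (contMDiff_snd.comp contMDiff_fst)
      exact (ContMDiff.comp h h1).contMDiffAt
    have h2 := ContMDiffAt.mfderiv (m := 0) (fun (q : ℝ × S2) (x : ℝ) => ψ (x, q.2))
      (fun q : ℝ × S2 => q.1) hf contMDiffAt_fst (by simp)
    have e := inTangentCoordinates_model_space (I := 𝓘(ℝ, ℝ)) (I' := 𝓘(ℝ, ℝ))
      (fun q : ℝ × S2 => q.1) (fun q : ℝ × S2 => ψ (q.1, q.2))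
      (fun q : ℝ × S2 =>
        (mfderiv 𝓘(ℝ, ℝ) 𝓘(ℝ, ℝ) (fun x : ℝ => ψ (x, q.2)) q.1 : ℝ →L[ℝ] ℝ)) p
    have h3 := (congrArg (fun F => ContinuousAt F p) e).mp h2.continuousAt
    have h4 : ContinuousAt (fun q : ℝ × S2 =>
        (mfderiv 𝓘(ℝ, ℝ) 𝓘(ℝ, ℝ) (fun x : ℝ => ψ (x, q.2)) q.1 : ℝ →L[ℝ] ℝ) 1) p :=
      ContinuousAt.clm_apply h3 continuousAt_const
    refine h4.congr (Filter.Eventually.of_forall fun q => ?_)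
    simp only [mfderiv_eq_fderiv]
    rfl
  exact continuous_iff_continuousAt.2 key

lemma Smooth.add {ψ χ : ℝ × S2 → ℝ} (h : Smooth ψ) (h' : Smooth χ) : Smooth (ψ + χ) :=
  ContMDiff.add h h'

lemma Smooth.smul {ψ : ℝ × S2 → ℝ} (c : ℝ) (h : Smooth ψ) : Smooth (c • ψ) :=
  (contDiff_const_smul c).contMDiff.comp h

lemma pd_add {ψ χ : ℝ × S2 → ℝ} (h : Smooth ψ) (h' : Smooth χ) (p : ℝ × S2) :
    pd (ψ + χ) p = pd ψ p + pd χ p :=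
  deriv_add (h.differentiable p.2 p.1) (h'.differentiable p.2 p.1)

lemma pd_smul {ψ : ℝ × S2 → ℝ} (c : ℝ) (p : ℝ × S2) : pd (c • ψ) p = c * pd ψ p := by
  change deriv (fun x => c * ψ (x, p.2)) p.1 = _
  rw [deriv_const_mul_field]
  rfl

/-- Decay of `ψ` and `∂ψ` outside a compact set of values of the first variable, with rates
`a` and `b`. -/
def Decays (a b : ℝ → ℝ) (ψ : ℝ × S2 → ℝ) : Prop :=
  ∃ C > 0, ∃ C' > 1, ∀ (x : ℝ) (w : S2), C' < |x| → |ψ (x, w)| < C * a x ∧ |pd ψ (x, w)| < C * b x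

lemma Decays.zero {a b : ℝ → ℝ} (ha : ∀ x, 1 < |x| → 0 < a x) (hb : ∀ x, 1 < |x| → 0 < b x) :
    Decays a b 0 := by
  refine ⟨1, one_pos, 2, by norm_num, fun x w hx => ?_⟩
  have h : pd (0 : ℝ × S2 → ℝ) (x, w) = 0 := by simp [pd]
  rw [h]
  simp [ha x (by linarith), hb x (by linarith)]

lemma Decays.add {a b : ℝ → ℝ} {ψ χ : ℝ × S2 → ℝ} (hs : Smooth ψ) (hs' : Smooth χ)
    (h : Decays a b ψ) (h' : Decays a b χ) : Decays a b (ψ + χ) := by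
  obtain ⟨C, hC, C', hC', hh⟩ := h
  obtain ⟨D, hD, D', hD', hh'⟩ := h'
  refine ⟨C + D, by positivity, max C' D', lt_max_of_lt_left hC', fun x w hx => ?_⟩
  obtain ⟨h1, h2⟩ := hh x w ((le_max_left _ _).trans_lt hx)
  obtain ⟨h3, h4⟩ := hh' x w ((le_max_right _ _).trans_lt hx)
  rw [pd_add hs hs', add_mul, add_mul]
  exact ⟨(abs_add_le _ _).trans_lt (add_lt_add h1 h3), (abs_add_le _ _).trans_lt (add_lt_add h2 h4)⟩

lemma Decays.smul {a b : ℝ → ℝ} {ψ : ℝ × S2 → ℝ} (c : ℝ) (h : Decays a b ψ) :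
    Decays a b (c • ψ) := by
  obtain ⟨C, hC, C', hC', hh⟩ := h
  refine ⟨(|c| + 1) * C, by positivity, C', hC', fun x w hx => ?_⟩
  obtain ⟨h1, h2⟩ := hh x w hx
  have ha := (abs_nonneg _).trans_lt h1
  have hb := (abs_nonneg _).trans_lt h2
  have hc := abs_nonneg c
  rw [pd_smul, Pi.smul_apply, smul_eq_mul, abs_mul, abs_mul]
  constructor
  · nlinarith [mul_le_mul_of_nonneg_left h1.le hc]
  · nlinarith [mul_le_mul_of_nonneg_left h2.le hc]

/-- The space `S(B)` on the Killing horizon `B = {V_b = 0} ≅ ℝ × S²` with coordinates `(U_b, ω)`: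
smooth functions `φ - φ₀`, where `φ` vanishes at the bifurcation sphere `U_b = 0` and `φ₀` is a
constant, with `|φ - φ₀| < C / |U_b|` and `|∂φ| < C / U_b²` for large `|U_b|`. -/
def SB : Submodule ℝ (ℝ × S2 → ℝ) where
  carrier := {ψ | Smooth ψ ∧ (∃ φ₀ : ℝ, ∀ w : S2, ψ (0, w) + φ₀ = 0) ∧
    Decays (fun U => 1 / |U|) (fun U => 1 / U ^ 2) ψ}
  zero_mem' := ⟨contMDiff_const, ⟨0, by simp⟩, Decays.zero (fun x hx => by positivity)
    (fun x hx => by have : 0 < |x| := by linarith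
                    have : x ≠ 0 := abs_pos.1 this
                    positivity)⟩
  add_mem' := by
    rintro ψ χ ⟨h, ⟨c, hc⟩, hd⟩ ⟨h', ⟨c', hc'⟩, hd'⟩
    refine ⟨h.add h', ⟨c + c', fun w => ?_⟩, hd.add h h' hd'⟩
    have := hc w
    have := hc' w
    simp only [Pi.add_apply]
    linarith
  smul_mem' := by
    rintro c ψ ⟨h, ⟨φ₀, h0⟩, hd⟩
    refine ⟨h.smul c, ⟨c * φ₀, fun w => ?_⟩, hd.smul c⟩
    rw [Pi.smul_apply, smul_eq_mul, ← mul_add, h0, mul_zero]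

/-- The space `S(H)` on one of the two halves `H_b^±` of the horizon, each identified with `ℝ × S²`
by the coordinates `(u, ω)`: smooth functions with `|ψ| < C e^{-|u|}` and `|∂ψ| < C e^{-|u|}` for
large `|u|`. -/
def SH : Submodule ℝ (ℝ × S2 → ℝ) where
  carrier := {ψ | Smooth ψ ∧ Decays (fun u => exp (-|u|)) (fun u => exp (-|u|)) ψ}
  zero_mem' := ⟨contMDiff_const, Decays.zero (fun x _ => exp_pos _) (fun x _ => exp_pos _)⟩
  add_mem' := by
    rintro ψ χ ⟨h, hd⟩ ⟨h', hd'⟩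
    exact ⟨h.add h', hd.add h h' hd'⟩
  smul_mem' := by
    rintro c ψ ⟨h, hd⟩
    exact ⟨h.smul c, hd.smul c⟩

/-- Smooth functions `ψ` such that `ψ ∂χ` is integrable for all `ψ`, `χ` of this kind. -/
def Tame (ψ : ℝ × S2 → ℝ) : Prop :=
  Smooth ψ ∧ ∃ D : ℝ, ∀ p : ℝ × S2, |ψ p| ≤ D ∧ |pd ψ p| ≤ D * (1 + p.1 ^ 2)⁻¹

lemma tame_of_decays {a b : ℝ → ℝ} {K : ℝ} (ha : ∀ x, 1 < |x| → a x ≤ K)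
    (hb : ∀ x, 1 < |x| → b x ≤ K * (1 + x ^ 2)⁻¹) {ψ : ℝ × S2 → ℝ} (hs : Smooth ψ)
    (h : Decays a b ψ) : Tame ψ := by
  obtain ⟨C, hC, C', hC', hh⟩ := h
  have hc : IsCompact (Set.Icc (-C') C' ×ˢ (Set.univ : Set S2)) :=
    isCompact_Icc.prod isCompact_univ
  obtain ⟨B₁, hB₁⟩ := hc.exists_bound_of_continuousOn (f := ψ)
    (ContMDiff.continuous hs).continuousOn
  obtain ⟨B₂, hB₂⟩ := hc.exists_bound_of_continuousOn (f := pd ψ) hs.continuous_pd.continuousOn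
  refine ⟨hs, max (C * K) (max B₁ (B₂ * (1 + C' ^ 2))), fun p => ?_⟩
  have hp : 0 < 1 + p.1 ^ 2 := by positivity
  rcases lt_or_ge C' |p.1| with h1 | h1
  · obtain ⟨h2, h3⟩ := hh p.1 p.2 h1
    have ha' := ha p.1 (hC'.trans h1)
    have hb' := hb p.1 (hC'.trans h1)
    constructor
    · exact (h2.le.trans (mul_le_mul_of_nonneg_left ha' hC.le)).trans (le_max_left _ _)
    · refine (h3.le.trans (mul_le_mul_of_nonneg_left hb' hC.le)).trans ?_
      rw [← mul_assoc]
      exact mul_le_mul_of_nonneg_right (le_max_left _ _) (by positivity)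
  · have hm : p ∈ Set.Icc (-C') C' ×ˢ (Set.univ : Set S2) := ⟨abs_le.1 h1, trivial⟩
    have h2 := hB₁ p hm
    have h3 := hB₂ p hm
    rw [Real.norm_eq_abs] at h2 h3
    constructor
    · exact h2.trans ((le_max_left _ _).trans (le_max_right _ _))
    · refine le_trans ?_ (mul_le_mul_of_nonneg_right ((le_max_right _ _).trans (le_max_right _ _))
        (by positivity))
      have hB : 0 ≤ B₂ := (abs_nonneg _).trans h3
      have h5 : p.1 ^ 2 ≤ C' ^ 2 := by
        rw [← sq_abs]
        exact pow_le_pow_left₀ (abs_nonneg _) h1 2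
      rw [← div_eq_mul_inv, le_div_iff₀ hp]
      exact mul_le_mul h3 (by linarith) hp.le hB

lemma tame_of_mem_SB {ψ : ℝ × S2 → ℝ} (h : ψ ∈ SB) : Tame ψ := by
  refine tame_of_decays (K := 2) (fun x hx => ?_) (fun x hx => ?_) h.1 h.2.2
  · rw [div_le_iff₀ (by linarith)]
    linarith
  · have h1 : 1 < x ^ 2 := by rw [← sq_abs]; nlinarith
    rw [← div_eq_mul_inv, div_le_div_iff₀ (by linarith) (by linarith)]
    linarith

lemma tame_of_mem_SH {ψ : ℝ × S2 → ℝ} (h : ψ ∈ SH) : Tame ψ := by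
  refine tame_of_decays (K := 2) (fun x hx => ?_) (fun x hx => ?_) h.1 h.2
  · have : exp (-|x|) ≤ 1 := exp_le_one_iff.2 (by linarith)
    linarith
  · have h1 := quadratic_le_exp_of_nonneg (abs_nonneg x)
    rw [sq_abs] at h1
    have hx0 := abs_nonneg x
    rw [exp_neg, ← div_eq_mul_inv, ← one_div, div_le_div_iff₀ (exp_pos _) (by positivity)]
    linarith

lemma Tame.integrable {ψ χ : ℝ × S2 → ℝ} (h : Tame ψ) (h' : Tame χ) :
    Integrable (fun p => ψ p * pd χ p) ((volume : Measure ℝ).prod sphereMeasure) := by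
  obtain ⟨hs, D, hD⟩ := h
  obtain ⟨hs', D', hD'⟩ := h'
  have h1 : Integrable (fun p : ℝ × S2 => (1 + p.1 ^ 2)⁻¹)
      ((volume : Measure ℝ).prod sphereMeasure) :=
    (integrable_inv_one_add_sq).comp_fst sphereMeasure
  refine (h1.const_mul (D * D')).mono'
    ((ContMDiff.continuous hs).mul hs'.continuous_pd).aestronglyMeasurable
    (Filter.Eventually.of_forall fun p => ?_)
  rw [norm_mul, Real.norm_eq_abs, Real.norm_eq_abs, mul_assoc]
  exact mul_le_mul (hD p).1 (hD' p).2 (abs_nonneg _) ((abs_nonneg _).trans (hD p).1)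

lemma Tame.integrable_symp {ψ χ : ℝ × S2 → ℝ} (h : Tame ψ) (h' : Tame χ) :
    Integrable (fun p => ψ p * pd χ p - χ p * pd ψ p)
      ((volume : Measure ℝ).prod sphereMeasure) :=
  (h.integrable h').sub (h'.integrable h)

/-- The symplectic form `σ(ψ, χ) = r² ∫ (ψ ∂χ - χ ∂ψ)` over `ℝ × S²`, on a space of tame
functions. -/
def sympForm (S : Submodule ℝ (ℝ × S2 → ℝ)) (hS : ∀ ψ ∈ S, Tame ψ) (r : ℝ) : SkewForm S where
  toBilin := LinearMap.mk₂ ℝ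
    (fun ψ χ => r ^ 2 * ∫ p, ((ψ : ℝ × S2 → ℝ) p * pd χ p - (χ : ℝ × S2 → ℝ) p * pd ψ p)
      ∂((volume : Measure ℝ).prod sphereMeasure))
    (by
      intro ψ ψ' χ
      have i1 := (hS _ ψ.2).integrable_symp (hS _ χ.2)
      have i2 := (hS _ ψ'.2).integrable_symp (hS _ χ.2)
      rw [← mul_add, ← integral_add i1 i2]
      congr 2
      funext p
      simp only [Submodule.coe_add, Pi.add_apply, pd_add (hS _ ψ.2).1 (hS _ ψ'.2).1]
      ring)
    (by
      intro c ψ χ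
      rw [smul_eq_mul, mul_left_comm c, ← integral_const_mul c]
      congr 2
      funext p
      simp only [Submodule.coe_smul, Pi.smul_apply, smul_eq_mul, pd_smul]
      ring)
    (by
      intro ψ χ χ'
      have i1 := (hS _ ψ.2).integrable_symp (hS _ χ.2)
      have i2 := (hS _ ψ.2).integrable_symp (hS _ χ'.2)
      rw [← mul_add, ← integral_add i1 i2]
      congr 2
      funext p
      simp only [Submodule.coe_add, Pi.add_apply, pd_add (hS _ χ.2).1 (hS _ χ'.2).1]
      ring)
    (by
      intro c ψ χ
      rw [smul_eq_mul, mul_left_comm c, ← integral_const_mul c]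
      congr 2
      funext p
      simp only [Submodule.coe_smul, Pi.smul_apply, smul_eq_mul, pd_smul]
      ring)
  alt := by
    intro ψ
    simp [LinearMap.mk₂_apply]

/-- The symplectic form of `S(B)`. -/
def sigmaB (r : ℝ) : SkewForm SB := sympForm SB (fun _ => tame_of_mem_SB) r

/-- The symplectic form of `S(H_b^±)`. -/
def sigmaH (r : ℝ) : SkewForm SH := sympForm SH (fun _ => tame_of_mem_SH) r

/-! ### The Killing flow and the rotations -/

/-- The two halves `H_b^+ = {U_b > 0}` and `H_b^- = {U_b < 0}` of the horizon. -/
inductive Half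
  | plus
  | minus

/-- The sign of `U_b` on the half. -/
def Half.sgn : Half → ℝ
  | .plus => 1
  | .minus => -1

lemma Half.sgn_mul_self (b : Half) : b.sgn * b.sgn = 1 := by
  cases b <;> simp [Half.sgn]

/-- The function on `B` which is `ψ(u(U_b), ω)` on the half `H_b^±`, with
`u = ± κ⁻¹ log (± κ U_b)`, and zero elsewhere. -/
def extendZero (κ : ℝ) (b : Half) (ψ : ℝ × S2 → ℝ) (p : ℝ × S2) : ℝ :=
  if 0 < b.sgn * p.1 then ψ (b.sgn / κ * log (κ * (b.sgn * p.1)), p.2) else 0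

lemma Smooth.comp_left {ψ : ℝ × S2 → ℝ} (h : Smooth ψ) {f : ℝ → ℝ}
    (hf : ContDiff ℝ ((⊤ : ℕ∞) : WithTop ℕ∞) f) : Smooth fun p => ψ (f p.1, p.2) := by
  have h1 : ContMDiff (𝓘(ℝ, ℝ).prod (𝓡 2)) (𝓘(ℝ, ℝ).prod (𝓡 2)) ((⊤ : ℕ∞) : WithTop ℕ∞)
      fun p : ℝ × S2 => ((f p.1, p.2) : ℝ × S2) :=
    (hf.contMDiff.comp contMDiff_fst).prodMk contMDiff_snd
  exact ContMDiff.comp h h1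

/-- The action `(β_τ ψ)(U_b, ω) = ψ(e^{κτ} U_b, ω)` of the flow of the Killing field
`X = -κ U_b ∂_{U_b}` on `S(B)`. -/
def flowB (κ τ : ℝ) : SB →ₗ[ℝ] SB where
  toFun ψ := ⟨fun p => (ψ : ℝ × S2 → ℝ) (exp (κ * τ) * p.1, p.2), by
    obtain ⟨ψ, hs, ⟨φ₀, h0⟩, C, hC, C', hC', hd⟩ := ψ
    have he := exp_pos (κ * τ)
    refine ⟨hs.comp_left (contDiff_const.mul contDiff_id), ⟨φ₀, fun w => by simpa using h0 w⟩,
      C / exp (κ * τ), by positivity, C' / exp (κ * τ) + C', by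
        have : 0 < C' / exp (κ * τ) := by positivity
        linarith, fun x w hx => ?_⟩
    have hpos : 0 < C' / exp (κ * τ) := by positivity
    have hx0 : 0 < |x| := by linarith
    have hx1 : C' < |exp (κ * τ) * x| := by
      rw [abs_mul, abs_of_pos he]
      have : C' / exp (κ * τ) < |x| := by linarith
      rw [div_lt_iff₀ he] at this
      linarith
    obtain ⟨h1, h2⟩ := hd _ w hx1
    have hpd : pd (fun p => ψ (exp (κ * τ) * p.1, p.2)) (x, w)
        = exp (κ * τ) * pd ψ (exp (κ * τ) * x, w) := by
      have := deriv_comp_mul_left (exp (κ * τ)) (fun y => ψ (y, w)) x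
      simpa [pd] using this
    rw [hpd]
    constructor
    · refine h1.trans_le (le_of_eq ?_)
      simp only
      rw [abs_mul, abs_of_pos he]
      field_simp
    · rw [abs_mul, abs_of_pos he]
      refine (mul_lt_mul_of_pos_left h2 he).trans_le (le_of_eq ?_)
      simp only
      have : x ≠ 0 := abs_pos.1 hx0
      field_simp⟩
  map_add' _ _ := rfl
  map_smul' _ _ := rfl

/-- The action of a rotation `R` of `S²` on `S(B)`, `(ρ_R ψ)(U_b, ω) = ψ(U_b, R⁻¹ ω)`. -/
def rotB (R : E3 ≃ₗᵢ[ℝ] E3) : SB →ₗ[ℝ] SB where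
  toFun ψ := ⟨fun p => (ψ : ℝ × S2 → ℝ) (p.1, ⟨R.symm p.2, by simp⟩), by
    obtain ⟨ψ, hs, ⟨φ₀, h0⟩, C, hC, C', hC', hd⟩ := ψ
    refine ⟨?_, ⟨φ₀, fun w => h0 _⟩, C, hC, C', hC', fun x w hx => hd x _ hx⟩
    have h1 : ContMDiff (𝓡 2) 𝓘(ℝ, E3) ((⊤ : ℕ∞) : WithTop ℕ∞) fun w : S2 => R.symm (w : E3) :=
      R.symm.contDiff.contMDiff.comp contMDiff_coe_sphere
    have h2 := h1.codRestrict_sphere (n := 2) (fun w => by simp)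
    have h3 : ContMDiff (𝓘(ℝ, ℝ).prod (𝓡 2)) (𝓘(ℝ, ℝ).prod (𝓡 2)) ((⊤ : ℕ∞) : WithTop ℕ∞)
        fun p : ℝ × S2 => ((p.1, ⟨R.symm p.2, by simp⟩) : ℝ × S2) :=
      contMDiff_fst.prodMk (h2.comp contMDiff_snd)
    exact ContMDiff.comp hs h3⟩
  map_add' _ _ := rfl
  map_smul' _ _ := rfl

/-- Translation `ψ ↦ ψ(u + t, ω)` on `S(H)`. -/
def translateH (t : ℝ) : SH →ₗ[ℝ] SH where
  toFun ψ := ⟨fun p => (ψ : ℝ × S2 → ℝ) (p.1 + t, p.2), by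
    obtain ⟨ψ, hs, C, hC, C', hC', hd⟩ := ψ
    refine ⟨hs.comp_left (contDiff_id.add contDiff_const), C * exp |t|, by positivity, C' + |t|, by
      have := abs_nonneg t
      linarith, fun x w hx => ?_⟩
    have h3 : |x| ≤ |x + t| + |t| := by
      have := abs_sub (x + t) t
      simpa using this
    obtain ⟨h1, h2⟩ := hd (x + t) w (by linarith)
    have hpd : pd (fun p => ψ (p.1 + t, p.2)) (x, w) = pd ψ (x + t, w) :=
      deriv_comp_add_const (f := fun y => ψ (y, w)) t x
    have he : C * exp (-|x + t|) ≤ C * exp |t| * exp (-|x|) := by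
      rw [mul_assoc, ← exp_add]
      exact mul_le_mul_of_nonneg_left (exp_le_exp.2 (by linarith)) hC.le
    rw [hpd]
    exact ⟨h1.trans_le he, h2.trans_le he⟩⟩
  map_add' _ _ := rfl
  map_smul' _ _ := rfl

/-- The action of the flow of the Killing field `X`, which is `∂_u` on `H_b^-` and `-∂_u` on
`H_b^+`: thus `(β_τ ψ)(u, ω) = ψ(u - τ, ω)` on `H_b^-` and `ψ(u + τ, ω)` on `H_b^+`. -/
def flowH (b : Half) (τ : ℝ) : SH →ₗ[ℝ] SH := translateH (b.sgn * τ)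

/-- The flows on the halves and on the whole horizon are compatible. -/
lemma extendZero_flowH {κ : ℝ} (hκ : 0 < κ) (b : Half) (τ : ℝ) (ψ : SH) (p : ℝ × S2) :
    extendZero κ b (flowH b τ ψ : SH) p
      = extendZero κ b (ψ : ℝ × S2 → ℝ) (exp (κ * τ) * p.1, p.2) := by
  have he := exp_pos (κ * τ)
  unfold extendZero
  have e : b.sgn * (exp (κ * τ) * p.1) = exp (κ * τ) * (b.sgn * p.1) := by ring
  simp only [e, mul_pos_iff_of_pos_left he]
  split_ifs with h
  · change (ψ : ℝ × S2 → ℝ) (_ + b.sgn * τ, _) = _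
    refine congrArg (fun x => (ψ : ℝ × S2 → ℝ) (x, p.2)) ?_
    have e2 : κ * (exp (κ * τ) * (b.sgn * p.1)) = exp (κ * τ) * (κ * (b.sgn * p.1)) := by ring
    rw [e2, log_mul he.ne' (by positivity), log_exp]
    field_simp
    ring
  · rfl

/-! ### One-particle spaces and Fourier transforms -/

/-- The measure `2K dK ∧ r² dS²` on `ℝ₊ × S²`. -/
def measureB (r : ℝ) : Measure (ℝ × S2) :=
  (((volume : Measure ℝ).restrict (Set.Ioi 0)).withDensity fun K => ENNReal.ofReal (2 * K)).prod
    (ENNReal.ofReal (r ^ 2) • sphereMeasure)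

/-- The one-particle space `H_B = L²(ℝ₊ × S², 2K dK ∧ r² dS²)`. -/
abbrev HB (r : ℝ) : Type := Lp ℂ 2 (measureB r)

/-- The truncated Fourier transform `(2π)^{-1/2} ∫_{-R}^{R} e^{iKU} ψ(U, ω) dU`. -/
def fourierTrunc (ψ : ℝ × S2 → ℝ) (R : ℝ) (p : ℝ × S2) : ℂ :=
  ((√(2 * π) : ℝ) : ℂ)⁻¹ *
    ∫ U in (-R)..R, Complex.exp (Complex.I * p.1 * U) * (ψ (U, p.2) : ℂ)

/-- `h` is the restriction to `K > 0` of the `U`-Fourier-Plancherel transform of `ψ`, i.e. the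
`L²(dK ∧ dS²)` limit of the truncated Fourier transforms. -/
def IsFourierPlancherel (ψ : ℝ × S2 → ℝ) (h : ℝ × S2 → ℂ) : Prop :=
  Tendsto (fun R : ℝ => eLpNorm (fun p => h p - fourierTrunc ψ R p) 2
    (((volume : Measure ℝ).restrict (Set.Ioi 0)).prod sphereMeasure)) atTop (𝓝 0)

/-- The Fourier transform `(2π)^{-1/2} ∫ e^{iku} ψ(u, ω) du`. -/
def fourierU (ψ : ℝ × S2 → ℝ) (p : ℝ × S2) : ℂ :=
  ((√(2 * π) : ℝ) : ℂ)⁻¹ * ∫ u : ℝ, Complex.exp (Complex.I * p.1 * u) * (ψ (u, p.2) : ℂ)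

/-- The measure `dμ(k) ∧ r² dS²` on `ℝ × S²`, where
`dμ(k) = 2 k e^{πk/κ} / (e^{πk/κ} - e^{-πk/κ}) dk`. -/
def measureH (r κ : ℝ) : Measure (ℝ × S2) :=
  ((volume : Measure ℝ).withDensity fun k =>
    ENNReal.ofReal (2 * k * exp (π * k / κ) / (exp (π * k / κ) - exp (-(π * k / κ))))).prod
    (ENNReal.ofReal (r ^ 2) • sphereMeasure)

/-- The one-particle space `H_{H_b^±} = L²(ℝ × S², dμ(k) ∧ r² dS²)`. -/
abbrev HH (r κ : ℝ) : Type := Lp ℂ 2 (measureH r κ)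

/-- The domain `{φ | ∫ |k φ|² < ∞}` of `k̂`. -/
def kDom (ν : Measure (ℝ × S2)) : Submodule ℂ (Lp ℂ 2 ν) where
  carrier := {φ | MemLp (fun p => (p.1 : ℂ) * φ p) 2 ν}
  zero_mem' := by
    refine (memLp_congr_ae ?_).2 (MemLp.zero (p := 2) (μ := ν) : MemLp (0 : ℝ × S2 → ℂ) 2 ν)
    filter_upwards [Lp.coeFn_zero ℂ 2 ν] with p hp
    rw [hp, Pi.zero_apply, mul_zero]
  add_mem' := by
    intro φ χ h h'
    refine (memLp_congr_ae ?_).2 (MemLp.add h h')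
    filter_upwards [Lp.coeFn_add φ χ] with p hp
    rw [hp, Pi.add_apply, mul_add]
    rfl
  smul_mem' := by
    intro c φ h
    refine (memLp_congr_ae ?_).2 (MemLp.const_smul h c)
    filter_upwards [Lp.coeFn_smul c φ] with p hp
    rw [hp, Pi.smul_apply, Pi.smul_apply, smul_eq_mul, smul_eq_mul, mul_left_comm]

lemma kDom.memLp {ν : Measure (ℝ × S2)} (φ : kDom ν) :
    MemLp (fun p => (p.1 : ℂ) * (φ : Lp ℂ 2 ν) p) 2 ν := φ.2

/-- The operator `k̂` of multiplication by `k`, on its maximal domain. -/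
def kHat (ν : Measure (ℝ × S2)) : Lp ℂ 2 ν →ₗ.[ℂ] Lp ℂ 2 ν where
  domain := kDom ν
  toFun :=
    { toFun := fun φ => MemLp.toLp (fun p => (p.1 : ℂ) * (φ : Lp ℂ 2 ν) p) (kDom.memLp φ)
      map_add' := by
        intro φ χ
        refine (MemLp.toLp_congr _ ((kDom.memLp φ).add (kDom.memLp χ)) ?_).trans
          (MemLp.toLp_add _ _)
        filter_upwards [Lp.coeFn_add (φ : Lp ℂ 2 ν) (χ : Lp ℂ 2 ν)] with p hp
        rw [Submodule.coe_add, hp, Pi.add_apply, mul_add]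
        rfl
      map_smul' := by
        intro c φ
        refine (MemLp.toLp_congr _ ((kDom.memLp φ).const_smul c) ?_).trans
          (MemLp.toLp_const_smul _ _)
        filter_upwards [Lp.coeFn_smul c (φ : Lp ℂ 2 ν)] with p hp
        rw [Submodule.coe_smul, hp, Pi.smul_apply, Pi.smul_apply, smul_eq_mul, smul_eq_mul,
          mul_left_comm] }

/-- `V_τ = e^{iτA}`: `A` is self-adjoint and `V` is the strongly continuous one-parameter unitary
group generated by `A`. -/
def IsExpOf {H : Type*} [NormedAddCommGroup H] [InnerProductSpace ℂ H] [CompleteSpace H]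
    (V : ℝ → H ≃ₗᵢ[ℂ] H) (A : H →ₗ.[ℂ] H) : Prop :=
  IsSelfAdjoint A ∧ (∀ φ, V 0 φ = φ) ∧ (∀ s t φ, V (s + t) φ = V s (V t φ)) ∧
    (∀ φ, Continuous fun t => V t φ) ∧
    ∀ φ : A.domain, HasDerivAt (fun t => V t (φ : H)) (Complex.I • A φ) 0

/-- The kernel integral
`-(r²/π) ∫ conj ψ₁(U₁, ω) ψ₂(U₂, ω) (U₁ - U₂ - iε)⁻² dU₁ dU₂ dS²`. -/
def lambdaReg (r ε : ℝ) (ψ₁ ψ₂ : ℝ × S2 → ℝ) : ℂ :=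
  -((r ^ 2 / π : ℝ) : ℂ) *
    ∫ q : ℝ × ℝ × S2, (starRingEnd ℂ) (ψ₁ (q.1, q.2.2) : ℂ) * (ψ₂ (q.2.1, q.2.2) : ℂ) /
      ((q.1 : ℂ) - (q.2.1 : ℂ) - Complex.I * (ε : ℂ)) ^ 2
      ∂((volume : Measure ℝ).prod ((volume : Measure ℝ).prod sphereMeasure))

/-- `λ(ψ₁, ψ₂) = z`, where `λ` is the limit `ε → 0⁺` of the kernel integrals. -/
def IsLambda (r : ℝ) (ψ₁ ψ₂ : ℝ × S2 → ℝ) (z : ℂ) : Prop :=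
  Tendsto (fun ε => lambdaReg r ε ψ₁ ψ₂) (𝓝[>] 0) (𝓝 z)

/-! ### Quasifree states, one-particle structures, KMS states -/

section Quasifree

variable {L : Type*} [AddCommGroup L] [Module ℝ L] {σ : SkewForm L}

/-- `ω(W(f)) = exp (-μ(f, f)/2)` with a symmetric form `μ` that majorizes `σ`. -/
def IsQuasifreeWith (ω : AlgState (Weyl σ)) (μ : L →ₗ[ℝ] L →ₗ[ℝ] ℝ) : Prop :=
  (∀ f g, μ f g = μ g f) ∧ (∀ f g, |σ f g| ^ 2 ≤ 4 * μ f f * μ g g) ∧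
    ∀ f, ω (Weyl.W σ f) = ((exp (-(μ f f) / 2) : ℝ) : ℂ)

/-- Quasifree states. -/
def IsQuasifree (ω : AlgState (Weyl σ)) : Prop := ∃ μ, IsQuasifreeWith ω μ

/-- The two-point function `ω(Φ(f) Φ(g)) = -∂_s ∂_t ω(W(s f) W(t g))` at `s = t = 0`, where
`W(f) = e^{iΦ(f)}`. -/
def twoPoint (ω : AlgState (Weyl σ)) (f g : L) : ℂ :=
  -deriv (fun s : ℝ => deriv (fun t : ℝ => ω (Weyl.W σ (s • f) * Weyl.W σ (t • g))) 0) 0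

/-- `(H, K)` is a one-particle structure of `(σ, μ)`: the complex span of the range of `K` is
dense, `μ = Re ⟨K·, K·⟩` and `σ = 2 Im ⟨K·, K·⟩`. -/
def IsOneParticle {H : Type*} [NormedAddCommGroup H] [InnerProductSpace ℂ H] (σ : SkewForm L)
    (μ : L →ₗ[ℝ] L →ₗ[ℝ] ℝ) (K : L →ₗ[ℝ] H) : Prop :=
  Dense (Submodule.span ℂ (Set.range K) : Set H) ∧
    (∀ f g, μ f g = (inner ℂ (K f) (K g)).re) ∧ ∀ f g, σ f g = 2 * (inner ℂ (K f) (K g)).im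

/-- `ω` is a quasifree state with one-particle structure `(H, K)`. -/
def HasOneParticle {H : Type*} [NormedAddCommGroup H] [InnerProductSpace ℂ H]
    (ω : AlgState (Weyl σ)) (K : L →ₗ[ℝ] H) : Prop :=
  ∃ μ, IsQuasifreeWith ω μ ∧ IsOneParticle σ μ K

/-- The KMS condition at inverse temperature `β` for a one-parameter group of
`*`-automorphisms. -/
def IsKMS {A : Type*} [CStarAlgebra A] (ω : AlgState A) (α : Multiplicative ℝ →* (A ≃⋆ₐ[ℂ] A))
    (β : ℝ) : Prop :=
  ∀ a b : A, ∃ F : ℂ → ℂ,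
    ContinuousOn F {z | 0 ≤ z.im ∧ z.im ≤ β} ∧ DifferentiableOn ℂ F {z | 0 < z.im ∧ z.im < β} ∧
    (∃ C : ℝ, ∀ z : ℂ, 0 ≤ z.im → z.im ≤ β → ‖F z‖ ≤ C) ∧
    ∀ t : ℝ, F t = ω (a * α (Multiplicative.ofAdd t) b) ∧
      F (t + Complex.I * β) = ω (α (Multiplicative.ofAdd t) b * a)

end Quasifree

end SdSState
end

open SdSState

noncomputable section

namespace SdSState

open scoped FourierTransform ENNReal ComplexConjugate

/-! ### Continuity, extension and uniqueness of states -/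

namespace AlgState

/-! A real-linear map `K` with `σ = 2 Im ⟨K·, K·⟩` always carries a quasifree state. Rescaled by
`exp (‖K f‖² / 2)`, the Weyl symbols have the inner products `exp ⟨K f, K g⟩` of exponential
vectors, and the entrywise exponential of a Gram matrix is positive by the Schur product theorem
(`posSemidef_exp_gram`, `exists_quasifree`). States on a Weyl algebra are automatically continuous
and determined by the symbols, so invariance, uniqueness and restriction all reduce to equalities of
one-particle norms.

Both one-particle maps are the Fourier transform in the first variable, with values in an `L²` space
whose weight satisfies `w(k) - w(-k) = 2k`. For real functions the transform at `-k` is the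
conjugate of the transform at `k`. Hence the imaginary part of the inner product sees only the odd
part of the weight and equals the symplectic form by Plancherel (`im_inner_Kmap`), while the norm
sees only `w(k) + w(-k)` (`lintegral_symm`): this is `2|k|` for the vacuum and `2k coth(πk/κ)` for
the thermal weight.

Purity holds because the range of `K_B` is dense as a real subspace, so that `i K f` is a limit of
vectors of the range. A functional dominated by the state satisfies the Cauchy-Riemann equations on
exponential vectors; if it is hermitian it also satisfies the conjugate equations, hence it is
constant along rays (`state_eq_of_le`). The density itself (`dense_range_Kmap_SB`) must cope with
the condition that elements of `S(B)` be constant on the bifurcation sphere. Narrow Gaussians repair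
that condition for free: dilations preserve the vacuum norm, and the narrowing Gaussians tend weakly
to zero. The kernel formula comes from the Fourier transform `-2π k₊ e^{-εk}` of `(x - iε)⁻²`
(`Reg.lambdaReg_eq`).

The restriction to a half rests on difference integrals. The vacuum norm is a multiple of the
integral of `|Ψ(V) - Ψ(U)|² / (V - U)²`. In the exponential coordinate the part inside the half has
the kernel `κ² / (4 sinh²(κ(v - u)/2))`, whose symbol is `2πk coth(πk/κ) - 2κ`; the pairs with one
point in each half add exactly the missing `2κ ∫ |ψ|²` (`Half.lintegral_differences`,
`lintegral_thermal`).

The KMS condition comes from `w(k) e^{-2πk/κ} = w(-k)` for the thermal weight: `∫ e^{ikz} w(k)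
conj(f^) g^` then converges up to the upper edge of the strip and exchanges `f` and `g` there
(`exists_stripFun`). Exponentiation transfers this to Weyl symbols, and Phragmén-Lindelöf to their
closed span (`isKMS_of_span_dense`). -/

lemma ext_apply {A : Type*} [Ring A] [StarRing A] [Algebra ℂ A] {φ ψ : AlgState A}
    (h : ∀ a, φ a = ψ a) : φ = ψ := by
  cases φ
  cases ψ
  congr
  exact LinearMap.ext h

section CStar

variable {A : Type*} [CStarAlgebra A] (φ : AlgState A)

/-- `‖a‖² - a* a` is positive in a C*-algebra, hence of the form `b* b`, and a state is nonnegative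
there. Continuity of states is thus a consequence of positivity and normalization. -/
lemma gnsNorm_le_norm (a : A) : φ.gnsNorm a ≤ ‖a‖ := by
  let _ := CStarAlgebra.spectralOrder A
  let _ := CStarAlgebra.spectralOrderedRing A
  have h : 0 ≤ algebraMap ℝ A (‖a‖ ^ 2) - star a * a :=
    sub_nonneg.2 CStarAlgebra.star_mul_le_algebraMap_norm_sq
  obtain ⟨b, hb⟩ := CStarAlgebra.nonneg_iff_eq_star_mul_self.1 h
  have h2 := (Complex.le_def.1 (φ.nonneg b)).1
  have e : algebraMap ℝ A (‖a‖ ^ 2) = ((‖a‖ ^ 2 : ℝ) : ℂ) • (1 : A) := by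
    rw [Algebra.algebraMap_eq_smul_one]
    exact (Complex.coe_smul (‖a‖ ^ 2) (1 : A)).symm
  rw [← hb, e, map_sub, map_smul, φ.map_one] at h2
  simp only [smul_eq_mul, mul_one, Complex.sub_re, Complex.ofReal_re, Complex.zero_re] at h2
  exact Real.sqrt_le_iff.2 ⟨norm_nonneg a, by linarith⟩

lemma norm_apply_le_gnsNorm {A : Type*} [Ring A] [StarRing A] [Algebra ℂ A] [StarModule ℂ A]
    (φ : AlgState A) (a : A) : ‖φ a‖ ≤ φ.gnsNorm a := by
  have h := φ.norm_apply_le 1 a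
  rwa [star_one, one_mul, gnsNorm, star_one, one_mul, φ.map_one, Complex.one_re, Real.sqrt_one,
    one_mul] at h

/-- A state of a C*-algebra as a continuous linear functional. -/
def toCLM : A →L[ℂ] ℂ :=
  φ.toFun.mkContinuous 1 fun a => by
    rw [one_mul]
    exact (φ.norm_apply_le_gnsNorm a).trans (φ.gnsNorm_le_norm a)

lemma norm_apply_le_norm (a : A) : ‖φ a‖ ≤ ‖a‖ :=
  (φ.norm_apply_le_gnsNorm a).trans (φ.gnsNorm_le_norm a)

lemma conj_apply_star {A : Type*} [Ring A] [StarRing A] [Algebra ℂ A] [StarModule ℂ A]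
    (φ : AlgState A) (a : A) : φ (star a) = (starRingEnd ℂ) (φ a) := by
  have := φ.conj_symm a 1
  simpa using this.symm

/-- Pullback of a state along a `*`-homomorphism. -/
def comap {A B : Type*} [Ring A] [StarRing A] [Algebra ℂ A] [Ring B] [StarRing B] [Algebra ℂ B]
    (φ : AlgState B) (T : A →⋆ₐ[ℂ] B) : AlgState A where
  toFun := φ.toFun ∘ₗ T.toAlgHom.toLinearMap
  nonneg a := by
    have := φ.nonneg (T a)
    rw [← map_star, ← map_mul] at this
    exact this
  map_one := by
    change φ (T 1) = 1
    rw [_root_.map_one, φ.map_one]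

end CStar

end AlgState

section WeylTools

variable {L : Type*} [AddCommGroup L] [Module ℝ L] {σ : SkewForm L}

namespace Weyl

lemma clm_ext {E : Type*} [NormedAddCommGroup E] [NormedSpace ℂ E] {S T : Weyl σ →L[ℂ] E}
    (h : ∀ f, S (W σ f) = T (W σ f)) : S = T :=
  ContinuousLinearMap.ext_on (dense_span_W σ) (by rintro _ ⟨f, rfl⟩; exact h f)

/-- The symbols span a dense subspace and states are continuous. Every equality of states is reduced
to symbols through this. -/
lemma state_ext {φ ψ : AlgState (Weyl σ)} (h : ∀ f, φ (W σ f) = ψ (W σ f)) : φ = ψ :=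
  AlgState.ext_apply fun a => congrArg (fun T : Weyl σ →L[ℂ] ℂ => T a)
    (clm_ext (S := φ.toCLM) (T := ψ.toCLM) h)

variable (σ) in
/-- The inclusion of the formal finite sums as a linear map. -/
def inclₗ : PreWeyl σ →ₗ[ℂ] Weyl σ where
  toFun := incl σ
  map_add' := incl_add σ
  map_smul' := incl_smul σ

/-- The extension of a state to the Weyl algebra. -/
def extendState (φ : AlgState (PreWeyl σ)) : AlgState (Weyl σ) :=
  -- The norm of a finite sum is the supremum of the GNS seminorms of all states, `φ` among them;
  -- this gives the bound with constant 1.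
  have hb : ∃ C : ℝ, ∀ a, ‖φ.toFun a‖ ≤ C * ‖inclₗ σ a‖ := ⟨1, fun a => by
    rw [one_mul]
    exact (φ.norm_apply_le_gnsNorm a).trans
      ((PreWeyl.gnsNorm_le σ φ a).trans (norm_incl σ a).ge)⟩
  { toFun := (φ.toFun.extendOfNorm (inclₗ σ)).toLinearMap
    nonneg := by
      intro a
      refine (denseRange_incl σ).induction_on a (p := fun a =>
        0 ≤ (φ.toFun.extendOfNorm (inclₗ σ)) (star a * a)) ?_ fun a => ?_
      · exact isClosed_le continuous_const ((ContinuousLinearMap.continuous _).comp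
          ((continuous_star' σ).mul continuous_id))
      · rw [star_incl, ← incl_mul]
        have := LinearMap.extendOfNorm_eq (f := φ.toFun) (e := inclₗ σ) (denseRange_incl σ) hb
          (star a * a)
        exact (φ.nonneg a).trans_eq this.symm
    map_one := by
      have := LinearMap.extendOfNorm_eq (f := φ.toFun) (e := inclₗ σ) (denseRange_incl σ) hb 1
      exact this.trans φ.map_one }

lemma extendState_W (φ : AlgState (PreWeyl σ)) (f : L) :
    extendState φ (W σ f) = φ (PreWeyl.sym σ f 1) := by
  have hb : ∃ C : ℝ, ∀ a, ‖φ.toFun a‖ ≤ C * ‖inclₗ σ a‖ := ⟨1, fun a => by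
    rw [one_mul]
    exact (φ.norm_apply_le_gnsNorm a).trans
      ((PreWeyl.gnsNorm_le σ φ a).trans (norm_incl σ a).ge)⟩
  exact LinearMap.extendOfNorm_eq (f := φ.toFun) (e := inclₗ σ) (denseRange_incl σ) hb _

end Weyl

/-! ### Automorphisms induced by symplectic maps -/

namespace PreWeyl

/-- The linear map `W(f) ↦ W(T f)`. -/
def mapₗ (T : L →ₗ[ℝ] L) : PreWeyl σ →ₗ[ℂ] PreWeyl σ :=
  (Finsupp.lmapDomain ℂ ℂ T : (L →₀ ℂ) →ₗ[ℂ] (L →₀ ℂ))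

lemma mapₗ_sym (T : L →ₗ[ℝ] L) (f : L) (x : ℂ) :
    mapₗ (σ := σ) T (sym σ f x) = sym σ (T f) x := Finsupp.mapDomain_single

/-- The `*`-homomorphism `W(f) ↦ W(T f)` for a symplectic map `T`. -/
def map (T : L →ₗ[ℝ] L) (hT : ∀ f g, σ (T f) (T g) = σ f g) : PreWeyl σ →⋆ₐ[ℂ] PreWeyl σ where
  toFun := mapₗ T
  map_add' := map_add _
  map_zero' := map_zero _
  map_one' := by
    rw [one_def, mapₗ_sym, map_zero]
  map_mul' := by
    intro a b
    induction a using PreWeyl.induct with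
    | h0 => rw [zero_mul, map_zero, zero_mul]
    | hadd a a' h h' => rw [add_mul, map_add, map_add, add_mul, h, h']
    | hs f x =>
      induction b using PreWeyl.induct with
      | h0 => rw [mul_zero, map_zero, mul_zero]
      | hadd b b' h h' => rw [mul_add, map_add, map_add, mul_add, h, h']
      | hs g y =>
        rw [sym_mul_sym, mapₗ_sym, mapₗ_sym, mapₗ_sym, sym_mul_sym, phase, phase, hT, map_add]
  commutes' := by
    intro r
    rw [Algebra.algebraMap_eq_smul_one, one_def, smul_sym, mapₗ_sym, map_zero]
  map_star' := by
    intro a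
    induction a using PreWeyl.induct with
    | h0 => rw [star_zero, map_zero, star_zero]
    | hadd a a' h h' => rw [star_add, map_add, map_add, star_add, h, h']
    | hs f x => rw [star_sym, mapₗ_sym, mapₗ_sym, star_sym, map_neg]

lemma map_sym (T : L →ₗ[ℝ] L) (hT : ∀ f g, σ (T f) (T g) = σ f g) (f : L) (x : ℂ) :
    map T hT (sym σ f x) = sym σ (T f) x := mapₗ_sym T f x

/-- States pull back to states along a `*`-homomorphism, so the supremum on the left runs over a
subfamily of the states on the right. Neither injectivity of `T` nor nondegeneracy of `σ` enters. -/
lemma norm_map_le (T : L →ₗ[ℝ] L) (hT : ∀ f g, σ (T f) (T g) = σ f g) (a : PreWeyl σ) :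
    ‖map T hT a‖ ≤ ‖a‖ := by
  refine norm_le_of σ _ _ fun φ => ?_
  refine le_trans (le_of_eq ?_) (gnsNorm_le σ (φ.comap (map T hT)) a)
  unfold AlgState.gnsNorm
  rw [← map_star, ← map_mul]
  rfl

end PreWeyl

namespace Weyl

variable (T : L →ₗ[ℝ] L) (hT : ∀ f g, σ (T f) (T g) = σ f g)

/-- The continuous linear map `W(f) ↦ W(T f)` for a symplectic map `T`. -/
def mapCLM : Weyl σ →L[ℂ] Weyl σ :=
  (inclₗ σ ∘ₗ (PreWeyl.map T hT).toAlgHom.toLinearMap).extendOfNorm (inclₗ σ)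

lemma mapCLM_incl (a : PreWeyl σ) : mapCLM T hT (incl σ a) = incl σ (PreWeyl.map T hT a) := by
  refine LinearMap.extendOfNorm_eq (f := inclₗ σ ∘ₗ (PreWeyl.map T hT).toAlgHom.toLinearMap)
    (e := inclₗ σ) (denseRange_incl σ) ⟨1, fun a => ?_⟩ a
  rw [one_mul]
  exact (norm_incl σ _).le.trans ((PreWeyl.norm_map_le T hT a).trans (norm_incl σ a).ge)

lemma mapCLM_W (f : L) : mapCLM T hT (W σ f) = W σ (T f) := by
  rw [W, mapCLM_incl, PreWeyl.map_sym, W]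

/-- The `*`-endomorphism `W(f) ↦ W(T f)` for a symplectic map `T`. -/
def map : Weyl σ →⋆ₐ[ℂ] Weyl σ where
  toFun := mapCLM T hT
  map_add' := map_add _
  map_zero' := map_zero _
  map_one' := by rw [← W_zero, mapCLM_W, map_zero]
  map_mul' a b := by
    refine (denseRange_incl σ).induction_on₂
      (p := fun a b => mapCLM T hT (a * b) = mapCLM T hT a * mapCLM T hT b)
      (isClosed_eq (by fun_prop) (by fun_prop)) (fun a b => ?_) a b
    rw [← incl_mul, mapCLM_incl, mapCLM_incl, mapCLM_incl, _root_.map_mul, incl_mul]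
  commutes' r := by
    rw [Algebra.algebraMap_eq_smul_one, map_smul, ← W_zero, mapCLM_W, map_zero]
  map_star' a := by
    refine (denseRange_incl σ).induction_on a
      (isClosed_eq ((ContinuousLinearMap.continuous _).comp (continuous_star' σ))
        ((continuous_star' σ).comp (ContinuousLinearMap.continuous _))) (fun a => ?_)
    rw [star_incl, mapCLM_incl, mapCLM_incl, star_incl, map_star]

lemma map_W (f : L) : map T hT (W σ f) = W σ (T f) := mapCLM_W T hT f

end Weyl

variable {G : Type*} [Group G] (ρ : G → L →ₗ[ℝ] L) (hσ : ∀ x f g, σ (ρ x f) (ρ x g) = σ f g)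
  (h1 : ∀ f, ρ 1 f = f) (hmul : ∀ x y f, ρ (x * y) f = ρ x (ρ y f))

/-- The group of `*`-automorphisms `W(f) ↦ W(ρ_x f)` of a symplectic representation. -/
def Weyl.autHom : G →* (Weyl σ ≃⋆ₐ[ℂ] Weyl σ) :=
  have e1 : ∀ a, Weyl.mapCLM (ρ 1) (hσ 1) a = a := fun a =>
    congrArg (fun T : Weyl σ →L[ℂ] Weyl σ => T a) (Weyl.clm_ext (S := Weyl.mapCLM (ρ 1) (hσ 1))
      (T := ContinuousLinearMap.id ℂ _) fun f => by rw [Weyl.mapCLM_W, h1]; rfl)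
  have e2 : ∀ x y a, Weyl.mapCLM (ρ (x * y)) (hσ (x * y)) a
      = Weyl.mapCLM (ρ x) (hσ x) (Weyl.mapCLM (ρ y) (hσ y) a) := fun x y a =>
    congrArg (fun T : Weyl σ →L[ℂ] Weyl σ => T a) (Weyl.clm_ext
      (T := (Weyl.mapCLM (ρ x) (hσ x)).comp (Weyl.mapCLM (ρ y) (hσ y)))
      fun f => by
        rw [Weyl.mapCLM_W, hmul, ContinuousLinearMap.comp_apply, Weyl.mapCLM_W, Weyl.mapCLM_W])
  { toFun := fun x => StarAlgEquiv.ofStarAlgHom (Weyl.map (ρ x) (hσ x))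
      (Weyl.map (ρ x⁻¹) (hσ x⁻¹))
      (StarAlgHom.ext fun a => by
        change Weyl.mapCLM _ _ (Weyl.mapCLM _ _ a) = a
        rw [← e2, ← e1 a]
        simp only [inv_mul_cancel, e1])
      (StarAlgHom.ext fun a => by
        change Weyl.mapCLM _ _ (Weyl.mapCLM _ _ a) = a
        rw [← e2, ← e1 a]
        simp only [mul_inv_cancel, e1])
    map_one' := StarAlgEquiv.ext fun a => e1 a
    map_mul' := fun x y => StarAlgEquiv.ext fun a => e2 x y a }

lemma Weyl.autHom_W (x : G) (f : L) :
    Weyl.autHom ρ hσ h1 hmul x (Weyl.W σ f) = Weyl.W σ (ρ x f) := Weyl.map_W _ _ f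

lemma Weyl.state_autHom (ω : AlgState (Weyl σ))
    (h : ∀ x f, ω (Weyl.W σ (ρ x f)) = ω (Weyl.W σ f)) (x : G) (a : Weyl σ) :
    ω (Weyl.autHom ρ hσ h1 hmul x a) = ω a := by
  have := Weyl.clm_ext (S := ω.toCLM.comp (Weyl.mapCLM (ρ x) (hσ x))) (T := ω.toCLM) fun f => by
    rw [ContinuousLinearMap.comp_apply, Weyl.mapCLM_W]
    exact h x f
  exact congrArg (fun T : Weyl σ →L[ℂ] ℂ => T a) this

end WeylTools

/-! ### Quasifree states from one-particle maps -/

section Exponential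

variable {ι H : Type*} [NormedAddCommGroup H] [InnerProductSpace ℂ H]

/-- The quadratic form at a finitely supported `x` is `‖∑ xᵢ vᵢ‖²`. The index type will be all of
`L`, so it is not assumed finite. -/
lemma posSemidef_gram_of_infinite (v : ι → H) :
    (Matrix.of fun i j => inner ℂ (v i) (v j)).PosSemidef := by
  refine ⟨?_, fun x => ?_⟩
  · ext i j
    simp only [Matrix.conjTranspose_apply, Matrix.of_apply, Complex.star_def, inner_conj_symm]
  · have h : (x.sum fun i xi => x.sum fun j xj => star xi *
        (Matrix.of fun i j => inner ℂ (v i) (v j)) i j * xj)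
        = inner ℂ (x.sum fun i xi => xi • v i) (x.sum fun i xi => xi • v i) := by
      simp only [Finsupp.sum, sum_inner, inner_sum, inner_smul_left, inner_smul_right,
        Matrix.of_apply, Complex.star_def, Finset.mul_sum]
      rw [Finset.sum_comm]
      refine Finset.sum_congr rfl fun i _ => Finset.sum_congr rfl fun j _ => ?_
      ring
    rw [h, inner_self_eq_norm_sq_to_K]
    rw [RCLike.ofReal_eq_complex_ofReal, ← Complex.ofReal_pow]
    exact Complex.zero_le_real.2 (sq_nonneg _)

/-- Entrywise powers of a Gram matrix are positive by the Schur product theorem, and the exponential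
series combines them with positive coefficients. The entries are the inner products of exponential
vectors in Fock space. -/
lemma posSemidef_exp_gram (v : ι → H) :
    (Matrix.of fun i j => Complex.exp (inner ℂ (v i) (v j))).PosSemidef := by
  have hpow : ∀ n : ℕ, (Matrix.of fun i j => (inner ℂ (v i) (v j)) ^ n).PosSemidef := by
    intro n
    induction n with
    -- The zeroth power is the all-ones matrix, the Gram matrix of a constant family in `ℂ`.
    | zero => simpa using posSemidef_gram_of_infinite (fun _ : ι => (1 : ℂ))
    | succ n ih => exact ih.hadamard (posSemidef_gram_of_infinite v)
  refine ⟨?_, fun x => ?_⟩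
  · ext i j
    simp only [Matrix.conjTranspose_apply, Matrix.of_apply, Complex.star_def, ← Complex.exp_conj,
      inner_conj_symm]
  · have hs : HasSum (fun n : ℕ => x.sum fun i xi => x.sum fun j xj =>
        star xi * ((n.factorial : ℂ)⁻¹ * (inner ℂ (v i) (v j)) ^ n) * xj)
        (x.sum fun i xi => x.sum fun j xj => star xi * Complex.exp (inner ℂ (v i) (v j)) * xj) := by
      simp only [Finsupp.sum]
      refine hasSum_sum fun i _ => hasSum_sum fun j _ => ?_
      refine ((HasSum.mul_left _ ?_).mul_right _)
      have := NormedSpace.expSeries_div_hasSum_exp (inner ℂ (v i) (v j))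
      rw [← Complex.exp_eq_exp_ℂ] at this
      simpa [div_eq_inv_mul] using this
    refine hs.nonneg fun n => ?_
    have h := (hpow n).2 x
    have e : (x.sum fun i xi => x.sum fun j xj =>
        star xi * ((n.factorial : ℂ)⁻¹ * (inner ℂ (v i) (v j)) ^ n) * xj)
        = (n.factorial : ℂ)⁻¹ * x.sum fun i xi => x.sum fun j xj =>
          star xi * (Matrix.of fun i j => (inner ℂ (v i) (v j)) ^ n) i j * xj := by
      simp only [Finsupp.sum, Finset.mul_sum, Matrix.of_apply]
      refine Finset.sum_congr rfl fun i _ => Finset.sum_congr rfl fun j _ => ?_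
      ring
    rw [e]
    refine mul_nonneg ?_ h
    have : (0 : ℝ) ≤ ((n.factorial : ℝ))⁻¹ := by positivity
    have h2 : ((n.factorial : ℂ))⁻¹ = (((n.factorial : ℝ)⁻¹ : ℝ) : ℂ) := by push_cast; rfl
    rw [h2]
    exact Complex.zero_le_real.2 this

end Exponential

section Quasifree

variable {L : Type*} [AddCommGroup L] [Module ℝ L] {σ : SkewForm L}
variable {H : Type*} [NormedAddCommGroup H] [InnerProductSpace ℂ H] (K : L →ₗ[ℝ] H)

/-- The real part of the inner product, pulled back along a real linear map. -/
def reForm : L →ₗ[ℝ] L →ₗ[ℝ] ℝ :=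
  LinearMap.mk₂ ℝ (fun f g => (inner ℂ (K f) (K g)).re)
    (fun f f' g => by rw [map_add, inner_add_left, Complex.add_re])
    (fun c f g => by
      rw [map_smul, inner_smul_left_eq_smul, Complex.smul_re])
    (fun f g g' => by rw [map_add, inner_add_right, Complex.add_re])
    (fun c f g => by
      rw [map_smul, inner_smul_right_eq_smul, Complex.smul_re])

lemma reForm_apply (f g : L) : reForm K f g = (inner ℂ (K f) (K g)).re := rfl

lemma reForm_self (f : L) : reForm K f f = ‖K f‖ ^ 2 := by
  rw [reForm_apply, inner_self_eq_norm_sq_to_K]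
  norm_cast

variable (hσ : ∀ f g, σ f g = 2 * (inner ℂ (K f) (K g)).im)

section
include hσ

/-- Polarization gives the real part and the hypothesis on `σ` the imaginary part. The point of the
form: up to factors depending on `f` or on `g` alone, `exp ⟨K f, K g⟩` is the Weyl phase of `W(-f)
W(g)` times the Gaussian at `g - f`. -/
lemma exp_inner_eq (f g : L) : Complex.exp (inner ℂ (K f) (K g))
    = Complex.exp (((‖K f‖ ^ 2 / 2 : ℝ) : ℂ) + ((‖K g‖ ^ 2 / 2 : ℝ) : ℂ)
      + Complex.I * (σ f g : ℂ) / 2 - ((‖K (g - f)‖ ^ 2 / 2 : ℝ) : ℂ)) := by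
  congr 1
  have h := norm_sub_sq (𝕜 := ℂ) (K g) (K f)
  rw [map_sub, hσ, h]
  have h2 : RCLike.re (inner ℂ (K g) (K f)) = (inner ℂ (K f) (K g)).re := by
    rw [← inner_conj_symm]
    exact Complex.conj_re _
  rw [h2]
  have h3 : ∀ x : ℝ, ((x : ℂ) ^ 2).im = 0 := fun x => by rw [← Complex.ofReal_pow, Complex.ofReal_im]
  apply Complex.ext
  · simp; ring
  · simp [h3]

/-- By `exp_inner_eq` the value on `a* a` is the exponential Gram form at the coefficients of `a`
rescaled by `exp (-‖K f‖² / 2)`; positivity is then `posSemidef_exp_gram`. -/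
lemma exists_preWeyl_state : ∃ φ : AlgState (PreWeyl σ),
    ∀ f, φ (PreWeyl.sym σ f 1) = ((exp (-(‖K f‖ ^ 2) / 2) : ℝ) : ℂ) := by
  let Φ : PreWeyl σ →ₗ[ℂ] ℂ :=
    (Finsupp.lsum ℂ fun f => LinearMap.toSpanSingleton ℂ ℂ ((exp (-(‖K f‖ ^ 2) / 2) : ℝ) : ℂ) :
      (L →₀ ℂ) →ₗ[ℂ] ℂ)
  have hΦ : ∀ f x, Φ (PreWeyl.sym σ f x) = x * ((exp (-(‖K f‖ ^ 2) / 2) : ℝ) : ℂ) := by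
    intro f x
    change (Finsupp.lsum ℂ _ : (L →₀ ℂ) →ₗ[ℂ] ℂ) (Finsupp.single f x) = _
    rw [Finsupp.lsum_single]
    rfl
  refine ⟨⟨Φ, fun a => ?_, ?_⟩, fun f => by rw [hΦ, one_mul]⟩
  · let c : L → ℂ := fun f => ((exp (-(‖K f‖ ^ 2) / 2) : ℝ) : ℂ)
    have key : ∀ a b : PreWeyl σ, Φ (star a * b) = (PreWeyl.toFinsupp σ a).sum fun f x =>
        (PreWeyl.toFinsupp σ b).sum fun g y =>
          star (x * c f) * Complex.exp (inner ℂ (K f) (K g)) * (y * c g) := by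
      intro a b
      induction a using PreWeyl.induct with
      | h0 =>
        rw [star_zero, zero_mul, map_zero]
        exact (Finsupp.sum_zero_index (h := fun f x => (PreWeyl.toFinsupp σ b).sum fun g y =>
          star (x * c f) * Complex.exp (inner ℂ (K f) (K g)) * (y * c g))).symm
      | hadd a a' h h' =>
        rw [star_add, add_mul, map_add, h, h']
        exact (Finsupp.sum_add_index' (f := PreWeyl.toFinsupp σ a) (g := PreWeyl.toFinsupp σ a')
          (h := fun f x => (PreWeyl.toFinsupp σ b).sum fun g y =>
          star (x * c f) * Complex.exp (inner ℂ (K f) (K g)) * (y * c g)) (by simp)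
          (by intros; rw [← Finsupp.sum_add]; congr 1; ext; simp only [add_mul, star_add])).symm
      | hs f x =>
        refine Eq.trans ?_ (Finsupp.sum_single_index (a := f) (b := x)
          (h := fun f x => (PreWeyl.toFinsupp σ b).sum fun g y =>
          star (x * c f) * Complex.exp (inner ℂ (K f) (K g)) * (y * c g)) (by simp)).symm
        induction b using PreWeyl.induct with
        | h0 =>
          rw [mul_zero, map_zero]
          exact (Finsupp.sum_zero_index (h := fun g y =>
            star (x * c f) * Complex.exp (inner ℂ (K f) (K g)) * (y * c g))).symm
        | hadd a a' h h' =>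
          rw [mul_add, map_add, h, h']
          exact (Finsupp.sum_add_index' (f := PreWeyl.toFinsupp σ a)
            (g := PreWeyl.toFinsupp σ a') (h := fun g y =>
            star (x * c f) * Complex.exp (inner ℂ (K f) (K g)) * (y * c g)) (by simp)
            (by intros; simp only [add_mul, mul_add])).symm
        | hs g y =>
          refine Eq.trans ?_ (Finsupp.sum_single_index (a := g) (b := y) (h := fun g y =>
            star (x * c f) * Complex.exp (inner ℂ (K f) (K g)) * (y * c g)) (by simp)).symm
          rw [PreWeyl.star_sym, PreWeyl.sym_mul_sym, hΦ, exp_inner_eq K hσ, PreWeyl.phase]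
          have e : -f + g = g - f := by abel
          rw [e]
          simp only [c, map_neg, LinearMap.neg_apply, star_mul', Complex.star_def,
            Complex.conj_ofReal]
          have : ∀ p q r s t u : ℂ, p * q = r * s * t →
              (starRingEnd ℂ) x * y * p * q = (starRingEnd ℂ) x * r * s * (y * t) := by
            intro p q r s t u h
            linear_combination (starRingEnd ℂ) x * y * h
          refine this _ _ _ _ _ 0 ?_
          simp only [Complex.ofReal_exp]
          rw [← Complex.exp_add, ← Complex.exp_add, ← Complex.exp_add]
          congr 1
          push_cast
          ring
    have h := (posSemidef_exp_gram (fun f : L => K f)).2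
      ((PreWeyl.toFinsupp σ a).mapRange id rfl |>.zipWith (fun x y => x * y) (by simp)
        ((PreWeyl.toFinsupp σ a).mapRange id rfl))
    change 0 ≤ Φ (star a * a)
    rw [key]
    -- The rescaled coefficients. The support is copied from `a`, since the factors `c f` create no
    -- new nonzero coefficient.
    let b : L →₀ ℂ := Finsupp.onFinset (PreWeyl.toFinsupp σ a).support
      (fun f => PreWeyl.toFinsupp σ a f * c f) (fun f hf => by
        rw [Finsupp.mem_support_iff]
        exact left_ne_zero_of_mul hf)
    have h := (posSemidef_exp_gram (fun f : L => K f)).2 b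
    have hb : ∀ F : L → ℂ → ℂ, (∀ f, F f 0 = 0) →
        b.sum F = (PreWeyl.toFinsupp σ a).sum fun f x => F f (x * c f) := by
      intro F hF
      rw [Finsupp.onFinset_sum _ hF]
      rfl
    rw [hb _ (by simp)] at h
    refine h.trans_eq ?_
    refine Finsupp.sum_congr fun f _ => ?_
    rw [hb _ (by simp)]
    rfl
  · change Φ 1 = 1
    rw [PreWeyl.one_def, hΦ]
    simp

lemma abs_sq_le_reForm (f g : L) : |σ f g| ^ 2 ≤ 4 * reForm K f f * reForm K g g := by
  rw [hσ, reForm_self, reForm_self, sq_abs]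
  have h1 := norm_inner_le_norm (𝕜 := ℂ) (K f) (K g)
  have h2 := (Complex.abs_im_le_norm (inner ℂ (K f) (K g))).trans h1
  have h3 := pow_le_pow_left₀ (abs_nonneg _) h2 2
  rw [sq_abs, mul_pow] at h3
  nlinarith

/-- Every one-particle map is the one-particle map of a quasifree state. -/
lemma exists_quasifree : ∃ ω : AlgState (Weyl σ), IsQuasifreeWith ω (reForm K) := by
  obtain ⟨φ, hφ⟩ := exists_preWeyl_state K hσ
  refine ⟨Weyl.extendState φ, fun f g => ?_, abs_sq_le_reForm K hσ, fun f => ?_⟩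
  · rw [reForm_apply, reForm_apply, ← inner_conj_symm, Complex.conj_re]
  · rw [Weyl.extendState_W, hφ, reForm_self]

end

lemma HasOneParticle.apply_W {ω : AlgState (Weyl σ)} (h : HasOneParticle ω K) (f : L) :
    ω (Weyl.W σ f) = ((exp (-(‖K f‖ ^ 2) / 2) : ℝ) : ℂ) := by
  obtain ⟨μ, ⟨_, _, h⟩, _, h2, _⟩ := h
  rw [h, h2, ← reForm_apply, reForm_self]

lemma HasOneParticle.unique {ω ω' : AlgState (Weyl σ)} (h : HasOneParticle ω K)
    (h' : HasOneParticle ω' K) : ω = ω' :=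
  Weyl.state_ext fun f => by rw [h.apply_W, h'.apply_W]

/-- The two-point function of a quasifree state. -/
lemma twoPoint_eq {ω : AlgState (Weyl σ)} {μ : L →ₗ[ℝ] L →ₗ[ℝ] ℝ} (h : IsQuasifreeWith ω μ)
    (f g : L) : twoPoint ω f g = (μ f g : ℂ) + Complex.I * (σ f g : ℂ) / 2 := by
  obtain ⟨hs, _, hW⟩ := h
  -- The expectation is a Gaussian in `(s, t)`. Of its exponent only the coefficient of `s t`
  -- survives the two derivatives at the origin.
  have e : ∀ s t : ℝ, ω (Weyl.W σ (s • f) * Weyl.W σ (t • g))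
      = Complex.exp (-(Complex.I * (σ f g : ℂ) / 2 + (μ f g : ℂ)) * s * t
        - (μ f f : ℂ) / 2 * s ^ 2 - (μ g g : ℂ) / 2 * t ^ 2) := by
    intro s t
    rw [Weyl.W_mul_W, map_smul, hW, smul_eq_mul, Complex.ofReal_exp, ← Complex.exp_add]
    congr 1
    simp only [map_add, map_smul, LinearMap.add_apply, LinearMap.smul_apply, smul_eq_mul, hs g f]
    push_cast
    ring
  have hd : ∀ s : ℝ, HasDerivAt (fun t : ℝ => ω (Weyl.W σ (s • f) * Weyl.W σ (t • g)))
      (Complex.exp (- (μ f f : ℂ) / 2 * s ^ 2)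
        * (-(Complex.I * (σ f g : ℂ) / 2 + (μ f g : ℂ)) * s)) 0 := by
    intro s
    simp only [e]
    have h1 : HasDerivAt (fun t : ℂ => Complex.exp (-(Complex.I * (σ f g : ℂ) / 2 + (μ f g : ℂ))
        * s * t - (μ f f : ℂ) / 2 * s ^ 2 - (μ g g : ℂ) / 2 * t ^ 2))
        (Complex.exp (-(Complex.I * (σ f g : ℂ) / 2 + (μ f g : ℂ))
        * s * ((0 : ℝ) : ℂ) - (μ f f : ℂ) / 2 * s ^ 2 - (μ g g : ℂ) / 2 * ((0 : ℝ) : ℂ) ^ 2)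
        * ((-(Complex.I * (σ f g : ℂ) / 2 + (μ f g : ℂ)) * s * 1
          - (μ g g : ℂ) / 2 * ((2 : ℕ) * ((0 : ℝ) : ℂ) ^ (2 - 1) * 1)))) ((0 : ℝ) : ℂ) := by
      have := ((((hasDerivAt_id ((0 : ℝ) : ℂ)).const_mul
        (-(Complex.I * (σ f g : ℂ) / 2 + (μ f g : ℂ)) * s)).sub_const
        ((μ f f : ℂ) / 2 * s ^ 2)).sub (((hasDerivAt_id ((0 : ℝ) : ℂ)).pow 2).const_mul
        ((μ g g : ℂ) / 2))).cexp
      exact this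
    have h2 := h1.comp_ofReal
    convert h2 using 1
    simp [neg_div]
  have hd2 : HasDerivAt (fun s : ℝ => Complex.exp (- (μ f f : ℂ) / 2 * s ^ 2)
        * (-(Complex.I * (σ f g : ℂ) / 2 + (μ f g : ℂ)) * s))
      (-(Complex.I * (σ f g : ℂ) / 2 + (μ f g : ℂ))) 0 := by
    have h1 := (((((hasDerivAt_id ((0 : ℝ) : ℂ)).pow 2).const_mul (-(μ f f : ℂ) / 2)).cexp).mul
      ((hasDerivAt_id ((0 : ℝ) : ℂ)).const_mul
        (-(Complex.I * (σ f g : ℂ) / 2 + (μ f g : ℂ))))).comp_ofReal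
    convert h1 using 1 <;> simp
  unfold twoPoint
  simp only [fun s => (hd s).deriv, hd2.deriv]
  ring

end Quasifree

/-! ### Purity of quasifree states -/

section Purity

lemma isLittleO_exp_sub_taylor (a b : ℂ) :
    (fun ε : ℝ => Complex.exp (ε * a + ε ^ 2 * b) - (1 + ε * a + ε ^ 2 * (b + a ^ 2 / 2)))
      =o[𝓝 0] fun ε : ℝ => ε ^ 2 := by
  have hz : Tendsto (fun ε : ℝ => (ε * a + ε ^ 2 * b : ℂ)) (𝓝 0) (𝓝 0) := by
    have : Continuous (fun ε : ℝ => (ε * a + ε ^ 2 * b : ℂ)) := by fun_prop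
    simpa using this.tendsto 0
  have hO : (fun ε : ℝ => (ε * a + ε ^ 2 * b : ℂ)) =O[𝓝 0] fun ε : ℝ => ε := by
    have h : (fun ε : ℝ => (ε : ℂ) * (a + ε * b)) =O[𝓝 0] fun ε : ℝ => ε * (1 : ℝ) := by
      refine Asymptotics.IsBigO.mul ?_ ?_
      · exact Asymptotics.isBigO_of_le _ fun ε => by simp
      · have : Continuous fun ε : ℝ => a + ε * b := by fun_prop
        exact (this.tendsto 0).isBigO_one ℝ
    simp only [mul_one] at h
    refine h.congr_left fun ε => by ring
  have h1 := ((Complex.exp_sub_sum_range_isBigO_pow 3).comp_tendsto hz).trans (hO.pow 3)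
  have h2 : (fun ε : ℝ => ε ^ 3) =o[𝓝 0] fun ε : ℝ => ε ^ 2 :=
    Asymptotics.isLittleO_pow_pow (by norm_num)
  -- What remains of `(εa + ε²b)² / 2` beyond second order.
  have h3 : (fun ε : ℝ => (ε : ℂ) ^ 3 * (a * b) + (ε : ℂ) ^ 4 * (b ^ 2 / 2)) =o[𝓝 0]
      fun ε : ℝ => ε ^ 2 := by
    have e : ∀ n : ℕ, (fun ε : ℝ => (ε : ℂ) ^ n) =O[𝓝 0] fun ε : ℝ => ε ^ n := fun n =>
      Asymptotics.isBigO_of_le _ fun ε => by simp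
    have h4 : (fun ε : ℝ => ε ^ 4) =o[𝓝 0] fun ε : ℝ => ε ^ 2 :=
      Asymptotics.isLittleO_pow_pow (by norm_num)
    refine Asymptotics.IsLittleO.add ?_ ?_
    · simp only [mul_comm _ (a * b)]
      exact ((e 3).trans_isLittleO h2).const_mul_left _
    · simp only [mul_comm _ (b ^ 2 / 2)]
      exact ((e 4).trans_isLittleO h4).const_mul_left _
  refine ((h1.trans_isLittleO h2).add h3).congr_left fun ε => ?_
  simp only [Function.comp_apply, Finset.sum_range_succ, Finset.sum_range_zero, Nat.factorial]
  push_cast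
  ring

variable {H : Type*} [NormedAddCommGroup H] [InnerProductSpace ℂ H]

/-- The squared norm of `e₁ + i e₂ - (1 + i) e₀` for the exponential vectors `eⱼ` of `xⱼ`. -/
def expNormSq (x₀ x₁ x₂ : H) : ℂ :=
  Complex.exp (inner ℂ x₁ x₁) + Complex.exp (inner ℂ x₂ x₂) + 2 * Complex.exp (inner ℂ x₀ x₀)
    + Complex.I * Complex.exp (inner ℂ x₁ x₂) - Complex.I * Complex.exp (inner ℂ x₂ x₁)
    - (1 + Complex.I) * Complex.exp (inner ℂ x₁ x₀) - (1 - Complex.I) * Complex.exp (inner ℂ x₀ x₁)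
    + (Complex.I - 1) * Complex.exp (inner ℂ x₂ x₀) + (-Complex.I - 1) * Complex.exp (inner ℂ x₀ x₂)

/-- The exponential vector depends holomorphically on its argument: its increment along `εv` plus
`i` times its increment along `iεv` has no first-order term, because `1 + i · i = 0`. The
combination has norm `O(ε²)`, so its square is `o(ε²)`. -/
lemma isLittleO_expNormSq (x v : H) :
    (fun ε : ℝ => expNormSq x (x + (ε : ℂ) • v) (x + (ε : ℂ) • (Complex.I • v)))
      =o[𝓝 0] fun ε : ℝ => ε ^ 2 := by
  set A := inner ℂ x x
  set B := inner ℂ x v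
  set B' := inner ℂ v x
  set D := inner ℂ v v
  let R : ℂ → ℂ → ℝ → ℂ := fun a b ε =>
    Complex.exp (ε * a + ε ^ 2 * b) - (1 + ε * a + ε ^ 2 * (b + a ^ 2 / 2))
  have hR : ∀ a b c, (fun ε => c * R a b ε) =o[𝓝 0] fun ε : ℝ => ε ^ 2 := fun a b c =>
    (isLittleO_exp_sub_taylor a b).const_mul_left c
  have hsum := ((((((((hR (B + B') D 1).add (hR (Complex.I * B - Complex.I * B') D 1)).add
    (hR 0 0 2)).add (hR (B' + Complex.I * B) (Complex.I * D) Complex.I)).sub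
    (hR (B - Complex.I * B') (-Complex.I * D) Complex.I)).sub (hR B' 0 (1 + Complex.I))).sub
    (hR B 0 (1 - Complex.I))).add (hR (-Complex.I * B') 0 (Complex.I - 1))).add
    (hR (Complex.I * B) 0 (-Complex.I - 1))
  refine (hsum.const_mul_left (Complex.exp A)).congr_left fun ε => ?_
  have hI := Complex.I_sq
  -- The second-order Taylor polynomials of the nine terms, with the common factor `exp A` removed,
  -- cancel identically.
  have hP : ∀ e : ℂ, 1 * (1 + e * (B + B') + e ^ 2 * (D + (B + B') ^ 2 / 2))
      + 1 * (1 + e * (Complex.I * B - Complex.I * B') + e ^ 2 * (D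
        + (Complex.I * B - Complex.I * B') ^ 2 / 2))
      + 2 * (1 + e * 0 + e ^ 2 * (0 + 0 ^ 2 / 2))
      + Complex.I * (1 + e * (B' + Complex.I * B) + e ^ 2 * (Complex.I * D
        + (B' + Complex.I * B) ^ 2 / 2))
      - Complex.I * (1 + e * (B - Complex.I * B') + e ^ 2 * (-Complex.I * D
        + (B - Complex.I * B') ^ 2 / 2))
      - (1 + Complex.I) * (1 + e * B' + e ^ 2 * (0 + B' ^ 2 / 2))
      - (1 - Complex.I) * (1 + e * B + e ^ 2 * (0 + B ^ 2 / 2))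
      + (Complex.I - 1) * (1 + e * (-Complex.I * B') + e ^ 2 * (0 + (-Complex.I * B') ^ 2 / 2))
      + (-Complex.I - 1) * (1 + e * (Complex.I * B) + e ^ 2 * (0 + (Complex.I * B) ^ 2 / 2))
      = 0 := by
    intro e
    generalize Complex.I = I at *
    grind
  have i11 : inner ℂ (x + (ε : ℂ) • v) (x + (ε : ℂ) • v) = A + (ε * (B + B') + ε ^ 2 * D) := by
    simp only [inner_add_left, inner_add_right, inner_smul_left, inner_smul_right,
      Complex.conj_ofReal]
    ring
  have i22 : inner ℂ (x + (ε : ℂ) • (Complex.I • v)) (x + (ε : ℂ) • (Complex.I • v))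
      = A + (ε * (Complex.I * B - Complex.I * B') + ε ^ 2 * D) := by
    simp only [inner_add_left, inner_add_right, inner_smul_left, inner_smul_right,
      Complex.conj_ofReal, Complex.conj_I]
    linear_combination (-(ε ^ 2) * D) * hI
  have i12 : inner ℂ (x + (ε : ℂ) • v) (x + (ε : ℂ) • (Complex.I • v))
      = A + (ε * (B' + Complex.I * B) + ε ^ 2 * (Complex.I * D)) := by
    simp only [inner_add_left, inner_add_right, inner_smul_left, inner_smul_right,
      Complex.conj_ofReal]
    ring
  have i21 : inner ℂ (x + (ε : ℂ) • (Complex.I • v)) (x + (ε : ℂ) • v)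
      = A + (ε * (B - Complex.I * B') + ε ^ 2 * (-Complex.I * D)) := by
    simp only [inner_add_left, inner_add_right, inner_smul_left, inner_smul_right,
      Complex.conj_ofReal, Complex.conj_I]
    ring
  have i10 : inner ℂ (x + (ε : ℂ) • v) x = A + (ε * B' + ε ^ 2 * 0) := by
    simp only [inner_add_left, inner_smul_left, Complex.conj_ofReal]
    ring
  have i01 : inner ℂ x (x + (ε : ℂ) • v) = A + (ε * B + ε ^ 2 * 0) := by
    simp only [inner_add_right, inner_smul_right]
    ring
  have i20 : inner ℂ (x + (ε : ℂ) • (Complex.I • v)) x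
      = A + (ε * (-Complex.I * B') + ε ^ 2 * 0) := by
    simp only [inner_add_left, inner_smul_left, Complex.conj_ofReal, Complex.conj_I]
    ring
  have i02 : inner ℂ x (x + (ε : ℂ) • (Complex.I • v))
      = A + (ε * (Complex.I * B) + ε ^ 2 * 0) := by
    simp only [inner_add_right, inner_smul_right]
    ring
  have i00 : inner ℂ x x = A + (ε * 0 + ε ^ 2 * 0) := by
    ring
  rw [expNormSq, i11, i22, i12, i21, i10, i01, i20, i02, i00]
  simp only [Complex.exp_add A, R]
  linear_combination -(Complex.exp A) * hP ε

lemma continuous_expNormSq (x₀ x₁ : H) : Continuous (expNormSq x₀ x₁) := by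
  unfold expNormSq
  fun_prop

variable {L : Type*} [AddCommGroup L] [Module ℝ L] {σ : SkewForm L} (K : L →ₗ[ℝ] H)

variable (σ) in
/-- The Weyl elements normalized to give exponential vectors. -/
def coh (f : L) : Weyl σ := ((exp (‖K f‖ ^ 2 / 2) : ℝ) : ℂ) • Weyl.W σ f

lemma star_coh (f : L) : star (coh σ K f) = coh σ K (-f) := by
  rw [coh, coh, star_smul, Weyl.star_W, Complex.star_def, Complex.conj_ofReal, map_neg, norm_neg]

variable {K}

section
variable (hσ : ∀ f g, σ f g = 2 * (inner ℂ (K f) (K g)).im) {ω : AlgState (Weyl σ)}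
  (hω : ∀ f, ω (Weyl.W σ f) = ((exp (-(‖K f‖ ^ 2) / 2) : ℝ) : ℂ))
include hσ hω

lemma state_star_coh_mul_coh (f g : L) :
    ω (star (coh σ K f) * coh σ K g) = Complex.exp (inner ℂ (K f) (K g)) := by
  rw [exp_inner_eq K hσ, star_coh, coh, coh, smul_mul_smul_comm, Weyl.W_mul_W, map_smul, map_smul,
    hω, smul_eq_mul, smul_eq_mul, Complex.ofReal_exp, Complex.ofReal_exp, Complex.ofReal_exp,
    ← Complex.exp_add, ← Complex.exp_add, ← Complex.exp_add]
  have e : -f + g = g - f := by abel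
  have e' : σ.toBilin (-f) g = -σ.toBilin f g := by rw [map_neg, LinearMap.neg_apply]
  rw [e, map_neg, norm_neg]
  simp only [e']
  congr 1
  push_cast
  ring

lemma gnsNorm_coh_comb (f₀ f₁ f₂ : L) :
    ω.gnsNorm (coh σ K f₁ + Complex.I • coh σ K f₂ - (1 + Complex.I) • coh σ K f₀)
      = √(expNormSq (K f₀) (K f₁) (K f₂)).re := by
  unfold AlgState.gnsNorm
  congr 2
  have hI := Complex.I_sq
  simp only [star_sub, star_add, star_smul, sub_mul, add_mul, mul_sub, mul_add,
    smul_mul_assoc, mul_smul_comm, map_sub, map_add, map_smul, smul_eq_mul,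
    state_star_coh_mul_coh hσ hω, Complex.star_def, Complex.conj_I, map_one, expNormSq]
  generalize Complex.I = I at *
  grind

/-- With `g h = ω' (coh h)`, domination by the GNS norm of `ω` and `isLittleO_expNormSq` make `g`
satisfy the Cauchy-Riemann equation up to `o(ε)`. Since `ω'` is hermitian and `coh h` has adjoint
`coh (-h)`, the conjugate equation holds too. Adding the two removes the increment in the direction
`i K f`, so `g` has zero derivative along the ray through `f` and equals its value `1` at `0`. -/
lemma state_eq_of_le (hi : ∀ f, Complex.I • K f ∈ closure (Set.range K)) {ω' : AlgState (Weyl σ)}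
    {c : ℝ} (hc : ∀ a, ‖ω' a‖ ≤ c * ω.gnsNorm a) : ω' = ω := by
  refine Weyl.state_ext fun f => ?_
  have hc0 : 0 ≤ c := by
    have h1 := hc 1
    have h2 : ω.gnsNorm 1 = 1 := by simp [AlgState.gnsNorm, ω.map_one]
    rw [ω'.map_one, h2, norm_one, mul_one] at h1
    linarith
  let g : L → ℂ := fun h => ω' (coh σ K h)
  have hneg : ∀ h, g (-h) = (starRingEnd ℂ) (g h) := fun h => by
    simp only [g]
    rw [← star_coh, ω'.conj_apply_star]
  have hol : ∀ f₀ f₁ f₂ : L, ‖g f₁ + Complex.I * g f₂ - (1 + Complex.I) * g f₀‖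
      ≤ c * √(expNormSq (K f₀) (K f₁) (K f₂)).re := fun f₀ f₁ f₂ => by
    rw [← gnsNorm_coh_comb hσ hω]
    refine le_trans (le_of_eq ?_) (hc _)
    simp only [map_sub, map_add, map_smul, smul_eq_mul, g]
  have hantihol : ∀ f₀ f₁ f₂ : L, ‖g f₁ - Complex.I * g f₂ - (1 - Complex.I) * g f₀‖
      ≤ c * √(expNormSq (K f₀) (K f₁) (K f₂)).re := fun f₀ f₁ f₂ => by
    have h := hol (-f₀) (-f₁) (-f₂)
    rw [hneg, hneg, hneg, ← Complex.norm_conj] at h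
    have e : expNormSq (K (-f₀)) (K (-f₁)) (K (-f₂)) = expNormSq (K f₀) (K f₁) (K f₂) := by
      simp only [expNormSq, map_neg, inner_neg_left, inner_neg_right, neg_neg]
    rw [e] at h
    refine le_trans (le_of_eq ?_) h
    congr 1
    simp only [map_sub, map_add, map_mul, Complex.conj_conj, Complex.conj_I, map_one]
    ring
  have hdiff : ∀ s ε : ℝ, ‖g ((s + ε) • f) - g (s • f)‖
      ≤ c * √‖expNormSq (s • K f) (s • K f + (ε : ℂ) • K f)
        (s • K f + (ε : ℂ) • (Complex.I • K f))‖ := by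
    intro s ε
    -- The vector `i K f` need not lie in the range of `K`. The estimate is proved for approximating
    -- vectors of the range, and only its right-hand side is passed to the limit.
    obtain ⟨y, hy, hyl⟩ := mem_closure_iff_seq_limit.1 (hi f)
    choose h hh using hy
    have hb : ∀ n, ‖g ((s + ε) • f) - g (s • f)‖
        ≤ c * √(expNormSq (s • K f) (s • K f + (ε : ℂ) • K f) (s • K f + (ε : ℂ) • y n)).re := by
      intro n
      have h1 := hol (s • f) ((s + ε) • f) (s • f + ε • h n)
      have h2 := hantihol (s • f) ((s + ε) • f) (s • f + ε • h n)
      have e1 : K (s • f + ε • h n) = s • K f + (ε : ℂ) • y n := by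
        rw [map_add, map_smul, map_smul, hh, Complex.coe_smul]
      have e2 : K ((s + ε) • f) = s • K f + (ε : ℂ) • K f := by
        rw [map_smul, add_smul, Complex.coe_smul]
      rw [e1, e2, map_smul] at h1 h2
      have h3 := norm_add_le_of_le h1 h2
      have e3 : g ((s + ε) • f) + Complex.I * g (s • f + ε • h n) - (1 + Complex.I) * g (s • f)
          + (g ((s + ε) • f) - Complex.I * g (s • f + ε • h n) - (1 - Complex.I) * g (s • f))
          = 2 * (g ((s + ε) • f) - g (s • f)) := by ring
      -- In the sum of the two estimates the terms in the imaginary direction cancel.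
      rw [e3, norm_mul, Complex.norm_ofNat] at h3
      linarith
    have ht : Tendsto (fun n => c * √(expNormSq (s • K f) (s • K f + (ε : ℂ) • K f)
        (s • K f + (ε : ℂ) • y n)).re) atTop (𝓝 (c * √(expNormSq (s • K f)
        (s • K f + (ε : ℂ) • K f) (s • K f + (ε : ℂ) • (Complex.I • K f))).re)) := by
      have hcont : Continuous fun z => c * √(expNormSq (s • K f) (s • K f + (ε : ℂ) • K f)
          (s • K f + (ε : ℂ) • z)).re := by
        have := continuous_expNormSq (s • K f) (s • K f + (ε : ℂ) • K f)
        fun_prop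
      exact (hcont.tendsto _).comp hyl
    refine (ge_of_tendsto' ht hb).trans (mul_le_mul_of_nonneg_left ?_ hc0)
    exact Real.sqrt_le_sqrt (Complex.re_le_norm _)
  have hder : ∀ s : ℝ, HasDerivAt (fun s : ℝ => g (s • f)) 0 s := by
    intro s
    rw [hasDerivAt_iff_isLittleO_nhds_zero]
    have h1 := isLittleO_expNormSq (s • K f) (K f)
    rw [Asymptotics.isLittleO_iff] at h1 ⊢
    intro δ hδ
    -- An `o(ε²)` under the square root leaves `o(ε)`; dividing by `c + 1` absorbs the factor `c`,
    -- which may be zero.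
    have hpos : 0 < δ / (c + 1) := by positivity
    filter_upwards [h1 (pow_pos hpos 2)] with ε hε
    rw [smul_zero, sub_zero]
    refine (hdiff s ε).trans ?_
    have h2 := Real.sqrt_le_sqrt hε
    rw [norm_pow, ← mul_pow, Real.sqrt_sq (by positivity)] at h2
    calc _ ≤ c * (δ / (c + 1) * ‖ε‖) := mul_le_mul_of_nonneg_left h2 hc0
      _ = c / (c + 1) * (δ * ‖ε‖) := by ring
      _ ≤ 1 * (δ * ‖ε‖) := by
        refine mul_le_mul_of_nonneg_right ?_ (by positivity)
        rw [div_le_one (by linarith)]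
        linarith
      _ = δ * ‖ε‖ := one_mul _
  have hconst := is_const_of_deriv_eq_zero (f := fun s : ℝ => g (s • f))
    (fun s => (hder s).differentiableAt) (fun s => (hder s).deriv) 1 0
  simp only [one_smul, zero_smul, g, coh, map_zero, norm_zero, map_smul, Weyl.W_zero,
    ω'.map_one, smul_eq_mul] at hconst
  rw [hω]
  have h0 : ((exp (‖K f‖ ^ 2 / 2) : ℝ) : ℂ) ≠ 0 := by
    exact_mod_cast (exp_pos _).ne'
  refine mul_left_cancel₀ h0 (hconst.trans ?_)
  rw [← Complex.ofReal_mul, ← exp_add]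
  simp [neg_div]

/-- A quasifree state whose one-particle map has real-dense range is pure. -/
lemma isPure_of_smul_I_mem_closure (hi : ∀ f, Complex.I • K f ∈ closure (Set.range K)) :
    ω.IsPure := by
  have key : ∀ (ω₁ ω₂ : AlgState (Weyl σ)) (t : ℝ), 0 < t → t < 1 →
      (∀ a, ω a = t * ω₁ a + (1 - t) * ω₂ a) → ω₁ = ω := by
    intro ω₁ ω₂ t h0 h1 h
    -- Dropping the positive term of `ω₂` gives `t ω₁(a* a) ≤ ω(a* a)`, hence the constant `√(1/t)`.
    refine state_eq_of_le hσ hω hi (c := √(t⁻¹)) fun a => ?_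
    refine (ω₁.norm_apply_le_gnsNorm a).trans ?_
    unfold AlgState.gnsNorm
    rw [← Real.sqrt_mul (by positivity)]
    refine Real.sqrt_le_sqrt ?_
    rw [h (star a * a)]
    have h2 := (Complex.le_def.1 (ω₂.nonneg a)).1
    have h3 : ((t : ℂ) * ω₁ (star a * a) + (1 - t) * ω₂ (star a * a)).re
        = t * (ω₁ (star a * a)).re + (1 - t) * (ω₂ (star a * a)).re := by
      have : (1 - t : ℂ) = ((1 - t : ℝ) : ℂ) := by push_cast; rfl
      rw [this, Complex.add_re, Complex.re_ofReal_mul, Complex.re_ofReal_mul]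
    rw [h3, inv_mul_eq_div, le_div_iff₀ h0]
    rw [Complex.zero_re] at h2
    nlinarith [mul_nonneg (sub_pos.2 h1).le h2]
  intro ω₁ ω₂ t h0 h1 h
  refine ⟨key ω₁ ω₂ t h0 h1 h, key ω₂ ω₁ (1 - t) (by linarith) (by linarith) fun a => ?_⟩
  rw [h a]
  push_cast
  ring

end

end Purity

/-! ### The KMS condition for quasifree states -/

section KMS

/-- The strip `0 ≤ Im z ≤ β`. -/
def strip (β : ℝ) : Set ℂ := {z | 0 ≤ z.im ∧ z.im ≤ β}

/-- Bounded continuous functions on the strip, holomorphic in the interior. -/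
structure StripFun (β : ℝ) (F : ℂ → ℂ) : Prop where
  continuousOn : ContinuousOn F (strip β)
  differentiableOn : DifferentiableOn ℂ F {z | 0 < z.im ∧ z.im < β}
  bounded : ∃ C : ℝ, ∀ z ∈ strip β, ‖F z‖ ≤ C

lemma StripFun.add {β : ℝ} {F G : ℂ → ℂ} (hF : StripFun β F) (hG : StripFun β G) :
    StripFun β (fun z => F z + G z) := by
  obtain ⟨C, hC⟩ := hF.bounded
  obtain ⟨D, hD⟩ := hG.bounded
  exact ⟨hF.1.add hG.1, hF.2.add hG.2, C + D, fun z hz => norm_add_le_of_le (hC z hz) (hD z hz)⟩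

lemma StripFun.const_mul {β : ℝ} {F : ℂ → ℂ} (c : ℂ) (hF : StripFun β F) :
    StripFun β (fun z => c * F z) := by
  obtain ⟨C, hC⟩ := hF.bounded
  exact ⟨continuousOn_const.mul hF.1, hF.2.const_mul c, ‖c‖ * C, fun z hz => by
    rw [norm_mul]
    exact mul_le_mul_of_nonneg_left (hC z hz) (norm_nonneg c)⟩

/-- This is Phragmén-Lindelöf. The bound contained in `StripFun` serves only as its growth
condition, which holds with both growth constants equal to zero. -/
lemma StripFun.norm_le {β : ℝ} (hβ : 0 < β) {F : ℂ → ℂ} (hF : StripFun β F) {C : ℝ}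
    (h0 : ∀ t : ℝ, ‖F t‖ ≤ C) (h1 : ∀ t : ℝ, ‖F (t + Complex.I * β)‖ ≤ C) {z : ℂ}
    (hz : z ∈ strip β) : ‖F z‖ ≤ C := by
  obtain ⟨B, hB⟩ := hF.bounded
  refine PhragmenLindelof.horizontal_strip (a := 0) (b := β) (f := F) ?_ ⟨0, by positivity, 0, ?_⟩
    (fun w hw => ?_) (fun w hw => ?_) hz.1 hz.2
  · refine ⟨hF.2, hF.1.mono ?_⟩
    refine closure_minimal (fun w hw => ⟨hw.1.le, hw.2.le⟩) ?_
    exact (isClosed_le continuous_const Complex.continuous_im).inter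
      (isClosed_le Complex.continuous_im continuous_const)
  · refine Asymptotics.IsBigO.of_bound B ?_
    refine (Filter.eventually_inf_principal.2 (Filter.Eventually.of_forall fun w hw => ?_))
    have := hB w ⟨hw.1.le, hw.2.le⟩
    simpa using this
  · have : w = ((w.re : ℝ) : ℂ) := Complex.ext rfl (by simpa using hw)
    rw [this]
    exact h0 _
  · have : w = ((w.re : ℝ) : ℂ) + Complex.I * β := by
      apply Complex.ext <;> simp [hw]
    rw [this]
    exact h1 _

variable {A : Type*} [CStarAlgebra A] (ω : AlgState A) (α : Multiplicative ℝ →* (A ≃⋆ₐ[ℂ] A))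
  (β : ℝ)

/-- `F` interpolates between `ω(a α_t(b))` and `ω(α_t(b) a)` on the strip. -/
def IsKMSFun (a b : A) (F : ℂ → ℂ) : Prop :=
  StripFun β F ∧ ∀ t : ℝ, F t = ω (a * α (Multiplicative.ofAdd t) b) ∧
    F (t + Complex.I * β) = ω (α (Multiplicative.ofAdd t) b * a)

variable {ω α β}

lemma IsKMSFun.add_left {a a' b : A} {F G : ℂ → ℂ} (hF : IsKMSFun ω α β a b F)
    (hG : IsKMSFun ω α β a' b G) : IsKMSFun ω α β (a + a') b (fun z => F z + G z) :=
  ⟨hF.1.add hG.1, fun t => by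
    simp only [add_mul, mul_add, map_add, hF.2 t, hG.2 t, and_self]⟩

lemma IsKMSFun.add_right {a b b' : A} {F G : ℂ → ℂ} (hF : IsKMSFun ω α β a b F)
    (hG : IsKMSFun ω α β a b' G) : IsKMSFun ω α β a (b + b') (fun z => F z + G z) :=
  ⟨hF.1.add hG.1, fun t => by
    simp only [add_mul, mul_add, map_add, hF.2 t, hG.2 t, and_self]⟩

lemma IsKMSFun.smul_left {a b : A} {F : ℂ → ℂ} (c : ℂ) (hF : IsKMSFun ω α β a b F) :
    IsKMSFun ω α β (c • a) b (fun z => c * F z) :=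
  ⟨hF.1.const_mul c, fun t => by
    simp only [smul_mul_assoc, mul_smul_comm, map_smul, smul_eq_mul, hF.2 t, and_self]⟩

lemma IsKMSFun.smul_right {a b : A} {F : ℂ → ℂ} (c : ℂ) (hF : IsKMSFun ω α β a b F) :
    IsKMSFun ω α β a (c • b) (fun z => c * F z) :=
  ⟨hF.1.const_mul c, fun t => by
    simp only [smul_mul_assoc, mul_smul_comm, map_smul, smul_eq_mul, hF.2 t, and_self]⟩

lemma exists_isKMSFun_of_mem_span {S : Set A} (h : ∀ a ∈ S, ∀ b ∈ S, ∃ F, IsKMSFun ω α β a b F)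
    {a b : A} (ha : a ∈ Submodule.span ℂ S) (hb : b ∈ Submodule.span ℂ S) :
    ∃ F, IsKMSFun ω α β a b F := by
  have h0l : ∀ b, IsKMSFun ω α β 0 b (fun _ => 0) := fun b =>
    ⟨⟨continuousOn_const, differentiableOn_const _, 0, by simp⟩, by simp⟩
  have h0r : ∀ a, IsKMSFun ω α β a 0 (fun _ => 0) := fun b =>
    ⟨⟨continuousOn_const, differentiableOn_const _, 0, by simp⟩, by simp⟩
  induction ha using Submodule.span_induction with
  | zero => exact ⟨_, h0l b⟩
  | add x y _ _ hx hy =>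
    obtain ⟨F, hF⟩ := hx
    obtain ⟨G, hG⟩ := hy
    exact ⟨_, hF.add_left hG⟩
  | smul c x _ hx =>
    obtain ⟨F, hF⟩ := hx
    exact ⟨_, hF.smul_left c⟩
  | mem x hx =>
    induction hb using Submodule.span_induction with
    | zero => exact ⟨_, h0r x⟩
    | add y z _ _ hy hz =>
      obtain ⟨F, hF⟩ := hy
      obtain ⟨G, hG⟩ := hz
      exact ⟨_, hF.add_right hG⟩
    | smul c y _ hy =>
      obtain ⟨F, hF⟩ := hy
      exact ⟨_, hF.smul_right c⟩
    | mem y hy => exact h x hx y hy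

lemma norm_mul_sub_mul_le {a a' b b' : A} {D : ℝ} (ha : ‖a‖ ≤ D) (hb' : ‖b'‖ ≤ D) :
    ‖a * b - a' * b'‖ ≤ D * (‖b - b'‖ + ‖a - a'‖) := by
  have e : a * b - a' * b' = a * (b - b') + (a - a') * b' := by noncomm_ring
  rw [e, mul_add]
  refine norm_add_le_of_le ((norm_mul_le _ _).trans ?_) ((norm_mul_le _ _).trans ?_)
  · exact mul_le_mul_of_nonneg_right ha (norm_nonneg _)
  · rw [mul_comm D]
    exact mul_le_mul_of_nonneg_left hb' (norm_nonneg _)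

/-- The KMS condition extends from a total set. -/
lemma isKMS_of_span_dense (hβ : 0 < β) {S : Set A} (hS : Dense (Submodule.span ℂ S : Set A))
    (h : ∀ a ∈ S, ∀ b ∈ S, ∃ F, IsKMSFun ω α β a b F) : IsKMS ω α β := by
  intro a b
  obtain ⟨x, hx, hxa⟩ := mem_closure_iff_seq_limit.1 (hS a)
  obtain ⟨y, hy, hyb⟩ := mem_closure_iff_seq_limit.1 (hS b)
  choose F hF using fun n => exists_isKMSFun_of_mem_span h (hx n) (hy n)
  obtain ⟨Dx, hDx⟩ := hxa.norm.bddAbove_range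
  obtain ⟨Dy, hDy⟩ := hyb.norm.bddAbove_range
  set D := max Dx Dy
  have hxD : ∀ n, ‖x n‖ ≤ D := fun n => (hDx ⟨n, rfl⟩).trans (le_max_left _ _)
  have hyD : ∀ n, ‖y n‖ ≤ D := fun n => (hDy ⟨n, rfl⟩).trans (le_max_right _ _)
  have hD0 : 0 ≤ D := (norm_nonneg _).trans (hxD 0)
  have hα : ∀ t c, ‖α t c‖ = ‖c‖ := fun t c => StarAlgEquiv.norm_map (α t) c
  -- On the edges the interpolating functions are states evaluated on products, so their differences
  -- are controlled by the norms; the maximum principle carries the bound inside and makes the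
  -- sequence uniformly Cauchy on the strip.
  have hdiff : ∀ m n, ∀ z ∈ strip β, ‖F m z - F n z‖ ≤ D * (‖y m - y n‖ + ‖x m - x n‖) := by
    intro m n z hz
    have e : ∀ z, F m z - F n z = F m z + (-1) * F n z := fun z => by ring
    simp only [e]
    refine ((hF m).1.add ((hF n).1.const_mul (-1))).norm_le hβ (fun t => ?_) (fun t => ?_) hz
    · rw [((hF m).2 t).1, ((hF n).2 t).1, neg_one_mul, ← sub_eq_add_neg, ← map_sub]
      refine (ω.norm_apply_le_norm _).trans
        ((norm_mul_sub_mul_le (hxD m) ((hα _ _).trans_le (hyD n))).trans ?_)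
      rw [← map_sub, hα]
    · rw [((hF m).2 t).2, ((hF n).2 t).2, neg_one_mul, ← sub_eq_add_neg, ← map_sub]
      refine (ω.norm_apply_le_norm _).trans
        ((norm_mul_sub_mul_le ((hα _ _).trans_le (hyD m)) (hxD n)).trans ?_)
      rw [← map_sub, hα, add_comm]
  have hcauchy : UniformCauchySeqOn F atTop (strip β) := by
    rw [Metric.uniformCauchySeqOn_iff]
    intro ε hε
    obtain ⟨N₁, h₁⟩ := Metric.cauchySeq_iff.1 hxa.cauchySeq (ε / (2 * (D + 1))) (by positivity)
    obtain ⟨N₂, h₂⟩ := Metric.cauchySeq_iff.1 hyb.cauchySeq (ε / (2 * (D + 1))) (by positivity)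
    refine ⟨max N₁ N₂, fun m hm n hn z hz => ?_⟩
    rw [dist_eq_norm]
    refine (hdiff m n z hz).trans_lt ?_
    have e₁ := h₁ m (le_of_max_le_left hm) n (le_of_max_le_left hn)
    have e₂ := h₂ m (le_of_max_le_right hm) n (le_of_max_le_right hn)
    rw [dist_eq_norm] at e₁ e₂
    calc _ ≤ (D + 1) * (‖y m - y n‖ + ‖x m - x n‖) :=
          mul_le_mul_of_nonneg_right (by linarith) (by positivity)
      _ < (D + 1) * (ε / (2 * (D + 1)) + ε / (2 * (D + 1))) :=
          mul_lt_mul_of_pos_left (add_lt_add e₂ e₁) (by linarith)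
      _ = ε := by field_simp; ring
  let G : ℂ → ℂ := fun z => limUnder atTop fun n => F n z
  have hlim : ∀ z ∈ strip β, Tendsto (fun n => F n z) atTop (𝓝 (G z)) := fun z hz =>
    (hcauchy.cauchySeq hz).tendsto_limUnder
  have hunif := hcauchy.tendstoUniformlyOn_of_tendsto hlim
  have hsub : {z : ℂ | 0 < z.im ∧ z.im < β} ⊆ strip β := fun z hz => ⟨hz.1.le, hz.2.le⟩
  have hαc : ∀ t, Tendsto (fun n => α t (y n)) atTop (𝓝 (α t b)) := fun t => by
    rw [tendsto_iff_norm_sub_tendsto_zero] at hyb ⊢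
    refine hyb.congr fun n => ?_
    rw [← map_sub, hα]
  have hωc : ∀ (u : ℕ → A) (v : A), Tendsto u atTop (𝓝 v) →
      Tendsto (fun n => ω (u n)) atTop (𝓝 (ω v)) := fun u v huv =>
    (ω.toCLM.continuous.tendsto v).comp huv
  refine ⟨G, hunif.continuousOn (Frequently.of_forall fun n => (hF n).1.1), ?_, ?_, fun t => ⟨?_, ?_⟩⟩
  · refine (hunif.mono hsub).tendstoLocallyUniformlyOn.differentiableOn
      (Eventually.of_forall fun n => (hF n).1.2) ?_
    exact (isOpen_lt continuous_const Complex.continuous_im).inter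
      (isOpen_lt Complex.continuous_im continuous_const)
  · refine ⟨D * D, fun z h0 h1 => le_of_tendsto' (hlim z ⟨h0, h1⟩).norm fun n => ?_⟩
    refine (hF n).1.norm_le hβ (fun t => ?_) (fun t => ?_) ⟨h0, h1⟩
    · rw [((hF n).2 t).1]
      refine (ω.norm_apply_le_norm _).trans ((norm_mul_le _ _).trans ?_)
      rw [hα]
      exact mul_le_mul (hxD n) (hyD n) (norm_nonneg _) hD0
    · rw [((hF n).2 t).2]
      refine (ω.norm_apply_le_norm _).trans ((norm_mul_le _ _).trans ?_)
      rw [hα]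
      exact mul_le_mul (hyD n) (hxD n) (norm_nonneg _) hD0
  · refine tendsto_nhds_unique (hlim t ⟨by simp, by simpa using hβ.le⟩) ?_
    simp only [fun n => ((hF n).2 t).1]
    exact hωc _ _ (hxa.mul (hαc _))
  · refine tendsto_nhds_unique (hlim _ ⟨by simpa using hβ.le, by simp⟩) ?_
    simp only [fun n => ((hF n).2 t).2]
    exact hωc _ _ ((hαc _).mul hxa)

/-- A quasifree state is KMS if its one-particle two-point functions are. -/
lemma isKMS_of_oneParticle {H : Type*} [NormedAddCommGroup H] [InnerProductSpace ℂ H]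
    {L : Type*} [AddCommGroup L] [Module ℝ L] {σ : SkewForm L} {K : L →ₗ[ℝ] H}
    (hσ : ∀ f g, σ f g = 2 * (inner ℂ (K f) (K g)).im) {ω : AlgState (Weyl σ)}
    (hω : ∀ f, ω (Weyl.W σ f) = ((exp (-(‖K f‖ ^ 2) / 2) : ℝ) : ℂ))
    {α : Multiplicative ℝ →* (Weyl σ ≃⋆ₐ[ℂ] Weyl σ)} {T : ℝ → L → L}
    (hα : ∀ t f, α (Multiplicative.ofAdd t) (Weyl.W σ f) = Weyl.W σ (T t f))
    (hT : ∀ t f, ‖K (T t f)‖ = ‖K f‖) {β : ℝ} (hβ : 0 < β)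
    (h : ∀ f g, ∃ G, StripFun β G ∧ ∀ t : ℝ, G t = inner ℂ (K f) (K (T t g)) ∧
      G (t + Complex.I * β) = inner ℂ (K (T t g)) (K f)) : IsKMS ω α β := by
  refine isKMS_of_span_dense hβ (Weyl.dense_span_W σ) ?_
  have hprod : ∀ f g, ω (Weyl.W σ f * Weyl.W σ g)
      = Complex.exp (-((‖K f‖ ^ 2 + ‖K g‖ ^ 2) / 2 : ℝ) - inner ℂ (K f) (K g)) := by
    intro f g
    have h2 := norm_add_sq (𝕜 := ℂ) (K f) (K g)
    rw [Weyl.W_mul_W, map_smul, hω, smul_eq_mul, Complex.ofReal_exp, ← Complex.exp_add]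
    congr 1
    rw [map_add, h2, hσ]
    have h3 : (inner ℂ (K f) (K g)) = ((inner ℂ (K f) (K g)).re : ℂ)
      + ((inner ℂ (K f) (K g)).im : ℂ) * Complex.I := (Complex.re_add_im _).symm
    have h4 : RCLike.re (inner ℂ (K f) (K g)) = (inner ℂ (K f) (K g)).re := rfl
    rw [h4]
    conv_rhs => rw [h3]
    push_cast
    ring
  rintro _ ⟨f, rfl⟩ _ ⟨g, rfl⟩
  obtain ⟨G, hG, hGt⟩ := h f g
  obtain ⟨C, hC⟩ := hG.bounded
  -- The norms `‖K f‖` and `‖K g‖` are constant under the flow, so time enters `hprod` only through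
  -- the inner product. Replacing that by `G` interpolates both orderings.
  refine ⟨fun z => Complex.exp (-((‖K f‖ ^ 2 + ‖K g‖ ^ 2) / 2 : ℝ) - G z), ⟨?_, ?_, ?_⟩,
    fun t => ⟨?_, ?_⟩⟩
  · exact (continuousOn_const.sub hG.1).cexp
  · exact ((differentiableOn_const _).sub hG.2).cexp
  · refine ⟨exp (-((‖K f‖ ^ 2 + ‖K g‖ ^ 2) / 2) + C), fun z hz => ?_⟩
    rw [Complex.norm_exp, Real.exp_le_exp, Complex.sub_re, ← Complex.ofReal_neg, Complex.ofReal_re,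
      sub_eq_add_neg]
    have := (abs_le.1 ((Complex.abs_re_le_norm (G z)).trans (hC z hz))).1
    linarith
  · beta_reduce
    rw [hα, hprod, hT, (hGt t).1]
  · beta_reduce
    rw [hα, hprod, hT, (hGt t).2, add_comm (‖K g‖ ^ 2)]

end KMS

/-! ### The Plancherel theorem in the first variable -/

section Line

/-- The unitary Fourier transform `(2π)^{-1/2} ∫ e^{iku} g(u) du` on the line. -/
def lineFT (g : ℝ → ℂ) (k : ℝ) : ℂ :=
  ((√(2 * π) : ℝ) : ℂ)⁻¹ * ∫ u : ℝ, Complex.exp (Complex.I * k * u) * g u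

/-- The kernel of `𝓕` is `e^{-2πixv}`, hence the frequency `-k/(2π)`. -/
lemma lineFT_eq_fourier (g : ℝ → ℂ) (k : ℝ) :
    lineFT g k = ((√(2 * π) : ℝ) : ℂ)⁻¹ * 𝓕 g (-(2 * π)⁻¹ * k) := by
  rw [lineFT, Real.fourier_real_eq_integral_exp_smul]
  congr 1
  refine integral_congr_ae (Eventually.of_forall fun u => ?_)
  simp only [smul_eq_mul]
  congr 2
  have : (π : ℂ) ≠ 0 := by exact_mod_cast pi_ne_zero
  push_cast
  field_simp

/-- Both sides are tested against compactly supported smooth functions. The `L²` transform agrees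
with the distributional one, and Fubini moves the transform of an integrable function onto the test
function. -/
lemma fourier_ae_eq_fourier_toLp {f : ℝ → ℂ} (h1 : Integrable f) (h2 : MemLp f 2) :
    𝓕 f =ᵐ[volume] (𝓕 (h2.toLp f) : Lp ℂ 2 (volume : Measure ℝ)) := by
  have hc : Continuous (𝓕 f) :=
    VectorFourier.fourierIntegral_continuous Real.continuous_fourierChar continuous_inner h1
  refine ae_eq_of_integral_contDiff_smul_eq hc.locallyIntegrable
    ((Lp.memLp _).locallyIntegrable (by norm_num)) fun g hg hgc => ?_
  let g' : ℝ → ℂ := fun x => (g x : ℂ)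
  have hg' : ContDiff ℝ ((⊤ : ℕ∞) : WithTop ℕ∞) g' := Complex.ofRealCLM.contDiff.comp hg
  have hgc' : HasCompactSupport g' := hgc.comp_left (g := fun x : ℝ => (x : ℂ)) rfl
  let G := hgc'.toSchwartzMap hg'
  have hG : ∀ x, G x = g x := fun x => rfl
  have e1 := congrArg (fun T => T G) (Lp.fourier_toTemperedDistribution_eq (h2.toLp f))
  rw [TemperedDistribution.fourier_apply, Lp.toTemperedDistribution_apply,
    Lp.toTemperedDistribution_apply] at e1
  have e2 : ∫ x, g x • (𝓕 (h2.toLp f) : Lp ℂ 2 (volume : Measure ℝ)) x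
      = ∫ x, G x • (𝓕 (h2.toLp f) : Lp ℂ 2 (volume : Measure ℝ)) x :=
    integral_congr_ae (Eventually.of_forall fun x => by simp only [hG, Complex.coe_smul])
  have e3 : ∫ x, g x • 𝓕 f x = ∫ x, 𝓕 f x • G x :=
    integral_congr_ae (Eventually.of_forall fun x => by
      simp only [hG, Complex.real_smul, smul_eq_mul, mul_comm])
  have e4 : ∫ x, 𝓕 f x • G x = ∫ x, f x • 𝓕 (G : ℝ → ℂ) x :=
    VectorFourier.integral_fourierIntegral_smul_eq_flip (L := innerₗ ℝ)
      Real.continuous_fourierChar continuous_inner h1 G.integrable |>.trans (by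
        rw [flip_innerₗ]; rfl)
  rw [e2, ← e1, e3, e4]
  refine integral_congr_ae ?_
  filter_upwards [h2.coeFn_toLp] with x hx
  rw [hx, SchwartzMap.fourier_coe, smul_eq_mul, smul_eq_mul, mul_comm]

lemma memLp_fourier {f : ℝ → ℂ} (h1 : Integrable f) (h2 : MemLp f 2) : MemLp (𝓕 f) 2 :=
  (memLp_congr_ae (fourier_ae_eq_fourier_toLp h1 h2)).2 (Lp.memLp _)

lemma integral_conj_fourier_mul_fourier {f g : ℝ → ℂ} (hf1 : Integrable f) (hf2 : MemLp f 2)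
    (hg1 : Integrable g) (hg2 : MemLp g 2) : ∫ x, conj (𝓕 f x) * 𝓕 g x = ∫ x, conj (f x) * g x := by
  have h := Lp.inner_fourier_eq (hf2.toLp f) (hg2.toLp g)
  rw [L2.inner_def, L2.inner_def] at h
  refine Eq.trans (integral_congr_ae ?_) (h.trans (integral_congr_ae ?_))
  · filter_upwards [fourier_ae_eq_fourier_toLp hf1 hf2, fourier_ae_eq_fourier_toLp hg1 hg2]
      with x h1 h2
    rw [h1, h2, RCLike.inner_apply, mul_comm]
  · filter_upwards [hf2.coeFn_toLp, hg2.coeFn_toLp] with x h1 h2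
    rw [h1, h2, RCLike.inner_apply, mul_comm]

lemma memLp_lineFT {f : ℝ → ℂ} (h1 : Integrable f) (h2 : MemLp f 2) : MemLp (lineFT f) 2 := by
  have hc : Continuous (𝓕 f) :=
    VectorFourier.fourierIntegral_continuous Real.continuous_fourierChar continuous_inner h1
  have e : lineFT f = fun k => ((√(2 * π) : ℝ) : ℂ)⁻¹ * 𝓕 f (-(2 * π)⁻¹ * k) :=
    funext (lineFT_eq_fourier f)
  rw [e]
  refine MemLp.const_mul ?_ _
  have h := (memLp_two_iff_integrable_sq_norm hc.aestronglyMeasurable).1 (memLp_fourier h1 h2)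
  have hne : -(2 * π)⁻¹ ≠ 0 := neg_ne_zero.2 (by positivity)
  refine (memLp_two_iff_integrable_sq_norm ?_).2 (h.comp_mul_left' hne)
  exact (hc.comp (continuous_const.mul continuous_id)).aestronglyMeasurable

lemma integral_conj_lineFT_mul_lineFT {f g : ℝ → ℂ} (hf1 : Integrable f) (hf2 : MemLp f 2)
    (hg1 : Integrable g) (hg2 : MemLp g 2) :
    ∫ k, conj (lineFT f k) * lineFT g k = ∫ x, conj (f x) * g x := by
  have h := Measure.integral_comp_mul_left (fun x => conj (𝓕 f x) * 𝓕 g x) (-(2 * π)⁻¹)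
  have hp : 0 < 2 * π := by positivity
  simp only [lineFT_eq_fourier]
  rw [← integral_conj_fourier_mul_fourier hf1 hf2 hg1 hg2]
  have e : ∀ k : ℝ, conj (((√(2 * π) : ℝ) : ℂ)⁻¹ * 𝓕 f (-(2 * π)⁻¹ * k))
      * (((√(2 * π) : ℝ) : ℂ)⁻¹ * 𝓕 g (-(2 * π)⁻¹ * k))
      = ((2 * π : ℝ) : ℂ)⁻¹ * (conj (𝓕 f (-(2 * π)⁻¹ * k)) * 𝓕 g (-(2 * π)⁻¹ * k)) := by
    intro k
    have h2 : ((2 * π : ℝ) : ℂ) = ((√(2 * π) : ℝ) : ℂ) * ((√(2 * π) : ℝ) : ℂ) := by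
      rw [← Complex.ofReal_mul, Real.mul_self_sqrt hp.le]
    rw [h2, map_mul, map_inv₀, Complex.conj_ofReal, mul_inv]
    ring
  simp only [e]
  rw [integral_const_mul, h, inv_neg, inv_inv, abs_neg, abs_of_pos hp, Complex.real_smul,
    ← mul_assoc, inv_mul_cancel₀, one_mul]
  exact_mod_cast hp.ne'

lemma lintegral_enorm_sq_eq {α : Type*} [MeasurableSpace α] {μ : Measure α} {f : α → ℂ}
    (h : MemLp f 2 μ) : ∫⁻ x, ‖f x‖ₑ ^ 2 ∂μ = ENNReal.ofReal (∫ x, conj (f x) * f x ∂μ).re := by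
  have h1 := (memLp_two_iff_integrable_sq_norm h.1).1 h
  have e : ∀ x, conj (f x) * f x = ((‖f x‖ ^ 2 : ℝ) : ℂ) := fun x => by
    rw [← Complex.normSq_eq_conj_mul_self, Complex.normSq_eq_norm_sq]
  simp only [e]
  rw [integral_complex_ofReal, Complex.ofReal_re, ofReal_integral_eq_lintegral_ofReal h1
    (Eventually.of_forall fun x => sq_nonneg _)]
  refine lintegral_congr fun x => ?_
  rw [ENNReal.ofReal_pow (norm_nonneg _), ofReal_norm]

lemma lintegral_enorm_sq_lineFT {f : ℝ → ℂ} (h1 : Integrable f) (h2 : MemLp f 2) :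
    ∫⁻ k, ‖lineFT f k‖ₑ ^ 2 = ∫⁻ x, ‖f x‖ₑ ^ 2 := by
  rw [lintegral_enorm_sq_eq (memLp_lineFT h1 h2), lintegral_enorm_sq_eq h2,
    integral_conj_lineFT_mul_lineFT h1 h2 h1 h2]

end Line

section Prod

/-- The measure `du dS²` on `ℝ × S²`. -/
abbrev cylMeasure : Measure (ℝ × S2) := (volume : Measure ℝ).prod sphereMeasure

/-- The Fourier transform in the first variable. -/
def cylFT (g : ℝ × S2 → ℂ) (p : ℝ × S2) : ℂ := lineFT (fun u => g (u, p.2)) p.1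

lemma stronglyMeasurable_cylFT {g : ℝ × S2 → ℂ} (hg : StronglyMeasurable g) :
    StronglyMeasurable (cylFT g) := by
  unfold cylFT lineFT
  refine StronglyMeasurable.const_mul ?_ _
  have h : StronglyMeasurable fun q : (ℝ × S2) × ℝ =>
      Complex.exp (Complex.I * q.1.1 * q.2) * g (q.2, q.1.2) := by
    refine StronglyMeasurable.mul ?_ ?_
    · exact Continuous.stronglyMeasurable (by fun_prop)
    · exact hg.comp_measurable (measurable_snd.prodMk (measurable_snd.comp measurable_fst))
  exact h.integral_prod_right

lemma memLp_two_iff_lintegral {α : Type*} [MeasurableSpace α] {μ : Measure α} {f : α → ℂ}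
    (hf : AEStronglyMeasurable f μ) : MemLp f 2 μ ↔ ∫⁻ x, ‖f x‖ₑ ^ 2 ∂μ < ∞ := by
  rw [MemLp, and_iff_right hf, eLpNorm_lt_top_iff_lintegral_rpow_enorm_lt_top (by norm_num)
    (by norm_num)]
  norm_num

lemma eLpNorm_two_sq {α : Type*} [MeasurableSpace α] {μ : Measure α} (f : α → ℂ) :
    eLpNorm f 2 μ ^ 2 = ∫⁻ x, ‖f x‖ₑ ^ 2 ∂μ := by
  rw [eLpNorm_eq_lintegral_rpow_enorm_toReal (by norm_num) (by norm_num)]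
  rw [← ENNReal.rpow_natCast, ← ENNReal.rpow_mul]
  norm_num

lemma ae_slices {g : ℝ × S2 → ℂ} (hg : StronglyMeasurable g) (h1 : Integrable g cylMeasure)
    (h2 : MemLp g 2 cylMeasure) : ∀ᵐ w ∂sphereMeasure,
    Integrable (fun u => g (u, w)) ∧ MemLp (fun u => g (u, w)) 2 := by
  have h3 := h1.prod_left_ae
  have h4 := (memLp_two_iff_lintegral h2.1).1 h2
  rw [lintegral_prod_symm _ (by fun_prop (disch := exact hg.measurable))] at h4
  have h5 := ae_lt_top' (by
    exact (Measurable.lintegral_prod_left' (f := fun p => ‖g p‖ₑ ^ 2)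
      (by have := hg.measurable; fun_prop)).aemeasurable) h4.ne
  filter_upwards [h3, h5] with w hw1 hw2
  exact ⟨hw1, (memLp_two_iff_lintegral hw1.1).2 hw2⟩

lemma cylFT_mk (g : ℝ × S2 → ℂ) (k : ℝ) (w : S2) :
    cylFT g (k, w) = lineFT (fun u => g (u, w)) k := rfl

lemma lintegral_enorm_sq_cylFT {g : ℝ × S2 → ℂ} (hg : StronglyMeasurable g)
    (h1 : Integrable g cylMeasure) (h2 : MemLp g 2 cylMeasure) :
    ∫⁻ p, ‖cylFT g p‖ₑ ^ 2 ∂cylMeasure = ∫⁻ p, ‖g p‖ₑ ^ 2 ∂cylMeasure := by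
  have hm := hg.measurable
  have hm' := (stronglyMeasurable_cylFT hg).measurable
  rw [lintegral_prod_symm _ (by fun_prop), lintegral_prod_symm _ (by fun_prop)]
  refine lintegral_congr_ae ?_
  filter_upwards [ae_slices hg h1 h2] with w hw
  simp only [cylFT_mk]
  exact lintegral_enorm_sq_lineFT hw.1 hw.2

lemma memLp_cylFT {g : ℝ × S2 → ℂ} (hg : StronglyMeasurable g)
    (h1 : Integrable g cylMeasure) (h2 : MemLp g 2 cylMeasure) : MemLp (cylFT g) 2 cylMeasure := by
  refine (memLp_two_iff_lintegral (stronglyMeasurable_cylFT hg).aestronglyMeasurable).2 ?_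
  rw [lintegral_enorm_sq_cylFT hg h1 h2]
  exact (memLp_two_iff_lintegral h2.1).1 h2

lemma eLpNorm_cylFT {g : ℝ × S2 → ℂ} (hg : StronglyMeasurable g)
    (h1 : Integrable g cylMeasure) (h2 : MemLp g 2 cylMeasure) :
    eLpNorm (cylFT g) 2 cylMeasure = eLpNorm g 2 cylMeasure := by
  refine (ENNReal.pow_right_strictMono two_ne_zero).injective ?_
  beta_reduce
  rw [eLpNorm_two_sq, eLpNorm_two_sq, lintegral_enorm_sq_cylFT hg h1 h2]

lemma integrable_conj_mul {α : Type*} [MeasurableSpace α] {μ : Measure α} {f g : α → ℂ}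
    (hf : MemLp f 2 μ) (hg : MemLp g 2 μ) : Integrable (fun x => conj (f x) * g x) μ := by
  have := (hf.star).integrable_mul hg
  exact this

lemma integral_conj_cylFT_mul_cylFT {f g : ℝ × S2 → ℂ} (hf : StronglyMeasurable f)
    (hf1 : Integrable f cylMeasure) (hf2 : MemLp f 2 cylMeasure) (hg : StronglyMeasurable g)
    (hg1 : Integrable g cylMeasure) (hg2 : MemLp g 2 cylMeasure) :
    ∫ p, conj (cylFT f p) * cylFT g p ∂cylMeasure = ∫ p, conj (f p) * g p ∂cylMeasure := by
  rw [integral_prod_symm _ (integrable_conj_mul (memLp_cylFT hf hf1 hf2) (memLp_cylFT hg hg1 hg2)),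
    integral_prod_symm _ (integrable_conj_mul hf2 hg2)]
  refine integral_congr_ae ?_
  filter_upwards [ae_slices hf hf1 hf2, ae_slices hg hg1 hg2] with w h1 h2
  simp only [cylFT_mk]
  exact integral_conj_lineFT_mul_lineFT h1.1 h1.2 h2.1 h2.2

end Prod

/-! ### Fourier-Plancherel transforms -/

section Plancherel

lemma tendsto_zero_of_sq {ι : Type*} {l : Filter ι} {f : ι → ℝ≥0∞}
    (h : Tendsto (fun i => f i ^ 2) l (𝓝 0)) : Tendsto f l (𝓝 0) := by
  have h2 := (ENNReal.continuous_rpow_const (y := (1 / 2 : ℝ))).tendsto 0 |>.comp h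
  rw [ENNReal.zero_rpow_of_pos (by norm_num)] at h2
  refine h2.congr fun i => ?_
  simp only [Function.comp_apply]
  rw [← ENNReal.rpow_natCast, ← ENNReal.rpow_mul]
  norm_num

lemma tendsto_integral_conj_mul {α ι : Type*} [MeasurableSpace α] {μ : Measure α} {l : Filter ι}
    {u v : ι → α → ℂ} {U V : α → ℂ} (hu : ∀ i, MemLp (u i) 2 μ) (hv : ∀ i, MemLp (v i) 2 μ)
    (hU : MemLp U 2 μ) (hV : MemLp V 2 μ)
    (lu : Tendsto (fun i => eLpNorm (fun x => U x - u i x) 2 μ) l (𝓝 0))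
    (lv : Tendsto (fun i => eLpNorm (fun x => V x - v i x) 2 μ) l (𝓝 0)) :
    Tendsto (fun i => ∫ x, conj (u i x) * v i x ∂μ) l (𝓝 (∫ x, conj (U x) * V x ∂μ)) := by
  have e : ∀ {f g : α → ℂ} (hf : MemLp f 2 μ) (hg : MemLp g 2 μ),
      ∫ x, conj (f x) * g x ∂μ = inner ℂ (hf.toLp f) (hg.toLp g) := by
    intro f g hf hg
    rw [L2.inner_def]
    refine integral_congr_ae ?_
    filter_upwards [hf.coeFn_toLp, hg.coeFn_toLp] with x h1 h2
    rw [h1, h2, RCLike.inner_apply, mul_comm]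
  have t : ∀ {u : ι → α → ℂ} {U : α → ℂ} (hu : ∀ i, MemLp (u i) 2 μ) (hU : MemLp U 2 μ)
      (_ : Tendsto (fun i => eLpNorm (fun x => U x - u i x) 2 μ) l (𝓝 0)),
      Tendsto (fun i => (hu i).toLp (u i)) l (𝓝 (hU.toLp U)) := by
    intro u U hu hU lu
    rw [tendsto_iff_norm_sub_tendsto_zero]
    have := (ENNReal.tendsto_toReal ENNReal.zero_ne_top).comp lu
    rw [ENNReal.toReal_zero] at this
    refine this.congr fun i => ?_
    rw [norm_sub_rev, ← MemLp.toLp_sub, Lp.norm_toLp]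
    rfl
  rw [e hU hV]
  simp only [fun i => e (hu i) (hv i)]
  exact (t hu hU lu).inner (t hv hV lv)

/-- The truncation of a function to `-R < u ≤ R`. -/
def trunc (g : ℝ × S2 → ℂ) (R : ℝ) : ℝ × S2 → ℂ :=
  (Set.Ioc (-R) R ×ˢ (Set.univ : Set S2)).indicator g

lemma measurableSet_trunc (R : ℝ) : MeasurableSet (Set.Ioc (-R) R ×ˢ (Set.univ : Set S2)) :=
  measurableSet_Ioc.prod MeasurableSet.univ

lemma cylMeasure_trunc_lt_top (R : ℝ) :
    cylMeasure (Set.Ioc (-R) R ×ˢ (Set.univ : Set S2)) < ∞ := by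
  rw [Measure.prod_prod]
  exact ENNReal.mul_lt_top measure_Ioc_lt_top (measure_lt_top _ _)

lemma trunc_sm {g : ℝ × S2 → ℂ} (hg : StronglyMeasurable g) (R : ℝ) :
    StronglyMeasurable (trunc g R) := hg.indicator (measurableSet_trunc R)

lemma trunc_memLp {g : ℝ × S2 → ℂ} (hg : MemLp g 2 cylMeasure) (R : ℝ) :
    MemLp (trunc g R) 2 cylMeasure := hg.indicator (measurableSet_trunc R)

lemma trunc_integrable {g : ℝ × S2 → ℂ} (hg : MemLp g 2 cylMeasure) (R : ℝ) :
    Integrable (trunc g R) cylMeasure := by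
  rw [trunc, integrable_indicator_iff (measurableSet_trunc R), IntegrableOn]
  have : IsFiniteMeasure (cylMeasure.restrict (Set.Ioc (-R) R ×ˢ (Set.univ : Set S2))) :=
    ⟨by rw [Measure.restrict_apply_univ]; exact cylMeasure_trunc_lt_top R⟩
  exact (hg.restrict _).integrable (by norm_num)

lemma cylFT_trunc (g : ℝ × S2 → ℂ) {R : ℝ} (hR : 0 ≤ R) (p : ℝ × S2) :
    cylFT (trunc g R) p = ((√(2 * π) : ℝ) : ℂ)⁻¹ *
      ∫ U in (-R)..R, Complex.exp (Complex.I * p.1 * U) * g (U, p.2) := by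
  rw [cylFT, lineFT, intervalIntegral.integral_of_le (by linarith),
    ← integral_indicator measurableSet_Ioc]
  congr 2
  funext u
  simp only [trunc, Set.indicator, Set.mem_prod, Set.mem_univ, and_true]
  split_ifs <;> simp

lemma tendsto_eLpNorm_sub_trunc {g : ℝ × S2 → ℂ} (hg : StronglyMeasurable g)
    (h2 : MemLp g 2 cylMeasure) :
    Tendsto (fun R : ℝ => eLpNorm (fun p => g p - trunc g R p) 2 cylMeasure) atTop (𝓝 0) := by
  refine tendsto_zero_of_sq ?_
  simp only [eLpNorm_two_sq]
  have h0 : ∫⁻ _ : ℝ × S2, (0 : ℝ≥0∞) ∂cylMeasure = 0 := lintegral_zero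
  rw [← h0]
  refine tendsto_lintegral_filter_of_dominated_convergence (fun p => ‖g p‖ₑ ^ 2) ?_ ?_ ?_ ?_
  · refine Eventually.of_forall fun R => ?_
    have := hg.measurable
    have := (trunc_sm hg R).measurable
    fun_prop
  · refine Eventually.of_forall fun R => Eventually.of_forall fun p => ?_
    simp only [trunc, Set.indicator]
    split_ifs <;> simp
  · exact ((memLp_two_iff_lintegral h2.1).1 h2).ne
  · refine Eventually.of_forall fun p => ?_
    refine tendsto_const_nhds.congr' ?_
    filter_upwards [eventually_gt_atTop |p.1|] with R hR
    have : p ∈ Set.Ioc (-R) R ×ˢ (Set.univ : Set S2) :=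
      ⟨⟨(abs_lt.1 hR).1, (abs_lt.1 hR).2.le⟩, trivial⟩
    simp [trunc, Set.indicator_of_mem this]

/-- `h` is the Fourier-Plancherel transform of `g` in the first variable. -/
structure IsFT (g h : ℝ × S2 → ℂ) : Prop where
  sm : StronglyMeasurable g
  memLp : MemLp g 2 cylMeasure
  memLp_ft : MemLp h 2 cylMeasure
  lim : Tendsto (fun R : ℝ => eLpNorm (fun p => h p - cylFT (trunc g R) p) 2 cylMeasure)
    atTop (𝓝 0)

lemma cylFT_sub_ae {f g : ℝ × S2 → ℂ} (hf : StronglyMeasurable f)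
    (hf1 : Integrable f cylMeasure) (hf2 : MemLp f 2 cylMeasure) (hg : StronglyMeasurable g)
    (hg1 : Integrable g cylMeasure) (hg2 : MemLp g 2 cylMeasure) :
    (fun p => cylFT f p - cylFT g p) =ᵐ[cylMeasure] cylFT (fun p => f p - g p) := by
  have h := (Measure.quasiMeasurePreserving_snd (μ := (volume : Measure ℝ))
    (ν := sphereMeasure)).ae ((ae_slices hf hf1 hf2).and (ae_slices hg hg1 hg2))
  filter_upwards [h] with p hp
  have hi : ∀ {f : ℝ → ℂ}, Integrable f →
      Integrable fun u : ℝ => Complex.exp (Complex.I * p.1 * u) * f u := by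
    intro f hf
    refine hf.bdd_mul (c := 1) (by fun_prop) (Eventually.of_forall fun u => ?_)
    rw [mul_assoc, ← Complex.ofReal_mul, mul_comm, Complex.norm_exp_ofReal_mul_I]
  simp only [cylFT, lineFT, mul_sub]
  rw [integral_sub (hi hp.1.1) (hi hp.2.1), mul_sub]

/-- Pointwise convergence of the truncated transforms identifies their `L²` limit. By Fatou, the
distance from `h` to the transform of a truncation is at most the liminf of the distances between
two truncated transforms, and Plancherel bounds these by the tail of `g`. -/
lemma isFT_of_tendsto {g h : ℝ × S2 → ℂ} (hg : StronglyMeasurable g) (h2 : MemLp g 2 cylMeasure)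
    (hh : AEStronglyMeasurable h cylMeasure)
    (hl : ∀ᵐ p ∂cylMeasure, Tendsto (fun R : ℝ => cylFT (trunc g R) p) atTop (𝓝 (h p))) :
    IsFT g h := by
  have hFT : ∀ R, MemLp (cylFT (trunc g R)) 2 cylMeasure := fun R =>
    memLp_cylFT (trunc_sm hg R) (trunc_integrable h2 R) (trunc_memLp h2 R)
  have hb : ∀ R, eLpNorm (fun p => h p - cylFT (trunc g R) p) 2 cylMeasure
      ≤ eLpNorm (fun p => g p - trunc g R p) 2 cylMeasure := by
    intro R
    refine (Lp.eLpNorm_lim_le_liminf_eLpNorm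
      (f := fun (n : ℕ) p => cylFT (trunc g n) p - cylFT (trunc g R) p)
      (fun n => ((hFT n).1.sub (hFT R).1)) _ ?_).trans ?_
    · filter_upwards [hl] with p hp
      exact (hp.comp tendsto_natCast_atTop_atTop).sub_const _
    · refine liminf_le_of_frequently_le' (Eventually.frequently ?_)
      filter_upwards [eventually_ge_atTop ⌈R⌉₊] with n hn
      have hn' : R ≤ n := Nat.ceil_le.1 hn
      rw [eLpNorm_congr_ae (cylFT_sub_ae (trunc_sm hg n) (trunc_integrable h2 n)
        (trunc_memLp h2 n) (trunc_sm hg R) (trunc_integrable h2 R) (trunc_memLp h2 R)),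
        eLpNorm_cylFT (g := fun p => trunc g n p - trunc g R p)
          ((trunc_sm hg n).sub (trunc_sm hg R))
          ((trunc_integrable h2 n).sub (trunc_integrable h2 R))
          ((trunc_memLp h2 n).sub (trunc_memLp h2 R))]
      refine eLpNorm_mono fun p => ?_
      simp only [trunc, Set.indicator, Set.mem_prod, Set.mem_univ, and_true, Set.mem_Ioc]
      split_ifs with h3 h4
      · simp
      · simp
      · exfalso
        exact h3 ⟨by linarith [‹_ ∧ _›.1], by linarith [‹_ ∧ _›.2]⟩
      · simp
  have hlim := tendsto_of_tendsto_of_tendsto_of_le_of_le tendsto_const_nhds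
    (tendsto_eLpNorm_sub_trunc hg h2) (fun R => bot_le) hb
  refine ⟨hg, h2, ?_, hlim⟩
  -- A single finite distance to a square integrable transform already puts `h` in `L²`.
  obtain ⟨R, hR⟩ := (hlim.eventually (gt_mem_nhds ENNReal.zero_lt_top)).exists
  have h4 : MemLp (fun p => h p - cylFT (trunc g R) p) 2 cylMeasure := ⟨hh.sub (hFT R).1, hR⟩
  exact (memLp_congr_ae (Eventually.of_forall fun p => by simp)).1 (h4.add (hFT R))

lemma IsFT.memLp_trunc {g h : ℝ × S2 → ℂ} (H : IsFT g h) (R : ℝ) :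
    MemLp (cylFT (trunc g R)) 2 cylMeasure :=
  memLp_cylFT (trunc_sm H.sm R) (trunc_integrable H.memLp R) (trunc_memLp H.memLp R)

/-- Plancherel's theorem. -/
lemma IsFT.integral_conj_mul {g h g' h' : ℝ × S2 → ℂ} (H : IsFT g h) (H' : IsFT g' h') :
    ∫ p, conj (h p) * h' p ∂cylMeasure = ∫ p, conj (g p) * g' p ∂cylMeasure := by
  refine tendsto_nhds_unique (tendsto_integral_conj_mul H.memLp_trunc H'.memLp_trunc
    H.memLp_ft H'.memLp_ft H.lim H'.lim) ?_
  refine (tendsto_integral_conj_mul (trunc_memLp H.memLp) (trunc_memLp H'.memLp) H.memLp H'.memLp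
    (tendsto_eLpNorm_sub_trunc H.sm H.memLp) (tendsto_eLpNorm_sub_trunc H'.sm H'.memLp)).congr
    fun R => ?_
  exact (integral_conj_cylFT_mul_cylFT (trunc_sm H.sm R) (trunc_integrable H.memLp R)
    (trunc_memLp H.memLp R) (trunc_sm H'.sm R) (trunc_integrable H'.memLp R)
    (trunc_memLp H'.memLp R)).symm

lemma IsFT.lintegral_enorm_sq {g h : ℝ × S2 → ℂ} (H : IsFT g h) :
    ∫⁻ p, ‖h p‖ₑ ^ 2 ∂cylMeasure = ∫⁻ p, ‖g p‖ₑ ^ 2 ∂cylMeasure := by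
  rw [lintegral_enorm_sq_eq H.memLp_ft, lintegral_enorm_sq_eq H.memLp, H.integral_conj_mul H]

lemma integrable_exp_mul {f : ℝ → ℂ} (hf : Integrable f) (k : ℝ) :
    Integrable fun u : ℝ => Complex.exp (Complex.I * k * u) * f u := by
  refine hf.bdd_mul (c := 1) (by fun_prop) (Eventually.of_forall fun u => ?_)
  rw [mul_assoc, ← Complex.ofReal_mul, mul_comm, Complex.norm_exp_ofReal_mul_I]

lemma tendsto_cylFT_trunc {g : ℝ × S2 → ℂ} {p : ℝ × S2} (h : Integrable fun u => g (u, p.2)) :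
    Tendsto (fun R : ℝ => cylFT (trunc g R) p) atTop (𝓝 (cylFT g p)) := by
  have h1 := intervalIntegral_tendsto_integral (integrable_exp_mul h p.1) tendsto_neg_atTop_atBot
    tendsto_id
  refine ((h1.const_mul (((√(2 * π) : ℝ) : ℂ)⁻¹)).congr' ?_)
  filter_upwards [eventually_ge_atTop 0] with R hR
  exact (cylFT_trunc g hR p).symm

lemma isFT_of_integrable {g : ℝ × S2 → ℂ} (hg : StronglyMeasurable g)
    (h1 : Integrable g cylMeasure) (h2 : MemLp g 2 cylMeasure) : IsFT g (cylFT g) := by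
  refine isFT_of_tendsto hg h2 (stronglyMeasurable_cylFT hg).aestronglyMeasurable ?_
  filter_upwards [(Measure.quasiMeasurePreserving_snd (μ := (volume : Measure ℝ))
    (ν := sphereMeasure)).ae (ae_slices hg h1 h2)] with p hp
  exact tendsto_cylFT_trunc hp.1

end Plancherel

/-! ### Functions on the cylinder with decaying derivative -/

section Reg

/-- Smooth square integrable functions with integrable derivative. -/
def Reg (ψ : ℝ × S2 → ℝ) : Prop :=
  Smooth ψ ∧ ∃ D : ℝ, ∀ p : ℝ × S2, ψ p ^ 2 ≤ D * (1 + p.1 ^ 2)⁻¹ ∧ |pd ψ p| ≤ D * (1 + p.1 ^ 2)⁻¹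

/-- The Fourier-Plancherel transform of a regular function. -/
def FP (ψ : ℝ × S2 → ℝ) (p : ℝ × S2) : ℂ :=
  Complex.I / p.1 * cylFT (fun q => (pd ψ q : ℂ)) p

lemma reg_of_tame {ψ : ℝ × S2 → ℝ} (h : Tame ψ) {C C' : ℝ}
    (hd : ∀ p : ℝ × S2, C' < |p.1| → |ψ p| ≤ C * (1 / |p.1|)) : Reg ψ := by
  obtain ⟨hs, D, hD⟩ := h
  -- Three bounds: `D` for the derivative; `2C²` where `ψ² ≤ C²/u²` and `1 + u² ≤ 2u²`; and `D²`
  -- times the largest value of `1 + u²` on the remaining compact range.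
  refine ⟨hs, max D (max (2 * C ^ 2) (D ^ 2 * (1 + (max C' 1) ^ 2))), fun p => ⟨?_, ?_⟩⟩
  · have hp : 0 < 1 + p.1 ^ 2 := by positivity
    rw [← div_eq_mul_inv, le_div_iff₀ hp]
    rcases lt_or_ge (max C' 1) |p.1| with h1 | h1
    · have h2 := hd p ((le_max_left _ _).trans_lt h1)
      have h3 : 1 < |p.1| := (le_max_right _ _).trans_lt h1
      refine le_trans ?_ ((le_max_left _ _).trans (le_max_right _ _))
      have h4 := pow_le_pow_left₀ (abs_nonneg _) h2 2
      rw [sq_abs, mul_pow, div_pow, sq_abs, one_pow] at h4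
      have h5 : 1 < p.1 ^ 2 := by rw [← sq_abs]; nlinarith
      calc ψ p ^ 2 * (1 + p.1 ^ 2) ≤ C ^ 2 * (1 / p.1 ^ 2) * (2 * p.1 ^ 2) :=
            mul_le_mul h4 (by linarith) (by positivity) (by positivity)
        _ = 2 * C ^ 2 := by
            have : p.1 ≠ 0 := by
              intro h0
              rw [h0] at h5
              norm_num at h5
            field_simp
    · refine le_trans ?_ ((le_max_right _ _).trans (le_max_right _ _))
      have h4 := pow_le_pow_left₀ (abs_nonneg _) (hD p).1 2
      have h5 := pow_le_pow_left₀ (abs_nonneg _) h1 2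
      rw [sq_abs] at h4 h5
      exact mul_le_mul h4 (by linarith) hp.le (sq_nonneg _)
  · exact (hD p).2.trans (mul_le_mul_of_nonneg_right (le_max_left _ _) (by positivity))

lemma reg_of_mem_SB {ψ : ℝ × S2 → ℝ} (h : ψ ∈ SB) : Reg ψ := by
  obtain ⟨C, _, C', _, hh⟩ := h.2.2
  exact reg_of_tame (tame_of_mem_SB h) fun p hp => (hh p.1 p.2 hp).1.le

lemma reg_of_mem_SH {ψ : ℝ × S2 → ℝ} (h : ψ ∈ SH) : Reg ψ := by
  obtain ⟨C, hC, C', hC', hh⟩ := h.2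
  refine reg_of_tame (C := C) (C' := C') (tame_of_mem_SH h) fun p hp =>
    (hh p.1 p.2 hp).1.le.trans (mul_le_mul_of_nonneg_left ?_ hC.le)
  have h1 : 0 < |p.1| := by linarith
  change exp (-|p.1|) ≤ _
  rw [exp_neg, ← one_div]
  exact one_div_le_one_div_of_le h1 (by linarith [add_one_le_exp |p.1|])

namespace Reg

variable {ψ χ : ℝ × S2 → ℝ}

lemma add (h : Reg ψ) (h' : Reg χ) : Reg (ψ + χ) := by
  obtain ⟨hs, D, hD⟩ := h
  obtain ⟨hs', D', hD'⟩ := h'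
  refine ⟨hs.add hs', 2 * (max D 0 + max D' 0), fun p => ?_⟩
  have hp : 0 ≤ (1 + p.1 ^ 2)⁻¹ := by positivity
  have m1 := mul_le_mul_of_nonneg_right (le_max_left D 0) hp
  have m2 := mul_le_mul_of_nonneg_right (le_max_left D' 0) hp
  have m3 := mul_nonneg (le_max_right D 0) hp
  have m4 := mul_nonneg (le_max_right D' 0) hp
  constructor
  · rw [Pi.add_apply]
    nlinarith [(hD p).1, (hD' p).1, sq_nonneg (ψ p - χ p)]
  · rw [pd_add hs hs']
    refine (abs_add_le _ _).trans ?_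
    nlinarith [(hD p).2, (hD' p).2]

lemma smul (c : ℝ) (h : Reg ψ) : Reg (c • ψ) := by
  obtain ⟨hs, D, hD⟩ := h
  refine ⟨hs.smul c, (c ^ 2 + |c|) * max D 0, fun p => ?_⟩
  have hp : 0 ≤ (1 + p.1 ^ 2)⁻¹ := by positivity
  have m1 := mul_le_mul_of_nonneg_right (le_max_left D 0) hp
  have m3 := mul_nonneg (le_max_right D 0) hp
  constructor
  · rw [Pi.smul_apply, smul_eq_mul, mul_pow]
    have := mul_le_mul_of_nonneg_left ((hD p).1.trans m1) (sq_nonneg c)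
    nlinarith [mul_nonneg (abs_nonneg c) m3]
  · rw [pd_smul, abs_mul]
    have := mul_le_mul_of_nonneg_left ((hD p).2.trans m1) (abs_nonneg c)
    nlinarith [mul_nonneg (sq_nonneg c) m3]

lemma sub (h : Reg ψ) (h' : Reg χ) : Reg (ψ - χ) := by
  have := h.add (h'.smul (-1))
  rwa [neg_one_smul, ← sub_eq_add_neg] at this

lemma comp_add (h : Reg ψ) (t : ℝ) : Reg fun p => ψ (p.1 + t, p.2) := by
  obtain ⟨hs, D, hD⟩ := h
  refine ⟨hs.comp_left (contDiff_id.add contDiff_const), max D 0 * (2 * (1 + t ^ 2)), fun p => ?_⟩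
  have hpd : pd (fun p => ψ (p.1 + t, p.2)) p = pd ψ (p.1 + t, p.2) :=
    deriv_comp_add_const (f := fun y => ψ (y, p.2)) t p.1
  -- Peetre's inequality `1 + u² ≤ 2 (1 + t²)(1 + (u + t)²)`.
  have key : D * (1 + (p.1 + t) ^ 2)⁻¹ ≤ max D 0 * (2 * (1 + t ^ 2)) * (1 + p.1 ^ 2)⁻¹ := by
    refine (mul_le_mul_of_nonneg_right (le_max_left D 0) (by positivity)).trans ?_
    rw [mul_assoc]
    refine mul_le_mul_of_nonneg_left ?_ (le_max_right _ _)
    rw [← div_eq_mul_inv, inv_eq_one_div, div_le_div_iff₀ (by positivity) (by positivity)]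
    nlinarith [sq_nonneg (p.1 + 2 * t), sq_nonneg (t * (p.1 + t))]
  rw [hpd]
  exact ⟨((hD _).1).trans key, ((hD _).2).trans key⟩

lemma continuous (h : Reg ψ) : Continuous ψ := ContMDiff.continuous h.1

lemma sm (h : Reg ψ) : StronglyMeasurable fun p => (ψ p : ℂ) :=
  (Complex.continuous_ofReal.comp h.continuous).stronglyMeasurable

lemma sm_pd (h : Reg ψ) : StronglyMeasurable fun p => (pd ψ p : ℂ) :=
  (Complex.continuous_ofReal.comp h.1.continuous_pd).stronglyMeasurable

lemma integrable_inv_cyl :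
    Integrable (fun p : ℝ × S2 => (1 + p.1 ^ 2)⁻¹) cylMeasure :=
  (integrable_inv_one_add_sq).comp_fst sphereMeasure

lemma memLp (h : Reg ψ) : MemLp (fun p => (ψ p : ℂ)) 2 cylMeasure := by
  obtain ⟨D, hD⟩ := h.2
  refine (memLp_two_iff_integrable_sq_norm h.sm.aestronglyMeasurable).2 ?_
  refine (integrable_inv_cyl.const_mul D).mono' (h.sm.norm.pow 2).aestronglyMeasurable
    (Eventually.of_forall fun p => ?_)
  rw [Complex.norm_real, norm_pow, norm_norm, Real.norm_eq_abs, sq_abs]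
  exact (hD p).1

lemma integrable_pd (h : Reg ψ) : Integrable (fun p => (pd ψ p : ℂ)) cylMeasure := by
  obtain ⟨D, hD⟩ := h.2
  refine (integrable_inv_cyl.const_mul D).mono' h.sm_pd.aestronglyMeasurable
    (Eventually.of_forall fun p => ?_)
  rw [Complex.norm_real]
  exact (hD p).2

lemma integrable_pd_slice (h : Reg ψ) (w : S2) : Integrable fun u => (pd ψ (u, w) : ℂ) := by
  obtain ⟨D, hD⟩ := h.2
  refine (integrable_inv_one_add_sq.const_mul D).mono' ?_ (Eventually.of_forall fun u => ?_)
  · exact (Complex.continuous_ofReal.comp (h.1.continuous_pd.comp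
      (Continuous.prodMk_left w))).aestronglyMeasurable
  · rw [Complex.norm_real]
    exact (hD (u, w)).2

lemma memLp_pd (h : Reg ψ) : MemLp (fun p => (pd ψ p : ℂ)) 2 cylMeasure := by
  obtain ⟨D, hD⟩ := h.2
  refine (memLp_two_iff_integrable_sq_norm h.sm_pd.aestronglyMeasurable).2 ?_
  refine (integrable_inv_cyl.const_mul (D ^ 2)).mono' (h.sm_pd.norm.pow 2).aestronglyMeasurable
    (Eventually.of_forall fun p => ?_)
  rw [Complex.norm_real, norm_pow, norm_norm, Real.norm_eq_abs]
  refine (pow_le_pow_left₀ (abs_nonneg _) (hD p).2 2).trans ?_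
  rw [mul_pow]
  refine mul_le_mul_of_nonneg_left ?_ (sq_nonneg D)
  have h1 : (1 + p.1 ^ 2)⁻¹ ≤ 1 := inv_le_one_of_one_le₀ (by nlinarith [sq_nonneg p.1])
  have h2 : 0 ≤ (1 + p.1 ^ 2)⁻¹ := by positivity
  nlinarith

lemma isFT_pd (h : Reg ψ) : IsFT (fun p => (pd ψ p : ℂ)) (cylFT fun p => (pd ψ p : ℂ)) :=
  isFT_of_integrable h.sm_pd h.integrable_pd h.memLp_pd

lemma sm_FP (h : Reg ψ) : StronglyMeasurable (FP ψ) := by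
  refine StronglyMeasurable.mul ?_ (stronglyMeasurable_cylFT h.sm_pd)
  exact Measurable.stronglyMeasurable (by fun_prop)

lemma tendsto_zero (h : Reg ψ) (w : S2) :
    Tendsto (fun u => ψ (u, w)) (atBot ⊔ atTop) (𝓝 0) := by
  obtain ⟨D, hD⟩ := h.2
  have h1 : Tendsto (fun u : ℝ => D * (1 + u ^ 2)⁻¹) (atBot ⊔ atTop) (𝓝 (D * 0)) := by
    refine Tendsto.const_mul _ (tendsto_inv_atTop_zero.comp (tendsto_atTop_add_const_left _ _ ?_))
    exact Tendsto.sup (((tendsto_pow_atTop (α := ℝ) two_ne_zero).comp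
      tendsto_neg_atBot_atTop).congr fun x => neg_sq x) (tendsto_pow_atTop two_ne_zero)
  rw [mul_zero] at h1
  have h2 : Tendsto (fun u => ψ (u, w) ^ 2) (atBot ⊔ atTop) (𝓝 0) :=
    tendsto_of_tendsto_of_tendsto_of_le_of_le tendsto_const_nhds h1 (fun u => sq_nonneg _)
      fun u => (hD (u, w)).1
  have h3 := h2.sqrt
  rw [Real.sqrt_zero] at h3
  simp only [Real.sqrt_sq_eq_abs] at h3
  exact (tendsto_zero_iff_abs_tendsto_zero _).2 h3

lemma hasDerivAt (h : Reg ψ) (u : ℝ) (w : S2) :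
    HasDerivAt (fun u => ψ (u, w)) (pd ψ (u, w)) u := (h.1.differentiable w u).hasDerivAt

/-- Integration by parts on `[-R, R]`, where the boundary terms vanish as `R → ∞`. It explains the
form of `FP`: elements of `S(B)` are only `O(1/|U|)`, so in general only their derivatives are
integrable. -/
lemma tendsto_cylFT_trunc (h : Reg ψ) {p : ℝ × S2} (hp : p.1 ≠ 0) :
    Tendsto (fun R : ℝ => cylFT (trunc (fun q => (ψ q : ℂ)) R) p) atTop (𝓝 (FP ψ p)) := by
  obtain ⟨k, w⟩ := p
  have hk : Complex.I * k ≠ 0 := mul_ne_zero Complex.I_ne_zero (by exact_mod_cast hp)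
  let E : ℝ → ℂ := fun u => Complex.exp (Complex.I * k * u)
  have hE : ∀ u, HasDerivAt (fun u => E u / (Complex.I * k)) (E u) u := by
    intro u
    have h1 : HasDerivAt (fun z : ℂ => Complex.exp (Complex.I * k * z))
        (Complex.exp (Complex.I * k * (u : ℂ)) * (Complex.I * k * 1)) (u : ℂ) :=
      ((hasDerivAt_id (u : ℂ)).const_mul _).cexp
    have h2 := h1.comp_ofReal.div_const (Complex.I * k)
    have e : Complex.exp (Complex.I * k * (u : ℂ)) * (Complex.I * k * 1) / (Complex.I * k) = E u := by
      rw [mul_one]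
      exact mul_div_cancel_right₀ _ hk
    rw [e] at h2
    exact h2
  have hψ : ∀ u, HasDerivAt (fun u => (ψ (u, w) : ℂ)) (pd ψ (u, w) : ℂ) u := fun u =>
    (h.hasDerivAt u w).ofReal_comp
  have hcE : Continuous E := by fun_prop
  have hcp : Continuous fun u => (pd ψ (u, w) : ℂ) :=
    Complex.continuous_ofReal.comp (h.1.continuous_pd.comp (Continuous.prodMk_left w))
  have hparts : ∀ R : ℝ, ∫ u in (-R)..R, E u * (ψ (u, w) : ℂ)
      = (ψ (R, w) : ℂ) * (E R / (Complex.I * k)) - (ψ (-R, w) : ℂ) * (E (-R) / (Complex.I * k))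
        - (∫ u in (-R)..R, E u * (pd ψ (u, w) : ℂ)) / (Complex.I * k) := by
    intro R
    have := intervalIntegral.integral_mul_deriv_eq_deriv_mul (a := -R) (b := R)
      (fun u _ => hψ u) (fun u _ => hE u) (hcp.intervalIntegrable _ _) (hcE.intervalIntegrable _ _)
    rw [← intervalIntegral.integral_div]
    refine Eq.trans ?_ (this.trans ?_)
    · refine intervalIntegral.integral_congr fun u _ => mul_comm _ _
    · congr 1
      refine intervalIntegral.integral_congr fun u _ => ?_
      ring
  have hnE : ∀ u, ‖E u / (Complex.I * k)‖ ≤ 1 / |k| := by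
    intro u
    rw [norm_div, norm_mul, Complex.norm_I, one_mul, Complex.norm_real, Real.norm_eq_abs]
    have : ‖E u‖ = 1 := by
      simp only [E]
      rw [mul_assoc, ← Complex.ofReal_mul, mul_comm, Complex.norm_exp_ofReal_mul_I]
    rw [this]
  have hbd : ∀ (s : ℝ → ℝ), Tendsto s atTop (atBot ⊔ atTop) →
      Tendsto (fun R => (ψ (s R, w) : ℂ) * (E (s R) / (Complex.I * k))) atTop (𝓝 0) := by
    intro s hs
    have h1 := (h.tendsto_zero w).comp hs
    rw [tendsto_zero_iff_norm_tendsto_zero]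
    have h2 := (h1.abs).mul_const (1 / |k|)
    rw [abs_zero, zero_mul] at h2
    refine tendsto_of_tendsto_of_tendsto_of_le_of_le tendsto_const_nhds h2
      (fun R => norm_nonneg _) fun R => ?_
    rw [norm_mul, Complex.norm_real]
    exact mul_le_mul_of_nonneg_left (hnE _) (norm_nonneg _)
  have hint := intervalIntegral_tendsto_integral (integrable_exp_mul (h.integrable_pd_slice w) k)
    tendsto_neg_atTop_atBot tendsto_id
  have hall := ((((hbd id (tendsto_id.mono_right le_sup_right)).sub (hbd (fun R => -R)
    (tendsto_neg_atTop_atBot.mono_right le_sup_left))).sub (hint.div_const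
      (Complex.I * k))).const_mul (((√(2 * π) : ℝ) : ℂ)⁻¹))
  have e : ((√(2 * π) : ℝ) : ℂ)⁻¹ * (0 - 0 - (∫ u : ℝ, Complex.exp (Complex.I * k * u)
      * (pd ψ (u, w) : ℂ)) / (Complex.I * k)) = FP ψ (k, w) := by
    have hk' : (k : ℂ) ≠ 0 := by exact_mod_cast hp
    have hI := Complex.I_sq
    simp only [FP, cylFT, lineFT]
    field_simp
    rw [hI]
    ring
  rw [e] at hall
  refine hall.congr' ?_
  filter_upwards [eventually_ge_atTop 0] with R hR
  rw [cylFT_trunc _ hR]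
  have := hparts R
  simp only [E] at this
  rw [this]
  rfl

lemma ae_fst_ne_zero : ∀ᵐ p ∂cylMeasure, p.1 ≠ 0 :=
  (Measure.quasiMeasurePreserving_fst (μ := (volume : Measure ℝ)) (ν := sphereMeasure)).ae
    (Measure.ae_ne volume 0)

lemma isFT (h : Reg ψ) : IsFT (fun p => (ψ p : ℂ)) (FP ψ) := by
  refine isFT_of_tendsto h.sm h.memLp h.sm_FP.aestronglyMeasurable ?_
  filter_upwards [ae_fst_ne_zero] with p hp
  exact h.tendsto_cylFT_trunc hp

lemma mul_FP {p : ℝ × S2} (hp : p.1 ≠ 0) :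
    (p.1 : ℂ) * FP ψ p = Complex.I * cylFT (fun q => (pd ψ q : ℂ)) p := by
  have : (p.1 : ℂ) ≠ 0 := by exact_mod_cast hp
  rw [FP]
  field_simp

lemma FP_add (h : Reg ψ) (h' : Reg χ) (p : ℝ × S2) : FP (ψ + χ) p = FP ψ p + FP χ p := by
  simp only [FP, cylFT, lineFT, pd_add h.1 h'.1, Complex.ofReal_add, mul_add]
  rw [integral_add (integrable_exp_mul (h.integrable_pd_slice p.2) p.1)
    (integrable_exp_mul (h'.integrable_pd_slice p.2) p.1), mul_add, mul_add]

lemma FP_smul (c : ℝ) (p : ℝ × S2) : FP (c • ψ) p = c * FP ψ p := by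
  simp only [FP, cylFT, lineFT, pd_smul, Complex.ofReal_mul, mul_left_comm _ (c : ℂ)]
  rw [integral_const_mul]
  ring

lemma FP_sub (h : Reg ψ) (h' : Reg χ) (p : ℝ × S2) : FP (ψ - χ) p = FP ψ p - FP χ p := by
  have := h.FP_add (h'.smul (-1)) p
  rw [FP_smul, neg_one_smul, ← sub_eq_add_neg] at this
  rw [this]
  push_cast
  ring

lemma FP_comp_add (t : ℝ) (p : ℝ × S2) : FP (fun p => ψ (p.1 + t, p.2)) p
    = Complex.exp (-(Complex.I * p.1 * t)) * FP ψ p := by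
  have hpd : ∀ q : ℝ × S2, pd (fun p => ψ (p.1 + t, p.2)) q = pd ψ (q.1 + t, q.2) := fun q =>
    deriv_comp_add_const (f := fun y => ψ (y, q.2)) t q.1
  simp only [FP, cylFT, lineFT, hpd]
  have h := integral_add_right_eq_self (μ := (volume : Measure ℝ)) (fun u : ℝ =>
    Complex.exp (Complex.I * p.1 * ((u - t : ℝ) : ℂ)) * (pd ψ (u, p.2) : ℂ)) t
  simp only [add_sub_cancel_right] at h
  rw [h]
  have e : ∀ u : ℝ, Complex.exp (Complex.I * p.1 * ((u - t : ℝ) : ℂ)) * (pd ψ (u, p.2) : ℂ)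
      = Complex.exp (-(Complex.I * p.1 * t)) *
        (Complex.exp (Complex.I * p.1 * u) * (pd ψ (u, p.2) : ℂ)) := by
    intro u
    rw [← mul_assoc, ← Complex.exp_add]
    congr 2
    push_cast
    ring
  simp only [e]
  rw [integral_const_mul]
  ring

lemma FP_comp_mul {l : ℝ} (hl : 0 < l) (p : ℝ × S2) : FP (fun p => ψ (l * p.1, p.2)) p
    = (l : ℂ)⁻¹ * FP ψ (p.1 / l, p.2) := by
  have hpd : ∀ q : ℝ × S2, pd (fun p => ψ (l * p.1, p.2)) q = l * pd ψ (l * q.1, q.2) := by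
    intro q
    have := deriv_comp_mul_left l (fun y => ψ (y, q.2)) q.1
    simpa [pd] using this
  have hl' : (l : ℂ) ≠ 0 := by exact_mod_cast hl.ne'
  simp only [FP, cylFT, lineFT, hpd]
  have h := Measure.integral_comp_mul_left (fun u : ℝ =>
    Complex.exp (Complex.I * ((p.1 / l : ℝ) : ℂ) * u) * (pd ψ (u, p.2) : ℂ)) l
  rw [abs_of_pos (inv_pos.2 hl)] at h
  have e : ∀ u : ℝ, Complex.exp (Complex.I * p.1 * u) * ((l * pd ψ (l * u, p.2) : ℝ) : ℂ)
      = l * (Complex.exp (Complex.I * ((p.1 / l : ℝ) : ℂ) * ((l * u : ℝ) : ℂ))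
        * (pd ψ (l * u, p.2) : ℂ)) := by
    intro u
    push_cast
    have : Complex.I * ((p.1 : ℂ) / l) * (l * u) = Complex.I * p.1 * u := by field_simp
    rw [this]
    ring
  simp only [e]
  rw [integral_const_mul, h, Complex.real_smul]
  push_cast
  -- At `k = 0` both sides are zero, since `I / 0 = 0`.
  by_cases hp : (p.1 : ℂ) = 0
  · rw [hp]; simp
  · field_simp

/-- Real values of `ψ`. Through this symmetry the odd part of a weight governs imaginary parts and
the even part governs norms. -/
lemma FP_neg (p : ℝ × S2) : FP ψ (-p.1, p.2) = conj (FP ψ p) := by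
  simp only [FP, cylFT, lineFT, map_mul, map_div₀, Complex.conj_I, Complex.conj_ofReal, map_inv₀,
    ← integral_conj, ← Complex.exp_conj]
  push_cast
  have e : ∀ u : ℝ, Complex.I * -(p.1 : ℂ) * u = -Complex.I * p.1 * u := fun u => by ring
  simp only [e, div_neg, neg_div]

lemma FP_eq_fourierU (h : Reg ψ) {p : ℝ × S2} (hp : p.1 ≠ 0)
    (hi : Integrable fun u => (ψ (u, p.2) : ℂ)) : FP ψ p = fourierU ψ p :=
  tendsto_nhds_unique (h.tendsto_cylFT_trunc hp) (SdSState.tendsto_cylFT_trunc hi)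

lemma isFourierPlancherel (h : Reg ψ) : IsFourierPlancherel ψ (FP ψ) := by
  have h1 := h.isFT.lim
  refine tendsto_of_tendsto_of_tendsto_of_le_of_le' tendsto_const_nhds h1
    (Eventually.of_forall fun R => bot_le) ?_
  filter_upwards [eventually_ge_atTop 0] with R hR
  have e : cylFT (trunc (fun q => (ψ q : ℂ)) R) = fourierTrunc ψ R :=
    funext fun p => cylFT_trunc _ hR p
  rw [e]
  refine eLpNorm_mono_measure _ ?_
  exact Measure.prod_mono Measure.restrict_le_self le_rfl

end Reg

end Reg

/-! ### Weighted one-particle spaces -/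

/-- Spectral weights `w ≥ 0` with `w(k) - w(-k) = 2k`. -/
structure IsWeight (w : ℝ → ℝ) : Prop where
  meas : Measurable w
  nonneg : ∀ k, 0 ≤ w k
  bound : ∃ C, ∀ k, w k ≤ C * (1 + k ^ 2)
  odd : ∀ k, w k - w (-k) = 2 * k

/-- The measure `r² w(k) dk dS²`. -/
def cylWeight (r : ℝ) (w : ℝ → ℝ) : Measure (ℝ × S2) :=
  cylMeasure.withDensity fun p => ENNReal.ofReal (r ^ 2 * w p.1)

lemma cylWeight_ac (r : ℝ) (w : ℝ → ℝ) : cylWeight r w ≪ cylMeasure :=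
  withDensity_absolutelyContinuous _ _

lemma prod_smul_eq_cylWeight {w : ℝ → ℝ} (hw : Measurable w) (h0 : ∀ k, 0 ≤ w k) (r : ℝ) :
    ((volume : Measure ℝ).withDensity fun k => ENNReal.ofReal (w k)).prod
      (ENNReal.ofReal (r ^ 2) • sphereMeasure) = cylWeight r w := by
  have hm : Measurable fun k => ENNReal.ofReal (w k) := hw.ennreal_ofReal
  have hd : (ENNReal.ofReal (r ^ 2) • sphereMeasure)
      = sphereMeasure.withDensity fun _ => ENNReal.ofReal (r ^ 2) := by
    rw [withDensity_const]
  rw [hd, prod_withDensity hm measurable_const, cylWeight]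
  congr 1
  funext p
  rw [mul_comm (r ^ 2), ENNReal.ofReal_mul (h0 _)]

lemma lintegral_cylWeight {w : ℝ → ℝ} (hw : Measurable w) (r : ℝ) {f : ℝ × S2 → ℝ≥0∞}
    (hf : AEMeasurable f cylMeasure) :
    ∫⁻ p, f p ∂cylWeight r w = ∫⁻ p, ENNReal.ofReal (r ^ 2 * w p.1) * f p ∂cylMeasure := by
  rw [cylWeight, lintegral_withDensity_eq_lintegral_mul₀ (by fun_prop) hf]
  rfl

lemma integral_cylWeight {w : ℝ → ℝ} (hw : IsWeight w) (r : ℝ) (f : ℝ × S2 → ℂ) :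
    ∫ p, f p ∂cylWeight r w = (r ^ 2 : ℝ) * ∫ p, (w p.1 : ℂ) * f p ∂cylMeasure := by
  have hm := hw.meas
  rw [cylWeight, integral_withDensity_eq_integral_toReal_smul (by fun_prop)
    (Eventually.of_forall fun _ => ENNReal.ofReal_lt_top), ← integral_const_mul]
  refine integral_congr_ae (Eventually.of_forall fun p => ?_)
  simp only [ENNReal.toReal_ofReal (mul_nonneg (sq_nonneg r) (hw.nonneg p.1))]
  rw [Complex.real_smul]
  push_cast
  ring

/-- The reflection `k ↦ -k`. -/
lemma measurePreserving_neg_fst :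
    MeasurePreserving (fun p : ℝ × S2 => (-p.1, p.2)) cylMeasure cylMeasure :=
  (Measure.measurePreserving_neg (volume : Measure ℝ)).prod (MeasurePreserving.id _)

lemma measurableEmbedding_neg_fst : MeasurableEmbedding (fun p : ℝ × S2 => (-p.1, p.2)) :=
  ((Homeomorph.neg ℝ).prodCongr (Homeomorph.refl S2)).measurableEmbedding

namespace Reg

variable {ψ χ : ℝ × S2 → ℝ}

lemma memLp_mul_FP (h : Reg ψ) : MemLp (fun p => (p.1 : ℂ) * FP ψ p) 2 cylMeasure := by
  refine (memLp_congr_ae ?_).2 (h.isFT_pd.memLp_ft.const_mul Complex.I)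
  filter_upwards [ae_fst_ne_zero] with p hp using mul_FP hp

/-- A weight of quadratic growth is absorbed by one factor `k` on each transform, and `k` times the
transform is, up to `i`, the transform of the square integrable derivative. -/
lemma integrable_weight (h : Reg ψ) (h' : Reg χ) {w : ℝ → ℝ} (hw : Measurable w) {C : ℝ}
    (hC : ∀ k, |w k| ≤ C * (1 + k ^ 2)) :
    Integrable (fun p => (w p.1 : ℂ) * (conj (FP ψ p) * FP χ p)) cylMeasure := by
  have i1 := (integrable_conj_mul h.isFT.memLp_ft h'.isFT.memLp_ft).norm
  have i2 := (integrable_conj_mul h.memLp_mul_FP h'.memLp_mul_FP).norm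
  refine ((i1.add i2).const_mul C).mono' ?_ (Eventually.of_forall fun p => ?_)
  · refine AEStronglyMeasurable.mul ?_
      (integrable_conj_mul h.isFT.memLp_ft h'.isFT.memLp_ft).aestronglyMeasurable
    exact (Complex.measurable_ofReal.comp (hw.comp measurable_fst)).aestronglyMeasurable
  · simp only [Pi.add_apply, norm_mul, RCLike.norm_conj, Complex.norm_real, Real.norm_eq_abs]
    have := mul_le_mul_of_nonneg_right (hC p.1)
      (mul_nonneg (norm_nonneg (FP ψ p)) (norm_nonneg (FP χ p)))
    refine this.trans (le_of_eq ?_)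
    have e : |p.1| * |p.1| = p.1 ^ 2 := by rw [← sq, sq_abs]
    linear_combination (-(C * ‖FP ψ p‖ * ‖FP χ p‖)) * e

/-- `∫ k conj(ψ^) χ^ = i ∫ ψ ∂χ`. -/
lemma integral_mul_conj_FP (h : Reg ψ) (h' : Reg χ) :
    ∫ p, (p.1 : ℂ) * (conj (FP ψ p) * FP χ p) ∂cylMeasure
      = Complex.I * ((∫ p, ψ p * pd χ p ∂cylMeasure : ℝ) : ℂ) := by
  have e := h.isFT.integral_conj_mul h'.isFT_pd
  have e2 : ∫ p, (p.1 : ℂ) * (conj (FP ψ p) * FP χ p) ∂cylMeasure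
      = ∫ p, Complex.I * (conj (FP ψ p) * cylFT (fun p => (pd χ p : ℂ)) p) ∂cylMeasure := by
    refine integral_congr_ae ?_
    filter_upwards [ae_fst_ne_zero] with p hp
    rw [mul_left_comm, mul_FP hp]
    ring
  rw [e2, integral_const_mul, e, ← integral_complex_ofReal]
  congr 2
  funext p
  simp

end Reg

section Kmap

variable {S : Submodule ℝ (ℝ × S2 → ℝ)} {ν : Measure (ℝ × S2)} {r : ℝ} {w : ℝ → ℝ}

lemma Reg.memLp_cylWeight {ψ : ℝ × S2 → ℝ} (h : Reg ψ) (hw : IsWeight w)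
    (hν : ν = cylWeight r w) : MemLp (FP ψ) 2 ν := by
  subst hν
  obtain ⟨C, hC⟩ := hw.bound
  have hs : AEStronglyMeasurable (FP ψ) (cylWeight r w) := h.sm_FP.aestronglyMeasurable
  rw [memLp_two_iff_lintegral hs, lintegral_cylWeight hw.meas r
    (h.sm_FP.measurable.enorm.pow_const 2).aemeasurable]
  have hi := h.integrable_weight h hw.meas (C := C)
    (fun k => by rw [abs_of_nonneg (hw.nonneg k)]; exact hC k)
  have h3 := (hi.const_mul ((r ^ 2 : ℝ) : ℂ)).2
  rw [hasFiniteIntegral_iff_enorm] at h3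
  refine (lintegral_congr fun p => ?_).trans_lt h3
  simp only [enorm_mul, RCLike.enorm_conj]
  rw [ENNReal.ofReal_mul (sq_nonneg r), mul_assoc, sq (‖FP ψ p‖ₑ)]
  have e : ∀ x : ℝ, 0 ≤ x → ‖(x : ℂ)‖ₑ = ENNReal.ofReal x := fun x hx => by
    rw [← ofReal_norm, Complex.norm_real, Real.norm_of_nonneg hx]
  rw [e _ (hw.nonneg _), e _ (sq_nonneg r)]

/-- The map `ψ ↦ ψ^` into the one-particle space `L²(ν)`. -/
def Kmap (hS : ∀ ψ ∈ S, Reg ψ) (hν : ∀ ψ ∈ S, MemLp (FP ψ) 2 ν) : S →ₗ[ℝ] Lp ℂ 2 ν where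
  toFun ψ := (hν ψ ψ.2).toLp
  map_add' ψ χ := by
    rw [← MemLp.toLp_add]
    exact MemLp.toLp_congr _ ((hν ψ ψ.2).add (hν χ χ.2))
      (Eventually.of_forall fun p => (hS ψ ψ.2).FP_add (hS χ χ.2) p)
  map_smul' c ψ := by
    change _ = c • _
    rw [← MemLp.toLp_const_smul]
    refine MemLp.toLp_congr _ ((hν ψ ψ.2).const_smul c) (Eventually.of_forall fun p => ?_)
    rw [Pi.smul_apply, Complex.real_smul]
    exact Reg.FP_smul c p

variable (hS : ∀ ψ ∈ S, Reg ψ) (hF : ∀ ψ ∈ S, MemLp (FP ψ) 2 ν)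

lemma coeFn_Kmap (ψ : S) : (Kmap hS hF ψ : ℝ × S2 → ℂ) =ᵐ[ν] FP ψ :=
  (hF ψ ψ.2).coeFn_toLp

lemma inner_Kmap (hw : IsWeight w) (hν : ν = cylWeight r w) (ψ χ : S) :
    inner ℂ (Kmap hS hF ψ) (Kmap hS hF χ)
      = (r ^ 2 : ℝ) * ∫ p, (w p.1 : ℂ) * (conj (FP ψ p) * FP χ p) ∂cylMeasure := by
  rw [← integral_cylWeight hw r, ← hν, L2.inner_def]
  refine integral_congr_ae ?_
  filter_upwards [coeFn_Kmap hS hF ψ, coeFn_Kmap hS hF χ] with p h1 h2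
  rw [h1, h2, RCLike.inner_apply, mul_comm]

lemma enorm_Kmap_sq (hw : IsWeight w) (hν : ν = cylWeight r w) (ψ : S) :
    ‖Kmap hS hF ψ‖ₑ ^ 2
      = ∫⁻ p, ENNReal.ofReal (r ^ 2 * w p.1) * ‖FP ψ p‖ₑ ^ 2 ∂cylMeasure := by
  change ‖(hF ψ ψ.2).toLp‖ₑ ^ 2 = _
  rw [Lp.enorm_toLp, eLpNorm_two_sq, hν,
    lintegral_cylWeight hw.meas r ((hS ψ ψ.2).sm_FP.measurable.enorm.pow_const 2).aemeasurable]

/-- The modulus of the transform is even, so the norm sees only the even part of the weight. The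
vacuum and thermal norms are compared in this form. -/
lemma lintegral_symm (hw : IsWeight w) {ψ : ℝ × S2 → ℝ} (h : Reg ψ) :
    2 * ∫⁻ p, ENNReal.ofReal (w p.1) * ‖FP ψ p‖ₑ ^ 2 ∂cylMeasure
      = ∫⁻ p, ENNReal.ofReal (w p.1 + w (-p.1)) * ‖FP ψ p‖ₑ ^ 2 ∂cylMeasure := by
  have hm := hw.meas
  have hF := h.sm_FP.measurable
  have e : ∫⁻ p, ENNReal.ofReal (w p.1) * ‖FP ψ p‖ₑ ^ 2 ∂cylMeasure
      = ∫⁻ p, ENNReal.ofReal (w (-p.1)) * ‖FP ψ p‖ₑ ^ 2 ∂cylMeasure := by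
    rw [← measurePreserving_neg_fst.lintegral_comp_emb measurableEmbedding_neg_fst]
    simp only [Reg.FP_neg, RCLike.enorm_conj]
  rw [two_mul]
  nth_rewrite 2 [e]
  rw [← lintegral_add_left (by fun_prop)]
  refine lintegral_congr fun p => ?_
  rw [ENNReal.ofReal_add (hw.nonneg _) (hw.nonneg _), add_mul]

/-- The reflection `k ↦ -k` turns the conjugate of the weighted integral into the one with weight
`w(-k)`. Subtracting leaves the weight `2k`, whatever `w` is, and `integral_mul_conj_FP` evaluates
that integral. -/
lemma im_inner_Kmap (hw : IsWeight w) (hν : ν = cylWeight r w) (ψ χ : S) :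
    (inner ℂ (Kmap hS hF ψ) (Kmap hS hF χ)).im
      = r ^ 2 * ∫ p, (ψ : ℝ × S2 → ℝ) p * pd χ p ∂cylMeasure := by
  rw [inner_Kmap hS hF hw hν, Complex.im_ofReal_mul]
  congr 1
  have h := hS ψ ψ.2
  have h' := hS χ χ.2
  obtain ⟨C, hC⟩ := hw.bound
  have hC1 : ∀ k, |w k| ≤ C * (1 + k ^ 2) := fun k => by
    rw [abs_of_nonneg (hw.nonneg k)]; exact hC k
  have hC2 : ∀ k, |w (-k)| ≤ C * (1 + k ^ 2) := fun k => by
    rw [abs_of_nonneg (hw.nonneg _), ← neg_sq]; exact hC (-k)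
  have i1 := h.integrable_weight h' hw.meas hC1
  have i2 := h.integrable_weight h' (hw.meas.comp measurable_neg) hC2
  have e1 : conj (∫ p, (w p.1 : ℂ) * (conj (FP ψ p) * FP χ p) ∂cylMeasure)
      = ∫ p, (w (-p.1) : ℂ) * (conj (FP ψ p) * FP χ p) ∂cylMeasure := by
    rw [← integral_conj, ← measurePreserving_neg_fst.integral_comp measurableEmbedding_neg_fst]
    simp [Reg.FP_neg]
  have e2 := integral_sub i1 i2
  have e3 : ∫ p, ((w p.1 : ℂ) * (conj (FP ψ p) * FP χ p)
      - (w (-p.1) : ℂ) * (conj (FP ψ p) * FP χ p)) ∂cylMeasure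
      = 2 * ∫ p, (p.1 : ℂ) * (conj (FP ψ p) * FP χ p) ∂cylMeasure := by
    rw [← integral_const_mul]
    refine integral_congr_ae (Eventually.of_forall fun p => ?_)
    have := congrArg (fun x : ℝ => (x : ℂ)) (hw.odd p.1)
    push_cast at this
    linear_combination (conj (FP ψ p) * FP χ p) * this
  simp only [Function.comp_apply] at e2
  rw [e3, ← e1, h.integral_mul_conj_FP h'] at e2
  have := congrArg Complex.im e2
  simp at this
  linarith

/-- The two terms of `σ` are computed separately by `im_inner_Kmap`; antisymmetry of the imaginary
part takes the place of an integration by parts. -/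
lemma two_im_inner_Kmap (hw : IsWeight w) (hν : ν = cylWeight r w)
    (hT : ∀ ψ ∈ S, Tame ψ) (ψ χ : S) :
    sympForm S hT r ψ χ = 2 * (inner ℂ (Kmap hS hF ψ) (Kmap hS hF χ)).im := by
  have e1 := im_inner_Kmap hS hF hw hν ψ χ
  have e2 := im_inner_Kmap hS hF hw hν χ ψ
  have e3 : (inner ℂ (Kmap hS hF χ) (Kmap hS hF ψ)).im
      = -(inner ℂ (Kmap hS hF ψ) (Kmap hS hF χ)).im := by
    rw [← inner_conj_symm, Complex.conj_im]
  change r ^ 2 * ∫ p, ((ψ : ℝ × S2 → ℝ) p * pd χ p - (χ : ℝ × S2 → ℝ) p * pd ψ p) ∂cylMeasure = _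
  rw [integral_sub ((hT _ ψ.2).integrable (hT _ χ.2)) ((hT _ χ.2).integrable (hT _ ψ.2)), mul_sub]
  linarith

end Kmap

/-! ### The two weights -/

/-- The vacuum weight. -/
def weightB (k : ℝ) : ℝ := if 0 < k then 2 * k else 0

/-- The thermal weight. -/
def weightH (κ k : ℝ) : ℝ :=
  2 * k * exp (π * k / κ) / (exp (π * k / κ) - exp (-(π * k / κ)))

lemma isWeight_weightB : IsWeight weightB where
  meas := Measurable.ite measurableSet_Ioi (by fun_prop) measurable_const
  nonneg k := by unfold weightB; split_ifs <;> linarith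
  bound := ⟨1, fun k => by unfold weightB; split_ifs <;> nlinarith [sq_nonneg (k - 1)]⟩
  odd k := by
    unfold weightB
    split_ifs with h1 h2 h2 <;> linarith

lemma weightB_add (k : ℝ) : weightB k + weightB (-k) = 2 * |k| := by
  unfold weightB
  rcases lt_trichotomy k 0 with h | h | h
  · rw [if_neg (by linarith), if_pos (by linarith), abs_of_neg h]; ring
  · subst h; simp
  · rw [if_pos h, if_neg (by linarith), abs_of_pos h]; ring

lemma measureB_eq (r : ℝ) : measureB r = cylWeight r weightB := by
  rw [← prod_smul_eq_cylWeight isWeight_weightB.meas isWeight_weightB.nonneg, measureB,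
    ← withDensity_indicator measurableSet_Ioi]
  congr 2
  funext k
  simp only [Set.indicator, Set.mem_Ioi, weightB]
  split_ifs <;> simp

section thermal

variable {κ : ℝ}

lemma weightH_neg (κ k : ℝ) : weightH κ (-k)
    = 2 * k * exp (-(π * k / κ)) / (exp (π * k / κ) - exp (-(π * k / κ))) := by
  have e : π * -k / κ = -(π * k / κ) := by ring
  rw [weightH, e, neg_neg, ← neg_sub (exp (π * k / κ)), div_neg, mul_neg, neg_mul, neg_div, neg_neg]

lemma exp_sub_exp_pos (hκ : 0 < κ) {k : ℝ} (hk : 0 < k) :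
    0 < exp (π * k / κ) - exp (-(π * k / κ)) := by
  have : 0 < π * k / κ := by positivity
  exact sub_pos.2 (exp_lt_exp.2 (by linarith))

lemma exp_sub_exp_ne (hκ : 0 < κ) {k : ℝ} (hk : k ≠ 0) :
    exp (π * k / κ) - exp (-(π * k / κ)) ≠ 0 := by
  rcases hk.lt_or_gt with h | h
  · have h2 := exp_sub_exp_pos hκ (neg_pos.2 h)
    rw [mul_neg, neg_div, neg_neg] at h2
    linarith
  · exact (exp_sub_exp_pos hκ h).ne'

lemma weightH_odd (hκ : 0 < κ) (k : ℝ) : weightH κ k - weightH κ (-k) = 2 * k := by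
  rw [weightH_neg, weightH]
  -- At `k = 0` the weight is `0 / 0`, which is `0` here and not the limit `κ/π`; the identity still
  -- holds, and one value is invisible to the measure.
  rcases eq_or_ne k 0 with rfl | hk
  · simp
  · have := exp_sub_exp_ne hκ hk
    rw [← sub_div, ← mul_sub, mul_div_assoc, div_self this, mul_one]

lemma weightH_nonneg (hκ : 0 < κ) (k : ℝ) : 0 ≤ weightH κ k := by
  have hp : ∀ k, 0 < k → 0 ≤ weightH κ k ∧ 0 ≤ weightH κ (-k) := fun k hk => by
    have := exp_sub_exp_pos hκ hk
    rw [weightH_neg, weightH]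
    constructor <;> positivity
  rcases lt_trichotomy k 0 with h | h | h
  · have := (hp (-k) (neg_pos.2 h)).2
    rwa [neg_neg] at this
  · simp [h, weightH]
  · exact (hp k h).1

/-- With `x = πk/κ > 0` the claim is `(2x + 1) e^{-2x} ≤ 1`. Negative `k` reduces to positive `k` by
oddness; the constant `κ/π` is the limit of the weight at zero. -/
lemma weightH_le (hκ : 0 < κ) (k : ℝ) : weightH κ k ≤ 2 * |k| + κ / π := by
  have hp : ∀ k, 0 < k → weightH κ k ≤ 2 * k + κ / π := fun k hk => by
    have h1 := exp_sub_exp_pos hκ hk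
    have hx : 0 < π * k / κ := by positivity
    have h2 := add_one_le_exp (2 * (π * k / κ))
    have e1 : exp (2 * (π * k / κ)) * exp (-(π * k / κ)) = exp (π * k / κ) := by
      rw [← exp_add]; congr 1; ring
    have e2 : 2 * k + κ / π = κ / π * (2 * (π * k / κ) + 1) := by field_simp
    have e3 : 2 * k = κ / π * (2 * (π * k / κ)) := by field_simp
    rw [weightH, div_le_iff₀ h1, e2, e3, mul_assoc (κ / π), mul_assoc (κ / π)]
    refine mul_le_mul_of_nonneg_left ?_ (div_pos hκ pi_pos).le
    rw [← e1]
    have h3 := mul_le_mul_of_nonneg_right h2 (exp_pos (-(π * k / κ))).le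
    nlinarith
  have h0 : 0 < κ / π := by positivity
  rcases lt_trichotomy k 0 with h | h | h
  · have h1 := hp (-k) (neg_pos.2 h)
    have h2 := weightH_odd hκ k
    rw [abs_of_neg h]
    linarith
  · simp [h, weightH, h0.le]
  · rw [abs_of_pos h]
    exact hp k h

lemma isWeight_weightH (hκ : 0 < κ) : IsWeight (weightH κ) where
  meas := by unfold weightH; fun_prop
  nonneg := weightH_nonneg hκ
  bound := ⟨κ / π + 1, fun k => by
    have h1 := weightH_le hκ k
    have h2 : 0 < κ / π := by positivity
    nlinarith [sq_nonneg (|k| - 1), sq_abs k, mul_nonneg h2.le (sq_nonneg k)]⟩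
  odd := weightH_odd hκ

lemma weightH_add (κ k : ℝ) : weightH κ k + weightH κ (-k)
    = 2 * (k * cosh (π * k / κ) / sinh (π * k / κ)) := by
  rw [weightH_neg, weightH, cosh_eq, sinh_eq, ← add_div, div_div_eq_mul_div, mul_div_assoc',
    mul_div_assoc']
  congr 1
  ring

/-- Detailed balance at inverse temperature `2π/κ`: the one-particle content of the KMS condition.
-/
lemma weightH_mul_exp (κ k : ℝ) :
    weightH κ k * exp (-(2 * π / κ * k)) = weightH κ (-k) := by
  rw [weightH_neg, weightH, div_mul_eq_mul_div, mul_assoc, ← exp_add]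
  congr 3
  ring

lemma measureH_eq (hκ : 0 < κ) (r : ℝ) : measureH r κ = cylWeight r (weightH κ) :=
  prod_smul_eq_cylWeight (isWeight_weightH hκ).meas (isWeight_weightH hκ).nonneg r

end thermal

/-! ### Fourier symbols of the difference kernels -/

/-- The common building block: both difference kernels are superpositions of `e^{-s|x|}`, continuous
for `1/x²` and discrete for `1/sinh²`. The value is twice an elementary Laplace transform on the
half-line. -/
lemma lintegral_exp_neg_abs_mul {s : ℝ} (hs : 0 < s) (k : ℝ) :
    ∫⁻ x : ℝ, ENNReal.ofReal (exp (-(s * |x|)) * (2 - 2 * cos (k * x)))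
      = ENNReal.ofReal (4 * k ^ 2 / (s * (s ^ 2 + k ^ 2))) := by
  have e0 : ∫ x in Set.Ioi (0 : ℝ), exp (-s * x) = 1 / s := by
    rw [integral_exp_mul_Ioi (by linarith)]
    simp
  have hi0 : Integrable fun x : ℝ => exp (-(s * |x|)) := by
    -- The integral of a non-integrable function is `0` by convention, so a positive value proves
    -- integrability.
    by_contra h
    have h1 := integral_undef h
    rw [integral_comp_abs (f := fun x => exp (-(s * x)))] at h1
    simp only [← neg_mul] at h1
    rw [e0] at h1
    have : 0 < 1 / s := by positivity
    linarith
  have hi : Integrable fun x : ℝ => exp (-(s * |x|)) * (2 - 2 * cos (k * x)) := by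
    refine hi0.mul_bdd (c := 4) (by fun_prop) (Eventually.of_forall fun x => ?_)
    rw [Real.norm_eq_abs, abs_le]
    constructor <;> linarith [neg_one_le_cos (k * x), cos_le_one (k * x)]
  rw [← ofReal_integral_eq_lintegral_ofReal hi (Eventually.of_forall fun x =>
    mul_nonneg (exp_pos _).le (by linarith [cos_le_one (k * x)]))]
  congr 1
  have e1 : ∀ x : ℝ, exp (-(s * |x|)) * (2 - 2 * cos (k * x))
      = (fun y => exp (-(s * y)) * (2 - 2 * cos (k * y))) |x| := by
    intro x
    have : cos (k * |x|) = cos (k * x) := by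
      rcases abs_choice x with h | h <;> rw [h]
      rw [mul_neg, cos_neg]
    simp only [this]
  rw [integral_congr_ae (Eventually.of_forall e1), integral_comp_abs (f := fun y => exp (-(s * y)) * (2 - 2 * cos (k * y)))]
  let a : ℂ := -s + k * Complex.I
  have ha : a.re < 0 := by simp [a, hs]
  have e2 : ∀ y : ℝ, exp (-(s * y)) * (2 - 2 * cos (k * y))
      = 2 * exp (-s * y) - 2 * (Complex.exp (a * y)).re := by
    intro y
    have : (Complex.exp (a * y)).re = exp (-s * y) * cos (k * y) := by
      rw [Complex.exp_re]
      simp [a]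
    rw [this, neg_mul]
    ring
  have i1 := (integrableOn_exp_mul_complex_Ioi ha 0)
  have e3 : ∫ y in Set.Ioi (0 : ℝ), (Complex.exp (a * y)).re = s / (s ^ 2 + k ^ 2) := by
    have h := integral_re (𝕜 := ℂ) i1
    simp only [RCLike.re_to_complex] at h
    rw [h, integral_exp_mul_complex_Ioi ha 0]
    simp [a, Complex.div_re, Complex.normSq_apply]
    ring
  have i2 : IntegrableOn (fun y : ℝ => (Complex.exp (a * y)).re) (Set.Ioi 0) := i1.re
  simp only [e2]
  rw [integral_sub ((integrableOn_exp_mul_Ioi (by linarith) 0).const_mul 2)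
    (i2.const_mul 2), integral_const_mul, integral_const_mul, e0, e3]
  have : s ^ 2 + k ^ 2 ≠ 0 := by positivity
  field_simp
  ring

lemma ofReal_inv_sq {x : ℝ} (hx : x ≠ 0) : ENNReal.ofReal (1 / x ^ 2)
    = ∫⁻ s in Set.Ioi (0 : ℝ), ENNReal.ofReal (s * exp (-(s * |x|))) := by
  have hx0 : 0 < |x| := abs_pos.2 hx
  have h := integral_rpow_mul_exp_neg_mul_Ioi (a := 2) (r := |x|) two_pos hx0
  have e : ∀ t : ℝ, t ^ ((2 : ℝ) - 1) * exp (-(|x| * t)) = t * exp (-(t * |x|)) := by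
    intro t
    rw [show (2 : ℝ) - 1 = 1 by norm_num, rpow_one, mul_comm |x|]
  simp only [e] at h
  have e2 : (1 / |x|) ^ (2 : ℝ) * Gamma 2 = 1 / x ^ 2 := by
    rw [Gamma_two, mul_one, rpow_two, div_pow, one_pow, sq_abs]
  rw [e2] at h
  have hi : IntegrableOn (fun t : ℝ => t * exp (-(t * |x|))) (Set.Ioi 0) := by
    by_contra hn
    rw [integral_undef hn] at h
    have : 0 < 1 / x ^ 2 := by positivity
    linarith
  rw [← h, ofReal_integral_eq_lintegral_ofReal hi]
  filter_upwards [ae_restrict_mem measurableSet_Ioi] with t ht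
  exact mul_nonneg (le_of_lt ht) (exp_pos _).le

/-- With `r = e^{-κ|x|}` one has `4 sinh²(κx/2) = (1 - r)²/r`, and `r/(1 - r)² = ∑ n rⁿ`. The index
is shifted by one because the term `n = 0` vanishes. -/
lemma ofReal_inv_sinh_sq {κ x : ℝ} (hκ : 0 < κ) (hx : x ≠ 0) :
    ENNReal.ofReal (κ ^ 2 / (4 * sinh (κ * x / 2) ^ 2))
      = ∑' n : ℕ, ENNReal.ofReal ((n + 1) * κ ^ 2 * exp (-((n + 1) * κ * |x|))) := by
  have hy : 0 < κ * |x| := mul_pos hκ (abs_pos.2 hx)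
  let r := exp (-(κ * |x|))
  have hr : r < 1 := by
    rw [← exp_zero]
    exact exp_lt_exp.2 (by linarith)
  have hr0 : 0 < r := exp_pos _
  have h1 : HasSum (fun n : ℕ => (n : ℝ) * r ^ n) (r / (1 - r) ^ 2) :=
    hasSum_coe_mul_geometric_of_norm_lt_one (by
      rw [Real.norm_of_nonneg hr0.le]; exact hr)
  have h2 := (hasSum_nat_add_iff' 1).2 h1
  simp only [Finset.range_one, Finset.sum_singleton, Nat.cast_zero, zero_mul, sub_zero] at h2
  have h3 := h2.mul_left (κ ^ 2)
  have e1 : ∀ n : ℕ, κ ^ 2 * (((n + 1 : ℕ) : ℝ) * r ^ (n + 1))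
      = (n + 1) * κ ^ 2 * exp (-((n + 1) * κ * |x|)) := by
    intro n
    simp only [r]
    rw [← exp_nat_mul]
    push_cast
    rw [show ((n : ℝ) + 1) * -(κ * |x|) = -((n + 1) * κ * |x|) by ring]
    ring
  simp only [e1] at h3
  have e2 : κ ^ 2 * (r / (1 - r) ^ 2) = κ ^ 2 / (4 * sinh (κ * x / 2) ^ 2) := by
    have hs : sinh (κ * x / 2) ^ 2 = sinh (κ * |x| / 2) ^ 2 := by
      rcases abs_choice x with h | h <;> rw [h]
      rw [mul_neg, neg_div, sinh_neg, neg_sq]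
    have hq : 4 * sinh (κ * |x| / 2) ^ 2 = (1 - r) ^ 2 / r := by
      let q := exp (κ * |x| / 2)
      have hq0 : q ≠ 0 := (exp_pos _).ne'
      have hrq : r = (q ^ 2)⁻¹ := by
        simp only [r, q]
        rw [← exp_nat_mul, ← exp_neg]
        congr 1
        push_cast
        ring
      rw [sinh_eq, exp_neg, hrq]
      change 4 * ((q - q⁻¹) / 2) ^ 2 = _
      field_simp
      ring
    rw [hs, hq, div_div_eq_mul_div, mul_div_assoc]
  rw [e2] at h3
  rw [← h3.tsum_eq, ENNReal.ofReal_tsum_of_nonneg (fun n => by positivity) h3.summable]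

/-- Writing `1/x²` as the integral of `s e^{-s|x|}` and exchanging the integrals by Tonelli leaves
the arctangent integral of `4k²/(s² + k²)` over `s > 0`. -/
lemma lintegral_inv_sq_kernel (k : ℝ) :
    ∫⁻ x : ℝ, ENNReal.ofReal (1 / x ^ 2) * ENNReal.ofReal (2 - 2 * cos (k * x))
      = ENNReal.ofReal (2 * π * |k|) := by
  have e1 : ∫⁻ x : ℝ, ENNReal.ofReal (1 / x ^ 2) * ENNReal.ofReal (2 - 2 * cos (k * x))
      = ∫⁻ x : ℝ, ∫⁻ s in Set.Ioi (0 : ℝ), ENNReal.ofReal s *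
        ENNReal.ofReal (exp (-(s * |x|)) * (2 - 2 * cos (k * x))) := by
    refine lintegral_congr_ae ?_
    filter_upwards [Measure.ae_ne volume 0] with x hx
    rw [ofReal_inv_sq hx, ← lintegral_mul_const _ (by fun_prop)]
    refine setLIntegral_congr_fun measurableSet_Ioi fun s hs => ?_
    rw [ENNReal.ofReal_mul (le_of_lt hs), ENNReal.ofReal_mul (exp_pos _).le, mul_assoc]
  rw [e1, lintegral_lintegral_swap (by fun_prop)]
  have e2 : ∫⁻ s in Set.Ioi (0 : ℝ), ∫⁻ x : ℝ, ENNReal.ofReal s *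
        ENNReal.ofReal (exp (-(s * |x|)) * (2 - 2 * cos (k * x)))
      = ∫⁻ s in Set.Ioi (0 : ℝ), ENNReal.ofReal (4 * k ^ 2 / (s ^ 2 + k ^ 2)) := by
    refine setLIntegral_congr_fun measurableSet_Ioi fun s hs => ?_
    have hs' : 0 < s := hs
    rw [lintegral_const_mul _ (by fun_prop), lintegral_exp_neg_abs_mul hs',
      ← ENNReal.ofReal_mul hs'.le]
    congr 1
    have : s ^ 2 + k ^ 2 ≠ 0 := by positivity
    field_simp
  rw [e2]
  rcases eq_or_ne k 0 with rfl | hk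
  · simp
  have hk0 : 0 < |k| := abs_pos.2 hk
  have e3 : ∀ s : ℝ, 4 * k ^ 2 / (s ^ 2 + k ^ 2) = 4 * (1 + (|k|⁻¹ * s) ^ 2)⁻¹ := by
    intro s
    have h1 : s ^ 2 + k ^ 2 ≠ 0 := by positivity
    have h2 : 1 + (|k|⁻¹ * s) ^ 2 = (s ^ 2 + k ^ 2) / k ^ 2 := by
      rw [mul_pow, inv_pow, sq_abs]
      field_simp
      ring
    rw [h2, inv_div, mul_div_assoc]
  simp only [e3]
  have e4 := integral_comp_mul_left_Ioi (fun s : ℝ => (1 + s ^ 2)⁻¹) 0 (inv_pos.2 hk0)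
  rw [mul_zero, integral_Ioi_inv_one_add_sq, arctan_zero, sub_zero, inv_inv, smul_eq_mul] at e4
  have hi : IntegrableOn (fun s : ℝ => (1 + (|k|⁻¹ * s) ^ 2)⁻¹) (Set.Ioi 0) :=
    (integrable_inv_one_add_sq.comp_mul_left' (inv_ne_zero hk0.ne')).integrableOn
  rw [← ofReal_integral_eq_lintegral_ofReal (hi.const_mul 4)
    (Eventually.of_forall fun s => by positivity), integral_const_mul, e4]
  congr 1
  ring

/-- The partial fraction expansion of the cotangent at the imaginary point `ia`, multiplied by `i`.
-/
lemma hasSum_coth {a : ℝ} (ha : a ≠ 0) :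
    HasSum (fun n : ℕ => 2 * a / (a ^ 2 + (n + 1) ^ 2)) (π * cosh (π * a) / sinh (π * a) - 1 / a) := by
  let z : ℂ := Complex.I * a
  have hz : z ∈ Complex.integerComplement := by
    rw [Complex.mem_integerComplement_iff]
    rintro ⟨n, hn⟩
    have := congrArg Complex.im hn
    simp [z] at this
    exact ha this.symm
  have h1 := (Summable.hasSum (summable_cotTerm hz))
  have h2 := cot_series_rep' hz
  rw [← h2] at h1
  have h3 := h1.mul_left Complex.I
  have hs : sinh (π * a) ≠ 0 := by
    rw [Ne, sinh_eq_zero]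
    exact mul_ne_zero pi_ne_zero ha
  have e1 : ∀ n : ℕ, Complex.I * (1 / (z - (n + 1)) + 1 / (z + (n + 1)))
      = ((2 * a / (a ^ 2 + (n + 1) ^ 2) : ℝ) : ℂ) := by
    intro n
    have h4 : z - (n + 1) ≠ 0 := by
      have := Complex.integerComplement_add_ne_zero hz (-(n + 1 : ℤ))
      rwa [Int.cast_neg, ← sub_eq_add_neg, Int.cast_add, Int.cast_natCast, Int.cast_one] at this
    have h5 : z + (n + 1) ≠ 0 := by
      have := Complex.integerComplement_add_ne_zero hz (n + 1 : ℤ)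
      push_cast at this
      exact this
    have h6 : (a : ℂ) ^ 2 + (n + 1) ^ 2 ≠ 0 := by
      have : a ^ 2 + ((n : ℝ) + 1) ^ 2 ≠ 0 := by positivity
      exact_mod_cast this
    push_cast
    rw [div_add_div _ _ h4 h5, mul_div_assoc', div_eq_div_iff (mul_ne_zero h4 h5) h6]
    simp only [z]
    linear_combination (2 * (a : ℂ) * (a ^ 2 + (n + 1) ^ 2) - 2 * (a : ℂ) * a ^ 2) * Complex.I_sq
  simp only [cotTerm, e1] at h3
  have e2 : Complex.I * (π * Complex.cot (π * z) - 1 / z)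
      = ((π * cosh (π * a) / sinh (π * a) - 1 / a : ℝ) : ℂ) := by
    have hc : (π : ℂ) * z = ((π * a : ℝ) : ℂ) * Complex.I := by simp only [z]; push_cast; ring
    have ha' : (a : ℂ) ≠ 0 := by exact_mod_cast ha
    have hs' : Complex.sinh ((π * a : ℝ) : ℂ) ≠ 0 := by rw [← Complex.ofReal_sinh]; exact_mod_cast hs
    rw [Complex.cot, hc, Complex.cos_mul_I, Complex.sin_mul_I]
    push_cast at hs' ⊢
    simp only [z]
    field_simp
  rw [e2] at h3
  exact (Complex.hasSum_ofReal).1 h3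

/-- Integrating the exponential series termwise gives the partial fractions of `coth`. The term
`-2κ` is the pole `1/a` of `hasSum_coth` at `a = k/κ`, multiplied by `2k`. -/
lemma lintegral_inv_sinh_sq_kernel {κ : ℝ} (hκ : 0 < κ) {k : ℝ} (hk : k ≠ 0) :
    ∫⁻ x : ℝ, ENNReal.ofReal (κ ^ 2 / (4 * sinh (κ * x / 2) ^ 2))
        * ENNReal.ofReal (2 - 2 * cos (k * x))
      = ENNReal.ofReal (2 * π * (k * cosh (π * k / κ) / sinh (π * k / κ)) - 2 * κ) := by
  have e1 : ∫⁻ x : ℝ, ENNReal.ofReal (κ ^ 2 / (4 * sinh (κ * x / 2) ^ 2))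
        * ENNReal.ofReal (2 - 2 * cos (k * x))
      = ∫⁻ x : ℝ, ∑' n : ℕ, ENNReal.ofReal ((n + 1) * κ ^ 2) *
        ENNReal.ofReal (exp (-((n + 1) * κ * |x|)) * (2 - 2 * cos (k * x))) := by
    refine lintegral_congr_ae ?_
    filter_upwards [Measure.ae_ne volume 0] with x hx
    rw [ofReal_inv_sinh_sq hκ hx, ← ENNReal.tsum_mul_right]
    refine tsum_congr fun n => ?_
    rw [ENNReal.ofReal_mul (by positivity), ENNReal.ofReal_mul (exp_pos _).le, mul_assoc]
  rw [e1, lintegral_tsum (fun n => by fun_prop)]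
  have h := (hasSum_coth (div_ne_zero hk hκ.ne')).mul_left (2 * k)
  have e2 : ∀ n : ℕ, ∫⁻ x : ℝ, ENNReal.ofReal ((n + 1) * κ ^ 2) *
        ENNReal.ofReal (exp (-((n + 1) * κ * |x|)) * (2 - 2 * cos (k * x)))
      = ENNReal.ofReal (2 * k * (2 * (k / κ) / ((k / κ) ^ 2 + (n + 1) ^ 2))) := by
    intro n
    have hn : 0 < ((n : ℝ) + 1) * κ := by positivity
    rw [lintegral_const_mul _ (by fun_prop), lintegral_exp_neg_abs_mul hn,
      ← ENNReal.ofReal_mul (by positivity)]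
    congr 1
    have h1 : (((n : ℝ) + 1) * κ) ^ 2 + k ^ 2 ≠ 0 := by positivity
    have h2 : (k / κ) ^ 2 + ((n : ℝ) + 1) ^ 2 = ((((n : ℝ) + 1) * κ) ^ 2 + k ^ 2) / κ ^ 2 := by
      field_simp
      ring
    rw [h2]
    field_simp
    ring
  simp only [e2]
  rw [← ENNReal.ofReal_tsum_of_nonneg (fun n => ?_) h.summable, h.tsum_eq]
  · congr 1
    rw [mul_div_assoc π k κ]
    field_simp
  · have : 2 * k * (2 * (k / κ) / ((k / κ) ^ 2 + ((n : ℝ) + 1) ^ 2))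
        = 4 * (k ^ 2 / κ) / ((k / κ) ^ 2 + ((n : ℝ) + 1) ^ 2) := by ring
    rw [this]
    positivity

/-- The weighted norms of `ψ^` as integrals of difference quotients. -/
lemma Reg.lintegral_differences {ψ : ℝ × S2 → ℝ} (h : Reg ψ) {j : ℝ → ℝ≥0∞} (hj : Measurable j)
    {m : ℝ → ℝ≥0∞} (hm : ∀ k, k ≠ 0 → ∫⁻ x, j x * ENNReal.ofReal (2 - 2 * cos (k * x)) = m k) :
    ∫⁻ p, m p.1 * ‖FP ψ p‖ₑ ^ 2 ∂cylMeasure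
      = ∫⁻ x, j x * ∫⁻ p, ‖ψ (p.1 + x, p.2) - ψ p‖ₑ ^ 2 ∂cylMeasure := by
  have hF := h.sm_FP.measurable
  -- A translation by `x` multiplies the transform by `e^{-ikx}`, and `|e^{-ikx} - 1|² = 2 - 2
  -- cos(kx)`; Plancherel turns the difference into this symbol.
  have e1 : ∀ x : ℝ, ∫⁻ p, ‖ψ (p.1 + x, p.2) - ψ p‖ₑ ^ 2 ∂cylMeasure
      = ∫⁻ p, ENNReal.ofReal (2 - 2 * cos (p.1 * x)) * ‖FP ψ p‖ₑ ^ 2 ∂cylMeasure := by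
    intro x
    have h2 := ((h.comp_add x).sub h).isFT.lintegral_enorm_sq
    have e2 : ∀ p : ℝ × S2, ‖((((fun p : ℝ × S2 => ψ (p.1 + x, p.2)) - ψ) p : ℝ) : ℂ)‖ₑ
        = ‖ψ (p.1 + x, p.2) - ψ p‖ₑ := fun p => by
      rw [← ofReal_norm, Complex.norm_real, ofReal_norm]; rfl
    simp only [e2] at h2
    rw [← h2]
    refine lintegral_congr fun p => ?_
    rw [(h.comp_add x).FP_sub h, FP_comp_add]
    have e3 : Complex.exp (-(Complex.I * p.1 * x)) * FP ψ p - FP ψ p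
      = (Complex.exp (-(Complex.I * p.1 * x)) - 1) * FP ψ p := by ring
    rw [e3, enorm_mul, mul_pow]
    congr 1
    rw [← ofReal_norm, ← ENNReal.ofReal_pow (norm_nonneg _)]
    congr 1
    rw [← Complex.normSq_eq_norm_sq, show -(Complex.I * (p.1 : ℂ) * x)
      = ((-(p.1 * x) : ℝ) : ℂ) * Complex.I by push_cast; ring, Complex.normSq_apply,
      Complex.sub_re, Complex.sub_im, Complex.exp_ofReal_mul_I_re, Complex.exp_ofReal_mul_I_im,
      cos_neg, sin_neg, Complex.one_re, Complex.one_im]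
    linear_combination (sin_sq_add_cos_sq (p.1 * x))
  simp only [e1]
  have e2 : ∀ x, j x * ∫⁻ p, ENNReal.ofReal (2 - 2 * cos (p.1 * x)) * ‖FP ψ p‖ₑ ^ 2 ∂cylMeasure
      = ∫⁻ p, j x * (ENNReal.ofReal (2 - 2 * cos (p.1 * x)) * ‖FP ψ p‖ₑ ^ 2) ∂cylMeasure :=
    fun x => (lintegral_const_mul _ (by fun_prop)).symm
  simp only [e2]
  rw [lintegral_lintegral_swap (by fun_prop)]
  refine lintegral_congr_ae ?_
  filter_upwards [Reg.ae_fst_ne_zero] with p hp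
  rw [← hm _ hp, ← lintegral_mul_const _ (by fun_prop)]
  simp only [mul_assoc]

/-! ### Restriction to a half of the horizon -/

lemma lintegral_inv_add_sq {a : ℝ} (ha : 0 < a) :
    ∫⁻ y in Set.Ici (0 : ℝ), ENNReal.ofReal (1 / (y + a) ^ 2) = ENNReal.ofReal (1 / a) := by
  have hd : ∀ y ∈ Set.Ici (0 : ℝ), HasDerivAt (fun y => -(y + a)⁻¹) (1 / (y + a) ^ 2) y := by
    intro y hy
    have hy' : y + a ≠ 0 := by
      have : (0 : ℝ) ≤ y := hy
      positivity
    have := ((hasDerivAt_id y).add_const a).inv hy' |>.neg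
    exact this.congr_deriv (by rw [neg_div, neg_neg, id])
  have hl : Tendsto (fun y : ℝ => -(y + a)⁻¹) atTop (𝓝 0) := by
    have := (tendsto_inv_atTop_zero.comp (tendsto_atTop_add_const_right atTop a tendsto_id)).neg
    rwa [neg_zero] at this
  have h0 : ∀ y ∈ Set.Ioi (0 : ℝ), 0 ≤ 1 / (y + a) ^ 2 := fun y _ => by positivity
  have hi := integrableOn_Ioi_deriv_of_nonneg' hd h0 hl
  have he := integral_Ioi_of_hasDerivAt_of_nonneg' hd h0 hl
  rw [setLIntegral_congr Ioi_ae_eq_Ici.symm, ← ofReal_integral_eq_lintegral_ofReal hi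
    (ae_restrict_of_ae (Eventually.of_forall fun y => by positivity)), he]
  congr 1
  simp

namespace Half

variable (b : Half) {κ : ℝ}

lemma sgn_ne : b.sgn ≠ 0 := by cases b <;> simp [sgn]

lemma abs_sgn : |b.sgn| = 1 := by cases b <;> simp [sgn]

/-- The half `± U > 0`. -/
def region : Set ℝ := {U | 0 < b.sgn * U}

lemma measurableSet_region : MeasurableSet b.region :=
  (isOpen_lt continuous_const (continuous_const.mul continuous_id)).measurableSet

/-- The coordinate `U` as a function of `u`. -/
def coordU (κ u : ℝ) : ℝ := b.sgn / κ * exp (b.sgn * κ * u)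

lemma sgn_mul_coordU (κ u : ℝ) : b.sgn * b.coordU κ u = exp (b.sgn * κ * u) / κ := by
  rw [coordU]
  linear_combination (exp (b.sgn * κ * u) / κ) * b.sgn_mul_self

lemma hasDerivAt_coordU (hκ : 0 < κ) (u : ℝ) :
    HasDerivAt (b.coordU κ) (exp (b.sgn * κ * u)) u := by
  have h := (((hasDerivAt_id u).const_mul (b.sgn * κ)).exp).const_mul (b.sgn / κ)
  refine h.congr_deriv ?_
  have := b.sgn_mul_self
  simp only [id]
  field_simp
  linear_combination this

lemma log_coordU (hκ : 0 < κ) (u : ℝ) :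
    b.sgn / κ * log (κ * (b.sgn * b.coordU κ u)) = u := by
  rw [sgn_mul_coordU, mul_div_cancel₀ _ hκ.ne', log_exp]
  have := b.sgn_mul_self
  field_simp
  linear_combination u * this

lemma injective_coordU (hκ : 0 < κ) : Function.Injective (b.coordU κ) :=
  Function.LeftInverse.injective (g := fun U => b.sgn / κ * log (κ * (b.sgn * U))) (b.log_coordU hκ)

lemma image_coordU (hκ : 0 < κ) : b.coordU κ '' Set.univ = b.region := by
  ext U
  constructor
  · rintro ⟨u, -, rfl⟩
    change 0 < b.sgn * b.coordU κ u
    rw [sgn_mul_coordU]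
    positivity
  · intro hU
    have hU' : 0 < b.sgn * U := hU
    refine ⟨b.sgn / κ * log (κ * (b.sgn * U)), trivial, ?_⟩
    have e : b.sgn * κ * (b.sgn / κ * log (κ * (b.sgn * U))) = log (κ * (b.sgn * U)) := by
      have e1 : b.sgn * κ * (b.sgn / κ * log (κ * (b.sgn * U)))
          = b.sgn * b.sgn * (κ / κ) * log (κ * (b.sgn * U)) := by ring
      rw [e1, b.sgn_mul_self, div_self hκ.ne', one_mul, one_mul]
    rw [coordU, e, exp_log (by positivity)]
    have := b.sgn_mul_self
    field_simp
    linear_combination U * this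

lemma lintegral_region (hκ : 0 < κ) (g : ℝ → ℝ≥0∞) :
    ∫⁻ U in b.region, g U = ∫⁻ u, ENNReal.ofReal (exp (b.sgn * κ * u)) * g (b.coordU κ u) := by
  rw [← b.image_coordU hκ, lintegral_image_eq_lintegral_abs_deriv_mul MeasurableSet.univ
    (fun u _ => (b.hasDerivAt_coordU hκ u).hasDerivWithinAt) (b.injective_coordU hκ).injOn,
    Measure.restrict_univ]
  simp only [abs_exp]

lemma integral_region (hκ : 0 < κ) (g : ℝ → ℝ) :
    ∫ U in b.region, g U = ∫ u, exp (b.sgn * κ * u) * g (b.coordU κ u) := by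
  rw [← b.image_coordU hκ, integral_image_eq_integral_abs_deriv_smul MeasurableSet.univ
    (fun u _ => (b.hasDerivAt_coordU hκ u).hasDerivWithinAt) (b.injective_coordU hκ).injOn,
    Measure.restrict_univ]
  simp only [abs_exp, smul_eq_mul]

/-- The interaction of a point of one half with the whole other half. Summed over the half it
produces the extra mass term of the difference integral. -/
lemma lintegral_compl_region {U : ℝ} (hU : U ∈ b.region) :
    ∫⁻ V in b.regionᶜ, ENNReal.ofReal (1 / (V - U) ^ 2) = ENNReal.ofReal (1 / (b.sgn * U)) := by
  have himg : (fun y => -b.sgn * y) '' Set.Ici 0 = b.regionᶜ := by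
    ext V
    simp only [Set.mem_image, Set.mem_Ici, Set.mem_compl_iff, region, Set.mem_ofPred_eq, not_lt]
    constructor
    · rintro ⟨y, hy, rfl⟩
      have : b.sgn * (-b.sgn * y) = -y := by linear_combination (-y) * b.sgn_mul_self
      linarith
    · intro h
      exact ⟨-b.sgn * V, by linarith, by linear_combination V * b.sgn_mul_self⟩
  rw [← himg, lintegral_image_eq_lintegral_abs_deriv_mul measurableSet_Ici (f' := fun _ => -b.sgn)
    (fun y _ => by simpa using ((hasDerivAt_id y).const_mul (-b.sgn)).hasDerivWithinAt)
    (fun y _ z _ h => mul_left_cancel₀ (neg_ne_zero.2 b.sgn_ne) h),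
    ← lintegral_inv_add_sq (show 0 < b.sgn * U from hU)]
  refine lintegral_congr fun y => ?_
  rw [abs_neg, abs_sgn, ENNReal.ofReal_one, one_mul]
  congr 2
  linear_combination (y ^ 2 - U ^ 2) * b.sgn_mul_self

/-- The two exponentials are the Jacobians, so `dU dV / (V - U)²` becomes a translation invariant
kernel in the Killing coordinate. -/
lemma kernel_coordU (hκ : 0 < κ) (u v : ℝ) :
    exp (b.sgn * κ * u) * (exp (b.sgn * κ * v) * (1 / (b.coordU κ v - b.coordU κ u) ^ 2))
      = κ ^ 2 / (4 * sinh (κ * (v - u) / 2) ^ 2) := by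
  have hs : sinh (κ * (v - u) / 2) ^ 2 = sinh (b.sgn * κ * v / 2 - b.sgn * κ * u / 2) ^ 2 := by
    cases b
    · simp only [sgn]; ring_nf
    · simp only [sgn]
      rw [← neg_sq, ← sinh_neg]
      ring_nf
  let p := exp (b.sgn * κ * u / 2)
  let q := exp (b.sgn * κ * v / 2)
  have hp : 0 < p := exp_pos _
  have hq : 0 < q := exp_pos _
  have ep : exp (b.sgn * κ * u) = p ^ 2 := by
    simp only [p]; rw [← exp_nat_mul]; congr 1; push_cast; ring
  have eq : exp (b.sgn * κ * v) = q ^ 2 := by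
    simp only [q]; rw [← exp_nat_mul]; congr 1; push_cast; ring
  have e1 : 4 * sinh (b.sgn * κ * v / 2 - b.sgn * κ * u / 2) ^ 2
      = (q ^ 2 - p ^ 2) ^ 2 / (p ^ 2 * q ^ 2) := by
    rw [sinh_eq, neg_sub, exp_sub, exp_sub]
    change 4 * ((q / p - p / q) / 2) ^ 2 = _
    field_simp
    ring
  have e2 : (b.coordU κ v - b.coordU κ u) ^ 2 = (q ^ 2 - p ^ 2) ^ 2 / κ ^ 2 := by
    rw [coordU, coordU, ep, eq]
    have := b.sgn_mul_self
    field_simp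
    linear_combination (q ^ 2 - p ^ 2) ^ 2 * this
  rw [hs, e1, e2, ep, eq, one_div_div, div_div_eq_mul_div]
  ring

/-- The difference integral of a function supported on a half. -/
lemma lintegral_differences (hκ : 0 < κ) {f F : ℝ → ℝ} (hf : Measurable f) (hF : Measurable F)
    (h1 : ∀ u, F (b.coordU κ u) = f u) (h0 : ∀ U, U ∉ b.region → F U = 0) :
    ∫⁻ U, ∫⁻ V, ENNReal.ofReal (1 / (V - U) ^ 2) * ‖F V - F U‖ₑ ^ 2
      = (∫⁻ u, ∫⁻ v, ENNReal.ofReal (κ ^ 2 / (4 * sinh (κ * (v - u) / 2) ^ 2)) * ‖f v - f u‖ₑ ^ 2)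
        + ENNReal.ofReal (2 * κ) * ∫⁻ u, ‖f u‖ₑ ^ 2 := by
  have hP := b.measurableSet_region
  -- The contribution of pairs with one point in the half and one outside, where `F` vanishes. It
  -- occurs twice, once for each order, and in the coordinate `u` it is `κ ∫ |f|²`.
  let T := ∫⁻ U in b.region, ENNReal.ofReal (1 / (b.sgn * U)) * ‖F U‖ₑ ^ 2
  have a1 : ∀ U ∈ b.region, ∫⁻ V in b.regionᶜ, ENNReal.ofReal (1 / (V - U) ^ 2) * ‖F V - F U‖ₑ ^ 2
      = ENNReal.ofReal (1 / (b.sgn * U)) * ‖F U‖ₑ ^ 2 := by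
    intro U hU
    rw [← b.lintegral_compl_region hU, ← lintegral_mul_const _ (by fun_prop)]
    refine setLIntegral_congr_fun hP.compl fun V hV => ?_
    rw [h0 V hV, zero_sub, enorm_neg]
  have a2 : ∫⁻ U in b.regionᶜ, ∫⁻ V, ENNReal.ofReal (1 / (V - U) ^ 2) * ‖F V - F U‖ₑ ^ 2 = T := by
    have : ∀ U ∈ b.regionᶜ, ∫⁻ V, ENNReal.ofReal (1 / (V - U) ^ 2) * ‖F V - F U‖ₑ ^ 2
        = ∫⁻ V in b.region, ENNReal.ofReal (1 / (V - U) ^ 2) * ‖F V‖ₑ ^ 2 := by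
      intro U hU
      rw [← lintegral_add_compl _ hP]
      have z : ∫⁻ V in b.regionᶜ, ENNReal.ofReal (1 / (V - U) ^ 2) * ‖F V - F U‖ₑ ^ 2 = 0 := by
        rw [setLIntegral_congr_fun (g := fun _ => 0) hP.compl fun V hV => by
          rw [h0 V hV, h0 U hU]; simp]
        simp
      rw [z, add_zero, h0 U hU]
      simp only [sub_zero]
    -- Tonelli exchanges the outer point with the inner one and reduces this order of the pair to
    -- the other.
    rw [setLIntegral_congr_fun hP.compl this, lintegral_lintegral_swap (by fun_prop)]
    refine setLIntegral_congr_fun hP fun V hV => ?_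
    rw [lintegral_mul_const _ (by fun_prop), ← b.lintegral_compl_region hV]
    congr 1
    refine lintegral_congr fun U => ?_
    rw [← neg_sq, neg_sub]
  have a3 : ∫⁻ U in b.region, ∫⁻ V, ENNReal.ofReal (1 / (V - U) ^ 2) * ‖F V - F U‖ₑ ^ 2
      = (∫⁻ U in b.region, ∫⁻ V in b.region,
          ENNReal.ofReal (1 / (V - U) ^ 2) * ‖F V - F U‖ₑ ^ 2) + T := by
    rw [← lintegral_add_right _ (by fun_prop)]
    refine setLIntegral_congr_fun hP fun U hU => ?_
    rw [← a1 U hU, lintegral_add_compl _ hP]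
  have a4 : T = ENNReal.ofReal κ * ∫⁻ u, ‖f u‖ₑ ^ 2 := by
    simp only [T]
    rw [b.lintegral_region hκ, ← lintegral_const_mul _ (by fun_prop)]
    refine lintegral_congr fun u => ?_
    rw [h1, ← mul_assoc, ← ENNReal.ofReal_mul (exp_pos _).le, sgn_mul_coordU]
    congr 2
    have := (exp_pos (b.sgn * κ * u)).ne'
    field_simp
  have a5 : ∫⁻ U in b.region, ∫⁻ V in b.region, ENNReal.ofReal (1 / (V - U) ^ 2) * ‖F V - F U‖ₑ ^ 2
      = ∫⁻ u, ∫⁻ v, ENNReal.ofReal (κ ^ 2 / (4 * sinh (κ * (v - u) / 2) ^ 2)) * ‖f v - f u‖ₑ ^ 2 := by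
    rw [b.lintegral_region hκ]
    refine lintegral_congr fun u => ?_
    rw [b.lintegral_region hκ, ← lintegral_const_mul' _ _ ENNReal.ofReal_ne_top]
    refine lintegral_congr fun v => ?_
    rw [h1, h1, ← mul_assoc, ← mul_assoc, ← ENNReal.ofReal_mul (exp_pos _).le,
      ← ENNReal.ofReal_mul (by positivity), mul_assoc, b.kernel_coordU hκ]
  rw [← lintegral_add_compl _ hP, a2, a3, a4, a5, add_assoc, ← add_mul,
    ← ENNReal.ofReal_add hκ.le hκ.le, two_mul]

end Half

lemma lintegral_differences_prod {g : ℝ × S2 → ℝ} (hg : Measurable g) {j : ℝ → ℝ≥0∞}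
    (hj : Measurable j) :
    ∫⁻ x, j x * ∫⁻ p, ‖g (p.1 + x, p.2) - g p‖ₑ ^ 2 ∂cylMeasure
      = ∫⁻ w, (∫⁻ u, ∫⁻ v, j (v - u) * ‖g (v, w) - g (u, w)‖ₑ ^ 2) ∂sphereMeasure := by
  have e1 : ∀ x, j x * ∫⁻ p, ‖g (p.1 + x, p.2) - g p‖ₑ ^ 2 ∂cylMeasure
      = ∫⁻ p, j x * ‖g (p.1 + x, p.2) - g p‖ₑ ^ 2 ∂cylMeasure := fun x =>
    (lintegral_const_mul _ (by fun_prop)).symm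
  simp only [e1]
  rw [lintegral_lintegral_swap (by fun_prop), lintegral_prod_symm _ (by fun_prop)]
  refine lintegral_congr fun w => lintegral_congr fun u => ?_
  rw [← lintegral_add_left_eq_self (fun v => j (v - u) * ‖g (v, w) - g (u, w)‖ₑ ^ 2) u]
  simp only [add_sub_cancel_left]

section extendZero

variable {κ : ℝ} {ψ χ Ψ X : ℝ × S2 → ℝ} {b : Half}

lemma extendZero_coordU (hκ : 0 < κ) (b : Half) (ψ : ℝ × S2 → ℝ) (u : ℝ) (w : S2) :
    extendZero κ b ψ (b.coordU κ u, w) = ψ (u, w) := by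
  have h : 0 < b.sgn * b.coordU κ u := by rw [b.sgn_mul_coordU]; positivity
  rw [extendZero, if_pos h, b.log_coordU hκ]

lemma extendZero_of_notMem (b : Half) (ψ : ℝ × S2 → ℝ) {U : ℝ} (hU : U ∉ b.region) (w : S2) :
    extendZero κ b ψ (U, w) = 0 := if_neg hU

/-- `ENNReal.ofReal` is additive only on nonnegative numbers, so the sign of the symbol is needed
before the constant `2κ` can be added back. The partial fraction series has nonnegative terms. -/
lemma coth_kernel_nonneg (hκ : 0 < κ) {k : ℝ} (hk : k ≠ 0) :
    0 ≤ 2 * π * (k * cosh (π * k / κ) / sinh (π * k / κ)) - 2 * κ := by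
  have h := (hasSum_coth (div_ne_zero hk hκ.ne')).mul_left (2 * k)
  have h0 := h.nonneg fun n => by
    have : 2 * k * (2 * (k / κ) / ((k / κ) ^ 2 + ((n : ℝ) + 1) ^ 2))
        = 4 * (k ^ 2 / κ) / ((k / κ) ^ 2 + ((n : ℝ) + 1) ^ 2) := by ring
    rw [this]
    positivity
  refine h0.trans (le_of_eq ?_)
  rw [mul_div_assoc π k κ]
  field_simp

/-- The thermal norm of a function on a half is the vacuum norm of its extension by zero. -/
lemma lintegral_thermal (hκ : 0 < κ) (h : Reg ψ) (h' : Reg Ψ) (hΨ : Ψ = extendZero κ b ψ) :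
    ∫⁻ p, ENNReal.ofReal (weightH κ p.1) * ‖FP ψ p‖ₑ ^ 2 ∂cylMeasure
      = ∫⁻ p, ENNReal.ofReal (weightB p.1) * ‖FP Ψ p‖ₑ ^ 2 ∂cylMeasure := by
  have hm := h.continuous.measurable
  have hm' := h'.continuous.measurable
  have hF := h.sm_FP.measurable
  have hF' := h'.sm_FP.measurable
  have hB := h'.lintegral_differences (j := fun x => ENNReal.ofReal (1 / x ^ 2)) (by fun_prop)
    (fun k _ => lintegral_inv_sq_kernel k)
  have hH := h.lintegral_differences
    (j := fun x => ENNReal.ofReal (κ ^ 2 / (4 * sinh (κ * x / 2) ^ 2))) (by fun_prop)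
    (fun k hk => lintegral_inv_sinh_sq_kernel hκ hk)
  rw [lintegral_differences_prod hm' (by fun_prop)] at hB
  rw [lintegral_differences_prod hm (by fun_prop)] at hH
  have hD : ∀ w, ∫⁻ U, ∫⁻ V, ENNReal.ofReal (1 / (V - U) ^ 2) * ‖Ψ (V, w) - Ψ (U, w)‖ₑ ^ 2
      = _ := fun w => b.lintegral_differences hκ (f := fun u => ψ (u, w)) (F := fun U => Ψ (U, w))
    (by fun_prop) (by fun_prop) (fun u => by rw [hΨ, extendZero_coordU hκ])
    (fun U hU => by rw [hΨ, extendZero_of_notMem b ψ hU])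
  simp only [hD] at hB
  have hN : ∫⁻ w, (∫⁻ u, ‖ψ (u, w)‖ₑ ^ 2) ∂sphereMeasure = ∫⁻ p, ‖FP ψ p‖ₑ ^ 2 ∂cylMeasure := by
    rw [h.isFT.lintegral_enorm_sq, lintegral_prod_symm _ (h.sm.measurable.enorm.pow_const 2).aemeasurable]
    refine lintegral_congr fun w => lintegral_congr fun u => ?_
    rw [← ofReal_norm, ← ofReal_norm, Complex.norm_real]
  rw [lintegral_add_right _ (by fun_prop), lintegral_const_mul _ (by fun_prop), hN, ← hH,
    ← lintegral_const_mul _ (by fun_prop), ← lintegral_add_right _ (by fun_prop)] at hB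
  have sH := lintegral_symm (isWeight_weightH hκ) h
  have sB := lintegral_symm isWeight_weightB h'
  simp only [weightH_add] at sH
  simp only [weightB_add] at sB
  -- In `hB` the symbol of the `sinh` kernel carries `-2κ`, and the mixed pairs contribute `+2κ`
  -- times the `L²` norm. Their sum `2πk coth(πk/κ)` is `π` times the even combination of thermal
  -- weights.
  have key : ENNReal.ofReal π * (2 * ∫⁻ p, ENNReal.ofReal (weightH κ p.1) * ‖FP ψ p‖ₑ ^ 2 ∂cylMeasure)
      = ENNReal.ofReal π * (2 * ∫⁻ p, ENNReal.ofReal (weightB p.1) * ‖FP Ψ p‖ₑ ^ 2 ∂cylMeasure) := by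
    rw [sH, sB, ← lintegral_const_mul _ (by fun_prop), ← lintegral_const_mul _ (by fun_prop)]
    have e : ∫⁻ p, ENNReal.ofReal π * (ENNReal.ofReal (2 * |p.1|) * ‖FP Ψ p‖ₑ ^ 2) ∂cylMeasure
        = ∫⁻ p, ENNReal.ofReal (2 * π * |p.1|) * ‖FP Ψ p‖ₑ ^ 2 ∂cylMeasure := by
      refine lintegral_congr fun p => ?_
      rw [← mul_assoc, ← ENNReal.ofReal_mul pi_pos.le]
      congr 2
      ring
    rw [e, hB]
    refine lintegral_congr_ae ?_
    filter_upwards [Reg.ae_fst_ne_zero] with p hp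
    rw [← add_mul, ← ENNReal.ofReal_add (coth_kernel_nonneg hκ hp) (by positivity), ← mul_assoc,
      ← ENNReal.ofReal_mul pi_pos.le]
    congr 2
    ring
  have hpi : ENNReal.ofReal π ≠ 0 := by simp [pi_pos]
  rw [ENNReal.mul_right_inj hpi ENNReal.ofReal_ne_top] at key
  exact (ENNReal.mul_right_inj two_ne_zero ENNReal.ofNat_ne_top).1 key

/-- The one-form `∂X dU` does not depend on the parametrization: the factor of the chain rule
cancels the Jacobian. Outside the half the factor `Ψ` vanishes. -/
lemma integral_mul_pd_extendZero (hκ : 0 < κ) (hψ : Tame ψ) (hχ : Tame χ) (hΨT : Tame Ψ)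
    (hXT : Tame X) (hΨ : Ψ = extendZero κ b ψ) (hX : X = extendZero κ b χ) :
    ∫ p, Ψ p * pd X p ∂cylMeasure = ∫ p, ψ p * pd χ p ∂cylMeasure := by
  rw [integral_prod_symm _ (hΨT.integrable hXT), integral_prod_symm _ (hψ.integrable hχ)]
  congr 1
  funext w
  have e1 : ∫ U, Ψ (U, w) * pd X (U, w) = ∫ U in b.region, Ψ (U, w) * pd X (U, w) := by
    rw [← integral_indicator b.measurableSet_region]
    congr 1
    funext U
    by_cases hU : U ∈ b.region
    · rw [Set.indicator_of_mem hU]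
    · rw [Set.indicator_of_notMem hU, hΨ, extendZero_of_notMem b ψ hU, zero_mul]
  rw [e1, b.integral_region hκ]
  congr 1
  funext u
  have e2 : HasDerivAt (fun u => X (b.coordU κ u, w)) (pd X (b.coordU κ u, w) * exp (b.sgn * κ * u)) u :=
    (((hXT.1.differentiable w (b.coordU κ u)).hasDerivAt).comp u (b.hasDerivAt_coordU hκ u))
  have e3 : (fun u => X (b.coordU κ u, w)) = fun u => χ (u, w) := by
    funext u
    rw [hX, extendZero_coordU hκ]
  rw [e3] at e2
  have e4 : pd χ (u, w) = pd X (b.coordU κ u, w) * exp (b.sgn * κ * u) := e2.deriv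
  rw [e4, hΨ, extendZero_coordU hκ]
  ring

end extendZero

lemma sigmaH_eq_sigmaB {κ : ℝ} (hκ : 0 < κ) (r : ℝ) (b : Half) (ψ χ : SH) (Ψ X : SB)
    (hΨ : (Ψ : ℝ × S2 → ℝ) = extendZero κ b ψ) (hX : (X : ℝ × S2 → ℝ) = extendZero κ b χ) :
    sigmaH r ψ χ = sigmaB r Ψ X := by
  have t1 := tame_of_mem_SH ψ.2
  have t2 := tame_of_mem_SH χ.2
  have t3 := tame_of_mem_SB Ψ.2
  have t4 := tame_of_mem_SB X.2
  change r ^ 2 * ∫ p, ((ψ : ℝ × S2 → ℝ) p * pd χ p - (χ : ℝ × S2 → ℝ) p * pd ψ p) ∂cylMeasure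
    = r ^ 2 * ∫ p, ((Ψ : ℝ × S2 → ℝ) p * pd X p - (X : ℝ × S2 → ℝ) p * pd Ψ p) ∂cylMeasure
  rw [integral_sub (t1.integrable t2) (t2.integrable t1),
    integral_sub (t3.integrable t4) (t4.integrable t3),
    integral_mul_pd_extendZero hκ t1 t2 t3 t4 hΨ hX,
    integral_mul_pd_extendZero hκ t2 t1 t4 t3 hX hΨ]

/-! ### Uniqueness of Fourier transforms on the cylinder -/

lemma measurableEmbedding_cyl :
    MeasurableEmbedding (fun p : ℝ × S2 => ((p.1, (p.2 : E3)) : ℝ × E3)) :=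
  MeasurableEmbedding.id.prodMap (MeasurableEmbedding.subtype_coe Metric.isClosed_sphere.measurableSet)

lemma norm_exp_I_mul (x : ℝ) : ‖Complex.exp (Complex.I * x)‖ = 1 := by
  rw [mul_comm, Complex.norm_exp_ofReal_mul_I]

/-- The plane wave with frequencies `c` and `l`. -/
def planeWave (c : ℝ) (l : E3 →L[ℝ] ℝ) (p : ℝ × S2) : ℂ :=
  Complex.exp (Complex.I * ((c * p.1 + l p.2 : ℝ) : ℂ))

lemma continuous_planeWave (c : ℝ) (l : E3 →L[ℝ] ℝ) : Continuous (planeWave c l) := by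
  unfold planeWave
  fun_prop

lemma integrable_planeWave {F : ℝ × S2 → ℂ} (hF : Integrable F cylMeasure) (c : ℝ)
    (l : E3 →L[ℝ] ℝ) : Integrable (fun p => planeWave c l p * F p) cylMeasure :=
  hF.bdd_mul (c := 1) (continuous_planeWave c l).aestronglyMeasurable
    (Eventually.of_forall fun _ => (norm_exp_I_mul _).le)

/-- The positive and negative parts of `f` are densities of finite measures. Pushed forward to `ℝ ×
ℝ³`, these have the same characteristic function by hypothesis, hence they are equal. -/
lemma ae_eq_zero_of_planeWave_real {f : ℝ × S2 → ℝ} (hf : Integrable f cylMeasure)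
    (h : ∀ (c : ℝ) (l : E3 →L[ℝ] ℝ), ∫ p, planeWave c l p * (f p : ℂ) ∂cylMeasure = 0) :
    f =ᵐ[cylMeasure] 0 := by
  let ρ : (ℝ × S2 → ℝ) → Measure (ℝ × S2) := fun g =>
    cylMeasure.withDensity fun p => ENNReal.ofReal (g p)
  let e : ℝ × S2 → ℝ × E3 := fun p => (p.1, (p.2 : E3))
  have he : MeasurableEmbedding e := measurableEmbedding_cyl
  have fin : ∀ g : ℝ × S2 → ℝ, Integrable g cylMeasure →
      ∫⁻ p, ENNReal.ofReal (g p) ∂cylMeasure ≠ ∞ := fun g hg =>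
    (lt_of_le_of_lt (lintegral_mono fun p => Real.ofReal_le_enorm _) hg.2).ne
  have hfin : ∀ g : ℝ × S2 → ℝ, Integrable g cylMeasure → IsFiniteMeasure (ρ g) := fun g hg =>
    isFiniteMeasure_withDensity (fin g hg)
  have i1 := hfin f hf
  have i2 := hfin (-f) hf.neg
  have hm := hf.aestronglyMeasurable.aemeasurable
  have hchar : ∀ (g : ℝ × S2 → ℝ), Integrable g cylMeasure → ∀ L : StrongDual ℝ (ℝ × E3),
      charFunDual ((ρ g).map e) L = ∫ p, planeWave (L (1, 0))
        (L.comp (ContinuousLinearMap.inr ℝ ℝ E3)) p * ((max (g p) 0 : ℝ) : ℂ) ∂cylMeasure := by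
    intro g hg L
    rw [charFunDual_apply, he.integral_map, integral_withDensity_eq_integral_toReal_smul₀
      hg.aestronglyMeasurable.aemeasurable.ennreal_ofReal
      (Eventually.of_forall fun _ => ENNReal.ofReal_lt_top)]
    refine integral_congr_ae (Eventually.of_forall fun p => ?_)
    simp only [ENNReal.toReal_ofReal']
    rw [Complex.real_smul, mul_comm, planeWave]
    congr 2
    have : e p = p.1 • ((1, 0) : ℝ × E3) + ContinuousLinearMap.inr ℝ ℝ E3 p.2 := by
      ext <;> simp [e]
    rw [this, map_add, map_smul, smul_eq_mul, mul_comm p.1, mul_comm]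
    rfl
  have heq : (ρ f).map e = (ρ (-f)).map e := by
    have j1 : IsFiniteMeasure ((ρ f).map e) := Measure.isFiniteMeasure_map _ _
    have j2 : IsFiniteMeasure ((ρ (-f)).map e) := Measure.isFiniteMeasure_map _ _
    refine Measure.ext_of_charFunDual (funext fun L => ?_)
    have q1 : Integrable (fun p => ((max (f p) 0 : ℝ) : ℂ)) cylMeasure := hf.pos_part.ofReal
    have q2 : Integrable (fun p => ((max ((-f) p) 0 : ℝ) : ℂ)) cylMeasure := hf.neg.pos_part.ofReal
    rw [hchar f hf, hchar (-f) hf.neg, ← sub_eq_zero, ← integral_sub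
      (integrable_planeWave q1 _ _) (integrable_planeWave q2 _ _)]
    refine (integral_congr_ae (Eventually.of_forall fun p => ?_)).trans
      (h (L (1, 0)) (L.comp (ContinuousLinearMap.inr ℝ ℝ E3)))
    simp only [← mul_sub, ← Complex.ofReal_sub, Pi.neg_apply]
    rw [max_zero_sub_max_neg_zero_eq_self]
  have heq2 : ρ f = ρ (-f) := by
    rw [← he.comap_map (ρ f), ← he.comap_map (ρ (-f)), heq]
  -- Equality of the positive and negative parts forces both to vanish, as at most one is nonzero at
  -- each point.
  have hae := (withDensity_eq_iff hm.ennreal_ofReal hm.neg.ennreal_ofReal (fin f hf)).1 heq2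
  filter_upwards [hae] with p hp
  rcases le_total 0 (f p) with h0 | h0
  · rw [Pi.neg_apply, ENNReal.ofReal_of_nonpos (by linarith : -f p ≤ 0), ENNReal.ofReal_eq_zero] at hp
    exact le_antisymm hp h0
  · rw [Pi.neg_apply, ENNReal.ofReal_of_nonpos h0, eq_comm, ENNReal.ofReal_eq_zero] at hp
    exact le_antisymm h0 (by simpa using hp)

lemma ae_eq_zero_of_planeWave {F : ℝ × S2 → ℂ} (hF : Integrable F cylMeasure)
    (h : ∀ (c : ℝ) (l : E3 →L[ℝ] ℝ), ∫ p, planeWave c l p * F p ∂cylMeasure = 0) :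
    F =ᵐ[cylMeasure] 0 := by
  have hc : ∀ (c : ℝ) (l : E3 →L[ℝ] ℝ), ∫ p, planeWave c l p * conj (F p) ∂cylMeasure = 0 := by
    intro c l
    have h1 := congrArg conj (h (-c) (-l))
    rw [map_zero, ← integral_conj] at h1
    refine (integral_congr_ae (Eventually.of_forall fun p => ?_)).trans h1
    simp only [map_mul, planeWave, ← Complex.exp_conj, Complex.conj_I, Complex.conj_ofReal]
    congr 2
    push_cast
    simp
    ring
  have iF := hF
  have iC : Integrable (fun p => conj (F p)) cylMeasure :=
    (LinearIsometryEquiv.integrable_comp_iff Complex.conjLIE).2 hF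
  have h1 : (fun p => (F p).re) =ᵐ[cylMeasure] 0 := by
    refine ae_eq_zero_of_planeWave_real hF.re fun c l => ?_
    have e : ∀ p, planeWave c l p * ((F p).re : ℂ)
        = (1 / 2 : ℂ) * (planeWave c l p * F p + planeWave c l p * conj (F p)) := fun p => by
      rw [← mul_add, Complex.add_conj]; push_cast; ring
    simp only [e]
    rw [integral_const_mul, integral_add (integrable_planeWave iF c l) (integrable_planeWave iC c l),
      h, hc, add_zero, mul_zero]
  have h2 : (fun p => (F p).im) =ᵐ[cylMeasure] 0 := by
    refine ae_eq_zero_of_planeWave_real hF.im fun c l => ?_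
    have e : ∀ p, planeWave c l p * ((F p).im : ℂ)
        = (1 / (2 * Complex.I) : ℂ) * (planeWave c l p * F p - planeWave c l p * conj (F p)) :=
      fun p => by
        rw [← mul_sub, Complex.sub_conj]
        have := Complex.I_ne_zero
        push_cast
        field_simp
    simp only [e]
    rw [integral_const_mul, integral_sub (integrable_planeWave iF c l) (integrable_planeWave iC c l),
      h, hc, sub_zero, mul_zero]
  filter_upwards [h1, h2] with p a b
  exact Complex.ext a b

/-! ### Gaussian test functions -/

/-- Smooth functions on the sphere with values in `[-1, 1]`. -/
def IsAngular (s : S2 → ℝ) : Prop :=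
  ContMDiff (𝓡 2) 𝓘(ℝ, ℝ) ((⊤ : ℕ∞) : WithTop ℕ∞) s ∧ ∀ w, |s w| ≤ 1

lemma isAngular_one : IsAngular fun _ => 1 := ⟨contMDiff_const, fun _ => by simp⟩

lemma isAngular_cos (l : E3 →L[ℝ] ℝ) : IsAngular fun w => cos (l w) :=
  ⟨(contDiff_cos.comp l.contDiff).contMDiff.comp contMDiff_coe_sphere, fun _ => abs_cos_le_one _⟩

lemma isAngular_sin (l : E3 →L[ℝ] ℝ) : IsAngular fun w => sin (l w) :=
  ⟨(contDiff_sin.comp l.contDiff).contMDiff.comp contMDiff_coe_sphere, fun _ => abs_sin_le_one _⟩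

/-- The Gaussian of inverse width `a` with angular profile `s`. -/
def gaussFun (a : ℝ) (s : S2 → ℝ) (p : ℝ × S2) : ℝ := exp (-(a * p.1) ^ 2 / 2) * s p.2

lemma smooth_gaussFun (a : ℝ) {s : S2 → ℝ} (hs : IsAngular s) : Smooth (gaussFun a s) := by
  have h1 : ContDiff ℝ ((⊤ : ℕ∞) : WithTop ℕ∞) fun x : ℝ => exp (-(a * x) ^ 2 / 2) := by fun_prop
  exact (h1.contMDiff.comp contMDiff_fst).mul (hs.1.comp contMDiff_snd)

lemma pd_gaussFun (a : ℝ) (s : S2 → ℝ) (p : ℝ × S2) :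
    pd (gaussFun a s) p = -(a ^ 2 * p.1) * gaussFun a s p := by
  have h : HasDerivAt (fun x : ℝ => -(a * x) ^ 2 / 2) (-(a ^ 2 * p.1)) p.1 := by
    have := ((((hasDerivAt_id p.1).const_mul a).pow 2).neg).div_const 2
    refine this.congr_deriv ?_
    simp
    ring
  have h2 := (h.exp.mul_const (s p.2)).deriv
  refine h2.trans ?_
  rw [gaussFun]
  ring

lemma gaussFun_mem_SH {a : ℝ} (ha : 0 < a) {s : S2 → ℝ} (hs : IsAngular s) :
    gaussFun a s ∈ SH := by
  -- Completing the square gives `-a²x²/2 ≤ 2/a² - 2|x|`. One factor `e^{-|x|}` is the required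
  -- decay; the other absorbs the factor `|x|` of the derivative.
  let C := exp (2 / a ^ 2)
  have hC : 0 < C := exp_pos _
  refine ⟨smooth_gaussFun a hs, C * (1 + a ^ 2) + 1, by positivity, 2, by norm_num, fun x w _ => ?_⟩
  have hx := abs_nonneg x
  have e1 : exp (-(a * x) ^ 2 / 2) ≤ C * exp (-(2 * |x|)) := by
    simp only [C]
    rw [← exp_add, exp_le_exp, ← sub_nonneg]
    have : 2 / a ^ 2 + -(2 * |x|) - -(a * x) ^ 2 / 2 = (a ^ 2 * |x| - 2) ^ 2 / (2 * a ^ 2) := by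
      field_simp
      rw [show (a ^ 2 * |x| - 2) ^ 2 = a ^ 4 * |x| ^ 2 - 4 * a ^ 2 * |x| + 4 by ring, sq_abs]
      ring
    rw [this]
    positivity
  have e2 : exp (-(2 * |x|)) = exp (-|x|) * exp (-|x|) := by rw [← exp_add]; ring_nf
  have e3 : exp (-|x|) ≤ 1 := exp_le_one_iff.2 (by linarith)
  have e4 : |x| * exp (-|x|) ≤ 1 := by
    have := add_one_le_exp |x|
    rw [exp_neg, ← div_eq_mul_inv, div_le_one (exp_pos _)]
    linarith
  have ep := exp_pos (-|x|)
  have g : |gaussFun a s (x, w)| ≤ C * (exp (-|x|) * exp (-|x|)) := by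
    rw [gaussFun, abs_mul, abs_exp, ← e2]
    calc _ ≤ exp (-(a * x) ^ 2 / 2) * 1 := mul_le_mul_of_nonneg_left (hs.2 w) (exp_pos _).le
      _ ≤ _ := by rw [mul_one]; exact e1
  have hCp := mul_pos hC ep
  constructor
  · have : C * (exp (-|x|) * exp (-|x|)) ≤ C * exp (-|x|) := by nlinarith
    have h2 : 0 ≤ C * a ^ 2 * exp (-|x|) := by positivity
    nlinarith
  · rw [pd_gaussFun, abs_mul, abs_neg, abs_mul, abs_of_pos (by positivity : 0 < a ^ 2)]
    have h1 : a ^ 2 * |x| * |gaussFun a s (x, w)|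
        ≤ a ^ 2 * |x| * (C * (exp (-|x|) * exp (-|x|))) :=
      mul_le_mul_of_nonneg_left g (by positivity)
    have h2 : a ^ 2 * |x| * (C * (exp (-|x|) * exp (-|x|)))
        = a ^ 2 * C * exp (-|x|) * (|x| * exp (-|x|)) := by ring
    have h3 : a ^ 2 * C * exp (-|x|) * (|x| * exp (-|x|)) ≤ a ^ 2 * C * exp (-|x|) * 1 :=
      mul_le_mul_of_nonneg_left e4 (by positivity)
    nlinarith

lemma mem_SB_of_mem_SH {ψ : ℝ × S2 → ℝ} (h : ψ ∈ SH) {c : ℝ} (h0 : ∀ w, ψ (0, w) = c) :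
    ψ ∈ SB := by
  obtain ⟨hs, C, hC, C', hC', hd⟩ := h
  refine ⟨hs, ⟨-c, fun w => by rw [h0, add_neg_cancel]⟩, 2 * C, by positivity, C', hC',
    fun x w hx => ?_⟩
  obtain ⟨h1, h2⟩ := hd x w hx
  have hx0 : 0 < |x| := by linarith
  have h3 := quadratic_le_exp_of_nonneg hx0.le
  have e1 : exp (-|x|) ≤ 2 * (1 / |x|) := by
    rw [exp_neg, ← one_div, mul_one_div, div_le_div_iff₀ (exp_pos _) hx0]
    nlinarith
  have e2 : exp (-|x|) ≤ 2 * (1 / x ^ 2) := by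
    rw [← sq_abs x, exp_neg, ← one_div, mul_one_div, div_le_div_iff₀ (exp_pos _) (by positivity)]
    nlinarith
  have m1 := mul_le_mul_of_nonneg_left e1 hC.le
  have m2 := mul_le_mul_of_nonneg_left e2 hC.le
  simp only at h1 h2 ⊢
  constructor <;> linarith

lemma FP_gaussFun_one {s : S2 → ℝ} (hs : IsAngular s) {p : ℝ × S2} (hp : p.1 ≠ 0) :
    FP (gaussFun 1 s) p = ((exp (-p.1 ^ 2 / 2) * s p.2 : ℝ) : ℂ) := by
  have hb : 0 < ((1 / 2 : ℝ) : ℂ).re := by norm_num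
  have e : ∀ u : ℝ, ((gaussFun 1 s (u, p.2) : ℝ) : ℂ)
      = (s p.2 : ℂ) * Complex.exp (-((1 / 2 : ℝ) : ℂ) * u ^ 2) := by
    intro u
    rw [gaussFun]
    push_cast
    rw [mul_comm]
    congr 2
    ring
  have hi : Integrable fun u : ℝ => ((gaussFun 1 s (u, p.2) : ℝ) : ℂ) := by
    simp only [e]
    have := integrable_cexp_quadratic hb 0 0
    simp only [zero_mul, add_zero] at this
    exact this.const_mul _
  rw [(reg_of_mem_SH (gaussFun_mem_SH one_pos hs)).FP_eq_fourierU hp hi, fourierU]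
  simp only [e, mul_left_comm _ (s p.2 : ℂ)]
  rw [integral_const_mul, fourierIntegral_gaussian hb]
  have e1 : ((π : ℂ) / ((1 / 2 : ℝ) : ℂ)) ^ (1 / 2 : ℂ) = ((√(2 * π) : ℝ) : ℂ) := by
    rw [Real.sqrt_eq_rpow, Complex.ofReal_cpow (by positivity)]
    push_cast
    congr 1
    ring
  have h0 : ((√(2 * π) : ℝ) : ℂ) ≠ 0 := by
    have : 0 < √(2 * π) := by positivity
    exact_mod_cast this.ne'
  rw [e1, mul_left_comm (s p.2 : ℂ), inv_mul_cancel_left₀ h0]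
  push_cast
  rw [mul_comm]
  congr 2
  ring

lemma FP_gaussFun {a : ℝ} (ha : 0 < a) {s : S2 → ℝ} (hs : IsAngular s) {p : ℝ × S2}
    (hp : p.1 ≠ 0) :
    FP (gaussFun a s) p = ((a⁻¹ * exp (-(p.1 / a) ^ 2 / 2) * s p.2 : ℝ) : ℂ) := by
  have e : gaussFun a s = fun p => gaussFun 1 s (a * p.1, p.2) := by
    funext p
    simp [gaussFun]
  rw [e, Reg.FP_comp_mul ha, FP_gaussFun_one hs (div_ne_zero hp ha.ne')]
  push_cast
  ring

/-- Only the zero function is orthogonal to the translates of all Gaussians. -/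
lemma ae_eq_zero_of_gaussFun {Φ : ℝ × S2 → ℂ}
    (hΦ : Integrable (fun p => (exp (-p.1 ^ 2 / 2) : ℂ) * Φ p) cylMeasure)
    (h : ∀ (c : ℝ) (s : S2 → ℝ), IsAngular s →
      ∫ p, conj (FP (fun p => gaussFun 1 s (p.1 + c, p.2)) p) * Φ p ∂cylMeasure = 0) :
    Φ =ᵐ[cylMeasure] 0 := by
  have h1 : ∀ (c : ℝ) (s : S2 → ℝ), IsAngular s →
      ∫ p, Complex.exp (Complex.I * ((c * p.1 : ℝ) : ℂ)) * ((s p.2 : ℂ) *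
        ((exp (-p.1 ^ 2 / 2) : ℂ) * Φ p)) ∂cylMeasure = 0 := by
    intro c s hs
    rw [← h c s hs]
    refine integral_congr_ae ?_
    filter_upwards [Reg.ae_fst_ne_zero] with p hp
    rw [Reg.FP_comp_add, FP_gaussFun_one hs hp, map_mul, ← Complex.exp_conj, Complex.conj_ofReal]
    simp only [map_neg, map_mul, Complex.conj_I, Complex.conj_ofReal]
    have : Complex.I * ((c * p.1 : ℝ) : ℂ) = -(-Complex.I * p.1 * c) := by push_cast; ring
    rw [this]
    push_cast
    ring
  have h2 := ae_eq_zero_of_planeWave hΦ fun c l => by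
    have i : ∀ s : S2 → ℝ, IsAngular s → Integrable (fun p : ℝ × S2 =>
        Complex.exp (Complex.I * ((c * p.1 : ℝ) : ℂ)) * ((s p.2 : ℂ) *
        ((exp (-p.1 ^ 2 / 2) : ℂ) * Φ p))) cylMeasure := by
      intro s hs
      refine Integrable.bdd_mul (c := 1) ?_ (by fun_prop)
        (Eventually.of_forall fun _ => (norm_exp_I_mul _).le)
      refine hΦ.bdd_mul (c := 1) ?_ (Eventually.of_forall fun p => ?_)
      · exact (Complex.continuous_ofReal.comp (hs.1.continuous.comp continuous_snd)).aestronglyMeasurable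
      · rw [Complex.norm_real]
        exact hs.2 p.2
    have h3 := h1 c _ (isAngular_cos l)
    have h4 := h1 c _ (isAngular_sin l)
    -- The angular part of a plane wave is complex; its cosine and sine are the real profiles for
    -- which the hypothesis is available.
    have e : ∀ p : ℝ × S2, planeWave c l p * ((exp (-p.1 ^ 2 / 2) : ℂ) * Φ p)
        = Complex.exp (Complex.I * ((c * p.1 : ℝ) : ℂ)) * (((cos (l p.2) : ℝ) : ℂ) *
          ((exp (-p.1 ^ 2 / 2) : ℂ) * Φ p)) + Complex.I *
          (Complex.exp (Complex.I * ((c * p.1 : ℝ) : ℂ)) * (((sin (l p.2) : ℝ) : ℂ) *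
          ((exp (-p.1 ^ 2 / 2) : ℂ) * Φ p))) := by
      intro p
      have : Complex.exp (Complex.I * ((l p.2 : ℝ) : ℂ)) = (cos (l p.2) : ℝ) + (sin (l p.2) : ℝ) * Complex.I := by
        rw [mul_comm, Complex.exp_mul_I]
        push_cast
        rfl
      rw [planeWave, Complex.ofReal_add, mul_add, Complex.exp_add, this]
      ring
    simp only [e]
    rw [integral_add (i _ (isAngular_cos l)) ((i _ (isAngular_sin l)).const_mul _),
      integral_const_mul, h3, h4, mul_zero, add_zero]
  filter_upwards [h2] with p hp
  have : (exp (-p.1 ^ 2 / 2) : ℂ) ≠ 0 := by exact_mod_cast (exp_pos _).ne'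
  exact (mul_eq_zero.1 hp).resolve_left this

/-! ### Density of the one-particle maps -/

lemma inner_toLp {α : Type*} [MeasurableSpace α] {μ : Measure α} {f g : α → ℂ}
    (hf : MemLp f 2 μ) (hg : MemLp g 2 μ) :
    inner ℂ (hf.toLp f) (hg.toLp g) = ∫ x, conj (f x) * g x ∂μ := by
  rw [L2.inner_def]
  refine integral_congr_ae ?_
  filter_upwards [hf.coeFn_toLp, hg.coeFn_toLp] with x h1 h2
  rw [h1, h2, RCLike.inner_apply, mul_comm]

lemma norm_integral_conj_mul_le {α : Type*} [MeasurableSpace α] {μ : Measure α} {f g : α → ℂ}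
    (hf : MemLp f 2 μ) (hg : MemLp g 2 μ) :
    ‖∫ x, conj (f x) * g x ∂μ‖ ≤ (eLpNorm f 2 μ).toReal * (eLpNorm g 2 μ).toReal := by
  rw [← inner_toLp hf hg, ← Lp.norm_toLp f hf, ← Lp.norm_toLp g hg]
  exact norm_inner_le_norm _ _

/-- An `L²`-bounded sequence tending uniformly to zero tends weakly to zero. -/
lemma tendsto_integral_conj_mul_zero {α : Type*} [MeasurableSpace α] {μ : Measure α}
    {v : ℕ → α → ℂ} (hv : ∀ n, MemLp (v n) 2 μ) {N : ℝ≥0∞} (hN : N ≠ ∞)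
    (hvN : ∀ n, eLpNorm (v n) 2 μ ≤ N) (hb : ∀ n, ∀ᵐ x ∂μ, ‖v n x‖ ≤ 1 / ((n : ℝ) + 1))
    {h : α → ℂ} (hh : MemLp h 2 μ) :
    Tendsto (fun n => ∫ x, conj (v n x) * h x ∂μ) atTop (𝓝 0) := by
  rw [Metric.tendsto_atTop]
  intro ε hε
  have hN1 : 0 < N.toReal + 1 := by positivity
  -- The uniform bound is effective only against integrable functions. So `h` is replaced by a
  -- simple function, and Cauchy-Schwarz with the bound `N` handles the error.
  obtain ⟨g, hg, hg2⟩ := hh.exists_simpleFunc_eLpNorm_sub_lt (p := 2) ENNReal.ofNat_ne_top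
    (ε := ENNReal.ofReal (ε / 2 / (N.toReal + 1))) (by simp; positivity)
  have hgi : Integrable g μ := (SimpleFunc.memLp_iff_integrable (by norm_num) ENNReal.ofNat_ne_top).1 hg2
  have hd : MemLp (h - ⇑g) 2 μ := hh.sub hg2
  have hlim : Tendsto (fun n : ℕ => 1 / ((n : ℝ) + 1) * ∫ x, ‖g x‖ ∂μ) atTop (𝓝 0) := by
    simpa using tendsto_one_div_add_atTop_nhds_zero_nat.mul_const (∫ x, ‖g x‖ ∂μ)
  obtain ⟨n₀, hn₀⟩ := (Metric.tendsto_atTop.1 hlim) (ε / 2) (by positivity)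
  refine ⟨n₀, fun n hn => ?_⟩
  have e : ∫ x, conj (v n x) * h x ∂μ
      = (∫ x, conj (v n x) * (h - ⇑g) x ∂μ) + ∫ x, conj (v n x) * g x ∂μ := by
    rw [← integral_add (integrable_conj_mul (hv n) hd) (integrable_conj_mul (hv n) hg2)]
    congr 1
    funext x
    simp only [Pi.sub_apply]
    ring
  have b1 : ‖∫ x, conj (v n x) * (h - ⇑g) x ∂μ‖ ≤ ε / 2 := by
    refine (norm_integral_conj_mul_le (hv n) hd).trans ?_
    have h1 : (eLpNorm (v n) 2 μ).toReal ≤ N.toReal + 1 :=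
      (ENNReal.toReal_mono hN (hvN n)).trans (by linarith)
    have h2 : (eLpNorm (h - ⇑g) 2 μ).toReal ≤ ε / 2 / (N.toReal + 1) := by
      refine (ENNReal.toReal_mono ENNReal.ofReal_ne_top hg.le).trans ?_
      rw [ENNReal.toReal_ofReal (by positivity)]
    refine (mul_le_mul h1 h2 ENNReal.toReal_nonneg hN1.le).trans (le_of_eq ?_)
    field_simp
  have b2 : ‖∫ x, conj (v n x) * g x ∂μ‖ ≤ 1 / ((n : ℝ) + 1) * ∫ x, ‖g x‖ ∂μ := by
    rw [← integral_const_mul]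
    refine norm_integral_le_of_norm_le (hgi.norm.const_mul _) ?_
    filter_upwards [hb n] with x hx
    rw [norm_mul, RCLike.norm_conj]
    exact mul_le_mul_of_nonneg_right hx (norm_nonneg _)
  have b3 := hn₀ n hn
  rw [dist_zero_right, Real.norm_eq_abs] at b3
  rw [dist_zero_right, e]
  have := norm_add_le (∫ x, conj (v n x) * (h - ⇑g) x ∂μ) (∫ x, conj (v n x) * g x ∂μ)
  have := le_abs_self (1 / ((n : ℝ) + 1) * ∫ x, ‖g x‖ ∂μ)
  linarith

lemma weightB_mul {l : ℝ} (hl : 0 < l) (k : ℝ) : weightB (l * k) = l * weightB k := by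
  unfold weightB
  simp only [mul_pos_iff_of_pos_left hl]
  split_ifs <;> ring

/-- Dilations preserve the vacuum norm. -/
lemma lintegral_weightB_dilate (r : ℝ) {ψ : ℝ × S2 → ℝ} (h : Reg ψ) {l : ℝ} (hl : 0 < l) :
    ∫⁻ p, ENNReal.ofReal (r ^ 2 * weightB p.1) * ‖FP (fun p => ψ (l * p.1, p.2)) p‖ₑ ^ 2 ∂cylMeasure
      = ∫⁻ p, ENNReal.ofReal (r ^ 2 * weightB p.1) * ‖FP ψ p‖ₑ ^ 2 ∂cylMeasure := by
  have hm := isWeight_weightB.meas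
  have hF := h.sm_FP.measurable
  simp only [Reg.FP_comp_mul hl]
  rw [lintegral_prod_symm _ (by fun_prop), lintegral_prod_symm _ (by fun_prop)]
  refine lintegral_congr fun w => ?_
  have hs : (fun k : ℝ => l * k) '' Set.univ = Set.univ := by
    rw [Set.image_univ]
    exact (mul_left_surjective₀ hl.ne').range_eq
  have e := lintegral_image_eq_lintegral_abs_deriv_mul MeasurableSet.univ
    (f := fun k : ℝ => l * k) (f' := fun _ => l)
    (fun k _ => (((hasDerivAt_id k).const_mul l).congr_deriv (mul_one l)).hasDerivWithinAt)
    (fun y _ z _ h => mul_left_cancel₀ hl.ne' h)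
    (fun k => ENNReal.ofReal (r ^ 2 * weightB k) * ‖(l : ℂ)⁻¹ * FP ψ (k / l, w)‖ₑ ^ 2)
  rw [hs, Measure.restrict_univ] at e
  rw [e]
  refine lintegral_congr fun k => ?_
  have e1 : ‖(l : ℂ)⁻¹‖ₑ = ENNReal.ofReal l⁻¹ := by
    rw [← ofReal_norm, ← Complex.ofReal_inv, Complex.norm_real, Real.norm_of_nonneg (by positivity)]
  rw [mul_div_cancel_left₀ _ hl.ne', weightB_mul hl, enorm_mul, mul_pow, e1,
    abs_of_pos hl, ← ENNReal.ofReal_pow (by positivity), ← mul_assoc, ← mul_assoc,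
    ← ENNReal.ofReal_mul hl.le, ← ENNReal.ofReal_mul (mul_nonneg hl.le (mul_nonneg (sq_nonneg r)
      (mul_nonneg hl.le (isWeight_weightB.nonneg k))))]
  congr 2
  field_simp

section density

variable {S : Submodule ℝ (ℝ × S2 → ℝ)} {ν : Measure (ℝ × S2)} {r : ℝ} {w : ℝ → ℝ}
  (hS : ∀ ψ ∈ S, Reg ψ) (hF : ∀ ψ ∈ S, MemLp (FP ψ) 2 ν)

lemma inner_Kmap_left (hw : IsWeight w) (hν : ν = cylWeight r w) (ψ : S) (h : Lp ℂ 2 ν) :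
    inner ℂ (Kmap hS hF ψ) h
      = (r ^ 2 : ℝ) * ∫ p, conj (FP ψ p) * ((w p.1 : ℂ) * h p) ∂cylMeasure := by
  have e := integral_cylWeight hw r (fun p => conj (FP ψ p) * h p)
  simp only [mul_left_comm (w _ : ℂ)] at e
  rw [← e, ← hν, L2.inner_def]
  refine integral_congr_ae ?_
  filter_upwards [coeFn_Kmap hS hF ψ] with p h1
  rw [h1, RCLike.inner_apply, mul_comm]

lemma integrable_conj_mul_weight (hw : IsWeight w) (hr : r ≠ 0) {u v : ℝ × S2 → ℂ}
    (hu : MemLp u 2 (cylWeight r w)) (hv : MemLp v 2 (cylWeight r w)) :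
    Integrable (fun p => conj (u p) * ((w p.1 : ℂ) * v p)) cylMeasure := by
  have h := integrable_conj_mul hu hv
  have hm := hw.meas
  rw [cylWeight, integrable_withDensity_iff_integrable_smul' (by fun_prop)
    (Eventually.of_forall fun _ => ENNReal.ofReal_lt_top)] at h
  have h2 := h.const_mul ((r ^ 2 : ℝ) : ℂ)⁻¹
  refine h2.congr (Eventually.of_forall fun p => ?_)
  simp only [ENNReal.toReal_ofReal (mul_nonneg (sq_nonneg r) (hw.nonneg p.1))]
  have : ((r ^ 2 : ℝ) : ℂ) ≠ 0 := by exact_mod_cast pow_ne_zero 2 hr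
  rw [Complex.real_smul, Complex.ofReal_mul]
  field_simp

lemma reg_gaussFun {a : ℝ} (ha : 0 < a) {s : S2 → ℝ} (hs : IsAngular s) : Reg (gaussFun a s) :=
  reg_of_mem_SH (gaussFun_mem_SH ha hs)

lemma integrable_gauss_mul (hw : IsWeight w) (hr : r ≠ 0) {h : ℝ × S2 → ℂ}
    (hh : MemLp h 2 (cylWeight r w)) :
    Integrable (fun p => (exp (-p.1 ^ 2 / 2) : ℂ) * ((w p.1 : ℂ) * h p)) cylMeasure := by
  have h1 := integrable_conj_mul_weight hw hr
    ((reg_gaussFun one_pos isAngular_one).memLp_cylWeight hw rfl) hh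
  refine h1.congr ?_
  filter_upwards [Reg.ae_fst_ne_zero] with p hp
  rw [FP_gaussFun_one isAngular_one hp, Complex.conj_ofReal, mul_one]

/-- The translate of a Gaussian, as an element of `S(H)`. -/
def gaussSH (c : ℝ) {s : S2 → ℝ} (hs : IsAngular s) : SH :=
  translateH c ⟨gaussFun 1 s, gaussFun_mem_SH one_pos hs⟩

/-- Orthogonality to all translated Gaussians makes the weighted function vanish by uniqueness of
the Fourier transform, and the weight has no zero off `k = 0`. -/
lemma dense_span_Kmap_SH {hS : ∀ ψ ∈ SH, Reg ψ} {hF : ∀ ψ ∈ SH, MemLp (FP ψ) 2 ν}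
    (hw : IsWeight w) (hw0 : ∀ k, k ≠ 0 → w k ≠ 0) (hr : r ≠ 0) (hν : ν = cylWeight r w) :
    Dense (Submodule.span ℂ (Set.range (Kmap hS hF)) : Set (Lp ℂ 2 ν)) := by
  rw [Submodule.dense_iff_topologicalClosure_eq_top, Submodule.topologicalClosure_eq_top_iff,
    Submodule.eq_bot_iff]
  intro h hh
  have h0 : ∀ ψ : SH, inner ℂ (Kmap hS hF ψ) h = 0 := fun ψ =>
    (Submodule.mem_orthogonal _ _).1 hh _ (Submodule.subset_span ⟨ψ, rfl⟩)
  have hm : MemLp h 2 (cylWeight r w) := hν ▸ Lp.memLp h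
  have hr2 : ((r ^ 2 : ℝ) : ℂ) ≠ 0 := by exact_mod_cast pow_ne_zero 2 hr
  have key := ae_eq_zero_of_gaussFun (integrable_gauss_mul hw hr hm) fun c s hs => by
    have := h0 (gaussSH c hs)
    rw [inner_Kmap_left hS hF hw hν] at this
    exact (mul_eq_zero.1 this).resolve_left hr2
  rw [Lp.eq_zero_iff_ae_eq_zero]
  have hac : ν ≪ cylMeasure := by rw [hν]; exact cylWeight_ac r w
  filter_upwards [hac.ae_le key, hac.ae_le Reg.ae_fst_ne_zero] with p h1 h2
  exact (mul_eq_zero.1 h1).resolve_left (by exact_mod_cast hw0 _ h2)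

/-- Real density, which is stronger than density of the complex span and is what purity needs.
Gaussians with an angular profile violate the constancy at `U = 0`; subtracting a narrow multiple
corrects this. Dilation invariance of the vacuum norm makes the correction bounded, and in the limit
weakly zero. A vector with vanishing real pairing against all Gaussians is then reflected to
negative frequencies, where uniqueness of the Fourier transform applies. -/
lemma dense_range_Kmap_SB {hS : ∀ ψ ∈ SB, Reg ψ} {hF : ∀ ψ ∈ SB, MemLp (FP ψ) 2 ν} (hr : r ≠ 0)
    (hν : ν = cylWeight r weightB) : Dense (Set.range (Kmap hS hF)) := by
  have hd : Dense (LinearMap.range (Kmap hS hF) : Set (Lp ℂ 2 ν)) := by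
    rw [Submodule.dense_iff_topologicalClosure_eq_top, Submodule.topologicalClosure_eq_top_iff,
      Submodule.eq_bot_iff]
    intro h hh
    have hw := isWeight_weightB
    have hm : MemLp h 2 (cylWeight r weightB) := hν ▸ Lp.memLp h
    let T : (ℝ × S2 → ℝ) → ℂ := fun ψ => ∫ p, conj (FP ψ p) * ((weightB p.1 : ℂ) * h p) ∂cylMeasure
    have hi : ∀ ψ, Reg ψ → Integrable (fun p => conj (FP ψ p) * ((weightB p.1 : ℂ) * h p)) cylMeasure :=
      fun ψ hψ => integrable_conj_mul_weight hw hr (hψ.memLp_cylWeight hw rfl) hm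
    have h0 : ∀ ψ, ψ ∈ SB → (T ψ).re = 0 := by
      intro ψ hψ
      have h1 := (Submodule.mem_orthogonal _ _).1 hh _ ⟨⟨ψ, hψ⟩, rfl⟩
      have h2 : (inner ℂ (Kmap hS hF ⟨ψ, hψ⟩) h).re = 0 := by
        rw [← h1, L2.inner_def, L2.inner_def]
        have := integral_re (𝕜 := ℂ) (L2.integrable_inner (𝕜 := ℂ) (Kmap hS hF ⟨ψ, hψ⟩) h)
        rw [RCLike.re_to_complex] at this
        rw [← this]
        rfl
      rw [inner_Kmap_left hS hF hw hν, Complex.re_ofReal_mul] at h2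
      exact (mul_eq_zero.1 h2).resolve_left (pow_ne_zero 2 hr)
    -- The factor `e^{-c²/2}` is the value of the translated Gaussian at `U = 0`, so the difference
    -- vanishes on the whole sphere there and lies in `S(B)`, for every inverse width `a`.
    have h1 : ∀ (c a : ℝ) (s : S2 → ℝ), 0 < a → IsAngular s →
        (T fun p => gaussFun 1 s (p.1 + c, p.2)).re = exp (-c ^ 2 / 2) * (T (gaussFun a s)).re := by
      intro c a s ha hs
      have m1 : (fun p => gaussFun 1 s (p.1 + c, p.2)) ∈ SH := (gaussSH c hs).2
      have m2 := SH.smul_mem (exp (-c ^ 2 / 2)) (gaussFun_mem_SH ha hs)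
      have m3 : (fun p => gaussFun 1 s (p.1 + c, p.2)) - exp (-c ^ 2 / 2) • gaussFun a s ∈ SB :=
        mem_SB_of_mem_SH (SH.sub_mem m1 m2) (c := 0) fun w => by simp [gaussFun]
      have h2 := h0 _ m3
      have e : T ((fun p => gaussFun 1 s (p.1 + c, p.2)) - exp (-c ^ 2 / 2) • gaussFun a s)
          = T (fun p => gaussFun 1 s (p.1 + c, p.2)) - (exp (-c ^ 2 / 2) : ℝ) * T (gaussFun a s) := by
        simp only [T]
        rw [← integral_const_mul, ← integral_sub (hi _ (reg_of_mem_SH m1))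
          ((hi _ (reg_gaussFun ha hs)).const_mul _)]
        congr 1
        funext p
        rw [(reg_of_mem_SH m1).FP_sub (reg_of_mem_SH m2), Reg.FP_smul, map_sub, map_mul,
          Complex.conj_ofReal]
        ring
      rw [e, Complex.sub_re, Complex.re_ofReal_mul] at h2
      linarith
    -- Weak convergence: the norms are independent of `n` by `lintegral_weightB_dilate`, and the
    -- transforms are bounded uniformly by `1/(n + 1)`.
    have h2 : ∀ s : S2 → ℝ, IsAngular s →
        Tendsto (fun n : ℕ => T (gaussFun ((n : ℝ) + 1) s)) atTop (𝓝 0) := by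
      intro s hs
      have hp : ∀ n : ℕ, 0 < (n : ℝ) + 1 := fun n => by positivity
      have hl := tendsto_integral_conj_mul_zero (v := fun n : ℕ => FP (gaussFun ((n : ℝ) + 1) s))
        (fun n => (reg_gaussFun (hp n) hs).memLp_cylWeight hw rfl)
        (N := eLpNorm (FP (gaussFun 1 s)) 2 (cylWeight r weightB))
        ((reg_gaussFun one_pos hs).memLp_cylWeight hw rfl).2.ne (fun n => le_of_eq ?_)
        (fun n => ?_) hm
      · have hl2 := hl.const_mul ((r ^ 2 : ℝ) : ℂ)⁻¹
        rw [mul_zero] at hl2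
        refine hl2.congr fun n => ?_
        have hr2 : ((r ^ 2 : ℝ) : ℂ) ≠ 0 := by exact_mod_cast pow_ne_zero 2 hr
        rw [integral_cylWeight hw, inv_mul_cancel_left₀ hr2]
        simp only [T, mul_left_comm (weightB _ : ℂ)]
      · have h3 := lintegral_weightB_dilate r (reg_gaussFun one_pos hs) (hp n)
        have e : (fun p : ℝ × S2 => gaussFun 1 s (((n : ℝ) + 1) * p.1, p.2))
            = gaussFun ((n : ℝ) + 1) s := by
          funext p
          simp [gaussFun]
        rw [e, ← lintegral_cylWeight hw.meas r ((reg_gaussFun (hp n) hs).sm_FP.measurable.enorm.pow_const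
          2).aemeasurable, ← lintegral_cylWeight hw.meas r ((reg_gaussFun one_pos
          hs).sm_FP.measurable.enorm.pow_const 2).aemeasurable, ← eLpNorm_two_sq,
          ← eLpNorm_two_sq] at h3
        exact (ENNReal.pow_right_strictMono two_ne_zero).injective h3
      · filter_upwards [(cylWeight_ac r weightB).ae_le Reg.ae_fst_ne_zero] with p hp0
        rw [FP_gaussFun (hp n) hs hp0, Complex.norm_real, norm_mul, norm_mul, one_div,
          Real.norm_of_nonneg (inv_pos.2 (hp n)).le, Real.norm_of_nonneg (exp_pos _).le]
        have e1 : exp (-(p.1 / ((n : ℝ) + 1)) ^ 2 / 2) ≤ 1 := exp_le_one_iff.2 (by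
          have := sq_nonneg (p.1 / ((n : ℝ) + 1))
          linarith)
        have e2 := hs.2 p.2
        rw [mul_assoc]
        refine mul_le_of_le_one_right (inv_pos.2 (hp n)).le ?_
        exact mul_le_one₀ e1 (norm_nonneg _) e2
    have h3 : ∀ (c : ℝ) (s : S2 → ℝ), IsAngular s →
        (T fun p => gaussFun 1 s (p.1 + c, p.2)).re = 0 := by
      intro c s hs
      have l1 := (Complex.continuous_re.tendsto 0).comp (h2 s hs)
      have l2 := l1.const_mul (exp (-c ^ 2 / 2))
      rw [Complex.zero_re, mul_zero] at l2
      refine tendsto_nhds_unique ?_ l2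
      refine tendsto_const_nhds.congr fun n => ?_
      exact h1 c _ s (by positivity) hs
    let Φ : ℝ × S2 → ℂ := fun p => (weightB p.1 : ℂ) * h p
    have hΦ := integrable_gauss_mul hw hr hm
    have hneg : ∀ {F : ℝ × S2 → ℂ}, Integrable F cylMeasure →
        Integrable (fun p => conj (F (-p.1, p.2))) cylMeasure := fun hF => by
      have := (measurePreserving_neg_fst.integrable_comp_emb measurableEmbedding_neg_fst).2 hF
      exact (LinearIsometryEquiv.integrable_comp_iff Complex.conjLIE).2 this
    -- Only the real part of the pairing is known to vanish. Adding the conjugate reflection of `Φ`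
    -- turns it into a full pairing over both signs of `k`.
    have key := ae_eq_zero_of_gaussFun (Φ := fun p => Φ p + conj (Φ (-p.1, p.2))) (by
        refine (hΦ.add (hneg hΦ)).congr (Eventually.of_forall fun p => ?_)
        simp only [Pi.add_apply, map_mul, mul_add, Φ, Complex.conj_ofReal]
        push_cast
        simp) fun c s hs => by
      have hg : Reg fun p => gaussFun 1 s (p.1 + c, p.2) := (reg_gaussFun one_pos hs).comp_add c
      have i1 := hi _ hg
      have e : ∫ p, conj (conj (FP (fun p => gaussFun 1 s (p.1 + c, p.2)) (-p.1, p.2)) * Φ (-p.1, p.2))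
          ∂cylMeasure = conj (T fun p => gaussFun 1 s (p.1 + c, p.2)) := by
        rw [integral_conj, measurePreserving_neg_fst.integral_comp measurableEmbedding_neg_fst
          (fun p => conj (FP (fun p => gaussFun 1 s (p.1 + c, p.2)) p) * Φ p)]
      have e2 := integral_add i1 (hneg i1)
      rw [e] at e2
      refine (integral_congr_ae (Eventually.of_forall fun p => ?_)).trans (e2.trans ?_)
      · simp only [Reg.FP_neg, map_mul, Complex.conj_conj, Φ, mul_add]
      · change T _ + conj (T _) = 0
        rw [Complex.add_conj, h3 c s hs]
        simp
    rw [Lp.eq_zero_iff_ae_eq_zero]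
    have hac : ν ≪ cylMeasure := by rw [hν]; exact cylWeight_ac r weightB
    have hpos : ∀ᵐ p ∂ν, 0 < p.1 := by
      rw [hν, cylWeight, ae_withDensity_iff (by have := hw.meas; fun_prop)]
      refine Eventually.of_forall fun p hp => ?_
      by_contra hn
      exact hp (by simp [weightB, hn])
    -- For `k > 0` the reflected term carries `weightB (-k) = 0`, so the reflection leaves the
    -- vector visible.
    filter_upwards [hac.ae_le key, hpos] with p h4 h5
    have h6 : weightB (-p.1) = 0 := if_neg (by linarith)
    have h7 : weightB p.1 ≠ 0 := by
      rw [weightB, if_pos h5]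
      positivity
    simp only [Φ, h6, Complex.ofReal_zero, zero_mul, map_zero, add_zero, Pi.zero_apply] at h4
    exact (mul_eq_zero.1 h4).resolve_left (by exact_mod_cast h7)
  exact hd

end density

/-! ### The two-point kernel -/

/-- The symbol `k₊ e^{-εk}` of the regularized two-point kernel. -/
def rampExp (ε k : ℝ) : ℝ := max k 0 * exp (-ε * k)

lemma continuous_rampExp (ε : ℝ) : Continuous (rampExp ε) := by
  unfold rampExp
  fun_prop

lemma rampExp_nonneg (ε k : ℝ) : 0 ≤ rampExp ε k :=
  mul_nonneg (le_max_right _ _) (exp_pos _).le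

lemma rampExp_of_nonpos (ε : ℝ) {k : ℝ} (hk : k ≤ 0) : rampExp ε k = 0 := by
  simp [rampExp, max_eq_right hk]

lemma two_mul_rampExp (ε k : ℝ) : 2 * rampExp ε k = weightB k * exp (-ε * k) := by
  unfold rampExp weightB
  split_ifs with h
  · rw [max_eq_left h.le, mul_assoc]
  · rw [max_eq_right (not_lt.1 h)]
    ring

lemma integrable_rampExp {ε : ℝ} (hε : 0 < ε) : Integrable (rampExp ε) := by
  have h0 : Integrable (rampExp ε) (volume.restrict (Set.Ioi 0)) := by
    refine ((exp_neg_integrableOn_Ioi 0 (half_pos hε)).const_mul (2 / ε)).mono'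
      (continuous_rampExp ε).aestronglyMeasurable ?_
    filter_upwards [ae_restrict_mem measurableSet_Ioi] with k hk
    have hk' : 0 < k := hk
    rw [Real.norm_of_nonneg (rampExp_nonneg _ _), rampExp, max_eq_left hk'.le]
    have e : exp (-ε * k) = exp (-(ε / 2) * k) * exp (-(ε / 2) * k) := by
      rw [← exp_add]
      ring_nf
    have h1 : ε / 2 * k ≤ exp (ε / 2 * k) := by linarith [add_one_le_exp (ε / 2 * k)]
    have h2 : ε / 2 * k * exp (-(ε / 2) * k) ≤ 1 := by
      rw [neg_mul, exp_neg, ← div_eq_mul_inv]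
      exact (div_le_one (exp_pos _)).2 h1
    have h3 : k * exp (-(ε / 2) * k) ≤ 2 / ε := by
      rw [le_div_iff₀ hε]
      linarith
    rw [e, ← mul_assoc]
    exact mul_le_mul_of_nonneg_right h3 (exp_pos _).le
  refine (integrableOn_iff_integrable_of_support_subset ?_).1 h0
  intro k hk
  by_contra h
  exact hk (rampExp_of_nonpos ε (not_lt.1 h))

/-- The Laplace integral of `k e^{-ak}` over `k > 0`, with `a = ε + 2πiv`; the positive real part of
`a` gives convergence. -/
lemma fourier_rampExp {ε : ℝ} (hε : 0 < ε) (v : ℝ) :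
    𝓕 (fun k : ℝ => (rampExp ε k : ℂ)) v = (((ε : ℂ) + Complex.I * ((2 * π * v : ℝ) : ℂ)) ^ 2)⁻¹ := by
  rw [Real.fourier_real_eq_integral_exp_smul]
  set a : ℂ := (ε : ℂ) + Complex.I * ((2 * π * v : ℝ) : ℂ) with ha
  have hre : 0 < a.re := by simpa [ha] using hε
  have h : ∫ k in Set.Ioi (0 : ℝ), (k : ℂ) * Complex.exp (-(a * k)) = (a ^ 2)⁻¹ := by
    have ha0 : a ≠ 0 := by
      rintro h0
      rw [h0] at hre
      exact lt_irrefl _ hre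
    have hn : ∀ k : ℝ, ‖Complex.exp (-(a * k))‖ = exp (-ε * k) := by
      intro k
      rw [Complex.norm_exp]
      simp [ha]
    have hd : ∀ k : ℝ, HasDerivAt
        (fun k : ℝ => -((k : ℂ) / a + 1 / a ^ 2) * Complex.exp (-(a * k)))
        ((k : ℂ) * Complex.exp (-(a * k))) k := by
      intro k
      have h1 : HasDerivAt (fun k : ℝ => (k : ℂ)) 1 k := Complex.ofRealCLM.hasDerivAt
      have h2 := (((h1.div_const a).add_const (1 / a ^ 2)).neg).mul (h1.const_mul a).neg.cexp
      refine h2.congr_deriv ?_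
      simp only [Pi.neg_apply]
      field_simp
      ring
    have hi : IntegrableOn (fun k : ℝ => (k : ℂ) * Complex.exp (-(a * k))) (Set.Ioi 0) := by
      refine (integrable_rampExp hε).integrableOn.mono' (by fun_prop) ?_
      filter_upwards [ae_restrict_mem measurableSet_Ioi] with k hk
      have hk' : 0 < k := hk
      rw [norm_mul, hn, rampExp, max_eq_left hk'.le, Complex.norm_real, Real.norm_of_nonneg hk'.le]
    have hl : Tendsto (fun k : ℝ => -((k : ℂ) / a + 1 / a ^ 2) * Complex.exp (-(a * k))) atTop
        (𝓝 0) := by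
      have l1 : Tendsto (fun k : ℝ => k * exp (-ε * k)) atTop (𝓝 0) := by
        simpa using tendsto_rpow_mul_exp_neg_mul_atTop_nhds_zero 1 ε hε
      have l0 : Tendsto (fun k : ℝ => exp (-ε * k)) atTop (𝓝 0) := by
        simpa using tendsto_rpow_mul_exp_neg_mul_atTop_nhds_zero 0 ε hε
      have l2 := (l1.mul_const ‖a‖⁻¹).add (l0.mul_const (‖1 / a ^ 2‖))
      rw [zero_mul, zero_mul, add_zero] at l2
      refine squeeze_zero_norm' ?_ l2
      filter_upwards [eventually_ge_atTop 0] with k hk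
      rw [norm_mul, hn, norm_neg]
      have := norm_add_le ((k : ℂ) / a) (1 / a ^ 2)
      rw [norm_div (k : ℂ), Complex.norm_real, Real.norm_of_nonneg hk] at this
      refine (mul_le_mul_of_nonneg_right this (exp_pos _).le).trans (le_of_eq ?_)
      ring
    rw [integral_Ioi_of_hasDerivAt_of_tendsto' (fun k _ => hd k) hi hl]
    simp
  rw [← h, ← integral_indicator measurableSet_Ioi]
  congr 1
  funext k
  by_cases hk : 0 < k
  · rw [Set.indicator_of_mem (show k ∈ Set.Ioi 0 from hk), rampExp, max_eq_left hk.le,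
      smul_eq_mul, Complex.ofReal_mul k,
      mul_left_comm, Complex.ofReal_exp, ← Complex.exp_add, ha]
    congr 2
    push_cast
    ring
  · rw [Set.indicator_of_notMem (show k ∉ Set.Ioi 0 from hk),
      rampExp_of_nonpos ε (not_lt.1 hk)]
    simp

/-- The kernel `(x - iε)⁻²`. -/
def poleKernel (ε x : ℝ) : ℂ := (((x : ℂ) - Complex.I * (ε : ℂ)) ^ 2)⁻¹

lemma sub_I_mul_ne_zero {ε : ℝ} (hε : 0 < ε) (x : ℝ) : (x : ℂ) - Complex.I * (ε : ℂ) ≠ 0 := by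
  intro h
  have := congrArg Complex.im h
  simp at this
  exact hε.ne' this

lemma continuous_poleKernel {ε : ℝ} (hε : 0 < ε) : Continuous (poleKernel ε) := by
  unfold poleKernel
  exact Continuous.inv₀ (by fun_prop) fun x => pow_ne_zero 2 (sub_I_mul_ne_zero hε x)

lemma norm_poleKernel {ε : ℝ} (x : ℝ) : ‖poleKernel ε x‖ = (x ^ 2 + ε ^ 2)⁻¹ := by
  rw [poleKernel, norm_inv, norm_pow, ← Complex.normSq_eq_norm_sq, Complex.normSq_apply]
  simp
  ring

lemma integrable_poleKernel {ε : ℝ} (hε : 0 < ε) : Integrable (poleKernel ε) := by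
  have h : Integrable fun x : ℝ => (ε ^ 2)⁻¹ * (1 + (ε⁻¹ * x) ^ 2)⁻¹ :=
    (integrable_inv_one_add_sq.comp_mul_left' (inv_ne_zero hε.ne')).const_mul _
  refine h.mono' (continuous_poleKernel hε).aestronglyMeasurable (Eventually.of_forall fun x => ?_)
  rw [norm_poleKernel]
  refine le_of_eq ?_
  rw [← mul_inv]
  congr 1
  field_simp
  ring

/-- The Fourier transform of `(x - iε)⁻²`. -/
lemma integral_exp_mul_poleKernel {ε : ℝ} (hε : 0 < ε) (k : ℝ) :
    ∫ x : ℝ, Complex.exp (Complex.I * k * x) * poleKernel ε x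
      = -(2 * π * rampExp ε k : ℝ) := by
  -- Since `i(y - iε) = ε + iy`, squaring gives the minus sign. Fourier inversion then yields the
  -- transform of the pole kernel without contour integration.
  have hF : 𝓕 (fun k : ℝ => (rampExp ε k : ℂ)) = fun v => -poleKernel ε (2 * π * v) := by
    funext v
    rw [fourier_rampExp hε, poleKernel, ← inv_neg]
    congr 1
    linear_combination (((2 * π * v : ℝ) : ℂ) ^ 2 + (ε : ℂ) ^ 2) * Complex.I_sq
  have hi : Integrable (𝓕 (fun k : ℝ => (rampExp ε k : ℂ))) := by
    rw [hF]
    exact ((integrable_poleKernel hε).comp_mul_left' (by positivity)).neg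
  have h := (Complex.continuous_ofReal.comp (continuous_rampExp ε)).fourierInv_fourier_eq
    (integrable_rampExp hε).ofReal hi
  have hk := congrFun h k
  change 𝓕⁻ (𝓕 (fun k : ℝ => (rampExp ε k : ℂ))) k = (rampExp ε k : ℂ) at hk
  rw [Real.fourierInv_eq', hF] at hk
  have e := Measure.integral_comp_mul_left
    (fun x : ℝ => Complex.exp (Complex.I * k * x) * poleKernel ε x) (2 * π)
  have e2 : ∫ v : ℝ, Complex.exp (((2 * π * inner ℝ v k : ℝ) : ℂ) * Complex.I) •
        -poleKernel ε (2 * π * v)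
      = -∫ v : ℝ, Complex.exp (Complex.I * k * ((2 * π * v : ℝ) : ℂ)) * poleKernel ε (2 * π * v) := by
    rw [← integral_neg]
    congr 1
    funext v
    rw [smul_eq_mul, mul_neg]
    congr 3
    simp
    ring
  rw [e2, e, abs_of_pos (by positivity), Complex.real_smul] at hk
  have hp : ((π : ℝ) : ℂ) ≠ 0 := by exact_mod_cast Real.pi_ne_zero
  push_cast at hk ⊢
  rw [← hk]
  field_simp

/-! ### The regularized two-point function in frequency space -/

section

variable {ψ χ : ℝ × S2 → ℝ}

lemma Reg.integrable_sq (h : Reg ψ) : Integrable (fun p => ψ p ^ 2) cylMeasure := by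
  obtain ⟨D, hD⟩ := h.2
  refine (Reg.integrable_inv_cyl.const_mul D).mono'
    (h.continuous.pow 2).aestronglyMeasurable (Eventually.of_forall fun p => ?_)
  rw [Real.norm_of_nonneg (sq_nonneg _)]
  exact (hD p).1

lemma measurePreserving_add_fst (x : ℝ) :
    MeasurePreserving (fun p : ℝ × S2 => (p.1 + x, p.2)) cylMeasure cylMeasure :=
  (measurePreserving_add_right volume x).prod (MeasurePreserving.id sphereMeasure)

lemma Reg.integral_sq_comp_add (h : Reg ψ) (x : ℝ) :
    ∫ p, ψ (p.1 + x, p.2) ^ 2 ∂cylMeasure = ∫ p, ψ p ^ 2 ∂cylMeasure := by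
  have hm := measurePreserving_add_fst x
  have e := integral_map (μ := cylMeasure) hm.measurable.aemeasurable (f := fun p => ψ p ^ 2)
    (h.continuous.pow 2).aestronglyMeasurable
  rw [hm.map_eq] at e
  exact e.symm

lemma Reg.integrable_mul_poleKernel (h : Reg ψ) (h' : Reg χ) {ε : ℝ} (hε : 0 < ε) :
    Integrable (fun q : ℝ × ℝ × S2 => conj (ψ (q.2.1 + q.1, q.2.2) : ℂ) * (χ q.2 : ℂ)
      * poleKernel ε q.1) ((volume : Measure ℝ).prod cylMeasure) := by
  have hc : Continuous (fun q : ℝ × ℝ × S2 => conj (ψ (q.2.1 + q.1, q.2.2) : ℂ) * (χ q.2 : ℂ)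
      * poleKernel ε q.1) := by
    have := h.continuous
    have := h'.continuous
    have := continuous_poleKernel hε
    fun_prop
  rw [integrable_prod_iff hc.aestronglyMeasurable]
  have hi : ∀ x, Integrable (fun p : ℝ × S2 => conj (ψ (p.1 + x, p.2) : ℂ) * (χ p : ℂ)
      * poleKernel ε x) cylMeasure := fun x =>
    (integrable_conj_mul (h.comp_add x).memLp h'.memLp).mul_const _
  refine ⟨Eventually.of_forall hi, ?_⟩
  refine ((integrable_poleKernel hε).norm.const_mul
    ((∫ p, ψ p ^ 2 ∂cylMeasure) + ∫ p, χ p ^ 2 ∂cylMeasure)).mono'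
    hc.norm.aestronglyMeasurable.integral_prod_right' (Eventually.of_forall fun x => ?_)
  rw [Real.norm_of_nonneg (integral_nonneg fun p => norm_nonneg _), ← h.integral_sq_comp_add x,
    ← integral_add (h.comp_add x).integrable_sq h'.integrable_sq, ← integral_mul_const]
  refine integral_mono (hi x).norm (((h.comp_add x).integrable_sq.add h'.integrable_sq).mul_const _)
    fun p => ?_
  simp only [norm_mul, RCLike.norm_conj, Complex.norm_real, Real.norm_eq_abs]
  refine mul_le_mul_of_nonneg_right ?_ (norm_nonneg _)
  rw [← sq_abs (ψ _), ← sq_abs (χ _)]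
  nlinarith [sq_nonneg (|ψ (p.1 + x, p.2)| - |χ p|), sq_nonneg (|ψ (p.1 + x, p.2)|), sq_nonneg |χ p|]

/-- In the variable `x = U₁ - U₂` the kernel integrates translates of `ψ` against `χ`. Plancherel
turns a translate into the phase `e^{ikx}`, and the integral over `x` is the transform `-2π k₊
e^{-εk}`. The prefactor `-r²/π` turns this into `r²` times the damped vacuum weight. -/
lemma Reg.lambdaReg_eq (r : ℝ) (h : Reg ψ) (h' : Reg χ) {ε : ℝ} (hε : 0 < ε) :
    lambdaReg r ε ψ χ = (r ^ 2 : ℝ) * ∫ p, ((weightB p.1 * exp (-ε * p.1) : ℝ) : ℂ)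
      * (conj (FP ψ p) * FP χ p) ∂cylMeasure := by
  set A : ℝ × ℝ × S2 → ℂ := fun q => conj (ψ (q.1, q.2.2) : ℂ) * (χ q.2 : ℂ)
      * poleKernel ε (q.1 - q.2.1) with hA
  have hB := h.integrable_mul_poleKernel h' hε
  have hAB : ∀ p : ℝ × S2, ∀ x : ℝ, A (x + p.1, p) = conj (ψ (p.1 + x, p.2) : ℂ) * (χ p : ℂ)
      * poleKernel ε x := by
    intro p x
    rw [hA]
    simp only [add_comm x, add_sub_cancel_left]
  have hAc : Continuous A := by
    have := h.continuous
    have := h'.continuous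
    have := continuous_poleKernel hε
    fun_prop
  have hAi : Integrable A ((volume : Measure ℝ).prod cylMeasure) := by
    rw [integrable_prod_iff' hB.aestronglyMeasurable] at hB
    rw [integrable_prod_iff' hAc.aestronglyMeasurable]
    constructor
    · filter_upwards [hB.1] with p hp
      simp only [← hAB] at hp
      simpa using hp.comp_add_right (-p.1)
    · refine hB.2.congr (Eventually.of_forall fun p => ?_)
      simp only [← hAB]
      exact integral_add_right_eq_self (fun x => ‖A (x, p)‖) p.1
  have e1 : ∫ q, A q ∂((volume : Measure ℝ).prod cylMeasure)
      = ∫ x : ℝ, ∫ p, conj (ψ (p.1 + x, p.2) : ℂ) * (χ p : ℂ) * poleKernel ε x ∂cylMeasure := by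
    rw [integral_prod_symm _ hAi, integral_integral_swap (f := fun (x : ℝ) (p : ℝ × S2) =>
      conj (ψ (p.1 + x, p.2) : ℂ) * (χ p : ℂ) * poleKernel ε x) hB]
    congr 1
    funext p
    rw [← integral_add_right_eq_self (fun x => A (x, p)) p.1]
    simp only [hAB]
  set G : ℝ × S2 → ℂ := fun p => conj (FP ψ p) * FP χ p with hG
  have hGi : Integrable G cylMeasure := integrable_conj_mul h.isFT.memLp_ft h'.isFT.memLp_ft
  have e2 : ∀ x : ℝ, ∫ p, conj (ψ (p.1 + x, p.2) : ℂ) * (χ p : ℂ) * poleKernel ε x ∂cylMeasure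
      = ∫ p, Complex.exp (Complex.I * p.1 * x) * (poleKernel ε x * G p) ∂cylMeasure := by
    intro x
    rw [integral_mul_const, ← (h.comp_add x).isFT.integral_conj_mul h'.isFT, ← integral_mul_const]
    congr 1
    funext p
    rw [Reg.FP_comp_add, map_mul, ← Complex.exp_conj, hG]
    simp only [map_neg, map_mul, Complex.conj_I, Complex.conj_ofReal, neg_mul, neg_neg]
    ring
  have hC : Integrable (fun q : ℝ × ℝ × S2 => Complex.exp (Complex.I * q.2.1 * q.1)
      * (poleKernel ε q.1 * G q.2)) ((volume : Measure ℝ).prod cylMeasure) := by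
    refine ((integrable_poleKernel hε).mul_prod hGi).bdd_mul (c := 1)
      (by fun_prop) (Eventually.of_forall fun q => ?_)
    rw [mul_assoc, ← Complex.ofReal_mul, mul_comm Complex.I, Complex.norm_exp_ofReal_mul_I]
  have e3 : ∫ q, A q ∂((volume : Measure ℝ).prod cylMeasure)
      = ∫ p, -((2 * π * rampExp ε p.1 : ℝ) : ℂ) * G p ∂cylMeasure := by
    rw [e1]
    simp only [e2]
    rw [integral_integral_swap (f := fun (x : ℝ) (p : ℝ × S2) =>
      Complex.exp (Complex.I * p.1 * x) * (poleKernel ε x * G p)) hC]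
    congr 1
    funext p
    rw [← integral_exp_mul_poleKernel hε, ← integral_mul_const]
    simp only [mul_assoc]
  have e4 : lambdaReg r ε ψ χ
      = -((r ^ 2 / π : ℝ) : ℂ) * ∫ q, A q ∂((volume : Measure ℝ).prod cylMeasure) := by
    unfold lambdaReg
    congr 2
    funext q
    simp only [hA, div_eq_mul_inv, poleKernel, Complex.ofReal_sub]
  have hp : ((π : ℝ) : ℂ) ≠ 0 := by exact_mod_cast Real.pi_ne_zero
  rw [e4, e3, ← integral_const_mul, ← integral_const_mul]
  congr 1
  funext p
  rw [← two_mul_rampExp]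
  simp only [hG]
  push_cast
  field_simp

/-- The two-point kernel, as the limit `ε → 0⁺`. -/
lemma Reg.isLambda (r : ℝ) (h : Reg ψ) (h' : Reg χ) :
    IsLambda r ψ χ ((r ^ 2 : ℝ) * ∫ p, (weightB p.1 : ℂ) * (conj (FP ψ p) * FP χ p) ∂cylMeasure) := by
  have hw := isWeight_weightB
  obtain ⟨C, hC⟩ := hw.bound
  have hi := h.integrable_weight h' hw.meas (C := C) fun k => by
    rw [abs_of_nonneg (hw.nonneg k)]
    exact hC k
  have hev : ∀ᶠ ε : ℝ in 𝓝[>] 0, (r ^ 2 : ℝ) * ∫ p, ((weightB p.1 * exp (-ε * p.1) : ℝ) : ℂ)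
      * (conj (FP ψ p) * FP χ p) ∂cylMeasure = lambdaReg r ε ψ χ := by
    filter_upwards [self_mem_nhdsWithin] with ε hε
    exact (h.lambdaReg_eq r h' hε).symm
  refine Tendsto.congr' hev (Tendsto.const_mul _ ?_)
  refine tendsto_integral_filter_of_dominated_convergence _ ?_ ?_ hi.norm
    (Eventually.of_forall fun p => ?_)
  · have hm := hw.meas
    have := h.sm_FP.measurable
    have := h'.sm_FP.measurable
    exact Eventually.of_forall fun ε => Measurable.aestronglyMeasurable (by fun_prop)
  · filter_upwards [self_mem_nhdsWithin] with ε hε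
    refine Eventually.of_forall fun p => ?_
    rw [norm_mul, norm_mul (weightB p.1 : ℂ)]
    refine mul_le_mul_of_nonneg_right ?_ (norm_nonneg (conj (FP ψ p) * FP χ p))
    rw [Complex.norm_real, Complex.norm_real, norm_mul (weightB _), Real.norm_of_nonneg (exp_pos _).le]
    unfold weightB
    split_ifs with hp
    · refine mul_le_of_le_one_right (norm_nonneg _) (exp_le_one_iff.2 ?_)
      have : (0 : ℝ) < ε := hε
      nlinarith
    · simp
  · refine Tendsto.mul_const _ ?_
    have hc : Continuous fun ε : ℝ => ((weightB p.1 * exp (-ε * p.1) : ℝ) : ℂ) := by fun_prop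
    have := hc.tendsto 0
    simp only [neg_zero, zero_mul, exp_zero, mul_one] at this
    exact this.mono_left nhdsWithin_le_nhds

end

/-! ### The one-particle structures and the vacuum state -/

/-- The one-particle map `K_B`. -/
def oneB (r : ℝ) : SB →ₗ[ℝ] HB r :=
  Kmap (fun _ h => reg_of_mem_SB h)
    (fun _ h => (reg_of_mem_SB h).memLp_cylWeight isWeight_weightB (measureB_eq r))

/-- The thermal one-particle map `K^β`. -/
def oneH (r : ℝ) {κ : ℝ} (hκ : 0 < κ) : SH →ₗ[ℝ] HH r κ :=
  Kmap (fun _ h => reg_of_mem_SH h)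
    (fun _ h => (reg_of_mem_SH h).memLp_cylWeight (isWeight_weightH hκ) (measureH_eq hκ r))

lemma inner_oneB (r : ℝ) (ψ χ : SB) : inner ℂ (oneB r ψ) (oneB r χ)
    = (r ^ 2 : ℝ) * ∫ p, (weightB p.1 : ℂ) * (conj (FP ψ p) * FP χ p) ∂cylMeasure :=
  inner_Kmap _ _ isWeight_weightB (measureB_eq r) ψ χ

lemma inner_oneH (r : ℝ) {κ : ℝ} (hκ : 0 < κ) (ψ χ : SH) :
    inner ℂ (oneH r hκ ψ) (oneH r hκ χ)
      = (r ^ 2 : ℝ) * ∫ p, (weightH κ p.1 : ℂ) * (conj (FP ψ p) * FP χ p) ∂cylMeasure :=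
  inner_Kmap _ _ (isWeight_weightH hκ) (measureH_eq hκ r) ψ χ

lemma enorm_oneB_sq (r : ℝ) (ψ : SB) : ‖oneB r ψ‖ₑ ^ 2
    = ∫⁻ p, ENNReal.ofReal (r ^ 2 * weightB p.1) * ‖FP ψ p‖ₑ ^ 2 ∂cylMeasure :=
  enorm_Kmap_sq _ _ isWeight_weightB (measureB_eq r) ψ

lemma enorm_oneH_sq (r : ℝ) {κ : ℝ} (hκ : 0 < κ) (ψ : SH) : ‖oneH r hκ ψ‖ₑ ^ 2
    = ∫⁻ p, ENNReal.ofReal (r ^ 2 * weightH κ p.1) * ‖FP ψ p‖ₑ ^ 2 ∂cylMeasure :=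
  enorm_Kmap_sq _ _ (isWeight_weightH hκ) (measureH_eq hκ r) ψ

lemma sigmaB_eq (r : ℝ) (ψ χ : SB) :
    sigmaB r ψ χ = 2 * (inner ℂ (oneB r ψ) (oneB r χ)).im :=
  two_im_inner_Kmap _ _ isWeight_weightB (measureB_eq r) _ ψ χ

lemma sigmaH_eq (r : ℝ) {κ : ℝ} (hκ : 0 < κ) (ψ χ : SH) :
    sigmaH r ψ χ = 2 * (inner ℂ (oneH r hκ ψ) (oneH r hκ χ)).im :=
  two_im_inner_Kmap _ _ (isWeight_weightH hκ) (measureH_eq hκ r) _ ψ χ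

lemma norm_eq_of_enorm_sq_eq {E F : Type*} [NormedAddCommGroup E] [NormedAddCommGroup F] {x : E}
    {y : F} (h : ‖x‖ₑ ^ 2 = ‖y‖ₑ ^ 2) : ‖x‖ = ‖y‖ := by
  have h1 := (ENNReal.pow_right_strictMono two_ne_zero).injective h
  rw [← toReal_enorm, ← toReal_enorm, h1]

/-- Vectors of `HB` are classes for the weighted measure. As `2K > 0` on the half-line and `r ≠ 0`,
the measure `dK ∧ dS²` is absolutely continuous with respect to it. -/
lemma isFourierPlancherel_oneB {r : ℝ} (hr : r ≠ 0) (ψ : SB) :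
    IsFourierPlancherel (ψ : ℝ × S2 → ℝ) (oneB r ψ : ℝ × S2 → ℂ) := by
  have h := (reg_of_mem_SB ψ.2).isFourierPlancherel
  have hae := coeFn_Kmap (fun _ h => reg_of_mem_SB h)
    (fun _ h => (reg_of_mem_SB h).memLp_cylWeight isWeight_weightB (measureB_eq r)) ψ
  have hac : ((volume : Measure ℝ).restrict (Set.Ioi 0)).prod sphereMeasure ≪ measureB r := by
    have hm : Measurable fun k : ℝ => ENNReal.ofReal (2 * k) := by fun_prop
    refine Measure.AbsolutelyContinuous.prod ?_ (Measure.absolutelyContinuous_smul ?_)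
    · refine withDensity_absolutelyContinuous' hm.aemeasurable ?_
      filter_upwards [ae_restrict_mem measurableSet_Ioi] with k hk
      have : (0 : ℝ) < k := hk
      simpa using this
    · simpa using hr
  have hae' := hac.ae_le hae
  refine h.congr fun R => eLpNorm_congr_ae ?_
  filter_upwards [hae'] with p hp
  rw [show oneB r ψ p = FP ψ p from hp]

/-- Real density of the range supplies both the dense complex span and the hypothesis of the purity
criterion. Uniqueness uses only the diagonal: a quasifree state is fixed by `μ(f, f)`, which the
kernel determines. -/
lemma exists_vacuum {r : ℝ} (hr : r ≠ 0) : ∃ ω : AlgState (Weyl (sigmaB r)),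
    HasOneParticle ω (oneB r) ∧ ω.IsPure ∧
      (∀ ψ₁ ψ₂ : SB, IsLambda r ψ₁ ψ₂ (twoPoint ω ψ₁ ψ₂)) ∧
      ∀ ω' : AlgState (Weyl (sigmaB r)), IsQuasifree ω' →
        (∀ ψ₁ ψ₂ : SB, IsLambda r ψ₁ ψ₂ (twoPoint ω' ψ₁ ψ₂)) → ω' = ω := by
  obtain ⟨ω, hω⟩ := exists_quasifree (oneB r) (sigmaB_eq r)
  have hd : Dense (Set.range (oneB r)) := dense_range_Kmap_SB hr (measureB_eq r)
  have h1 : HasOneParticle ω (oneB r) :=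
    ⟨_, hω, hd.mono Submodule.subset_span, fun f g => reForm_apply _ f g, sigmaB_eq r⟩
  have hT : ∀ ψ₁ ψ₂ : SB, twoPoint ω ψ₁ ψ₂ = inner ℂ (oneB r ψ₁) (oneB r ψ₂) := by
    intro ψ₁ ψ₂
    refine (twoPoint_eq hω ψ₁ ψ₂).trans (Eq.trans ?_ (Complex.re_add_im _))
    change (((inner ℂ (oneB r ψ₁) (oneB r ψ₂)).re : ℝ) : ℂ)
      + Complex.I * ((sigmaB r ψ₁ ψ₂ : ℝ) : ℂ) / 2 = _
    rw [sigmaB_eq]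
    push_cast
    ring
  have hL : ∀ ψ₁ ψ₂ : SB, IsLambda r ψ₁ ψ₂ (twoPoint ω ψ₁ ψ₂) := by
    intro ψ₁ ψ₂
    rw [hT, inner_oneB]
    exact (reg_of_mem_SB ψ₁.2).isLambda r (reg_of_mem_SB ψ₂.2)
  refine ⟨ω, h1, isPure_of_smul_I_mem_closure (sigmaB_eq r) h1.apply_W fun f => hd _, hL, ?_⟩
  rintro ω' ⟨μ, hμ⟩ hL'
  refine Weyl.state_ext fun f => ?_
  -- Both two-point values are limits of the same regularized integrals, and their symplectic parts
  -- agree.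
  have e := tendsto_nhds_unique (hL f f) (hL' f f)
  rw [twoPoint_eq hω, twoPoint_eq hμ] at e
  have e2 : reForm (oneB r) f f = μ f f := by exact_mod_cast add_right_cancel e
  rw [hω.2.2, hμ.2.2, e2]

/-! ### Invariance under the Killing flow and the rotations -/

lemma sigmaB_flowB (κ r τ : ℝ) (ψ χ : SB) :
    sigmaB r (flowB κ τ ψ) (flowB κ τ χ) = sigmaB r ψ χ := by
  have i1 := (tame_of_mem_SB (flowB κ τ ψ).2).integrable_symp (tame_of_mem_SB (flowB κ τ χ).2)
  have i2 := (tame_of_mem_SB ψ.2).integrable_symp (tame_of_mem_SB χ.2)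
  have hpd : ∀ (φ : SB) p, pd (flowB κ τ φ) p = exp (κ * τ) * pd φ (exp (κ * τ) * p.1, p.2) := by
    intro φ p
    have := deriv_comp_mul_left (exp (κ * τ)) (fun y => (φ : ℝ × S2 → ℝ) (y, p.2)) p.1
    exact this
  change r ^ 2 * ∫ p, ((flowB κ τ ψ : ℝ × S2 → ℝ) p * pd (flowB κ τ χ) p
    - (flowB κ τ χ : ℝ × S2 → ℝ) p * pd (flowB κ τ ψ) p) ∂cylMeasure
    = r ^ 2 * ∫ p, ((ψ : ℝ × S2 → ℝ) p * pd χ p - (χ : ℝ × S2 → ℝ) p * pd ψ p) ∂cylMeasure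
  congr 1
  rw [integral_prod_symm _ i1, integral_prod_symm _ i2]
  congr 1
  funext w
  have e := Measure.integral_comp_mul_left (fun x : ℝ => (ψ : ℝ × S2 → ℝ) (x, w) * pd χ (x, w)
    - (χ : ℝ × S2 → ℝ) (x, w) * pd ψ (x, w)) (exp (κ * τ))
  rw [abs_of_pos (inv_pos.2 (exp_pos _)), smul_eq_mul, eq_inv_mul_iff_mul_eq₀ (exp_pos _).ne',
    ← integral_const_mul] at e
  rw [← e]
  congr 1
  funext x
  simp only [hpd]
  change (ψ : ℝ × S2 → ℝ) (exp (κ * τ) * x, w) * _ - (χ : ℝ × S2 → ℝ) (exp (κ * τ) * x, w) * _ = _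
  ring

lemma norm_oneB_flowB (κ r τ : ℝ) (ψ : SB) : ‖oneB r (flowB κ τ ψ)‖ = ‖oneB r ψ‖ := by
  refine norm_eq_of_enorm_sq_eq ?_
  rw [enorm_oneB_sq, enorm_oneB_sq]
  exact lintegral_weightB_dilate r (reg_of_mem_SB ψ.2) (exp_pos (κ * τ))

/-- The action of a linear isometry on the sphere. -/
def sphereMap (R : E3 ≃ₗᵢ[ℝ] E3) (w : S2) : S2 := ⟨R w, by simp⟩

lemma continuous_sphereMap (R : E3 ≃ₗᵢ[ℝ] E3) : Continuous (sphereMap R) :=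
  (R.continuous.comp continuous_subtype_val).subtype_mk _

-- The measure of a set on the sphere is a multiple of the volume of the cone over it. A linear
-- isometry maps cones to cones and preserves volume.
open scoped Pointwise in
lemma measurePreserving_sphereMap (R : E3 ≃ₗᵢ[ℝ] E3) :
    MeasurePreserving (sphereMap R) sphereMeasure sphereMeasure := by
  refine ⟨(continuous_sphereMap R).measurable, ?_⟩
  ext s hs
  rw [Measure.map_apply (continuous_sphereMap R).measurable hs, sphereMeasure,
    Measure.toSphere_apply' _ ((continuous_sphereMap R).measurable hs),
    Measure.toSphere_apply' _ hs]
  congr 1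
  have hset : Set.Ioo (0 : ℝ) 1 • ((↑) '' (sphereMap R ⁻¹' s) : Set E3)
      = R ⁻¹' (Set.Ioo (0 : ℝ) 1 • ((↑) '' s)) := by
    ext x
    simp only [Set.mem_smul, Set.mem_image, Set.mem_preimage]
    constructor
    · rintro ⟨c, hc, _, ⟨w, hw, rfl⟩, rfl⟩
      exact ⟨c, hc, _, ⟨sphereMap R w, hw, rfl⟩, by simp [sphereMap]⟩
    · rintro ⟨c, hc, _, ⟨w, hw, rfl⟩, hx⟩
      refine ⟨c, hc, _, ⟨sphereMap R.symm w, ?_, rfl⟩, ?_⟩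
      · have : sphereMap R (sphereMap R.symm w) = w := Subtype.ext (by simp [sphereMap])
        rwa [this]
      · apply R.injective
        simpa [sphereMap] using hx
  rw [hset]
  exact (R.measurePreserving).measure_preimage_equiv (f := R.toMeasurableEquiv) _

lemma measurePreserving_rotate (R : E3 ≃ₗᵢ[ℝ] E3) :
    MeasurePreserving (fun p : ℝ × S2 => (p.1, sphereMap R p.2)) cylMeasure cylMeasure :=
  (MeasurePreserving.id _).prod (measurePreserving_sphereMap R)

lemma sigmaB_rotB (r : ℝ) (R : E3 ≃ₗᵢ[ℝ] E3) (ψ χ : SB) :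
    sigmaB r (rotB R ψ) (rotB R χ) = sigmaB r ψ χ := by
  have i2 := (tame_of_mem_SB ψ.2).integrable_symp (tame_of_mem_SB χ.2)
  have hm := measurePreserving_rotate R.symm
  have e := integral_map (μ := cylMeasure) hm.measurable.aemeasurable
    (f := fun p => (ψ : ℝ × S2 → ℝ) p * pd χ p - (χ : ℝ × S2 → ℝ) p * pd ψ p)
    (by rw [hm.map_eq]; exact i2.aestronglyMeasurable)
  rw [hm.map_eq] at e
  exact congrArg (r ^ 2 * ·) e.symm

lemma norm_oneB_rotB (r : ℝ) (R : E3 ≃ₗᵢ[ℝ] E3) (ψ : SB) : ‖oneB r (rotB R ψ)‖ = ‖oneB r ψ‖ := by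
  refine norm_eq_of_enorm_sq_eq ?_
  rw [enorm_oneB_sq, enorm_oneB_sq]
  have hm := isWeight_weightB.meas
  have hF := (reg_of_mem_SB ψ.2).sm_FP.measurable
  exact (measurePreserving_rotate R.symm).lintegral_comp
    (f := fun p => ENNReal.ofReal (r ^ 2 * weightB p.1) * ‖FP ψ p‖ₑ ^ 2) (by fun_prop)

lemma exists_flow {κ r : ℝ} {ω : AlgState (Weyl (sigmaB r))} (h : HasOneParticle ω (oneB r)) :
    ∃ α : Multiplicative ℝ →* (Weyl (sigmaB r) ≃⋆ₐ[ℂ] Weyl (sigmaB r)),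
      (∀ (τ : ℝ) (ψ : SB), α (Multiplicative.ofAdd τ) (Weyl.W (sigmaB r) ψ)
        = Weyl.W (sigmaB r) (flowB κ τ ψ)) ∧
      ∀ (τ : ℝ) (a : Weyl (sigmaB r)), ω (α (Multiplicative.ofAdd τ) a) = ω a := by
  have hσ : ∀ (x : Multiplicative ℝ) (ψ χ : SB),
      sigmaB r (flowB κ x.toAdd ψ) (flowB κ x.toAdd χ) = sigmaB r ψ χ := fun x =>
    sigmaB_flowB κ r x.toAdd
  have h1 : ∀ ψ : SB, flowB κ (1 : Multiplicative ℝ).toAdd ψ = ψ := by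
    intro ψ
    refine Subtype.ext (funext fun p => ?_)
    change (ψ : ℝ × S2 → ℝ) (exp (κ * 0) * p.1, p.2) = _
    rw [mul_zero, exp_zero, one_mul]
  have hmul : ∀ (x y : Multiplicative ℝ) (ψ : SB),
      flowB κ (x * y).toAdd ψ = flowB κ x.toAdd (flowB κ y.toAdd ψ) := by
    intro x y ψ
    refine Subtype.ext (funext fun p => ?_)
    change (ψ : ℝ × S2 → ℝ) (exp (κ * (x.toAdd + y.toAdd)) * p.1, p.2)
      = (ψ : ℝ × S2 → ℝ) (exp (κ * y.toAdd) * (exp (κ * x.toAdd) * p.1), p.2)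
    rw [mul_add, exp_add, ← mul_assoc, mul_comm (exp (κ * y.toAdd))]
  refine ⟨Weyl.autHom (fun x : Multiplicative ℝ => flowB κ x.toAdd) hσ h1 hmul,
    fun τ ψ => Weyl.autHom_W _ _ _ _ _ _, fun τ a => Weyl.state_autHom _ _ _ _ ω (fun x f => ?_) _ a⟩
  exact (h.apply_W _ _).trans ((congrArg (fun x : ℝ => ((exp (-(x ^ 2) / 2) : ℝ) : ℂ))
    (norm_oneB_flowB κ r _ f)).trans (h.apply_W _ f).symm)

lemma exists_rotations {r : ℝ} {ω : AlgState (Weyl (sigmaB r))} (h : HasOneParticle ω (oneB r)) :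
    ∃ ρ : (E3 ≃ₗᵢ[ℝ] E3) →* (Weyl (sigmaB r) ≃⋆ₐ[ℂ] Weyl (sigmaB r)),
      (∀ (R : E3 ≃ₗᵢ[ℝ] E3) (ψ : SB), ρ R (Weyl.W (sigmaB r) ψ) = Weyl.W (sigmaB r) (rotB R ψ)) ∧
      ∀ (R : E3 ≃ₗᵢ[ℝ] E3) (a : Weyl (sigmaB r)), ω (ρ R a) = ω a := by
  refine ⟨Weyl.autHom rotB (sigmaB_rotB r) (fun _ => rfl) (fun _ _ _ => rfl),
    fun τ ψ => Weyl.autHom_W _ _ _ _ _ _, fun τ a => Weyl.state_autHom _ _ _ _ ω (fun x f => ?_) _ a⟩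
  exact (h.apply_W _ _).trans ((congrArg (fun x : ℝ => ((exp (-(x ^ 2) / 2) : ℝ) : ℂ))
    (norm_oneB_rotB r x f)).trans (h.apply_W _ f).symm)

/-! ### Restriction to the halves of the horizon -/

lemma pd_eq_zero_of_eventually {ψ : ℝ × S2 → ℝ} {x : ℝ} {w : S2} (h : ∀ᶠ y in 𝓝 x, ψ (y, w) = 0) :
    pd ψ (x, w) = 0 := by
  have : (fun y => ψ (y, w)) =ᶠ[𝓝 x] fun _ => (0 : ℝ) := h
  exact this.deriv_eq.trans (deriv_const _ _)

lemma decays_of_eq_zero {a b : ℝ → ℝ} {ψ : ℝ × S2 → ℝ} {R : ℝ} (ha : ∀ x, 1 < |x| → 0 < a x)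
    (hb : ∀ x, 1 < |x| → 0 < b x) (h : ∀ x w, R < |x| → ψ (x, w) = 0) : Decays a b ψ := by
  refine ⟨1, one_pos, max R 1 + 1, by linarith [le_max_right R 1], fun x w hx => ?_⟩
  have hR : R < |x| := by linarith [le_max_left R 1]
  have h1 : 1 < |x| := by linarith [le_max_right R 1]
  have h0 : pd ψ (x, w) = 0 := by
    refine pd_eq_zero_of_eventually ?_
    filter_upwards [(isOpen_lt continuous_const continuous_abs).mem_nhds hR] with y hy
    exact h y w hy
  rw [h x w hR, h0, abs_zero, one_mul, one_mul]
  exact ⟨ha x h1, hb x h1⟩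

lemma mem_SH_of_eq_zero {ψ : ℝ × S2 → ℝ} {R : ℝ} (hs : Smooth ψ)
    (h : ∀ x w, R < |x| → ψ (x, w) = 0) : ψ ∈ SH :=
  ⟨hs, decays_of_eq_zero (fun _ _ => exp_pos _) (fun _ _ => exp_pos _) h⟩

section

variable {κ : ℝ} {ψ : ℝ × S2 → ℝ} {R : ℝ}

lemma Half.abs_eq (b : Half) {U : ℝ} (h : 0 < b.sgn * U) : |U| = b.sgn * U := by
  cases b
  · simp only [Half.sgn, one_mul] at h ⊢
    exact abs_of_pos h
  · simp only [Half.sgn] at h ⊢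
    rw [abs_of_neg (by linarith)]
    ring

/-- Because `|u| = κ⁻¹ |log (κ|U|)|`, the region `|u| > R` becomes a punctured neighbourhood of `U =
0` together with a neighbourhood of infinity. Hence the extension is smooth across the bifurcation
sphere and compactly supported in `U`. -/
lemma extendZero_eq_zero (hκ : 0 < κ) (b : Half) (h : ∀ x w, R < |x| → ψ (x, w) = 0) {U : ℝ}
    (hU : |U| < exp (-(κ * R)) / κ ∨ exp (κ * R) / κ < |U|) (w : S2) :
    extendZero κ b ψ (U, w) = 0 := by
  unfold extendZero
  split_ifs with h0
  · rw [b.abs_eq h0] at hU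
    simp only at h0 hU ⊢
    refine h _ w ?_
    rw [abs_mul, abs_div, b.abs_sgn, abs_of_pos hκ, one_div, inv_mul_eq_div, lt_div_iff₀ hκ]
    rcases hU with hU | hU
    · rw [lt_div_iff₀ hκ] at hU
      have := log_lt_log (by positivity) hU
      rw [log_exp] at this
      have := neg_le_abs (log (κ * (b.sgn * U)))
      rw [mul_comm κ (b.sgn * U)] at this ⊢
      linarith
    · rw [div_lt_iff₀ hκ] at hU
      have := log_lt_log (exp_pos _) hU
      rw [log_exp] at this
      have := le_abs_self (log (κ * (b.sgn * U)))
      rw [mul_comm κ (b.sgn * U)] at this ⊢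
      linarith
  · rfl

lemma smooth_extendZero (hκ : 0 < κ) (b : Half) (hs : Smooth ψ)
    (h : ∀ x w, R < |x| → ψ (x, w) = 0) : Smooth (extendZero κ b ψ) := by
  have hc : Continuous fun p : ℝ × S2 => b.sgn * p.1 := by fun_prop
  have h1 : Continuous fun p : ℝ × S2 => |p.1| := by fun_prop
  intro p
  by_cases hp : 0 < b.sgn * p.1
  · have hl : ContDiffAt ℝ ((⊤ : ℕ∞) : WithTop ℕ∞) (fun U => b.sgn / κ * log (κ * (b.sgn * U))) p.1 :=
      contDiffAt_const.mul ((contDiffAt_const.mul (contDiffAt_const.mul contDiffAt_id)).log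
        (by simp only [id]; positivity))
    have hm : ContMDiffAt (𝓘(ℝ, ℝ).prod (𝓡 2)) (𝓘(ℝ, ℝ).prod (𝓡 2)) ((⊤ : ℕ∞) : WithTop ℕ∞)
        (fun p : ℝ × S2 => ((b.sgn / κ * log (κ * (b.sgn * p.1)), p.2) : ℝ × S2)) p :=
      (hl.contMDiffAt.comp p contMDiffAt_fst).prodMk contMDiffAt_snd
    refine ((hs.contMDiffAt).comp p hm).congr_of_eventuallyEq ?_
    filter_upwards [(isOpen_lt continuous_const hc).mem_nhds hp] with q hq
    exact if_pos hq
  · refine (contMDiffAt_const (c := (0 : ℝ))).congr_of_eventuallyEq ?_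
    have h2 : b.sgn * p.1 < exp (-(κ * R)) / κ := lt_of_le_of_lt (not_lt.1 hp) (by positivity)
    filter_upwards [(isOpen_lt hc continuous_const).mem_nhds h2] with q hq
    by_cases hq0 : 0 < b.sgn * q.1
    · refine extendZero_eq_zero hκ b h (Or.inl ?_) q.2
      rw [b.abs_eq hq0]
      exact hq
    · exact if_neg hq0

lemma extendZero_mem_SB (hκ : 0 < κ) (b : Half) (hs : Smooth ψ)
    (h : ∀ x w, R < |x| → ψ (x, w) = 0) : extendZero κ b ψ ∈ SB := by
  refine ⟨smooth_extendZero hκ b hs h, ⟨0, fun w => ?_⟩,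
    decays_of_eq_zero (R := exp (κ * R) / κ) (fun x hx => by positivity) (fun x hx => ?_)
    fun U w hU => extendZero_eq_zero hκ b h (Or.inr hU) w⟩
  · simp [extendZero]
  · have : 0 < |x| := by linarith
    have : x ≠ 0 := abs_pos.1 this
    positivity

end

/-- A smooth cutoff, equal to `1` on `[-1, 1]` and supported in `[-2, 2]`. -/
def bump : ContDiffBump (0 : ℝ) := ⟨1, 2, one_pos, one_lt_two⟩

lemma bump_of_abs_le {x : ℝ} (hx : |x| ≤ 1) : bump x = 1 :=
  bump.one_of_mem_closedBall (by simpa [bump] using hx)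

lemma bump_of_two_le {x : ℝ} (hx : 2 ≤ |x|) : bump x = 0 :=
  bump.zero_of_le_dist (by simpa [bump] using hx)

/-- The function `ψ`, cut off at `|u| ~ n`. -/
def cutoff (n : ℕ) (ψ : ℝ × S2 → ℝ) (p : ℝ × S2) : ℝ := bump (p.1 / (n + 1)) * ψ p

/-! ### Cutoffs and approximation by extendable functions -/

section

variable {ψ : ℝ × S2 → ℝ} (n : ℕ)

lemma Smooth.cutoff (h : Smooth ψ) : Smooth (cutoff n ψ) := by
  have h1 : ContDiff ℝ ((⊤ : ℕ∞) : WithTop ℕ∞) fun x : ℝ => bump (x / (n + 1)) :=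
    bump.contDiff.comp (contDiff_id.div_const _)
  exact (h1.contMDiff.comp contMDiff_fst).mul h

lemma cutoff_eq_zero {x : ℝ} (hx : 2 * ((n : ℝ) + 1) < |x|) (w : S2) : cutoff n ψ (x, w) = 0 := by
  have hn : (0 : ℝ) < n + 1 := by positivity
  rw [cutoff, bump_of_two_le, zero_mul]
  rw [abs_div, abs_of_pos hn, le_div_iff₀ hn]
  exact hx.le

lemma cutoff_eq {x : ℝ} (hx : |x| < (n : ℝ) + 1) (w : S2) : cutoff n ψ (x, w) = ψ (x, w) := by
  have hn : (0 : ℝ) < n + 1 := by positivity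
  rw [cutoff, bump_of_abs_le, one_mul]
  rw [abs_div, abs_of_pos hn, div_le_one hn]
  exact hx.le

lemma abs_cutoff_sub_le (p : ℝ × S2) : |(cutoff n ψ - ψ) p| ≤ |ψ p| := by
  have e : (cutoff n ψ - ψ) p = -((1 - bump (p.1 / (n + 1))) * ψ p) := by
    rw [Pi.sub_apply, cutoff]
    ring
  have h0 := bump.nonneg (x := p.1 / (n + 1))
  have h1 := bump.le_one (x := p.1 / (n + 1))
  rw [e, abs_neg, abs_mul, abs_of_nonneg (by linarith)]
  exact mul_le_of_le_one_left (abs_nonneg _) (by linarith)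

/-- Differentiating the rescaled cutoff produces a factor `1/(n + 1) ≤ 1`, so one bound for the
derivative of `bump` serves all `n` and gives a dominating function. -/
lemma exists_abs_pd_cutoff_sub_le : ∃ M, 0 ≤ M ∧ ∀ (ψ : ℝ × S2 → ℝ), Smooth ψ → ∀ n p,
    |pd (cutoff n ψ - ψ) p| ≤ M * |ψ p| + |pd ψ p| := by
  have hc : Continuous (deriv bump) := (bump.contDiff (n := 1)).continuous_deriv le_rfl
  obtain ⟨M, hM⟩ := hc.bounded_above_of_compact_support bump.hasCompactSupport.deriv
  refine ⟨M, (norm_nonneg _).trans (hM 0), fun ψ hψ n p => ?_⟩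
  have hn : (0 : ℝ) < n + 1 := by positivity
  have hd := (hψ.differentiable p.2 p.1).hasDerivAt
  have hb : HasDerivAt bump (deriv bump (p.1 / (n + 1))) (p.1 / (n + 1)) :=
    ((bump.contDiff (n := 1)).differentiable one_ne_zero _).hasDerivAt
  have hb' := hb.comp p.1 ((hasDerivAt_id p.1).div_const ((n : ℝ) + 1))
  have e := ((hb'.mul hd).sub hd).deriv
  change pd (cutoff n ψ - ψ) p = deriv bump (p.1 / (n + 1)) * (1 / (n + 1)) * ψ p
    + bump (p.1 / (n + 1)) * pd ψ p - pd ψ p at e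
  have e2 : pd (cutoff n ψ - ψ) p = deriv bump (p.1 / (n + 1)) * (1 / (n + 1)) * ψ p
      + -((1 - bump (p.1 / (n + 1))) * pd ψ p) := by
    rw [e]
    ring
  have h0 := bump.nonneg (x := p.1 / (n + 1))
  have h1 := bump.le_one (x := p.1 / (n + 1))
  rw [e2]
  refine (abs_add_le _ _).trans (add_le_add ?_ ?_)
  · rw [abs_mul, abs_mul]
    refine mul_le_mul_of_nonneg_right ?_ (abs_nonneg _)
    have h2 : |1 / ((n : ℝ) + 1)| ≤ 1 := by
      rw [abs_of_pos (by positivity), div_le_one hn]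
      linarith
    have := mul_le_mul (hM (p.1 / (n + 1))) h2 (abs_nonneg _) ((norm_nonneg _).trans (hM 0))
    simpa using this
  · rw [abs_neg, abs_mul, abs_of_nonneg (by linarith)]
    exact mul_le_of_le_one_left (abs_nonneg _) (by linarith)

end

lemma enorm_ofReal_sq (x : ℝ) : ‖(x : ℂ)‖ₑ ^ 2 = ENNReal.ofReal (x ^ 2) := by
  rw [← ofReal_norm, Complex.norm_real, ← ENNReal.ofReal_pow (norm_nonneg _), Real.norm_eq_abs, sq_abs]

/-- The weighted norm is controlled by the `H¹` norm in the first variable. -/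
lemma Reg.lintegral_weight_le {w : ℝ → ℝ} {C : ℝ} (hC : ∀ k, w k ≤ C * (1 + k ^ 2)) (r : ℝ)
    {ψ : ℝ × S2 → ℝ} (h : Reg ψ) :
    ∫⁻ p, ENNReal.ofReal (r ^ 2 * w p.1) * ‖FP ψ p‖ₑ ^ 2 ∂cylMeasure
      ≤ ENNReal.ofReal (r ^ 2 * C) * ∫⁻ p, ENNReal.ofReal (ψ p ^ 2 + pd ψ p ^ 2) ∂cylMeasure := by
  have hF := h.sm_FP.measurable
  have hψ := h.continuous.measurable
  have hr := sq_nonneg r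
  have e1 : ∫⁻ p, ENNReal.ofReal (ψ p ^ 2 + pd ψ p ^ 2) ∂cylMeasure
      = ∫⁻ p, (‖FP ψ p‖ₑ ^ 2 + ‖(p.1 : ℂ) * FP ψ p‖ₑ ^ 2) ∂cylMeasure := by
    simp only [ENNReal.ofReal_add (sq_nonneg _) (sq_nonneg _), ← enorm_ofReal_sq]
    rw [lintegral_add_left (by fun_prop), lintegral_add_left (by fun_prop),
      ← h.isFT.lintegral_enorm_sq, ← h.isFT_pd.lintegral_enorm_sq]
    congr 1
    refine lintegral_congr_ae ?_
    filter_upwards [Reg.ae_fst_ne_zero] with p hp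
    rw [Reg.mul_FP hp, enorm_mul, ← ofReal_norm Complex.I, Complex.norm_I, ENNReal.ofReal_one,
      one_mul]
  rw [e1, ← lintegral_const_mul' _ _ ENNReal.ofReal_ne_top]
  refine lintegral_mono fun p => ?_
  have hC0 : 0 ≤ 1 + p.1 ^ 2 := by positivity
  have e2 : ‖FP ψ p‖ₑ ^ 2 + ‖(p.1 : ℂ) * FP ψ p‖ₑ ^ 2
      = ENNReal.ofReal (1 + p.1 ^ 2) * ‖FP ψ p‖ₑ ^ 2 := by
    rw [enorm_mul, mul_pow, enorm_ofReal_sq, ENNReal.ofReal_add zero_le_one (sq_nonneg _),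
      ENNReal.ofReal_one, add_mul, one_mul]
  rw [e2, ← mul_assoc, ← ENNReal.ofReal_mul' hC0]
  refine mul_le_mul' (ENNReal.ofReal_le_ofReal ?_) le_rfl
  rw [mul_assoc]
  exact mul_le_mul_of_nonneg_left (hC _) hr

lemma tendsto_lintegral_cutoff {ψ : ℝ × S2 → ℝ} (h : Reg ψ) :
    Tendsto (fun n : ℕ => ∫⁻ p, ENNReal.ofReal ((cutoff n ψ - ψ) p ^ 2 + pd (cutoff n ψ - ψ) p ^ 2)
      ∂cylMeasure) atTop (𝓝 0) := by
  obtain ⟨M, hM0, hM⟩ := exists_abs_pd_cutoff_sub_le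
  have hsm : ∀ n : ℕ, Smooth (cutoff n ψ - ψ) := fun n => by
    have := (h.1.cutoff n).add (h.1.smul (-1))
    rwa [neg_one_smul, ← sub_eq_add_neg] at this
  have hi : Integrable (fun p => ψ p ^ 2 + (2 * M ^ 2 * ψ p ^ 2 + 2 * pd ψ p ^ 2)) cylMeasure := by
    have h2 : Integrable (fun p => pd ψ p ^ 2) cylMeasure := by
      have := (memLp_two_iff_integrable_sq_norm h.sm_pd.aestronglyMeasurable).1 h.memLp_pd
      simpa only [Complex.norm_real, Real.norm_eq_abs, sq_abs] using this
    exact h.integrable_sq.add ((h.integrable_sq.const_mul _).add (h2.const_mul _))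
  have hlim := tendsto_lintegral_of_dominated_convergence (μ := cylMeasure)
    (F := fun (n : ℕ) p => ENNReal.ofReal ((cutoff n ψ - ψ) p ^ 2 + pd (cutoff n ψ - ψ) p ^ 2))
    (f := fun _ => 0)
    (fun p => ENNReal.ofReal (ψ p ^ 2 + (2 * M ^ 2 * ψ p ^ 2 + 2 * pd ψ p ^ 2)))
    (fun n => ?_) (fun n => Eventually.of_forall fun p => ?_) ?_ (Eventually.of_forall fun p => ?_)
  · simpa using hlim
  · have h1 := (hsm n).continuous.measurable
    have h2 := (hsm n).continuous_pd.measurable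
    fun_prop
  · refine ENNReal.ofReal_le_ofReal (add_le_add ?_ ?_)
    · rw [← sq_abs, ← sq_abs (ψ p)]
      exact pow_le_pow_left₀ (abs_nonneg _) (abs_cutoff_sub_le n p) 2
    · have h1 := pow_le_pow_left₀ (abs_nonneg _) (hM ψ h.1 n p) 2
      rw [sq_abs] at h1
      rw [← sq_abs (ψ p), ← sq_abs (pd ψ p)]
      nlinarith [sq_nonneg (M * |ψ p| - |pd ψ p|)]
  · rw [← ofReal_integral_eq_lintegral_ofReal hi (Eventually.of_forall fun p => by positivity)]
    exact ENNReal.ofReal_ne_top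
  · refine tendsto_const_nhds.congr' ?_
    obtain ⟨N, hN⟩ := exists_nat_gt |p.1|
    filter_upwards [eventually_ge_atTop N] with n hn
    have hn' : (N : ℝ) ≤ n := by exact_mod_cast hn
    have hx : |p.1| < (n : ℝ) + 1 := by linarith
    have h1 : ∀ x : ℝ, |x| < (n : ℝ) + 1 → (cutoff n ψ - ψ) (x, p.2) = 0 := fun x hx => by
      rw [Pi.sub_apply, cutoff_eq n hx, sub_self]
    have h2 : pd (cutoff n ψ - ψ) (p.1, p.2) = 0 := by
      refine pd_eq_zero_of_eventually ?_
      filter_upwards [(isOpen_lt continuous_abs continuous_const).mem_nhds hx] with y hy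
      exact h1 y hy
    rw [show p = (p.1, p.2) from rfl, h1 _ hx, h2]
    simp

/-- Functions with compact support in `u` extend by zero into `S(B)`. Cutoffs converge in the `H¹`
norm of the first variable, which dominates the thermal norm because the weight grows at most
quadratically. -/
lemma exists_extendable_near (r : ℝ) {κ : ℝ} (hκ : 0 < κ) (b : Half) (ψ : SH) {ε : ℝ} (hε : 0 < ε) :
    ∃ χ : SH, extendZero κ b (χ : ℝ × S2 → ℝ) ∈ SB ∧ ‖oneH r hκ χ - oneH r hκ ψ‖ < ε := by
  obtain ⟨C, hC⟩ := (isWeight_weightH hκ).bound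
  have hψ := reg_of_mem_SH ψ.2
  have hmem : ∀ n, cutoff n (ψ : ℝ × S2 → ℝ) ∈ SH := fun n =>
    mem_SH_of_eq_zero (hψ.1.cutoff n) fun x w hx => cutoff_eq_zero n hx w
  have hlim := ENNReal.Tendsto.const_mul (a := ENNReal.ofReal (r ^ 2 * C))
    (tendsto_lintegral_cutoff hψ) (Or.inr ENNReal.ofReal_ne_top)
  rw [mul_zero] at hlim
  have hε2 : (0 : ℝ≥0∞) < ENNReal.ofReal (ε ^ 2) := ENNReal.ofReal_pos.2 (by positivity)
  obtain ⟨n, hn⟩ := (hlim.eventually (gt_mem_nhds hε2)).exists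
  refine ⟨⟨_, hmem n⟩, extendZero_mem_SB hκ b (hψ.1.cutoff n)
    fun x w hx => cutoff_eq_zero n hx w, ?_⟩
  have h1 : Reg (cutoff n (ψ : ℝ × S2 → ℝ) - ψ) := (reg_of_mem_SH (hmem n)).sub hψ
  have h2 := enorm_oneH_sq r hκ (⟨_, hmem n⟩ - ψ)
  have h3 : ‖oneH r hκ (⟨_, hmem n⟩ - ψ)‖ₑ ^ 2 < ENNReal.ofReal (ε ^ 2) := by
    rw [h2]
    exact (h1.lintegral_weight_le hC r).trans_lt hn
  rw [map_sub, ← ofReal_norm, ← ENNReal.ofReal_pow (norm_nonneg _),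
    ENNReal.ofReal_lt_ofReal_iff (by positivity)] at h3
  exact lt_of_pow_lt_pow_left₀ 2 hε.le h3

lemma norm_oneH_eq_norm_oneB (r : ℝ) {κ : ℝ} (hκ : 0 < κ) (b : Half) (ψ : SH) (Ψ : SB)
    (h : (Ψ : ℝ × S2 → ℝ) = extendZero κ b ψ) : ‖oneH r hκ ψ‖ = ‖oneB r Ψ‖ := by
  refine norm_eq_of_enorm_sq_eq ?_
  rw [enorm_oneH_sq, enorm_oneB_sq]
  simp only [ENNReal.ofReal_mul (sq_nonneg r), mul_assoc]
  rw [lintegral_const_mul' _ _ ENNReal.ofReal_ne_top, lintegral_const_mul' _ _ ENNReal.ofReal_ne_top,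
    lintegral_thermal hκ (reg_of_mem_SH ψ.2) (reg_of_mem_SB Ψ.2) h]

lemma integrable_slice_of_mem_SH {ψ : ℝ × S2 → ℝ} (h : ψ ∈ SH) (w : S2) :
    Integrable fun u => (ψ (u, w) : ℂ) := by
  obtain ⟨-, D, hD⟩ := tame_of_mem_SH h
  obtain ⟨hs, C, hC, C', hC', hh⟩ := h
  have hc : Continuous fun u => (ψ (u, w) : ℂ) :=
    Complex.continuous_ofReal.comp (hs.differentiable w).continuous
  refine (integrable_inv_one_add_sq.const_mul (max (2 * C) (D * (1 + C' ^ 2)))).mono'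
    hc.aestronglyMeasurable (Eventually.of_forall fun u => ?_)
  have hu : 0 < 1 + u ^ 2 := by positivity
  have hD0 : 0 ≤ D := (abs_nonneg _).trans (hD (u, w)).1
  rw [Complex.norm_real, Real.norm_eq_abs, ← div_eq_mul_inv, le_div_iff₀ hu]
  rcases lt_or_ge C' |u| with h1 | h1
  · refine le_trans ?_ (le_max_left _ _)
    have h2 := (hh u w h1).1.le
    have h3 := quadratic_le_exp_of_nonneg (abs_nonneg u)
    rw [sq_abs] at h3
    have h4 : exp (-|u|) * exp |u| = 1 := by rw [← exp_add, neg_add_cancel, exp_zero]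
    have h5 : 1 + u ^ 2 ≤ 2 * exp |u| := by nlinarith [abs_nonneg u]
    calc |ψ (u, w)| * (1 + u ^ 2) ≤ C * exp (-|u|) * (2 * exp |u|) :=
          mul_le_mul h2 h5 hu.le (by positivity)
      _ = 2 * C * (exp (-|u|) * exp |u|) := by ring
      _ = 2 * C := by rw [h4, mul_one]
  · refine le_trans ?_ (le_max_right _ _)
    have h5 := pow_le_pow_left₀ (abs_nonneg _) h1 2
    rw [sq_abs] at h5
    exact mul_le_mul (hD (u, w)).1 (by linarith) hu.le hD0

lemma oneH_ae_eq (r : ℝ) {κ : ℝ} (hκ : 0 < κ) (ψ : SH) :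
    (oneH r hκ ψ : ℝ × S2 → ℂ) =ᵐ[measureH r κ] fourierU (ψ : ℝ × S2 → ℝ) := by
  have hae := coeFn_Kmap (fun _ h => reg_of_mem_SH h)
    (fun _ h => (reg_of_mem_SH h).memLp_cylWeight (isWeight_weightH hκ) (measureH_eq hκ r)) ψ
  have h0 := ((measureH_eq hκ r).symm ▸ cylWeight_ac r (weightH κ)).ae_le Reg.ae_fst_ne_zero
  filter_upwards [hae, h0] with p hp hp0
  exact hp.trans ((reg_of_mem_SH ψ.2).FP_eq_fourierU hp0 (integrable_slice_of_mem_SH ψ.2 p.2))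

/-! ### Multiplication operators -/

section multiplication

variable {ν : Measure (ℝ × S2)}

lemma memLp_bdd_mul {f g : ℝ × S2 → ℂ} (hf : Measurable f) {C : ℝ} (hC : ∀ p, ‖f p‖ ≤ C)
    (hg : MemLp g 2 ν) : MemLp (fun p => f p * g p) 2 ν :=
  hg.of_le_mul (c := C) (hf.aestronglyMeasurable.mul hg.1) (Eventually.of_forall fun p => by
    rw [norm_mul]
    exact mul_le_mul_of_nonneg_right (hC p) (norm_nonneg _))

/-- Convergence in `L²` by domination. -/
lemma tendsto_Lp_of_dominated {ι : Type*} {l : Filter ι} [l.IsCountablyGenerated]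
    {F : ι → Lp ℂ 2 ν} {G : Lp ℂ 2 ν} {f : ι → ℝ × S2 → ℂ} {g : ℝ × S2 → ℂ} {B : ℝ × S2 → ℂ}
    (hF : ∀ i, F i =ᵐ[ν] f i) (hG : G =ᵐ[ν] g) (hB : MemLp B 2 ν)
    (hb : ∀ᶠ i in l, ∀ p, ‖f i p - g p‖ ≤ ‖B p‖) (hl : ∀ p, Tendsto (f · p) l (𝓝 (g p))) :
    Tendsto F l (𝓝 G) := by
  refine tendsto_of_seq_tendsto fun u hu => ?_
  rw [Lp.tendsto_Lp_iff_tendsto_eLpNorm']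
  have hm : ∀ i, AEStronglyMeasurable (fun p => f i p - g p) ν := fun i =>
    ((Lp.aestronglyMeasurable (F i)).congr (hF i)).sub ((Lp.aestronglyMeasurable G).congr hG)
  have h1 : Tendsto (fun n => ∫⁻ p, ‖f (u n) p - g p‖ₑ ^ 2 ∂ν) atTop (𝓝 (∫⁻ _, 0 ∂ν)) := by
    obtain ⟨N, hN⟩ := eventually_atTop.1 (hu.eventually hb)
    rw [← tendsto_add_atTop_iff_nat N]
    refine tendsto_lintegral_of_dominated_convergence' (fun p => ‖B p‖ₑ ^ 2)
      (fun n => (hm _).enorm.pow_const 2) (fun n => Eventually.of_forall fun p => ?_)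
      ((memLp_two_iff_lintegral hB.1).1 hB).ne (Eventually.of_forall fun p => ?_)
    · have := hN (n + N) (by omega) p
      exact pow_le_pow_left' (enorm_le_iff_norm_le.2 this) 2
    · have h2 := ENNReal.Tendsto.pow (n := 2) (((hl p).comp hu).sub_const (g p)).enorm
      have h3 := (tendsto_add_atTop_iff_nat N).2 h2
      simpa using h3
  rw [lintegral_zero] at h1
  have h2 := ((ENNReal.continuous_rpow_const (y := 1 / 2)).tendsto 0).comp h1
  rw [ENNReal.zero_rpow_of_pos (by norm_num)] at h2
  refine h2.congr fun n => ?_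
  have e : eLpNorm (⇑(F (u n)) - ⇑G) 2 ν = eLpNorm (fun p => f (u n) p - g p) 2 ν := by
    refine eLpNorm_congr_ae ?_
    filter_upwards [hF (u n), hG] with p h h'
    rw [Pi.sub_apply, h, h']
  change _ = eLpNorm (⇑(F (u n)) - ⇑G) 2 ν
  rw [e, Function.comp_apply, ← eLpNorm_two_sq, ← ENNReal.rpow_natCast, ← ENNReal.rpow_mul]
  norm_num

lemma ae_eq_zero_of_inner {f : ℝ × S2 → ℂ} (hf : MemLp f 2 ν)
    (h : ∀ g : Lp ℂ 2 ν, ∫ p, conj (f p) * g p ∂ν = 0) : f =ᵐ[ν] 0 := by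
  have h0 : ∀ g : Lp ℂ 2 ν, inner ℂ (hf.toLp f) g = 0 := by
    intro g
    rw [← h g, L2.inner_def]
    refine integral_congr_ae ?_
    filter_upwards [hf.coeFn_toLp] with p hp
    rw [hp, RCLike.inner_apply, mul_comm]
  have h1 := inner_self_eq_zero.1 (h0 (hf.toLp f))
  have h2 := hf.coeFn_toLp
  rw [h1] at h2
  exact h2.symm.trans (Lp.coeFn_zero ℂ 2 ν)

/-- The regularizing factor `(1 + k²)⁻¹`. -/
def lorentz (p : ℝ × S2) : ℂ := (((1 + p.1 ^ 2)⁻¹ : ℝ) : ℂ)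

lemma lorentz_ne_zero (p : ℝ × S2) : lorentz p ≠ 0 := by
  have : (1 + p.1 ^ 2)⁻¹ ≠ 0 := by positivity
  exact Complex.ofReal_ne_zero.2 this

lemma measurable_lorentz : Measurable lorentz := by
  unfold lorentz
  fun_prop

lemma norm_lorentz_le (p : ℝ × S2) : ‖lorentz p‖ ≤ 1 := by
  rw [lorentz, Complex.norm_real, Real.norm_of_nonneg (by positivity)]
  exact inv_le_one_of_one_le₀ (by linarith [sq_nonneg p.1])

lemma norm_mul_lorentz_le (p : ℝ × S2) : ‖(p.1 : ℂ) * lorentz p‖ ≤ 1 := by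
  rw [lorentz, ← Complex.ofReal_mul, Complex.norm_real, Real.norm_eq_abs, abs_mul,
    abs_of_nonneg (a := (1 + p.1 ^ 2)⁻¹) (by positivity), ← div_eq_mul_inv,
    div_le_one (by positivity), ← sq_abs]
  nlinarith [sq_nonneg (|p.1| - 1), abs_nonneg p.1]

lemma conj_lorentz (p : ℝ × S2) : conj (lorentz p) = lorentz p := Complex.conj_ofReal _

/-- The vector `(1 + k²)⁻¹ g` of the domain of `k̂`. -/
def regularize (g : Lp ℂ 2 ν) : (kHat ν).domain :=
  ⟨(memLp_bdd_mul measurable_lorentz norm_lorentz_le (Lp.memLp g)).toLp, by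
    have h := (memLp_bdd_mul measurable_lorentz norm_lorentz_le (Lp.memLp g)).coeFn_toLp
    have hm : Measurable fun p : ℝ × S2 => (p.1 : ℂ) * lorentz p :=
      (Complex.measurable_ofReal.comp measurable_fst).mul measurable_lorentz
    refine (memLp_congr_ae ?_).1 (memLp_bdd_mul hm norm_mul_lorentz_le (Lp.memLp g))
    filter_upwards [h] with p hp
    rw [hp, mul_assoc]⟩

lemma coeFn_regularize (g : Lp ℂ 2 ν) :
    ((regularize g : Lp ℂ 2 ν) : ℝ × S2 → ℂ) =ᵐ[ν] fun p => lorentz p * g p :=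
  (memLp_bdd_mul measurable_lorentz norm_lorentz_le (Lp.memLp g)).coeFn_toLp

lemma coeFn_kHat (φ : (kHat ν).domain) :
    (kHat ν φ : ℝ × S2 → ℂ) =ᵐ[ν] fun p => (p.1 : ℂ) * (φ : Lp ℂ 2 ν) p :=
  (kDom.memLp φ).coeFn_toLp

/-- Multiplication by `(1 + k²)⁻¹` sends all of `L²` into the domain and has no zeros; a vector
orthogonal to its image vanishes. -/
lemma dense_kHat_domain : Dense ((kHat ν).domain : Set (Lp ℂ 2 ν)) := by
  rw [Submodule.dense_iff_topologicalClosure_eq_top, Submodule.topologicalClosure_eq_top_iff,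
    Submodule.eq_bot_iff]
  intro h hh
  have h0 := ae_eq_zero_of_inner (memLp_bdd_mul measurable_lorentz norm_lorentz_le (Lp.memLp h))
    fun g => by
      have h1 : inner ℂ h (regularize g : Lp ℂ 2 ν) = 0 :=
        (Submodule.mem_orthogonal' _ _).1 hh _ (regularize g).2
      rw [← h1, L2.inner_def]
      refine integral_congr_ae ?_
      filter_upwards [coeFn_regularize g] with p hp
      rw [hp, RCLike.inner_apply, map_mul, conj_lorentz]
      ring
  refine (Lp.eq_zero_iff_ae_eq_zero).2 ?_
  filter_upwards [h0] with p hp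
  exact (mul_eq_zero.1 hp).resolve_left (lorentz_ne_zero p)

lemma kHat_symm : (kHat ν).IsFormalAdjoint (kHat ν) := by
  intro φ χ
  rw [L2.inner_def, L2.inner_def]
  refine integral_congr_ae ?_
  filter_upwards [coeFn_kHat φ, coeFn_kHat χ] with p h1 h2
  rw [h1, h2, RCLike.inner_apply, RCLike.inner_apply, map_mul, Complex.conj_ofReal]
  ring

/-- Multiplication by `k` on its maximal domain is self-adjoint. -/
lemma isSelfAdjoint_kHat : IsSelfAdjoint (kHat ν) := by
  rw [LinearPMap.isSelfAdjoint_def]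
  refine le_antisymm (LinearPMap.le_of_le_graph ?_) (kHat_symm.le_adjoint dense_kHat_domain)
  intro x hx
  obtain ⟨y, hy1, hy2⟩ := (LinearPMap.mem_graph_iff _).1 hx
  have hm : Measurable fun p : ℝ × S2 => (p.1 : ℂ) * lorentz p :=
    (Complex.measurable_ofReal.comp measurable_fst).mul measurable_lorentz
  have m1 := memLp_bdd_mul measurable_lorentz norm_lorentz_le (Lp.memLp x.2)
  have m2 := memLp_bdd_mul hm norm_mul_lorentz_le (Lp.memLp x.1)
  -- The adjoint relation is tested on regularized vectors, where every product is integrable. It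
  -- says that `(1 + k²)⁻¹ (x₂ - k x₁)` is orthogonal to everything, so `k x₁ = x₂` is square
  -- integrable and `x₁` lies in the maximal domain.
  have h0 := ae_eq_zero_of_inner (m1.sub m2) fun g => by
    have h1 := LinearPMap.adjoint_isFormalAdjoint dense_kHat_domain y (regularize g)
    rw [hy1, hy2, L2.inner_def, L2.inner_def, ← sub_eq_zero,
      ← integral_sub (L2.integrable_inner _ _) (L2.integrable_inner _ _)] at h1
    rw [← h1]
    refine integral_congr_ae ?_
    filter_upwards [coeFn_regularize g, coeFn_kHat (regularize g)] with p hp hp'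
    rw [hp, hp', hp]
    simp only [Pi.sub_apply, RCLike.inner_apply, map_sub, map_mul, conj_lorentz, Complex.conj_ofReal]
    ring
  have h2 : (x.2 : ℝ × S2 → ℂ) =ᵐ[ν] fun p => (p.1 : ℂ) * x.1 p := by
    filter_upwards [h0] with p hp
    have h3 : lorentz p * (x.2 p - (p.1 : ℂ) * x.1 p) = 0 := by
      refine Eq.trans ?_ hp
      rw [Pi.sub_apply]
      ring
    exact sub_eq_zero.1 ((mul_eq_zero.1 h3).resolve_left (lorentz_ne_zero p))
  have h3 : x.1 ∈ (kHat ν).domain := (memLp_congr_ae h2).1 (Lp.memLp x.2)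
  refine (LinearPMap.mem_graph_iff _).2 ⟨⟨x.1, h3⟩, rfl, ?_⟩
  exact Lp.ext ((coeFn_kHat _).trans h2.symm)

lemma measurable_planeWave (t : ℝ) :
    Measurable fun p : ℝ × S2 => Complex.exp (Complex.I * p.1 * t) := by
  fun_prop

lemma norm_planeWave (t : ℝ) (p : ℝ × S2) : ‖Complex.exp (Complex.I * p.1 * t)‖ = 1 := by
  rw [mul_assoc, ← Complex.ofReal_mul, mul_comm Complex.I, Complex.norm_exp_ofReal_mul_I]

lemma memLp_planeWave_mul (t : ℝ) (g : Lp ℂ 2 ν) :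
    MemLp (fun p => Complex.exp (Complex.I * p.1 * t) * g p) 2 ν :=
  memLp_bdd_mul (measurable_planeWave t) (fun p => (norm_planeWave t p).le) (Lp.memLp g)

/-- Multiplication by `e^{itk}` as a linear map. -/
def expMulₗ (ν : Measure (ℝ × S2)) (t : ℝ) : Lp ℂ 2 ν →ₗ[ℂ] Lp ℂ 2 ν where
  toFun g := (memLp_planeWave_mul t g).toLp
  map_add' g h := by
    refine (MemLp.toLp_congr _ ((memLp_planeWave_mul t g).add (memLp_planeWave_mul t h)) ?_).trans
      (MemLp.toLp_add _ _)
    filter_upwards [Lp.coeFn_add g h] with p hp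
    rw [hp, Pi.add_apply, mul_add]
    rfl
  map_smul' c g := by
    refine (MemLp.toLp_congr _ ((memLp_planeWave_mul t g).const_smul c) ?_).trans
      (MemLp.toLp_const_smul _ _)
    filter_upwards [Lp.coeFn_smul c g] with p hp
    rw [hp, Pi.smul_apply, Pi.smul_apply, smul_eq_mul, smul_eq_mul, mul_left_comm]

lemma coeFn_expMulₗ (t : ℝ) (g : Lp ℂ 2 ν) :
    (expMulₗ ν t g : ℝ × S2 → ℂ) =ᵐ[ν] fun p => Complex.exp (Complex.I * p.1 * t) * g p :=
  (memLp_planeWave_mul t g).coeFn_toLp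

lemma expMulₗ_zero (g : Lp ℂ 2 ν) : expMulₗ ν 0 g = g := by
  refine Lp.ext ?_
  filter_upwards [coeFn_expMulₗ 0 g] with p hp
  rw [hp]
  simp

lemma expMulₗ_add (s t : ℝ) (g : Lp ℂ 2 ν) : expMulₗ ν (s + t) g = expMulₗ ν s (expMulₗ ν t g) := by
  refine Lp.ext ?_
  filter_upwards [coeFn_expMulₗ (s + t) g, coeFn_expMulₗ s (expMulₗ ν t g), coeFn_expMulₗ t g]
    with p h1 h2 h3
  rw [h1, h2, h3, ← mul_assoc, ← Complex.exp_add]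
  push_cast
  ring_nf

lemma norm_expMulₗ (t : ℝ) (g : Lp ℂ 2 ν) : ‖expMulₗ ν t g‖ = ‖g‖ := by
  rw [Lp.norm_def, Lp.norm_def]
  congr 1
  refine eLpNorm_congr_norm_ae ?_
  filter_upwards [coeFn_expMulₗ t g] with p hp
  rw [hp, norm_mul, norm_planeWave, one_mul]

/-- The unitary operator `e^{itk̂}`. -/
def expMul (ν : Measure (ℝ × S2)) (t : ℝ) : Lp ℂ 2 ν ≃ₗᵢ[ℂ] Lp ℂ 2 ν where
  toLinearEquiv := LinearEquiv.ofLinearMap (expMulₗ ν t) (expMulₗ ν (-t))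
    (LinearMap.ext fun g => by
      rw [LinearMap.comp_apply, ← expMulₗ_add, add_neg_cancel, expMulₗ_zero]; rfl)
    (LinearMap.ext fun g => by
      rw [LinearMap.comp_apply, ← expMulₗ_add, neg_add_cancel, expMulₗ_zero]; rfl)
  norm_map' g := norm_expMulₗ t g

lemma expMul_apply (t : ℝ) (g : Lp ℂ 2 ν) : expMul ν t g = expMulₗ ν t g := rfl

/-- Continuity and the derivative both follow by dominated convergence. The quotient `|e^{ikt} - 1|
/ |t|` is at most `|k|`, so membership of `φ` in the domain supplies the dominating function. -/
lemma isExpOf_expMul : IsExpOf (expMul ν) (kHat ν) := by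
  refine ⟨isSelfAdjoint_kHat, expMulₗ_zero, expMulₗ_add, fun φ => ?_, fun φ => ?_⟩
  · refine continuous_iff_continuousAt.2 fun t => ?_
    refine tendsto_Lp_of_dominated (fun s => coeFn_expMulₗ s φ) (coeFn_expMulₗ t φ)
      ((Lp.memLp φ).const_mul 2) (Eventually.of_forall fun s p => ?_) fun p => ?_
    · rw [← sub_mul, norm_mul, norm_mul]
      refine mul_le_mul_of_nonneg_right ((norm_sub_le _ _).trans ?_) (norm_nonneg _)
      rw [norm_planeWave, norm_planeWave]
      norm_num
    · have : Continuous fun s : ℝ => Complex.exp (Complex.I * p.1 * s) * φ p := by fun_prop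
      exact this.tendsto t
  · refine hasDerivAt_iff_tendsto_slope.2 ?_
    have hs : ∀ t : ℝ, slope (fun t => expMul ν t (φ : Lp ℂ 2 ν)) 0 t
        =ᵐ[ν] fun p => ((t⁻¹ : ℝ) : ℂ) * ((Complex.exp (Complex.I * p.1 * t) - 1)
          * (φ : Lp ℂ 2 ν) p) := by
      intro t
      have e : slope (fun t => expMul ν t (φ : Lp ℂ 2 ν)) 0 t
          = ((t⁻¹ : ℝ) : ℂ) • (expMulₗ ν t (φ : Lp ℂ 2 ν) - (φ : Lp ℂ 2 ν)) := by
        rw [slope_def_module, sub_zero, expMul_apply, expMul_apply, expMulₗ_zero]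
        rfl
      rw [e]
      filter_upwards [Lp.coeFn_smul ((t⁻¹ : ℝ) : ℂ) (expMulₗ ν t (φ : Lp ℂ 2 ν) - (φ : Lp ℂ 2 ν)),
        Lp.coeFn_sub (expMulₗ ν t (φ : Lp ℂ 2 ν)) (φ : Lp ℂ 2 ν), coeFn_expMulₗ t (φ : Lp ℂ 2 ν)] with p h1 h2 h3
      rw [h1, Pi.smul_apply, h2, Pi.sub_apply, h3, smul_eq_mul]
      ring
    have hI : (Complex.I • kHat ν φ : Lp ℂ 2 ν)
        =ᵐ[ν] fun p => Complex.I * ((p.1 : ℂ) * (φ : Lp ℂ 2 ν) p) := by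
      filter_upwards [Lp.coeFn_smul Complex.I (kHat ν φ), coeFn_kHat φ] with p h1 h2
      rw [h1, Pi.smul_apply, h2, smul_eq_mul]
    refine tendsto_Lp_of_dominated hs hI ((kDom.memLp φ).const_mul 2) ?_ fun p => ?_
    · filter_upwards [self_mem_nhdsWithin] with t ht p
      have ht' : t ≠ 0 := ht
      have h1 : ‖((t⁻¹ : ℝ) : ℂ) * ((Complex.exp (Complex.I * p.1 * t) - 1) * (φ : Lp ℂ 2 ν) p)‖
          ≤ ‖(p.1 : ℂ) * (φ : Lp ℂ 2 ν) p‖ := by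
        have h2 : ‖Complex.exp (Complex.I * p.1 * t) - 1‖ ≤ ‖(p.1 : ℂ)‖ * |t| := by
          have := Real.norm_exp_I_mul_ofReal_sub_one_le (x := p.1 * t)
          rw [Complex.ofReal_mul, ← mul_assoc] at this
          rwa [Complex.norm_real, Real.norm_eq_abs, ← abs_mul, ← Real.norm_eq_abs]
        rw [norm_mul, norm_mul, norm_mul, ← mul_assoc]
        refine mul_le_mul_of_nonneg_right ?_ (norm_nonneg _)
        rw [Complex.norm_real, norm_inv, Real.norm_eq_abs, inv_mul_le_iff₀ (abs_pos.2 ht'), mul_comm |t|]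
        exact h2
      refine (norm_sub_le _ _).trans ?_
      rw [norm_mul Complex.I, Complex.norm_I, one_mul, norm_mul (2 : ℂ), Complex.norm_ofNat]
      linarith
    · have hd : HasDerivAt (fun t : ℝ => Complex.exp (Complex.I * p.1 * t)) (Complex.I * p.1) 0 := by
        have h1 : HasDerivAt (fun t : ℝ => (t : ℂ)) 1 0 := Complex.ofRealCLM.hasDerivAt
        simpa using (h1.const_mul (Complex.I * (p.1 : ℂ))).cexp
      have h2 := (hasDerivAt_iff_tendsto_slope.1 hd).mul_const ((φ : Lp ℂ 2 ν) p)
      rw [mul_assoc Complex.I] at h2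
      refine h2.congr fun t => ?_
      rw [slope_def_module]
      simp [mul_assoc]

end multiplication

/-! ### The thermal state -/

/-- Laplace-type integrals that converge absolutely on both edges of a strip are analytic
inside. -/
lemma stripFun_integral {α : Type*} [MeasurableSpace α] {μ : Measure α} {h : α → ℂ} {k : α → ℝ}
    (hk : Measurable k) {β : ℝ} (h0 : Integrable h μ)
    (h1 : Integrable (fun x => ((exp (-(β * k x)) : ℝ) : ℂ) * h x) μ) :
    StripFun β (fun z => ∫ x, Complex.exp (Complex.I * k x * z) * h x ∂μ) := by
  have hn : ∀ z : ℂ, ∀ x, ‖Complex.exp (Complex.I * k x * z)‖ = exp (-(z.im * k x)) := by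
    intro z x
    rw [Complex.norm_exp]
    congr 1
    simp
    ring
  -- For `0 ≤ Im z ≤ β` the factor `e^{-k Im z}` is at most `1` when `k ≥ 0` and at most `e^{-βk}`
  -- when `k ≤ 0`; the sum covers both signs.
  set B : α → ℝ := fun x => ‖h x‖ + ‖((exp (-(β * k x)) : ℝ) : ℂ) * h x‖ with hB
  have hBi : Integrable B μ := h0.norm.add h1.norm
  have hBx : ∀ x, B x = (1 + exp (-(β * k x))) * ‖h x‖ := by
    intro x
    simp only [hB]
    rw [norm_mul, Complex.norm_real, Real.norm_of_nonneg (exp_pos _).le]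
    ring
  have hle : ∀ z ∈ strip β, ∀ x, ‖Complex.exp (Complex.I * k x * z) * h x‖ ≤ B x := by
    intro z hz x
    rw [hBx, norm_mul, hn]
    refine mul_le_mul_of_nonneg_right ?_ (norm_nonneg _)
    rcases le_total 0 (k x) with hx | hx
    · have : exp (-(z.im * k x)) ≤ 1 := exp_le_one_iff.2 (by nlinarith [hz.1])
      linarith [exp_pos (-(β * k x))]
    · have : exp (-(z.im * k x)) ≤ exp (-(β * k x)) := exp_le_exp.2 (by nlinarith [hz.2])
      linarith
  have hms : ∀ z : ℂ, AEStronglyMeasurable (fun x => Complex.exp (Complex.I * k x * z) * h x) μ :=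
    fun z => AEStronglyMeasurable.mul (Measurable.aestronglyMeasurable (by fun_prop)) h0.1
  refine ⟨?_, ?_, ∫ x, B x ∂μ, fun z hz =>
    norm_integral_le_of_norm_le hBi (Eventually.of_forall (hle z hz))⟩
  · refine continuousOn_of_dominated (fun z _ => hms z)
      (fun z hz => Eventually.of_forall (hle z hz)) hBi (Eventually.of_forall fun x => ?_)
    exact Continuous.continuousOn (by fun_prop)
  · rintro z₀ ⟨hz0, hz1⟩
    -- Half the distance to the boundary: points of the `δ`-ball stay at distance at least `δ` from
    -- both edges. That margin gives a factor `e^{-δ|k|}`, which absorbs the `|k|` of the derivative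
    -- at the price of `1/δ`.
    obtain ⟨δ, hδ, hδ0, hδ1⟩ : ∃ δ > 0, δ ≤ z₀.im / 2 ∧ δ ≤ (β - z₀.im) / 2 :=
      ⟨min (z₀.im / 2) ((β - z₀.im) / 2), lt_min (by linarith) (by linarith), min_le_left _ _,
        min_le_right _ _⟩
    have key := hasDerivAt_integral_of_dominated_loc_of_deriv_le (μ := μ)
      (F := fun z x => Complex.exp (Complex.I * k x * z) * h x)
      (F' := fun z x => Complex.exp (Complex.I * k x * z) * (Complex.I * k x) * h x)
      (x₀ := z₀) (bound := fun x => δ⁻¹ * B x) (Metric.ball_mem_nhds z₀ hδ)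
      (Eventually.of_forall hms) (hBi.mono' (hms z₀) (Eventually.of_forall (hle z₀ ⟨hz0.le, hz1.le⟩)))
      (AEStronglyMeasurable.mul (Measurable.aestronglyMeasurable (by fun_prop)) h0.1)
      (Eventually.of_forall fun x z hz => ?_) (hBi.const_mul _)
      (Eventually.of_forall fun x z _ => ?_)
    · exact key.2.differentiableAt.differentiableWithinAt
    · have hz' : |z.im - z₀.im| < δ := by
        have := (Complex.abs_im_le_norm (z - z₀)).trans_lt (mem_ball_iff_norm.1 hz)
        simpa using this
      have h2 := abs_lt.1 hz'
      rw [hBx, norm_mul, norm_mul, norm_mul, hn, Complex.norm_I, one_mul, Complex.norm_real,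
        Real.norm_eq_abs, ← mul_assoc]
      refine mul_le_mul_of_nonneg_right ?_ (norm_nonneg _)
      rw [le_inv_mul_iff₀ hδ]
      have ha : ∀ a : ℝ, 0 ≤ a → δ * a ≤ exp (δ * a) := fun a _ => by
        linarith [add_one_le_exp (δ * a)]
      rcases le_total 0 (k x) with hx | hx
      · rw [abs_of_nonneg hx]
        have e : δ * (exp (-(z.im * k x)) * k x) ≤ 1 := by
          have e1 : exp (-(z.im * k x)) ≤ exp (-(δ * k x)) := exp_le_exp.2 (by nlinarith)
          calc δ * (exp (-(z.im * k x)) * k x) = exp (-(z.im * k x)) * (δ * k x) := by ring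
            _ ≤ exp (-(δ * k x)) * exp (δ * k x) :=
              mul_le_mul e1 (ha _ hx) (by positivity) (exp_pos _).le
            _ = 1 := by rw [← exp_add, neg_add_cancel, exp_zero]
        linarith [exp_pos (-(β * k x))]
      · rw [abs_of_nonpos hx]
        have e : δ * (exp (-(z.im * k x)) * -k x) ≤ exp (-(β * k x)) := by
          have hx' : 0 ≤ -k x := by linarith
          have e1 : exp (-(z.im * k x)) ≤ exp (-((β - δ) * k x)) := exp_le_exp.2 (by nlinarith)
          calc δ * (exp (-(z.im * k x)) * -k x) = exp (-(z.im * k x)) * (δ * -k x) := by ring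
            _ ≤ exp (-((β - δ) * k x)) * exp (δ * -k x) :=
              mul_le_mul e1 (ha _ hx') (by positivity) (exp_pos _).le
            _ = exp (-(β * k x)) := by
              rw [← exp_add]
              ring_nf
        linarith
    · have h1 : HasDerivAt (fun z : ℂ => Complex.I * k x * z) (Complex.I * k x) z := by
        simpa using (hasDerivAt_id z).const_mul (Complex.I * (k x : ℂ))
      exact (h1.cexp).mul_const (h x)

/-! ### Translations, the thermal state and its KMS property -/

section

variable (r : ℝ) {κ : ℝ} (hκ : 0 < κ)

lemma FP_translateH (t : ℝ) (ψ : SH) (p : ℝ × S2) :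
    FP (translateH t ψ) p = Complex.exp (-(Complex.I * p.1 * t)) * FP ψ p :=
  Reg.FP_comp_add t p

lemma oneH_translateH (t : ℝ) (ψ : SH) :
    oneH r hκ (translateH t ψ) = expMul (measureH r κ) (-t) (oneH r hκ ψ) := by
  have hc := coeFn_Kmap (fun _ h => reg_of_mem_SH h)
    (fun _ h => (reg_of_mem_SH h).memLp_cylWeight (isWeight_weightH hκ) (measureH_eq hκ r))
  refine Lp.ext ?_
  filter_upwards [hc (translateH t ψ), hc ψ, coeFn_expMulₗ (-t) (oneH r hκ ψ)] with p h1 h2 h3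
  refine h1.trans ((FP_translateH t ψ p).trans (Eq.trans ?_ h3.symm))
  rw [show oneH r hκ ψ p = FP ψ p from h2]
  push_cast
  rw [mul_neg]

lemma oneH_flowH (b : Half) (τ : ℝ) (ψ : SH) :
    oneH r hκ (flowH b τ ψ) = expMul (measureH r κ) (-b.sgn * τ) (oneH r hκ ψ) := by
  rw [neg_mul]
  exact oneH_translateH r hκ _ ψ

lemma norm_oneH_flowH (b : Half) (τ : ℝ) (ψ : SH) :
    ‖oneH r hκ (flowH b τ ψ)‖ = ‖oneH r hκ ψ‖ := by
  rw [oneH_flowH]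
  exact LinearIsometryEquiv.norm_map _ _

-- The flow is unitary on the one-particle space and `σ` is twice the imaginary part of the inner
-- product there, so no change of variables is needed.
include hκ in
lemma sigmaH_flowH (b : Half) (τ : ℝ) (ψ χ : SH) :
    sigmaH r (flowH b τ ψ) (flowH b τ χ) = sigmaH r ψ χ := by
  rw [sigmaH_eq r hκ, sigmaH_eq r hκ, oneH_flowH, oneH_flowH]
  exact congrArg (fun z : ℂ => 2 * z.im) (LinearIsometryEquiv.inner_map_map _ _ _)

/-- The function is `r² ∫ e^{ikz} w(k) conj(f^) g^`. On the upper edge detailed balance replaces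
`w(k)` by `w(-k)`, and the reflection `k ↦ -k` conjugates the transforms, which exchanges the two
arguments of the inner product. -/
lemma exists_stripFun (b : Half) (f g : SH) :
    ∃ G, StripFun (2 * π / κ) G ∧ ∀ t : ℝ,
      G t = inner ℂ (oneH r hκ f) (oneH r hκ (flowH b (-b.sgn * t) g)) ∧
      G (t + Complex.I * (2 * π / κ : ℝ)) = inner ℂ (oneH r hκ (flowH b (-b.sgn * t) g)) (oneH r hκ f) := by
  have hw := isWeight_weightH hκ
  have hf := reg_of_mem_SH f.2
  have hg := reg_of_mem_SH g.2
  obtain ⟨C, hC⟩ := hw.bound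
  have hb : ∀ k, |weightH κ k| ≤ C * (1 + k ^ 2) := fun k => by
    rw [abs_of_nonneg (hw.nonneg k)]
    exact hC k
  have hb' : ∀ k, |weightH κ (-k)| ≤ C * (1 + k ^ 2) := fun k => by
    have := hb (-k)
    rwa [neg_sq] at this
  have i0 := hf.integrable_weight hg hw.meas hb
  have i1 := hf.integrable_weight hg (w := fun k => weightH κ (-k)) (hw.meas.comp measurable_neg) hb'
  have hflow : ∀ t : ℝ, ∀ p, FP (flowH b (-b.sgn * t) g) p = Complex.exp (Complex.I * p.1 * t) * FP g p := by
    intro t p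
    -- The group generated by `∓X` is translation of `u` by `-t` on either half: the two signs
    -- cancel.
    have e : b.sgn * (-b.sgn * t) = -t := by
      rw [neg_mul, mul_neg, ← mul_assoc, b.sgn_mul_self, one_mul]
    refine (FP_translateH _ g p).trans ?_
    rw [e]
    push_cast
    rw [mul_neg, neg_neg]
  have hexp : ∀ k : ℝ, ((exp (-(2 * π / κ * k)) : ℝ) : ℂ) * (weightH κ k : ℂ) = (weightH κ (-k) : ℂ) := by
    intro k
    rw [← weightH_mul_exp κ k]
    push_cast
    ring
  refine ⟨fun z => (r ^ 2 : ℝ) * ∫ p, Complex.exp (Complex.I * (p.1 : ℝ) * z)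
    * ((weightH κ p.1 : ℂ) * (conj (FP f p) * FP g p)) ∂cylMeasure,
    (stripFun_integral measurable_fst i0 ?_).const_mul _, fun t => ⟨?_, ?_⟩⟩
  · refine i1.congr (Eventually.of_forall fun p => ?_)
    simp only [← mul_assoc, hexp]
  · rw [inner_oneH]
    refine congrArg (((r ^ 2 : ℝ) : ℂ) * ·) (integral_congr_ae (Eventually.of_forall fun p => ?_))
    simp only [hflow]
    ring
  · rw [inner_oneH]
    refine congrArg (((r ^ 2 : ℝ) : ℂ) * ·) ?_
    have e := measurePreserving_neg_fst.integral_comp measurableEmbedding_neg_fst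
      (fun p => (weightH κ p.1 : ℂ) * (conj (FP (flowH b (-b.sgn * t) g) p) * FP f p))
    rw [← e]
    refine integral_congr_ae (Eventually.of_forall fun p => ?_)
    have e2 : Complex.exp (Complex.I * (p.1 : ℂ) * (t + Complex.I * (2 * π / κ : ℝ)))
        = Complex.exp (Complex.I * p.1 * t) * ((exp (-(2 * π / κ * p.1)) : ℝ) : ℂ) := by
      rw [Complex.ofReal_exp, ← Complex.exp_add]
      congr 1
      push_cast
      linear_combination ((p.1 : ℂ) * (2 * π / κ)) * Complex.I_sq
    simp only [hflow, Reg.FP_neg, e2]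
    rw [← hexp, map_mul, Complex.conj_conj, ← Complex.exp_conj]
    simp only [map_mul, map_neg, Complex.conj_I, Complex.conj_ofReal, Complex.ofReal_neg, mul_neg,
      neg_mul, neg_neg]
    ring

lemma exists_thermal (hr : r ≠ 0) :
    ∃ ω : AlgState (Weyl (sigmaH r)), HasOneParticle ω (oneH r hκ) := by
  obtain ⟨ω, hω⟩ := exists_quasifree (oneH r hκ) (sigmaH_eq r hκ)
  refine ⟨ω, _, hω, dense_span_Kmap_SH (isWeight_weightH hκ) (fun k hk => ?_) hr (measureH_eq hκ r),
    fun f g => reForm_apply _ f g, sigmaH_eq r hκ⟩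
  rw [weightH]
  exact div_ne_zero (mul_ne_zero (by simpa using hk) (exp_pos _).ne') (exp_sub_exp_ne hκ hk)

lemma exists_thermal_flow (b : Half) {ω : AlgState (Weyl (sigmaH r))}
    (h : HasOneParticle ω (oneH r hκ)) :
    ∃ α : Multiplicative ℝ →* (Weyl (sigmaH r) ≃⋆ₐ[ℂ] Weyl (sigmaH r)),
      (∀ (τ : ℝ) (ψ : SH), α (Multiplicative.ofAdd τ) (Weyl.W (sigmaH r) ψ)
        = Weyl.W (sigmaH r) (flowH b (-b.sgn * τ) ψ)) ∧ IsKMS ω α (2 * π / κ) := by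
  have hσ : ∀ (x : Multiplicative ℝ) (ψ χ : SH),
      sigmaH r (flowH b (-b.sgn * x.toAdd) ψ) (flowH b (-b.sgn * x.toAdd) χ) = sigmaH r ψ χ :=
    fun x => sigmaH_flowH r hκ b _
  have h1 : ∀ ψ : SH, flowH b (-b.sgn * (1 : Multiplicative ℝ).toAdd) ψ = ψ := by
    intro ψ
    refine Subtype.ext (funext fun p => ?_)
    change (ψ : ℝ × S2 → ℝ) (p.1 + b.sgn * (-b.sgn * 0), p.2) = _
    rw [mul_zero, mul_zero, add_zero]
  have hmul : ∀ (x y : Multiplicative ℝ) (ψ : SH), flowH b (-b.sgn * (x * y).toAdd) ψ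
      = flowH b (-b.sgn * x.toAdd) (flowH b (-b.sgn * y.toAdd) ψ) := by
    intro x y ψ
    refine Subtype.ext (funext fun p => ?_)
    change (ψ : ℝ × S2 → ℝ) (p.1 + b.sgn * (-b.sgn * (x.toAdd + y.toAdd)), p.2)
      = (ψ : ℝ × S2 → ℝ) (p.1 + b.sgn * (-b.sgn * x.toAdd) + b.sgn * (-b.sgn * y.toAdd), p.2)
    rw [mul_add, mul_add, add_assoc]
  refine ⟨Weyl.autHom (fun x : Multiplicative ℝ => flowH b (-b.sgn * x.toAdd)) hσ h1 hmul,
    fun τ ψ => Weyl.autHom_W _ _ _ _ _ _, ?_⟩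
  exact isKMS_of_oneParticle (sigmaH_eq r hκ) (HasOneParticle.apply_W _ h)
    (T := fun t f => flowH b (-b.sgn * t) f) (fun t f => Weyl.autHom_W _ _ _ _ _ _)
    (fun t f => norm_oneH_flowH r hκ b _ f) (by positivity) (exists_stripFun r hκ b)

end

end SdSState
end

/-! ### The vacuum on the horizon and the thermal states on its halves -/

theorem mainTheorem2 (M Λ : ℝ) (hM : 0 < M) (hΛ : 0 < Λ) (hMΛ : 3 * M * √Λ < 1) :
    ∃ (KB : SB →ₗ[ℝ] HB (radiusB M Λ)) (ωB : AlgState (Weyl (sigmaB (radiusB M Λ)))),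
      (∀ ψ : SB, IsFourierPlancherel (ψ : ℝ × S2 → ℝ) (KB ψ : ℝ × S2 → ℂ)) ∧
      -- part (a)
      (HasOneParticle ωB KB ∧ ωB.IsPure ∧
        (∀ ψ₁ ψ₂ : SB, IsLambda (radiusB M Λ) ψ₁ ψ₂ (twoPoint ωB ψ₁ ψ₂)) ∧
        ∀ ω : AlgState (Weyl (sigmaB (radiusB M Λ))), IsQuasifree ω →
          (∀ ψ₁ ψ₂ : SB, IsLambda (radiusB M Λ) ψ₁ ψ₂ (twoPoint ω ψ₁ ψ₂)) → ω = ωB) ∧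
      -- part (b)
      ((∃ α : Multiplicative ℝ →*
            (Weyl (sigmaB (radiusB M Λ)) ≃⋆ₐ[ℂ] Weyl (sigmaB (radiusB M Λ))),
          (∀ (τ : ℝ) (ψ : SB), α (Multiplicative.ofAdd τ) (Weyl.W (sigmaB (radiusB M Λ)) ψ)
            = Weyl.W (sigmaB (radiusB M Λ)) (flowB (kappaB M Λ) τ ψ)) ∧
          ∀ (τ : ℝ) (a : Weyl (sigmaB (radiusB M Λ))),
            ωB (α (Multiplicative.ofAdd τ) a) = ωB a) ∧
        ∃ ρ : (E3 ≃ₗᵢ[ℝ] E3) →*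
            (Weyl (sigmaB (radiusB M Λ)) ≃⋆ₐ[ℂ] Weyl (sigmaB (radiusB M Λ))),
          (∀ (R : E3 ≃ₗᵢ[ℝ] E3) (ψ : SB), ρ R (Weyl.W (sigmaB (radiusB M Λ)) ψ)
            = Weyl.W (sigmaB (radiusB M Λ)) (rotB R ψ)) ∧
          ∀ (R : E3 ≃ₗᵢ[ℝ] E3) (a : Weyl (sigmaB (radiusB M Λ))), ωB (ρ R a) = ωB a) ∧
      ∀ b : Half,
        ∃ (KH : SH →ₗ[ℝ] HH (radiusB M Λ) (kappaB M Λ))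
          (ωH : AlgState (Weyl (sigmaH (radiusB M Λ)))),
          (∀ ψ : SH, (KH ψ : ℝ × S2 → ℂ)
            =ᵐ[measureH (radiusB M Λ) (kappaB M Λ)] fourierU (ψ : ℝ × S2 → ℝ)) ∧
          -- part (c)
          (HasOneParticle ωH KH ∧
            (∀ ω : AlgState (Weyl (sigmaH (radiusB M Λ))), HasOneParticle ω KH → ω = ωH) ∧
            (∀ (ψ : SH) (Ψ : SB), (Ψ : ℝ × S2 → ℝ) = extendZero (kappaB M Λ) b ψ →
              ωH (Weyl.W (sigmaH (radiusB M Λ)) ψ) = ωB (Weyl.W (sigmaB (radiusB M Λ)) Ψ)) ∧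
            (∀ (ψ χ : SH) (Ψ X : SB), (Ψ : ℝ × S2 → ℝ) = extendZero (kappaB M Λ) b ψ →
              (X : ℝ × S2 → ℝ) = extendZero (kappaB M Λ) b χ →
              sigmaH (radiusB M Λ) ψ χ = sigmaB (radiusB M Λ) Ψ X) ∧
            ∀ (ψ : SH) (ε : ℝ), 0 < ε → ∃ χ : SH,
              extendZero (kappaB M Λ) b (χ : ℝ × S2 → ℝ) ∈ SB ∧ ‖KH χ - KH ψ‖ < ε) ∧
          -- part (d)
          (∃ V : ℝ → (HH (radiusB M Λ) (kappaB M Λ) ≃ₗᵢ[ℂ] HH (radiusB M Λ) (kappaB M Λ)),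
            IsExpOf V (kHat (measureH (radiusB M Λ) (kappaB M Λ))) ∧
            ∀ (τ : ℝ) (ψ : SH), KH (flowH b τ ψ) = V (-b.sgn * τ) (KH ψ)) ∧
          -- part (e)
          ∃ α : Multiplicative ℝ →*
              (Weyl (sigmaH (radiusB M Λ)) ≃⋆ₐ[ℂ] Weyl (sigmaH (radiusB M Λ))),
            (∀ (τ : ℝ) (ψ : SH), α (Multiplicative.ofAdd τ) (Weyl.W (sigmaH (radiusB M Λ)) ψ)
              = Weyl.W (sigmaH (radiusB M Λ)) (flowH b (-b.sgn * τ) ψ)) ∧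
            IsKMS ωH α (2 * π / kappaB M Λ) := by
  have hr : radiusB M Λ ≠ 0 := (radius_spec hM hΛ hMΛ).1.ne'
  have hκ : 0 < kappaB M Λ := kappaB_pos hM hΛ hMΛ
  obtain ⟨ωB, h1, h2, h3, h4⟩ := exists_vacuum hr
  refine ⟨oneB (radiusB M Λ), ωB, isFourierPlancherel_oneB hr, ⟨h1, h2, h3, h4⟩,
    ⟨exists_flow h1, exists_rotations h1⟩, fun b => ?_⟩
  obtain ⟨ωH, hH⟩ := exists_thermal (radiusB M Λ) hκ hr
  refine ⟨oneH (radiusB M Λ) hκ, ωH, oneH_ae_eq _ hκ,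
    ⟨hH, fun ω hω => HasOneParticle.unique _ hω hH, fun ψ Ψ hΨ => ?_,
      sigmaH_eq_sigmaB hκ _ b, fun ψ ε hε => exists_extendable_near _ hκ b ψ hε⟩,
    ⟨expMul _, isExpOf_expMul, oneH_flowH _ hκ b⟩, exists_thermal_flow _ hκ b hH⟩
  -- Both values are the same Gaussian of a one-particle norm, and the thermal norm equals the
  -- vacuum norm of the extension by zero.
  exact (HasOneParticle.apply_W _ hH ψ).trans ((congrArg
    (fun x : ℝ => ((exp (-(x ^ 2) / 2) : ℝ) : ℂ)) (norm_oneH_eq_norm_oneB _ hκ b ψ Ψ hΨ)).trans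
    (HasOneParticle.apply_W _ h1 Ψ).symm)
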